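/- **Notation.** Let $n\ge 2$ and write $\widehat f(\xi)=\int e^{-ix\cdot\xi}f(x)\,dx$. Fix a non-increasing $\phi\in C^\infty[0,\infty)$ with $0\le\phi\le1$, $\phi=1$ on $[0,5/4]$ and $\phi=0$ on $[3/2,\infty)$. Put $\psi(\xi)=\phi(|\xi|)-\phi(2|\xi|)$, and for a ($\mathbb C^n$-valued) tempered distribution $f$ on $\mathbb R^n$ let $S_0f=\mathscr F^{-1}(\phi(|\xi|)\widehat f)$ and $\Delta_jf=\mathscr F^{-1}(\psi(2^{-j}\xi)\widehat f)$. For $1\le q<\infty$ and $\sigma\ge0$, $B^{-1,\sigma}_{\infty q}$ is the space of all $f\in S'(\mathbb R^n)$ with $$\|f\|_{B^{-1,\sigma}_{\infty q}}=\|S_0f\|_\infty+\Big[\sum_{j\ge1}\big(2^{-j}j^{\sigma}\|\Delta_jf\|_\infty\big)^q\Big]^{1/q}<\infty ,$$ and $B^{-1,\sigma}_{\infty q0}$ is the closure of the Schwartz class in it. Let $\mathbb P$ be the matrix Fourier multiplier with symbol $\delta_{ij}-\xi_i\xi_j/|\xi|^2$. A *mild solution* of the Navier–Stokes problem $\partial_tu-\Delta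 u+\mathbb P\nabla\cdot(u\otimes u)=0$, $u(0)=u_0$, at the times $t\in I$, where $I$ is $[0,T]$ or $(0,T)$, is a function $u$ with $$u(t)=e^{t\Delta}u_0-\int_0^te^{(t-\tau)\Delta}\,\mathbb P\nabla\cdot[u(\tau)\otimes u(\tau)]\,d\tau\quad\text{in } S'(\mathbb R^n),\ t\in I,$$ where $e^{s\Delta}\mathbb P\nabla\cdot$ acts on bounded functions through its integrable convolution kernel and the integral converges absolutely when paired with Schwartz functions. For $T>0$ let $\mathscr X_T$ be the space of all $u\in L^\infty_{\rm loc}((0,T],L^\infty(\mathbb R^n))$ with $\nabla\cdot u=0$ and finite norm $$\|u\|_{\mathscr X_T}=\sup_{0<t<T}\sqrt t\,\Big|\ln\frac t{eT}\Big|^\sigma\|u(t)\|_\infty+\Big[\int_0^T\Big(\sqrt t\,\Big|\ln\frac t{eT}\Big|^\sigma\|u(t)\|_\infty\Big)^q\frac{dt}t\Big]^{1/q}.$$ **Theorem 1.2.** Let $1\le q<\infty$ and $\sigma\ge\sigma_q:=1-\min\{1-\frac1q,\frac1q\}$. (1) For every $u_0\in B^{-1,\sigma}_{\infty q0}$ with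 $\nabla\cdot u_0=0$ there is $T>0$ such that the problem has a unique mild solution at the times $t\in[0,T]$ in the class $C([0,T],B^{-1,\sigma}_{\infty q0})\cap\mathscr X_T$. Moreover there are $\delta>0$ and $L<\infty$ such that every divergence-free $v_0\in B^{-1,\sigma}_{\infty q0}$ with $\|v_0-u_0\|_{B^{-1,\sigma}_{\infty q}}<\delta$ has a mild solution in this class, on the same interval $[0,T]$, and for any two such data $v_0,w_0$ the solutions $v,w$ in this class satisfy $$\sup_{0\le t\le T}\|v(t)-w(t)\|_{B^{-1,\sigma}_{\infty q}}+\|v-w\|_{\mathscr X_T}\le L\,\|v_0-w_0\|_{B^{-1,\sigma}_{\infty q}}.$$ (2) For every $T>0$ there is $\varepsilon>0$ such that for every $u_0\in B^{-1,\sigma}_{\infty q}$ with $\nabla\cdot u_0=0$ and $\|u_0\|_{B^{-1,\sigma}_{\infty q}}<\varepsilon$ the problem has a unique mild solution at the times $t\in(0,T)$ in the class of all $u\in L^\infty((0,T),B^{-1,\sigma}_{\infty q})\cap\mathscr X_T$ for which $t\mapsto u(t)$ is continuous on $(0,T)$ with respect to the weak topology of $S'(\mathbb R^n)$. Moreover there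 are $\delta>0$ and $L<\infty$ such that every divergence-free $v_0\in B^{-1,\sigma}_{\infty q}$ with $\|v_0-u_0\|_{B^{-1,\sigma}_{\infty q}}<\delta$ has a mild solution in this class, and for any two such data $v_0,w_0$ the solutions $v,w$ in this class satisfy $$\sup_{0<t<T}\|v(t)-w(t)\|_{B^{-1,\sigma}_{\infty q}}+\|v-w\|_{\mathscr X_T}\le L\,\|v_0-w_0\|_{B^{-1,\sigma}_{\infty q}}.$$ In both parts, if the initial datum is real-valued, a solution with real values exists (so that the unique solution is real). -/

import Mathlib

open MeasureTheory Set Filter Topology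
open scoped ENNReal NNReal SchwartzMap ContDiff FourierTransform LineDeriv

noncomputable section

namespace NavierStokesBesov

/-- The space `ℝⁿ` with its Euclidean norm. -/
abbrev Rn (n : ℕ) := EuclideanSpace ℝ (Fin n)

/-- The space `ℂⁿ` with its Euclidean norm, in which the vector fields take their values. -/
abbrev Cn (n : ℕ) := EuclideanSpace ℂ (Fin n)

/-- Vector-valued tempered distributions on `ℝⁿ`; the topology is that of `S'`-weak convergence. -/
abbrev TempDist (n : ℕ) := 𝓢'(Rn n, Cn n)

/-! ### Fourier multipliers

Mathlib's Fourier transform is `∫ e^{-2πi x·η} f(x) dx`, so that the frequency variable `ξ` of the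
transform `∫ e^{-i x·ξ} f(x) dx` is `ξ = 2π η`. All symbols below are written in this way. -/

/-- The cutoff profile of the Littlewood-Paley decomposition: smooth and non-increasing on
`[0,∞)`, with values in `[0,1]`, equal to `1` on `[0,5/4]` and to `0` on `[3/2,∞)`. -/
structure IsCutoff (φ : ℝ → ℝ) : Prop where
  smooth : ContDiffOn ℝ ∞ φ (Ici 0)
  antitone : AntitoneOn φ (Ici 0)
  nonneg : ∀ t, 0 ≤ t → 0 ≤ φ t
  le_one : ∀ t, 0 ≤ t → φ t ≤ 1
  eq_one : ∀ t, 0 ≤ t → t ≤ 5 / 4 → φ t = 1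
  eq_zero : ∀ t, 3 / 2 ≤ t → φ t = 0

/-- The low frequency operator `S₀`, with symbol `φ(|ξ|)`. -/
def lowFreq {n : ℕ} (φ : ℝ → ℝ) (f : TempDist n) : TempDist n :=
  TemperedDistribution.fourierMultiplierCLM (Cn n)
    (fun η : Rn n => ((φ (2 * Real.pi * ‖η‖) : ℝ) : ℂ)) f

/-- The dyadic block `Δ_j`, with symbol `ψ(2^{-j} ξ)`, where `ψ(ξ) = φ(|ξ|) - φ(2|ξ|)`. -/
def dyadicBlock {n : ℕ} (φ : ℝ → ℝ) (j : ℕ) (f : TempDist n) : TempDist n :=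
  TemperedDistribution.fourierMultiplierCLM (Cn n)
    (fun η : Rn n => ((φ (2 * Real.pi * ‖η‖ / 2 ^ j) - φ (2 * (2 * Real.pi * ‖η‖ / 2 ^ j)) : ℝ) : ℂ))
    f

/-- The heat operator `e^{tΔ}`, `t ≥ 0`, with symbol `e^{-t|ξ|²}`. -/
def heat {n : ℕ} (t : ℝ) (f : TempDist n) : TempDist n :=
  TemperedDistribution.fourierMultiplierCLM (Cn n)
    (fun η : Rn n => ((Real.exp (-(t * (2 * Real.pi * ‖η‖) ^ 2)) : ℝ) : ℂ)) f

/-! ### Function spaces -/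

/-- The `L^p(ℝⁿ)` norm of a tempered distribution; it is `∞` if the distribution is not given by an
`L^p` function. -/
def lpENorm {n : ℕ} (p : ℝ≥0∞) [Fact (1 ≤ p)] (f : TempDist n) : ℝ≥0∞ :=
  ⨅ (g : Lp (Cn n) p (volume : Measure (Rn n))) (_ : (g : TempDist n) = f), ‖g‖ₑ

/-- The norm of `B^{s,σ}_{pq}(ℝⁿ)` for `q < ⊤`, with value `∞` outside of the space:
`‖S₀ f‖_p + (∑_{j ≥ 1} (2^{js} j^σ ‖Δ_j f‖_p)^q)^{1/q}`. -/
def besovENorm {n : ℕ} (φ : ℝ → ℝ) (s σ : ℝ) (p : ℝ≥0∞) [Fact (1 ≤ p)] (q : ℝ) (f : TempDist n) :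
    ℝ≥0∞ :=
  lpENorm p (lowFreq φ f) +
    (∑' j : ℕ, (ENNReal.ofReal ((2 : ℝ) ^ (((j + 1 : ℕ) : ℝ) * s) * ((j + 1 : ℕ) : ℝ) ^ σ) *
      lpENorm p (dyadicBlock φ (j + 1) f)) ^ q) ^ (1 / q)

/-- The norm of `B^{-1,σ}_{∞q}(ℝⁿ)`. -/
def normB {n : ℕ} (φ : ℝ → ℝ) (σ q : ℝ) (f : TempDist n) : ℝ≥0∞ :=
  besovENorm φ (-1) σ ⊤ q f

/-- Membership in `B^{-1,σ}_{∞q}(ℝⁿ)`. -/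
def MemB {n : ℕ} (φ : ℝ → ℝ) (σ q : ℝ) (f : TempDist n) : Prop :=
  normB φ σ q f < ⊤

/-- Membership in `B^{-1,σ}_{∞q0}(ℝⁿ)`, the closure of the Schwartz class in
`B^{-1,σ}_{∞q}(ℝⁿ)`. -/
def MemB0 {n : ℕ} (φ : ℝ → ℝ) (σ q : ℝ) (f : TempDist n) : Prop :=
  MemB φ σ q f ∧
    ∀ ε : ℝ≥0, 0 < ε → ∃ g : 𝓢(Rn n, Cn n), normB φ σ q (f - (g : TempDist n)) < ε

/-- The divergence of a vector-valued tempered distribution vanishes: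
`-∑_i ⟨u_i, ∂_i w⟩ = 0` for all Schwartz functions `w`. -/
def IsDivFree {n : ℕ} (u : TempDist n) : Prop :=
  ∀ w : 𝓢(Rn n, ℂ), ∑ i : Fin n, (u (∂_{EuclideanSpace.single i (1 : ℝ)} w)) i = 0

/-- A vector-valued tempered distribution is real if its components take real values on real test
functions. -/
def IsRealDist {n : ℕ} (u : TempDist n) : Prop :=
  ∀ w : 𝓢(Rn n, ℂ), (∀ x, (w x).im = 0) → ∀ i : Fin n, ((u w) i).im = 0

/-! ### Mild solutions -/

/-- The symbol `e^{-s|ξ|²} (δ_{ij} - ξ_i ξ_j / |ξ|²) i ξ_k` of the entries of `e^{sΔ} ℙ ∇`, where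
`ξ = 2π η` (`ξ_i ξ_j / |ξ|² = η_i η_j / |η|²`). -/
def oseenSymbol {n : ℕ} (s : ℝ) (i j k : Fin n) (η : Rn n) : ℂ :=
  ((Real.exp (-(s * (2 * Real.pi * ‖η‖) ^ 2)) *
      ((if i = j then 1 else 0) - η i * η j / ‖η‖ ^ 2) : ℝ) : ℂ) *
    (Complex.I * ((2 * Real.pi * η k : ℝ) : ℂ))

/-- The convolution kernel of `e^{sΔ} ℙ ∇`, `s > 0`: the inverse Fourier transform of the
(integrable) symbol. -/
def oseenKernel {n : ℕ} (s : ℝ) (i j k : Fin n) : Rn n → ℂ :=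
  𝓕⁻ (oseenSymbol s i j k)

/-- The bounded function `e^{sΔ} ℙ ∇·(g ⊗ g)`, `s > 0`, for `g ∈ L^∞(ℝⁿ)`. -/
def oseenQuadratic {n : ℕ} (s : ℝ) (g : Lp (Cn n) ⊤ (volume : Measure (Rn n))) (x : Rn n) : Cn n :=
  WithLp.toLp 2 fun i : Fin n =>
    ∑ j : Fin n, ∑ k : Fin n, ∫ y : Rn n, oseenKernel s i j k (x - y) * (g y j * g y k)

open Classical in
/-- The `L^∞` function which gives the distribution `f`, if there is one (it is then unique), and
`0` otherwise. -/
def linftyRep {n : ℕ} (f : TempDist n) : Lp (Cn n) ⊤ (volume : Measure (Rn n)) :=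
  if h : ∃ g : Lp (Cn n) ⊤ (volume : Measure (Rn n)), (g : TempDist n) = f then h.choose else 0

/-- `u` is a mild solution, at the times `t ∈ I`, with initial value `u₀`:
`u(t) = e^{tΔ} u₀ - ∫_0^t e^{(t-τ)Δ} ℙ ∇·(u(τ) ⊗ u(τ)) dτ` in `S'`, where the integral converges
absolutely when tested with Schwartz functions. -/
def IsMildSolution {n : ℕ} (I : Set ℝ) (u₀ : TempDist n) (u : ℝ → TempDist n) : Prop :=
  ∀ t ∈ I, ∀ w : 𝓢(Rn n, ℂ),
    IntervalIntegrable
      (fun τ => ∫ x : Rn n, w x • oseenQuadratic (t - τ) (linftyRep (u τ)) x) volume 0 t ∧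
    u t w = heat t u₀ w -
      ∫ τ in (0 : ℝ)..t, ∫ x : Rn n, w x • oseenQuadratic (t - τ) (linftyRep (u τ)) x

/-! ### Path spaces -/

/-- The function `√t |ln(t/(eT))|^σ ‖u(t)‖_∞`. -/
def weighted {n : ℕ} (σ T : ℝ) (u : ℝ → TempDist n) (t : ℝ) : ℝ≥0∞ :=
  ENNReal.ofReal (Real.sqrt t * |Real.log (t / (Real.exp 1 * T))| ^ σ) * lpENorm ⊤ (u t)

/-- `sup_{0<t<T} √t |ln(t/(eT))|^σ ‖u(t)‖_∞`. -/
def weightedSup {n : ℕ} (σ T : ℝ) (u : ℝ → TempDist n) : ℝ≥0∞ :=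
  ⨆ t ∈ Ioo 0 T, weighted σ T u t

/-- The norm of `√t |ln(t/(eT))|^σ ‖u(t)‖_∞` in `L^q((0,T), dt/t)`. -/
def weightedLq {n : ℕ} (σ q T : ℝ) (u : ℝ → TempDist n) : ℝ≥0∞ :=
  (∫⁻ t in Ioo 0 T, weighted σ T u t ^ q * ENNReal.ofReal (1 / t)) ^ (1 / q)

/-- The norm of the path spaces: `sup_{t ∈ I} ‖u(t)‖_{B^{-1,σ}_{∞q}}` plus the two weighted
norms. -/
def pathNorm {n : ℕ} (φ : ℝ → ℝ) (σ q T : ℝ) (I : Set ℝ) (u : ℝ → TempDist n) : ℝ≥0∞ :=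
  (⨆ t ∈ I, normB φ σ q (u t)) + weightedSup σ T u + weightedLq σ q T u

/-- `u ∈ L^∞_loc((0,T], L^∞(ℝⁿ))`: `u` is given by a measurable function of `(t,x)` which is
bounded on `(δ,T) × ℝⁿ` for all `δ > 0`. -/
def MemLinftyLoc {n : ℕ} (T : ℝ) (u : ℝ → TempDist n) : Prop :=
  (∃ U : ℝ × Rn n → Cn n,
    AEStronglyMeasurable U ((volume.restrict (Ioo 0 T)).prod volume) ∧
    ∀ t ∈ Ioo 0 T, ∃ g : Lp (Cn n) ⊤ (volume : Measure (Rn n)),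
      (g : TempDist n) = u t ∧ ∀ᵐ x, g x = U (t, x)) ∧
  ∀ δ : ℝ, 0 < δ → ∃ M : ℝ≥0, ∀ t ∈ Ioo δ T, lpENorm ⊤ (u t) ≤ M

/-- `u ∈ C([0,T], B^{-1,σ}_{∞q0}(ℝⁿ))`. -/
def MemCB0 {n : ℕ} (φ : ℝ → ℝ) (σ q T : ℝ) (u : ℝ → TempDist n) : Prop :=
  (∀ t ∈ Icc 0 T, MemB0 φ σ q (u t)) ∧
    ∀ t₀ ∈ Icc 0 T, Tendsto (fun t => normB φ σ q (u t - u t₀)) (𝓝[Icc 0 T] t₀) (𝓝 0)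

/-- `u ∈ L^∞((0,T), B^{-1,σ}_{∞q}(ℝⁿ))`: bounded, and strongly measurable, i.e. an almost
everywhere limit, in norm, of simple functions. -/
def MemLinftyB {n : ℕ} (φ : ℝ → ℝ) (σ q T : ℝ) (u : ℝ → TempDist n) : Prop :=
  (∃ M : ℝ≥0, ∀ t ∈ Ioo 0 T, normB φ σ q (u t) ≤ M) ∧
    ∃ v : ℕ → SimpleFunc ℝ (TempDist n), (∀ k t, MemB φ σ q (v k t)) ∧
      ∀ᵐ t ∂(volume.restrict (Ioo 0 T)),
        Tendsto (fun k => normB φ σ q (u t - v k t)) atTop (𝓝 0)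

/-- `u` is a mild solution on `[0,T]` with initial value `u₀`, in the class of all
`u ∈ C([0,T], B^{-1,σ}_{∞q0}) ∩ L^∞_loc((0,T], L^∞)` with `∇·u = 0` for which
`√t |ln(t/(eT))|^σ ‖u(t)‖_∞` is bounded and lies in `L^q((0,T), dt/t)`. -/
structure IsStrongPathSolution {n : ℕ} (φ : ℝ → ℝ) (σ q T : ℝ) (u₀ : TempDist n) (u : ℝ → TempDist n) :
    Prop where
  memCB0 : MemCB0 φ σ q T u
  memLinftyLoc : MemLinftyLoc T u
  divFree : ∀ t ∈ Icc 0 T, IsDivFree (u t)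
  sup_lt_top : weightedSup σ T u < ⊤
  lq_lt_top : weightedLq σ q T u < ⊤
  mild : IsMildSolution (Icc 0 T) u₀ u

/-- `u` is a mild solution on `(0,T)` with initial value `u₀`, in the class of all
`u ∈ L^∞((0,T), B^{-1,σ}_{∞q}) ∩ L^∞_loc((0,T], L^∞)` with `∇·u = 0` for which
`√t |ln(t/(eT))|^σ ‖u(t)‖_∞` is bounded and lies in `L^q((0,T), dt/t)`, and which are continuous
on `(0,T)` with respect to the `S'`-weak topology. -/
structure IsWeakPathSolution {n : ℕ} (φ : ℝ → ℝ) (σ q T : ℝ) (u₀ : TempDist n) (u : ℝ → TempDist n) :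
    Prop where
  memLinftyB : MemLinftyB φ σ q T u
  memLinftyLoc : MemLinftyLoc T u
  divFree : ∀ t ∈ Ioo 0 T, IsDivFree (u t)
  sup_lt_top : weightedSup σ T u < ⊤
  lq_lt_top : weightedLq σ q T u < ⊤
  weakly_continuous : ContinuousOn u (Ioo 0 T)
  mild : IsMildSolution (Ioo 0 T) u₀ u

end NavierStokesBesov

end

set_option linter.unusedSectionVars false
set_option maxSynthPendingDepth 3

noncomputable section

namespace NavierStokesBesov

variable {n : ℕ} {V W : Type*} [NormedAddCommGroup V] [NormedSpace ℂ V] [CompleteSpace V]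
  [NormedAddCommGroup W] [NormedSpace ℂ W] [CompleteSpace W]

/-! The equation is solved by iteration in the path space with the two weighted norms alone
(`normW`: a weighted supremum plus a weighted `L^q(dt/t)` norm). Write `ℓ = 1 + log(T/t)`. The Besov
bounds are derived only afterwards from these norms. Three estimates carry the existence proof.

Linear estimate. A dyadic block at frequency `2^j` decays under the heat flow like `(1 +
t4^j)^{-3}`, and on the scale `t ~ 4^{-j}` the weight `√t ℓ^σ` is comparable to `2^{-j} j^σ`. The
weighted norms of `e^{tΔ}u₀` are therefore controlled by the Besov norm through an almost diagonal
kernel between `((0,T), dt/t)` and the integers, to which Schur's test applies (`wt_mul_inv_le`,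
`exists_normW_heat_le`). For a bounded datum they are even `O(√T)` (`exists_normW_heat_toDist_le`).

Bilinear estimate. The kernel of `e^{sΔ}ℙ∇` has `L¹` norm `O(s^{-1/2})`, because
`|ξ|^{-2}e^{-s|ξ|²}` is the integral of `e^{-r|ξ|²}` over `r > s`; only Gaussians times polynomials
ever have to be estimated. Everything reduces to the scalar integral `gInt`. Near `τ = t` Schur's
test suffices. For `τ < t/2` one has to bound `ℓ^σ ∫_0^t AB`, where `AB` is
`(√τℓ^σA)(√τℓ^σB)ℓ^{-2σ}` with respect to `dτ/τ`; after the substitution `x = ℓ` this is a Hardy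
type inequality, and the supremum and `L^q` norms of one factor are interpolated to the conjugate
exponent. This is where `σ ≥ σ_q` enters (`lintegral_conj_le`, `lintegral_mul_le_norm_lq`,
`lintegral_rpow_lintegral_mul_le`, `normW_gInt_le`).

Besov estimate. In the block `j` of the Duhamel term the kernel is `2^j(1 + (t-τ)4^j)^{-2}`. Blocks
with `t4^j ≥ 1` form an essentially geometric series. The remaining ones number `O(ℓ)`, which costs
a factor `ℓ^{1/q}`; this is exactly the additional decay of `∫_0^t AB` in
`lintegral_mul_le_norm_lqOn` (`exists_seqB_blockInt_le`, `exists_normB_duh_sub_le`).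

When the heat extension is small in the weighted norms, Picard iteration converges
(`IsSingularBil.exists_fixed_point`). The iterates stay in every closed subspace respected by the
bilinear operator and containing the heat extension; this yields at once the divergence condition,
real values, and membership in the uniform closure of the Schwartz class. Smallness comes from a
small datum, or from a short time after approximating the datum by a Schwartz function
(`MemB0.exists_time_normW_le`).

Uniqueness is needed for solutions of arbitrary size, which are only measurable in time. Their
difference obeys a linear integral inequality whose coefficient contains the `L^q` norm over `(0,t)`
and `ℓ^{-σ}`, both of which vanish as `t → 0`. So the difference vanishes near zero, and beyond that
a Gronwall argument with fixed step length applies (`eq_zero_of_le_gInt`, `eqOn_of_isMildSolution`).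
Consequently every solution in the class is the small one produced by iteration, and the Lipschitz
bound for small fixed points holds for all of them (`wellPosed_of_small`). -/

/-- Bounded continuous functions on `ℝⁿ`. -/
abbrev Cb (n : ℕ) (V : Type*) [NormedAddCommGroup V] := BoundedContinuousFunction (Rn n) V

/-! ### Convolution with integrable kernels -/

theorem integrable_kernel_smul {k : Rn n → ℂ} (hk : Integrable k) {f : Rn n → V}
    (hf : AEStronglyMeasurable f) {M : ℝ} (hM : ∀ᵐ x, ‖f x‖ ≤ M) (x : Rn n) :
    Integrable (fun y => k y • f (x - y)) := by
  have hq : Measure.QuasiMeasurePreserving (fun y : Rn n => x - y) volume volume :=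
    quasiMeasurePreserving_sub_left_of_right_invariant volume x
  exact hk.smul_bdd M (hf.comp_quasiMeasurePreserving hq) (hq.ae hM)

theorem norm_integral_kernel_smul_le {k : Rn n → ℂ} (hk : Integrable k) {f : Rn n → V}
    {M : ℝ} (hM : ∀ᵐ x, ‖f x‖ ≤ M) (x : Rn n) :
    ‖∫ y, k y • f (x - y)‖ ≤ (∫ y, ‖k y‖) * M := by
  have hq : Measure.QuasiMeasurePreserving (fun y : Rn n => x - y) volume volume :=
    quasiMeasurePreserving_sub_left_of_right_invariant volume x
  rw [← integral_mul_const]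
  refine norm_integral_le_of_norm_le (hk.norm.mul_const _) ?_
  filter_upwards [hq.ae hM] with y hy
  rw [norm_smul]
  gcongr

theorem integral_kernel_smul_swap (k : Rn n → ℂ) (f : Rn n → V) (x : Rn n) :
    ∫ y, k (x - y) • f y = ∫ y, k y • f (x - y) := by
  rw [← integral_sub_left_eq_self _ volume x]
  simp

theorem norm_kernel_le (k : Lp ℂ 1 (volume : Measure (Rn n))) (f : Cb n V) (x : Rn n) :
    ‖∫ y, k y • f (x - y)‖ ≤ ‖k‖ * ‖f‖ := by
  rw [L1.norm_eq_integral_norm]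
  exact norm_integral_kernel_smul_le (L1.integrable_coeFn k)
    (Eventually.of_forall f.norm_coe_le_norm) x

/-- The convolution of an integrable kernel with a bounded continuous function. -/
def convFun (k : Lp ℂ 1 (volume : Measure (Rn n))) (f : Cb n V) : Cb n V :=
  BoundedContinuousFunction.ofNormedAddCommGroup (fun x => ∫ y, k y • f (x - y))
    (by
      have := BddAbove.continuous_convolution_right_of_integrable (μ := (volume : Measure (Rn n)))
        (ContinuousLinearMap.lsmul ℝ ℂ : ℂ →L[ℝ] V →L[ℝ] V) (f := k) (g := f)
        ⟨‖f‖, by rintro _ ⟨x, rfl⟩; exact f.norm_coe_le_norm x⟩ (L1.integrable_coeFn k)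
        f.continuous
      exact this)
    (‖k‖ * ‖f‖) (norm_kernel_le k f)

theorem convFun_apply (k : Lp ℂ 1 (volume : Measure (Rn n))) (f : Cb n V) (x : Rn n) :
    convFun k f x = ∫ y, k y • f (x - y) := rfl

theorem integrable_convFun (k : Lp ℂ 1 (volume : Measure (Rn n))) (f : Cb n V) (x : Rn n) :
    Integrable (fun y => k y • f (x - y)) :=
  integrable_kernel_smul (L1.integrable_coeFn k) f.continuous.aestronglyMeasurable
    (Eventually.of_forall f.norm_coe_le_norm) x

variable (n V) in
/-- Convolution as a continuous bilinear map `L¹ × C_b → C_b`. -/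
def convL : Lp ℂ 1 (volume : Measure (Rn n)) →L[ℂ] Cb n V →L[ℂ] Cb n V :=
  LinearMap.mkContinuous₂ (LinearMap.mk₂ ℂ convFun
    (fun k k' f => by
      ext x
      simp only [convFun_apply, BoundedContinuousFunction.coe_add, Pi.add_apply]
      rw [← integral_add (integrable_convFun k f x) (integrable_convFun k' f x)]
      refine integral_congr_ae ?_
      filter_upwards [Lp.coeFn_add k k'] with y hy
      rw [hy, Pi.add_apply, add_smul])
    (fun c k f => by
      ext x
      simp only [convFun_apply, BoundedContinuousFunction.coe_smul]
      rw [← integral_smul]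
      refine integral_congr_ae ?_
      filter_upwards [Lp.coeFn_smul c k] with y hy
      rw [hy, Pi.smul_apply, smul_eq_mul, mul_smul])
    (fun k f f' => by
      ext x
      simp only [convFun_apply, BoundedContinuousFunction.coe_add, Pi.add_apply]
      rw [← integral_add (integrable_convFun k f x) (integrable_convFun k f' x)]
      simp)
    (fun c k f => by
      ext x
      simp only [convFun_apply, BoundedContinuousFunction.coe_smul]
      rw [← integral_smul]
      simp_rw [smul_comm c]))
    1 (fun k f => by
      rw [one_mul]
      exact BoundedContinuousFunction.norm_ofNormedAddCommGroup_le _ (by positivity)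
        (norm_kernel_le k f))

theorem convL_apply (k : Lp ℂ 1 (volume : Measure (Rn n))) (f : Cb n V) (x : Rn n) :
    convL n V k f x = ∫ y, k y • f (x - y) := rfl

theorem norm_convL_le (k : Lp ℂ 1 (volume : Measure (Rn n))) : ‖convL n V k‖ ≤ ‖k‖ := by
  refine ContinuousLinearMap.opNorm_le_bound _ (norm_nonneg _) fun f => ?_
  exact BoundedContinuousFunction.norm_ofNormedAddCommGroup_le _ (by positivity)
        (norm_kernel_le k f)

/-- Convolution commutes with the application of a fixed linear map to the values. -/
theorem convL_comp (L : V →L[ℂ] W) (k : Lp ℂ 1 (volume : Measure (Rn n))) (f : Cb n V) :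
    convL n W k (L.compLeftContinuousBounded (Rn n) f) =
      L.compLeftContinuousBounded (Rn n) (convL n V k f) := by
  ext x
  simp only [convL_apply, ContinuousLinearMap.compLeftContinuousBounded_apply]
  rw [← ContinuousLinearMap.integral_comp_comm _ (integrable_convFun k f x)]
  simp

/-! ### Bounded functions as tempered distributions -/

theorem memLp_top_Cb (f : Cb n V) : MemLp f ⊤ (volume : Measure (Rn n)) :=
  memLp_top_of_bound f.continuous.aestronglyMeasurable ‖f‖
    (Eventually.of_forall f.norm_coe_le_norm)

/-- A bounded continuous function as an element of `L^∞`. -/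
def toLinf (f : Cb n V) : Lp V ⊤ (volume : Measure (Rn n)) := (memLp_top_Cb f).toLp f

theorem coeFn_toLinf (f : Cb n V) : toLinf f =ᵐ[volume] f := MemLp.coeFn_toLp _

theorem toLinf_add (f g : Cb n V) : toLinf (f + g) = toLinf f + toLinf g := rfl

theorem toLinf_smul (c : ℂ) (f : Cb n V) : toLinf (c • f) = c • toLinf f := rfl

theorem ae_norm_le_Linf (g : Lp V ⊤ (volume : Measure (Rn n))) : ∀ᵐ x, ‖g x‖ ≤ ‖g‖ := by
  filter_upwards [ae_le_eLpNormEssSup (f := g) (μ := (volume : Measure (Rn n)))] with x hx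
  have h1 := Lp.enorm_def g
  rw [eLpNorm_exponent_top] at h1
  rw [← h1, enorm_le_iff_norm_le] at hx
  exact hx

theorem Linf_norm_le {g : Lp V ⊤ (volume : Measure (Rn n))} {C : ℝ} (hC : 0 ≤ C)
    (h : ∀ᵐ x, ‖g x‖ ≤ C) : ‖g‖ ≤ C := by
  rw [Lp.norm_def, eLpNorm_exponent_top]
  exact ENNReal.toReal_le_of_le_ofReal hC (eLpNormEssSup_le_of_ae_bound h)

/-- An almost everywhere bound on a continuous function holds on a closed set of full measure, which
is dense and hence everything. So no information is lost in passing between `C_b` and `L^∞`. -/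
theorem norm_toLinf (f : Cb n V) : ‖toLinf f‖ = ‖f‖ := by
  refine le_antisymm ?_ ?_
  · rw [toLinf, Lp.norm_toLp, eLpNorm_exponent_top]
    refine ENNReal.toReal_le_of_le_ofReal (norm_nonneg f) ?_
    exact eLpNormEssSup_le_of_ae_bound (Eventually.of_forall f.norm_coe_le_norm)
  · refine (BoundedContinuousFunction.norm_le (norm_nonneg _)).2 fun x => ?_
    have h : ∀ᵐ x, ‖f x‖ ≤ ‖toLinf f‖ := by
      filter_upwards [coeFn_toLinf f, ae_norm_le_Linf (toLinf f)] with x hx h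
      rwa [← hx]
    have hc : IsClosed {x | ‖f x‖ ≤ ‖toLinf f‖} :=
      isClosed_le f.continuous.norm continuous_const
    have hd : Dense {x | ‖f x‖ ≤ ‖toLinf f‖} := Measure.dense_of_ae h
    have := hc.closure_eq ▸ hd x
    exact this

variable (n V) in
/-- The tempered distribution given by a bounded continuous function. -/
def toDist : Cb n V →ₗ[ℂ] 𝓢'(Rn n, V) where
  toFun f := (toLinf f : 𝓢'(Rn n, V))
  map_add' f g := by
    rw [toLinf_add]
    exact (Lp.toTemperedDistributionCLM V volume ⊤).map_add _ _
  map_smul' c f := by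
    rw [toLinf_smul]
    exact (Lp.toTemperedDistributionCLM V volume ⊤).map_smul _ _

theorem toDist_eq (f : Cb n V) : toDist n V f = (toLinf f : 𝓢'(Rn n, V)) := rfl

theorem toDist_apply (f : Cb n V) (w : 𝓢(Rn n, ℂ)) : toDist n V f w = ∫ x, w x • f x := by
  rw [toDist_eq, Lp.toTemperedDistribution_apply]
  refine integral_congr_ae ?_
  filter_upwards [coeFn_toLinf f] with x hx
  rw [hx]

theorem Linf_toDist_injective :
    Function.Injective (fun g : Lp V ⊤ (volume : Measure (Rn n)) => (g : 𝓢'(Rn n, V))) :=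
  LinearMap.ker_eq_bot.1 (Lp.ker_toTemperedDistributionCLM_eq_bot (F := V) (μ := volume) (p := ⊤)
    (E := Rn n))

theorem toDist_injective : Function.Injective (toDist n V) := by
  intro f g h
  have h1 : toLinf f = toLinf g := Linf_toDist_injective h
  have h2 : toLinf (f - g) = 0 := by
    have : toLinf (f - g) = toLinf f - toLinf g := rfl
    rw [this, h1, sub_self]
  rw [← sub_eq_zero, ← norm_eq_zero, ← norm_toLinf, h2, norm_zero]

theorem norm_toDist_apply_le (f : Cb n V) (w : 𝓢(Rn n, ℂ)) :
    ‖toDist n V f w‖ ≤ (∫ x, ‖w x‖) * ‖f‖ := by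
  rw [toDist_apply, ← integral_mul_const]
  refine norm_integral_le_of_norm_le (w.integrable.norm.mul_const _) (Eventually.of_forall fun x => ?_)
  rw [norm_smul]
  gcongr
  exact f.norm_coe_le_norm x

/-- Pairing bounded continuous functions with a fixed Schwartz function. -/
def pairL (w : 𝓢(Rn n, ℂ)) : Cb n V →L[ℂ] V :=
  LinearMap.mkContinuous
    { toFun := fun f => toDist n V f w
      map_add' := fun f g => by simp
      map_smul' := fun c f => by simp } (∫ x, ‖w x‖) (norm_toDist_apply_le · w)

theorem pairL_apply (w : 𝓢(Rn n, ℂ)) (f : Cb n V) : pairL w f = toDist n V f w := rfl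

theorem toDist_schwartz (g : 𝓢(Rn n, V)) :
    toDist n V g.toBoundedContinuousFunction = (g : 𝓢'(Rn n, V)) := by
  ext w
  rw [toDist_apply, SchwartzMap.coe_apply]
  rfl

/-- Representatives are unique, so the choice made in `linftyRep` is harmless. -/
theorem linftyRep_coe (g : Lp (Cn n) ⊤ (volume : Measure (Rn n))) :
    linftyRep (g : TempDist n) = g := by
  have h : ∃ g' : Lp (Cn n) ⊤ (volume : Measure (Rn n)), (g' : TempDist n) = g := ⟨g, rfl⟩
  rw [linftyRep, dif_pos h]
  exact Linf_toDist_injective h.choose_spec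

theorem lpENorm_coe (g : Lp (Cn n) ⊤ (volume : Measure (Rn n))) :
    lpENorm ⊤ (g : TempDist n) = ‖g‖ₑ := by
  refine le_antisymm (iInf₂_le (f := fun (g' : Lp (Cn n) ⊤ (volume : Measure (Rn n)))
    (_ : (g' : TempDist n) = g) => ‖g'‖ₑ) g rfl) (le_iInf₂ fun g' h => ?_)
  rw [Linf_toDist_injective h]

theorem lpENorm_toDist (f : Cb n (Cn n)) : lpENorm ⊤ (toDist n (Cn n) f) = ‖f‖ₑ := by
  rw [toDist_eq, lpENorm_coe, ← ofReal_norm, ← ofReal_norm, norm_toLinf]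

theorem exists_of_lpENorm_lt_top {f : TempDist n} (h : lpENorm ⊤ f < ⊤) :
    ∃ g : Lp (Cn n) ⊤ (volume : Measure (Rn n)), (g : TempDist n) = f := by
  by_contra! hc
  apply h.ne
  simp [lpENorm, hc]

theorem linftyRep_spec {f : TempDist n} (h : lpENorm ⊤ f < ⊤) : (linftyRep f : TempDist n) = f := by
  obtain ⟨g, rfl⟩ := exists_of_lpENorm_lt_top h
  rw [linftyRep_coe]

end NavierStokesBesov

namespace NavierStokesBesov

variable {n : ℕ} {V W : Type*} [NormedAddCommGroup V] [NormedSpace ℂ V] [CompleteSpace V]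
  [NormedAddCommGroup W] [NormedSpace ℂ W] [CompleteSpace W]

/-! ### Convolution operators and Fourier multipliers -/

/-- Fubini. Only integrability of the symbol is assumed, so that the identity also covers the Oseen
symbol, which is not smooth at the origin. -/
theorem fourier_mul_fourierInv {m : Rn n → ℂ} (hm : Integrable m) {w : Rn n → ℂ} (hw : Integrable w)
    (y : Rn n) :
    𝓕 (fun η => m η * 𝓕⁻ w η) y = ∫ x, 𝓕⁻ m (x - y) * w x := by
  simp_rw [Real.fourier_eq, Real.fourierInv_eq, Circle.smul_def, smul_eq_mul]
  have h1 : ∀ η : Rn n, (Real.fourierChar (-inner ℝ η y) : ℂ) *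
      (m η * ∫ x, (Real.fourierChar (inner ℝ x η) : ℂ) * w x)
      = ∫ x, (Real.fourierChar (-inner ℝ η y) : ℂ) * (m η * ((Real.fourierChar (inner ℝ x η) : ℂ) * w x)) := by
    intro η
    rw [integral_const_mul, integral_const_mul]
  simp_rw [h1]
  rw [integral_integral_swap]
  · refine integral_congr_ae (Eventually.of_forall fun x => ?_)
    simp only
    rw [← integral_mul_const]
    refine integral_congr_ae (Eventually.of_forall fun η => ?_)
    simp only
    rw [inner_sub_right, sub_eq_add_neg, AddChar.map_add_eq_mul, Circle.coe_mul, real_inner_comm x η]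
    ring
  · have h2 : Integrable (fun p : Rn n × Rn n => m p.1 * w p.2) (volume.prod volume) :=
      hm.mul_prod hw
    refine h2.mono ?_ (Eventually.of_forall fun p => ?_)
    · have h3 : AEStronglyMeasurable (fun p : Rn n × Rn n =>
          (Real.fourierChar (-inner ℝ p.1 y) : ℂ) * (Real.fourierChar (inner ℝ p.2 p.1) : ℂ))
          (volume.prod volume) := by
        refine Continuous.aestronglyMeasurable ?_
        have hc : Continuous fun x : ℝ => (Real.fourierChar x : ℂ) :=
          continuous_subtype_val.comp Real.continuous_fourierChar
        exact (hc.comp (by fun_prop)).mul (hc.comp (by fun_prop))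
      refine (h3.mul h2.aestronglyMeasurable).congr (Eventually.of_forall fun p => ?_)
      simp only [Function.uncurry, Pi.mul_apply]
      ring
    · simp only [Function.uncurry, norm_mul, Circle.norm_coe, one_mul, le_refl]

/-- A multiplier acts on a distribution by transposition; on the test function this is a correlation
with the kernel, which is what links multipliers to convolutions. -/
theorem fourier_smulLeft_fourierInv (m w : 𝓢(Rn n, ℂ)) (y : Rn n) :
    𝓕 (SchwartzMap.smulLeftCLM ℂ m (𝓕⁻ w)) y = ∫ x, (𝓕⁻ m) (x - y) * w x := by
  rw [SchwartzMap.fourierInv_coe, ← fourier_mul_fourierInv m.integrable w.integrable,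
    SchwartzMap.fourier_coe]
  refine congrArg (fun g : Rn n → ℂ => 𝓕 g y) (funext fun η => ?_)
  rw [SchwartzMap.smulLeftCLM_apply_apply m.hasTemperateGrowth, SchwartzMap.fourierInv_coe]
  rfl

/-- Fubini's theorem for the pairing of a convolution with an integrable function. -/
theorem integral_smul_conv {k : Rn n → ℂ} (hk : Integrable k) {w : Rn n → ℂ} (hw : Integrable w)
    {f : Rn n → V} (hf : AEStronglyMeasurable f) {M : ℝ} (hM : ∀ᵐ x, ‖f x‖ ≤ M) :
    ∫ x, w x • ∫ y, k (x - y) • f y = ∫ y, (∫ x, k (x - y) * w x) • f y := by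
  have h0 : Integrable (fun p : Rn n × Rn n => w p.1 * k (p.1 - p.2)) (volume.prod volume) := by
    have := (hw.convolution_integrand (ContinuousLinearMap.mul ℝ ℂ) (hk.comp_neg)).swap
    refine this.congr (Eventually.of_forall fun p => ?_)
    simp
  have h1 : Integrable (fun p : Rn n × Rn n => (w p.1 * k (p.1 - p.2)) • f p.2)
      (volume.prod volume) :=
    h0.smul_bdd M (hf.comp_quasiMeasurePreserving Measure.quasiMeasurePreserving_snd)
      (Measure.quasiMeasurePreserving_snd.ae hM)
  calc ∫ x, w x • ∫ y, k (x - y) • f y = ∫ x, ∫ y, (w x * k (x - y)) • f y := by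
        refine integral_congr_ae (Eventually.of_forall fun x => ?_)
        simp only
        rw [← integral_smul]
        simp_rw [mul_smul]
    _ = ∫ y, ∫ x, (w x * k (x - y)) • f y := integral_integral_swap h1
    _ = _ := by
        have h2 := h0.swap
        refine integral_congr_ae ?_
        filter_upwards with y
        rw [integral_smul_const]
        simp_rw [mul_comm]

/-! ### Multipliers with Schwartz symbols on bounded functions -/

/-- The kernel of the Fourier multiplier with a Schwartz symbol. -/
def ker (m : 𝓢(Rn n, ℂ)) : Lp ℂ 1 (volume : Measure (Rn n)) := (𝓕⁻ m : 𝓢(Rn n, ℂ)).toLp 1 volume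

theorem coeFn_ker (m : 𝓢(Rn n, ℂ)) : ker m =ᵐ[volume] (𝓕⁻ m : 𝓢(Rn n, ℂ)) := SchwartzMap.coeFn_toLp _ 1 volume

theorem ker_smul (c : ℂ) (m : 𝓢(Rn n, ℂ)) : ker (c • m) = c • ker m := by
  rw [ker, FourierTransform.fourierInv_smul]
  exact (SchwartzMap.toLpCLM ℂ ℂ 1 volume).map_smul c _

variable (V) in
/-- The Fourier multiplier with a Schwartz symbol on bounded continuous functions. -/
def mult (m : 𝓢(Rn n, ℂ)) : Cb n V →L[ℂ] Cb n V := convL n V (ker m)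

theorem norm_mult_le (m : 𝓢(Rn n, ℂ)) : ‖mult V m‖ ≤ ‖ker m‖ := norm_convL_le _

theorem mult_apply (m : 𝓢(Rn n, ℂ)) (f : Cb n V) (x : Rn n) :
    mult V m f x = ∫ y, (𝓕⁻ m) (x - y) • f y := by
  rw [mult, convL_apply, integral_kernel_smul_swap]
  refine integral_congr_ae ?_
  filter_upwards [coeFn_ker m] with y hy
  rw [hy]

theorem mult_smul (c : ℂ) (m : 𝓢(Rn n, ℂ)) : mult V (c • m) = c • mult V m := by
  rw [mult, ker_smul, map_smul]; rfl

theorem mult_comp (L : V →L[ℂ] W) (m : 𝓢(Rn n, ℂ)) (f : Cb n V) :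
    mult W m (L.compLeftContinuousBounded (Rn n) f) =
      L.compLeftContinuousBounded (Rn n) (mult V m f) := convL_comp L _ f

/-- The exponent `n + 1` is the first integer for which the majorant is integrable over `ℝⁿ`. -/
theorem exists_decay (k : 𝓢(Rn n, ℂ)) :
    ∃ C, 0 ≤ C ∧ ∀ z, ‖k z‖ ≤ C * (1 + ‖z‖) ^ (-((n + 1 : ℕ) : ℝ)) := by
  refine ⟨2 ^ (n + 1) * ((Finset.Iic (n + 1, 0)).sup (schwartzSeminormFamily ℝ (Rn n) ℂ)) k,
    by positivity, fun z => ?_⟩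
  have h := SchwartzMap.one_add_le_sup_seminorm_apply (𝕜 := ℝ) (m := (n + 1, 0)) (k := n + 1)
    (n := 0) le_rfl le_rfl k z
  rw [norm_iteratedFDeriv_zero] at h
  have hz : (0 : ℝ) < 1 + ‖z‖ := by positivity
  rw [Real.rpow_neg hz.le, Real.rpow_natCast, ← div_eq_mul_inv, le_div_iff₀ (by positivity)]
  calc _ = (1 + ‖z‖) ^ (n + 1) * ‖k z‖ := mul_comm _ _
    _ ≤ _ := h

theorem integrable_decay : Integrable (fun z : Rn n => (1 + ‖z‖) ^ (-((n + 1 : ℕ) : ℝ))) := by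
  refine integrable_one_add_norm ?_
  simp

/-- The convolution of a Schwartz kernel with a bounded measurable function. -/
theorem continuous_conv_Linf (k : 𝓢(Rn n, ℂ)) {f : Rn n → V} (hf : AEStronglyMeasurable f) {M : ℝ}
    (hM : ∀ᵐ x, ‖f x‖ ≤ M) : Continuous fun x => ∫ y, k (x - y) • f y := by
  obtain ⟨C, hC, hk⟩ := exists_decay k
  rw [continuous_iff_continuousAt]
  intro x₀
  have hb : ∀ᶠ x in 𝓝 x₀, ‖x - x₀‖ < 1 := by
    have := Metric.ball_mem_nhds x₀ one_pos
    filter_upwards [this] with x hx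
    rwa [mem_ball_iff_norm] at hx
  refine continuousAt_of_dominated
    (bound := fun y => (C * (2 ^ ((n + 1 : ℕ) : ℝ) * (1 + ‖x₀ - y‖) ^ (-((n + 1 : ℕ) : ℝ)))) * M)
    ?_ ?_ ?_ ?_
  · filter_upwards with x
    exact (k.continuous.comp (by fun_prop)).aestronglyMeasurable.smul hf
  · filter_upwards [hb] with x hx
    filter_upwards [hM] with y hy
    rw [norm_smul]
    have h1 : (1 + ‖x - y‖) ^ (-((n + 1 : ℕ) : ℝ)) ≤
        2 ^ ((n + 1 : ℕ) : ℝ) * (1 + ‖x₀ - y‖) ^ (-((n + 1 : ℕ) : ℝ)) := by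
      -- Moving the centre by less than one costs a factor two, so the majorant can be chosen
      -- independent of `x`.
      have h2 : 1 + ‖x₀ - y‖ ≤ 2 * (1 + ‖x - y‖) := by
        have : ‖x₀ - y‖ ≤ ‖x - y‖ + ‖x - x₀‖ := by
          have := norm_sub_le (x - y) (x - x₀)
          rwa [sub_sub_sub_cancel_left] at this
        have := norm_nonneg (x - y)
        linarith
      rw [Real.rpow_neg (by positivity), Real.rpow_neg (by positivity), ← div_eq_mul_inv,
        le_div_iff₀ (by positivity), inv_mul_le_iff₀ (by positivity),
        ← Real.mul_rpow (by positivity) (by positivity), mul_comm]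
      gcongr
    have h3 := (hk (x - y)).trans (mul_le_mul_of_nonneg_left h1 hC)
    gcongr
  · have := (integrable_decay (n := n)).comp_sub_left x₀
    exact ((this.const_mul _).const_mul C).mul_const M
  · filter_upwards with y
    exact ((k.continuous.comp (by fun_prop)).smul continuous_const).continuousAt

theorem norm_ker (m : 𝓢(Rn n, ℂ)) : ‖ker m‖ = ∫ x, ‖(𝓕⁻ m : 𝓢(Rn n, ℂ)) x‖ := by
  rw [L1.norm_eq_integral_norm]
  refine integral_congr_ae ?_
  filter_upwards [coeFn_ker m] with y hy
  rw [hy]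

/-- The convolution of a Schwartz kernel with an `L^∞` function. -/
def convLinf (k : 𝓢(Rn n, ℂ)) (g : Lp V ⊤ (volume : Measure (Rn n))) : Cb n V :=
  BoundedContinuousFunction.ofNormedAddCommGroup (fun x => ∫ y, k (x - y) • g y)
    (continuous_conv_Linf k (Lp.aestronglyMeasurable g) (ae_norm_le_Linf g)) ((∫ y, ‖k y‖) * ‖g‖)
    (fun x => by
      rw [integral_kernel_smul_swap]
      exact norm_integral_kernel_smul_le k.integrable (ae_norm_le_Linf g) x)

theorem convLinf_apply (k : 𝓢(Rn n, ℂ)) (g : Lp V ⊤ (volume : Measure (Rn n))) (x : Rn n) :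
    convLinf k g x = ∫ y, k (x - y) • g y := rfl

theorem norm_convLinf_le (k : 𝓢(Rn n, ℂ)) (g : Lp V ⊤ (volume : Measure (Rn n))) :
    ‖convLinf k g‖ ≤ (∫ y, ‖k y‖) * ‖g‖ := by
  refine (BoundedContinuousFunction.norm_le (by positivity)).2 fun x => ?_
  rw [convLinf_apply, integral_kernel_smul_swap]
  exact norm_integral_kernel_smul_le k.integrable (ae_norm_le_Linf g) x

/-- Smoothing: a merely measurable bounded function becomes continuous under a Schwartz multiplier.
This is why the whole iteration can be carried out in `C_b`. -/
theorem exists_mult_Linf (m : 𝓢(Rn n, ℂ)) (g : Lp V ⊤ (volume : Measure (Rn n))) :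
    ∃ f : Cb n V, toDist n V f = TemperedDistribution.fourierMultiplierCLM V m (g : 𝓢'(Rn n, V)) ∧
      ‖f‖ ≤ ‖ker m‖ * ‖g‖ := by
  refine ⟨convLinf (𝓕⁻ m) g, ?_, norm_ker m ▸ norm_convLinf_le _ _⟩
  ext w
  rw [toDist_apply, TemperedDistribution.fourierMultiplierCLM_apply_apply,
    Lp.toTemperedDistribution_apply]
  simp_rw [fourier_smulLeft_fourierInv, convLinf_apply]
  exact integral_smul_conv (SchwartzMap.integrable _) w.integrable (Lp.aestronglyMeasurable g)
    (ae_norm_le_Linf g)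

theorem toDist_mult (m : 𝓢(Rn n, ℂ)) (f : Cb n V) :
    toDist n V (mult V m f) = TemperedDistribution.fourierMultiplierCLM V m (toDist n V f) := by
  ext w
  rw [toDist_apply, TemperedDistribution.fourierMultiplierCLM_apply_apply, toDist_apply]
  simp_rw [mult_apply, fourier_smulLeft_fourierInv]
  exact integral_smul_conv (𝓕⁻ m).integrable w.integrable f.continuous.aestronglyMeasurable
    (Eventually.of_forall f.norm_coe_le_norm)

/-- The embedding of `C_b` into `S'` is injective, so the composition rule may be read off from the
symbol calculus of distributions. -/
theorem mult_mult {m₁ m₂ m : 𝓢(Rn n, ℂ)} (h : ∀ η, m η = m₁ η * m₂ η) :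
    mult V m = mult V m₂ ∘L mult V m₁ := by
  ext1 f
  apply toDist_injective
  rw [ContinuousLinearMap.comp_apply, toDist_mult, toDist_mult, toDist_mult,
    TemperedDistribution.fourierMultiplierCLM_fourierMultiplierCLM_apply m₁.hasTemperateGrowth
      m₂.hasTemperateGrowth]
  congr 2
  ext η
  exact h η

/-- Needed to keep solutions with data in the closed Schwartz class inside that class. -/
theorem mult_schwartz (m : 𝓢(Rn n, ℂ)) (g : 𝓢(Rn n, V)) :
    mult V m g.toBoundedContinuousFunction =
      (SchwartzMap.fourierMultiplierCLM V (m : Rn n → ℂ) g).toBoundedContinuousFunction := by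
  apply toDist_injective
  rw [toDist_mult, toDist_schwartz, toDist_schwartz,
    TemperedDistribution.fourierMultiplierCLM_toTemperedDistributionCLM_eq m.hasTemperateGrowth]

/-! ### Dilations of symbols -/

/-- The symbol `m(r ·)`, `r ≠ 0`. -/
def dil (r : ℝ) (hr : r ≠ 0) (m : 𝓢(Rn n, ℂ)) : 𝓢(Rn n, ℂ) :=
  SchwartzMap.compCLMOfContinuousLinearEquiv ℂ
    (ContinuousLinearEquiv.smulLeft (Units.mk0 r hr) : Rn n ≃L[ℝ] Rn n) m

theorem dil_apply (r : ℝ) (hr : r ≠ 0) (m : 𝓢(Rn n, ℂ)) (η : Rn n) : dil r hr m η = m (r • η) := rfl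

theorem fourierInv_dil (r : ℝ) (hr : 0 < r) (m : 𝓢(Rn n, ℂ)) (x : Rn n) :
    (𝓕⁻ (dil r hr.ne' m)) x = ((r⁻¹ ^ n : ℝ) : ℂ) * (𝓕⁻ m) (r⁻¹ • x) := by
  rw [SchwartzMap.fourierInv_coe, SchwartzMap.fourierInv_coe, Real.fourierInv_eq, Real.fourierInv_eq]
  have := Measure.integral_comp_smul_of_nonneg (volume : Measure (Rn n))
    (fun η => Real.fourierChar (inner ℝ η (r⁻¹ • x)) • m η) r (hR := hr.le)
  simp only [finrank_euclideanSpace, Fintype.card_fin] at this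
  rw [inv_pow, ← Complex.real_smul, ← this]
  refine integral_congr_ae (Eventually.of_forall fun η => ?_)
  simp only [dil_apply, inner_smul_left, inner_smul_right]
  congr 3
  simp
  field_simp

/-- Dilating the symbol rescales the kernel while preserving its `L¹` norm. All constants that are
uniform in time or in the dyadic index come from this invariance. -/
theorem norm_ker_dil (r : ℝ) (hr : 0 < r) (m : 𝓢(Rn n, ℂ)) : ‖ker (dil r hr.ne' m)‖ = ‖ker m‖ := by
  rw [norm_ker, norm_ker]
  simp_rw [fourierInv_dil r hr, norm_mul, Complex.norm_real]
  rw [integral_const_mul, Measure.integral_comp_smul_of_nonneg (volume : Measure (Rn n))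
    (fun x => ‖(𝓕⁻ m : 𝓢(Rn n, ℂ)) x‖) r⁻¹ (hR := inv_nonneg.2 hr.le)]
  simp only [finrank_euclideanSpace, Fintype.card_fin, smul_eq_mul]
  rw [Real.norm_of_nonneg (by positivity), ← mul_assoc, mul_inv_cancel₀ (by positivity), one_mul]

/-- The kernels of dilated symbols depend continuously in `L¹` on the dilation factor. -/
theorem continuousOn_ker_dil (m : 𝓢(Rn n, ℂ)) :
    Continuous fun r : Ioi (0 : ℝ) => ker (dil (r : ℝ) r.2.ne' m) := by
  rw [continuous_iff_continuousAt]
  intro r₀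
  obtain ⟨C, hC, hk⟩ := exists_decay (𝓕⁻ m)
  have hr₀ : (0 : ℝ) < r₀ := r₀.2
  rw [ContinuousAt, tendsto_iff_norm_sub_tendsto_zero]
  have hpos : ∀ r : Ioi (0 : ℝ), (0 : ℝ) < r := fun r => r.2
  have h1 : ∀ r : Ioi (0 : ℝ), ‖ker (dil (r : ℝ) r.2.ne' m) - ker (dil (r₀ : ℝ) r₀.2.ne' m)‖ =
      ∫ x, ‖(((r : ℝ)⁻¹ ^ n : ℝ) : ℂ) * (𝓕⁻ m) ((r : ℝ)⁻¹ • x) -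
        (((r₀ : ℝ)⁻¹ ^ n : ℝ) : ℂ) * (𝓕⁻ m) ((r₀ : ℝ)⁻¹ • x)‖ := by
    intro r
    rw [L1.norm_eq_integral_norm]
    refine integral_congr_ae ?_
    filter_upwards [Lp.coeFn_sub (ker (dil (r : ℝ) r.2.ne' m)) (ker (dil (r₀ : ℝ) r₀.2.ne' m)),
      coeFn_ker (dil (r : ℝ) r.2.ne' m), coeFn_ker (dil (r₀ : ℝ) r₀.2.ne' m)] with x h h' h''
    rw [h, Pi.sub_apply, h', h'', fourierInv_dil _ (hpos r), fourierInv_dil _ hr₀]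
  simp_rw [h1]
  have hb : ∀ᶠ r : Ioi (0 : ℝ) in 𝓝 r₀, (r₀ : ℝ) / 2 < r ∧ (r : ℝ) < 2 * r₀ := by
    have : Tendsto (fun r : Ioi (0 : ℝ) => (r : ℝ)) (𝓝 r₀) (𝓝 (r₀ : ℝ)) :=
      continuous_subtype_val.continuousAt
    exact (this.eventually (lt_mem_nhds (by linarith))).and
      (this.eventually (gt_mem_nhds (by linarith)))
  -- One majorant for all dilation factors between `r₀/2` and `2r₀`.
  have hdec : ∀ r : ℝ, 0 < r → (r₀ : ℝ) / 2 < r → r < 2 * r₀ → ∀ x : Rn n,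
      ‖((r⁻¹ ^ n : ℝ) : ℂ) * (𝓕⁻ m) (r⁻¹ • x)‖ ≤
      ((r₀ : ℝ) / 2)⁻¹ ^ n * (C * (1 + ‖(2 * r₀ : ℝ)⁻¹ • x‖) ^ (-((n + 1 : ℕ) : ℝ))) := by
    intro r hr h1 h2 x
    rw [norm_mul, Complex.norm_real, Real.norm_of_nonneg (by positivity)]
    have h3 : (1 + ‖r⁻¹ • x‖) ^ (-((n + 1 : ℕ) : ℝ)) ≤
        (1 + ‖(2 * r₀ : ℝ)⁻¹ • x‖) ^ (-((n + 1 : ℕ) : ℝ)) := by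
      refine Real.rpow_le_rpow_of_nonpos (by positivity) ?_ (neg_nonpos.2 (Nat.cast_nonneg _))
      rw [norm_smul, norm_smul, Real.norm_of_nonneg (by positivity),
        Real.norm_of_nonneg (by positivity)]
      gcongr
    have h4 := (hk (r⁻¹ • x)).trans (mul_le_mul_of_nonneg_left h3 hC)
    gcongr
  rw [show 𝓝 (0 : ℝ) = 𝓝 (∫ x : Rn n, (0 : ℝ)) by simp]
  refine tendsto_integral_filter_of_dominated_convergence
    (fun x => 2 * (((r₀ : ℝ) / 2)⁻¹ ^ n * (C * (1 + ‖(2 * r₀ : ℝ)⁻¹ • x‖) ^ (-((n + 1 : ℕ) : ℝ)))))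
    ?_ ?_ ?_ ?_
  · filter_upwards with r
    refine Continuous.aestronglyMeasurable ?_
    have := (𝓕⁻ m).continuous
    fun_prop
  · filter_upwards [hb] with r hr
    filter_upwards with x
    rw [norm_norm, two_mul]
    exact (norm_sub_le _ _).trans (add_le_add (hdec r r.2 hr.1 hr.2 x)
      (hdec r₀ hr₀ (by linarith) (by linarith) x))
  · refine ((Integrable.const_mul ?_ C).const_mul _).const_mul 2
    exact (integrable_decay (n := n)).comp_smul (by positivity)
  · filter_upwards with x
    have hc : Continuous fun r : Ioi (0 : ℝ) => ‖(((r : ℝ)⁻¹ ^ n : ℝ) : ℂ) * (𝓕⁻ m) ((r : ℝ)⁻¹ • x) -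
        (((r₀ : ℝ)⁻¹ ^ n : ℝ) : ℂ) * (𝓕⁻ m) ((r₀ : ℝ)⁻¹ • x)‖ := by
      have hi : Continuous fun r : Ioi (0 : ℝ) => (r : ℝ)⁻¹ :=
        continuous_subtype_val.inv₀ fun r => r.2.ne'
      have := (𝓕⁻ m).continuous
      fun_prop
    have := hc.tendsto r₀
    simpa using this

theorem norm_mult_dil_le (r : ℝ) (hr : 0 < r) (m : 𝓢(Rn n, ℂ)) :
    ‖mult V (dil r hr.ne' m)‖ ≤ ‖ker m‖ := (norm_mult_le _).trans (norm_ker_dil r hr m).le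

end NavierStokesBesov

namespace NavierStokesBesov

variable {n : ℕ} {V W : Type*} [NormedAddCommGroup V] [NormedSpace ℂ V] [CompleteSpace V]
  [NormedAddCommGroup W] [NormedSpace ℂ W] [CompleteSpace W]

/-! ### Gaussian symbols -/

theorem norm_iteratedFDeriv_exp_neg (i : ℕ) (t : ℝ) :
    ‖iteratedFDeriv ℝ i (fun s : ℝ => Real.exp (-s)) t‖ = Real.exp (-t) := by
  rw [norm_iteratedFDeriv_eq_norm_iteratedDeriv]
  have := congrFun (iteratedDeriv_exp_const_mul i (-1 : ℝ)) t
  simp only [neg_one_mul] at this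
  rw [this, norm_mul, norm_pow, norm_neg, norm_one, one_pow, one_mul,
    Real.norm_of_nonneg (Real.exp_pos _).le]

theorem pow_mul_exp_neg_sq_le (N : ℕ) (r : ℝ) (hr : 0 ≤ r) :
    (1 + r) ^ N * Real.exp (-r ^ 2) ≤ 2 ^ N * N.factorial * Real.exp 1 := by
  have h1 : (1 + r) ^ N ≤ 2 ^ N * (1 + r ^ 2) ^ N := by
    rw [← mul_pow]
    refine pow_le_pow_left₀ (by positivity) ?_ N
    nlinarith [sq_nonneg (r - 1)]
  have h2 : (1 + r ^ 2) ^ N ≤ N.factorial * Real.exp (1 + r ^ 2) := by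
    have := Real.pow_div_factorial_le_exp (1 + r ^ 2) (by positivity) N
    rw [div_le_iff₀ (by positivity)] at this
    linarith
  calc (1 + r) ^ N * Real.exp (-r ^ 2)
      ≤ 2 ^ N * (N.factorial * Real.exp (1 + r ^ 2)) * Real.exp (-r ^ 2) := by gcongr; exact h1.trans (by gcongr)
    _ = 2 ^ N * N.factorial * Real.exp 1 := by
        rw [Real.exp_add, Real.exp_neg]
        field_simp

/-- The Gaussian is `exp(-s)` composed with the squared norm. All derivatives of the outer function
have size `exp(-s)`, those of the inner one grow polynomially, so each derivative is bounded by a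
polynomial times the Gaussian. -/
theorem norm_iteratedFDeriv_gaussian (k l : ℕ) : ∃ C, ∀ x : Rn n,
    ‖x‖ ^ k * ‖iteratedFDeriv ℝ l (fun x : Rn n => Real.exp (-‖x‖ ^ 2)) x‖ ≤ C := by
  obtain ⟨p, C, hC, h⟩ := (Function.hasTemperateGrowth_norm_sq (H := Rn n)).norm_iteratedFDeriv_le_uniform l
  refine ⟨(l.factorial * (C + 1) ^ l) * (2 ^ (k + p * l) * (k + p * l).factorial * Real.exp 1),
    fun x => ?_⟩
  have h1 : ‖iteratedFDeriv ℝ l ((fun s : ℝ => Real.exp (-s)) ∘ fun x : Rn n => ‖x‖ ^ 2) x‖ ≤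
      l.factorial * Real.exp (-‖x‖ ^ 2) * ((C + 1) * (1 + ‖x‖) ^ p) ^ l := by
    refine norm_iteratedFDeriv_comp_le (N := ∞) (by fun_prop) (contDiff_norm_sq ℝ)
      (by exact_mod_cast le_top) x (fun i _ => (norm_iteratedFDeriv_exp_neg i _).le) fun i hi hil => ?_
    refine (h i hil x).trans ?_
    -- The composition bound wants the `i`-th derivative of the inner function below an `i`-th
    -- power. Enlarging `C` to `C + 1` makes the base at least one, so a first power suffices.
    have h2 : (1 : ℝ) ≤ (C + 1) * (1 + ‖x‖) ^ p :=
      one_le_mul_of_one_le_of_one_le (by linarith) (one_le_pow₀ (by linarith [norm_nonneg x]))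
    calc C * (1 + ‖x‖) ^ p ≤ (C + 1) * (1 + ‖x‖) ^ p := by gcongr; linarith
      _ ≤ _ := le_self_pow₀ h2 (by omega)
  have h3 : ‖x‖ ^ k ≤ (1 + ‖x‖) ^ k := by gcongr; linarith
  calc _ ≤ (1 + ‖x‖) ^ k * (l.factorial * Real.exp (-‖x‖ ^ 2) * ((C + 1) * (1 + ‖x‖) ^ p) ^ l) := by
        gcongr
        exact h1
    _ = (l.factorial * (C + 1) ^ l) * ((1 + ‖x‖) ^ (k + p * l) * Real.exp (-‖x‖ ^ 2)) := by
        rw [mul_pow, pow_add, pow_mul]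
        ring
    _ ≤ _ := by
        exact mul_le_mul_of_nonneg_left (pow_mul_exp_neg_sq_le _ _ (norm_nonneg x)) (by positivity)

variable (n) in
/-- The Gaussian `e^{-|η|²}`. -/
def gaussReal : 𝓢(Rn n, ℝ) where
  toFun x := Real.exp (-‖x‖ ^ 2)
  smooth' := by
    have := contDiff_norm_sq ℝ (E := Rn n) (n := ∞)
    fun_prop
  decay' k l := norm_iteratedFDeriv_gaussian k l

theorem two_pi_pos : (0 : ℝ) < 2 * Real.pi := Real.two_pi_pos

variable (n) in
/-- The symbol `e^{-|ξ|²}`, `ξ = 2πη`. -/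
def gauss : 𝓢(Rn n, ℂ) :=
  dil (2 * Real.pi) two_pi_pos.ne' (SchwartzMap.postcompCLM Complex.ofRealCLM (gaussReal n))

theorem gauss_apply (η : Rn n) : gauss n η = ((Real.exp (-(2 * Real.pi * ‖η‖) ^ 2) : ℝ) : ℂ) := by
  rw [gauss, dil_apply, SchwartzMap.postcompCLM_apply]
  change ((Real.exp (-‖(2 * Real.pi) • η‖ ^ 2) : ℝ) : ℂ) = _
  rw [norm_smul, Real.norm_of_nonneg two_pi_pos.le]

variable (n) in
/-- The symbol `e^{-t|ξ|²}` of the heat operator, `t > 0`. -/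
def heatS (t : ℝ) (ht : 0 < t) : 𝓢(Rn n, ℂ) := dil (√t) (Real.sqrt_pos.2 ht).ne' (gauss n)

theorem heatS_apply (t : ℝ) (ht : 0 < t) (η : Rn n) :
    heatS n t ht η = ((Real.exp (-(t * (2 * Real.pi * ‖η‖) ^ 2)) : ℝ) : ℂ) := by
  rw [heatS, dil_apply, gauss_apply, norm_smul, Real.norm_of_nonneg (Real.sqrt_nonneg t)]
  congr 3
  rw [show 2 * Real.pi * (√t * ‖η‖) = √t * (2 * Real.pi * ‖η‖) by ring, mul_pow, Real.sq_sqrt ht.le]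

theorem heat_eq (t : ℝ) (ht : 0 < t) (f : TempDist n) :
    heat t f = TemperedDistribution.fourierMultiplierCLM (Cn n) (heatS n t ht) f := by
  rw [heat]
  congr 1
  congr 1
  ext η
  rw [heatS_apply]

theorem heat_zero (f : TempDist n) : heat 0 f = f := by
  rw [heat]
  simp

/-! ### Products of symbols -/

/-- The product of two Schwartz symbols. -/
def mulS (m₁ m₂ : 𝓢(Rn n, ℂ)) : 𝓢(Rn n, ℂ) := SchwartzMap.smulLeftCLM ℂ (m₁ : Rn n → ℂ) m₂

theorem mulS_apply (m₁ m₂ : 𝓢(Rn n, ℂ)) (η : Rn n) : mulS m₁ m₂ η = m₁ η * m₂ η := by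
  rw [mulS, SchwartzMap.smulLeftCLM_apply_apply m₁.hasTemperateGrowth, smul_eq_mul]

theorem mult_mulS (m₁ m₂ : 𝓢(Rn n, ℂ)) : mult V (mulS m₁ m₂) = mult V m₂ ∘L mult V m₁ :=
  mult_mult (mulS_apply m₁ m₂)

theorem fourierMultiplier_congr {m₁ m₂ : Rn n → ℂ} (h : ∀ η, m₁ η = m₂ η) (f : 𝓢'(Rn n, V)) :
    TemperedDistribution.fourierMultiplierCLM V m₁ f =
      TemperedDistribution.fourierMultiplierCLM V m₂ f := by
  rw [funext h]

theorem fourierMultiplier_mulS (m₁ m₂ : 𝓢(Rn n, ℂ)) (f : 𝓢'(Rn n, V)) :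
    TemperedDistribution.fourierMultiplierCLM V m₂ (TemperedDistribution.fourierMultiplierCLM V m₁ f) =
      TemperedDistribution.fourierMultiplierCLM V (mulS m₁ m₂) f := by
  rw [TemperedDistribution.fourierMultiplierCLM_fourierMultiplierCLM_apply m₁.hasTemperateGrowth
    m₂.hasTemperateGrowth]
  exact fourierMultiplier_congr (fun η => (mulS_apply m₁ m₂ η).symm) f

theorem fourierMultiplier_comm (m₁ m₂ : 𝓢(Rn n, ℂ)) (f : 𝓢'(Rn n, V)) :
    TemperedDistribution.fourierMultiplierCLM V m₂ (TemperedDistribution.fourierMultiplierCLM V m₁ f) =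
      TemperedDistribution.fourierMultiplierCLM V m₁
        (TemperedDistribution.fourierMultiplierCLM V m₂ f) := by
  rw [fourierMultiplier_mulS, fourierMultiplier_mulS]
  refine fourierMultiplier_congr (fun η => ?_) f
  rw [mulS_apply, mulS_apply, mul_comm]

/-! ### The cutoff symbols -/

/-- The profile is smooth only on the half-line and the norm is not smooth at the origin, but there
the cutoff is constant. -/
theorem contDiff_cutoff {φ : ℝ → ℝ} (hφ : IsCutoff φ) : ContDiff ℝ ∞ fun η : Rn n => φ ‖η‖ := by
  rw [contDiff_iff_contDiffAt]
  intro η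
  by_cases h : η = 0
  · subst h
    have : (fun η : Rn n => φ ‖η‖) =ᶠ[𝓝 0] fun _ => 1 := by
      filter_upwards [Metric.ball_mem_nhds (0 : Rn n) one_pos] with x hx
      rw [mem_ball_zero_iff] at hx
      exact hφ.eq_one _ (norm_nonneg x) (by linarith)
    exact contDiffAt_const.congr_of_eventuallyEq this
  · have h1 : ContDiffAt ℝ ∞ φ ‖η‖ :=
      hφ.smooth.contDiffAt (Ici_mem_nhds (norm_pos_iff.2 h))
    exact h1.comp η (contDiffAt_norm ℝ h)

theorem hasCompactSupport_cutoff {φ : ℝ → ℝ} (hφ : IsCutoff φ) :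
    HasCompactSupport fun η : Rn n => φ ‖η‖ := by
  refine HasCompactSupport.intro (isCompact_closedBall (0 : Rn n) (3 / 2)) fun x hx => ?_
  rw [mem_closedBall_zero_iff, not_le] at hx
  exact hφ.eq_zero _ hx.le

/-- The symbol `φ(|ξ|)`, `ξ = 2πη`. -/
def phiS (n : ℕ) {φ : ℝ → ℝ} (hφ : IsCutoff φ) : 𝓢(Rn n, ℂ) :=
  dil (2 * Real.pi) two_pi_pos.ne' (SchwartzMap.postcompCLM Complex.ofRealCLM
    ((hasCompactSupport_cutoff hφ).toSchwartzMap (contDiff_cutoff hφ)))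

variable {φ : ℝ → ℝ} (hφ : IsCutoff φ)

theorem phiS_apply (η : Rn n) : phiS n hφ η = ((φ (2 * Real.pi * ‖η‖) : ℝ) : ℂ) := by
  rw [phiS, dil_apply, SchwartzMap.postcompCLM_apply]
  change ((φ ‖(2 * Real.pi) • η‖ : ℝ) : ℂ) = _
  rw [norm_smul, Real.norm_of_nonneg two_pi_pos.le]

theorem dil_phiS_apply (r : ℝ) (hr : 0 < r) (η : Rn n) :
    dil r hr.ne' (phiS n hφ) η = ((φ (r * (2 * Real.pi * ‖η‖)) : ℝ) : ℂ) := by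
  rw [dil_apply, phiS_apply, norm_smul, Real.norm_of_nonneg hr.le]
  congr 2
  ring

/-- The symbol `φ(|ξ|/2)`, which is `1` on the support of `φ(|ξ|)`. -/
def phiFat (n : ℕ) {φ : ℝ → ℝ} (hφ : IsCutoff φ) : 𝓢(Rn n, ℂ) :=
  dil (1 / 2) one_half_pos.ne' (phiS n hφ)

/-- The symbol `ψ(ξ) = φ(|ξ|) - φ(2|ξ|)`. -/
def psiS (n : ℕ) {φ : ℝ → ℝ} (hφ : IsCutoff φ) : 𝓢(Rn n, ℂ) :=
  phiS n hφ - dil 2 two_pos.ne' (phiS n hφ)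

/-- The symbol `φ(|ξ|/2) - φ(4|ξ|)`, which is `1` on the support of `ψ`. -/
def psiFat (n : ℕ) {φ : ℝ → ℝ} (hφ : IsCutoff φ) : 𝓢(Rn n, ℂ) :=
  phiFat n hφ - dil 4 four_pos.ne' (phiS n hφ)

theorem phiFat_apply (η : Rn n) :
    phiFat n hφ η = ((φ (1 / 2 * (2 * Real.pi * ‖η‖)) : ℝ) : ℂ) := dil_phiS_apply hφ _ one_half_pos η

theorem psiS_apply (η : Rn n) : psiS n hφ η =
    ((φ (2 * Real.pi * ‖η‖) - φ (2 * (2 * Real.pi * ‖η‖)) : ℝ) : ℂ) := by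
  rw [psiS, _root_.sub_apply, phiS_apply, dil_phiS_apply hφ 2 two_pos, Complex.ofReal_sub]

theorem psiFat_apply (η : Rn n) : psiFat n hφ η =
    ((φ (1 / 2 * (2 * Real.pi * ‖η‖)) - φ (4 * (2 * Real.pi * ‖η‖)) : ℝ) : ℂ) := by
  rw [psiFat, _root_.sub_apply, phiFat_apply, dil_phiS_apply hφ 4 four_pos, Complex.ofReal_sub]

/-- The annulus symbol lives on `5/8 ≤ |ξ| ≤ 3/2`; there `|ξ|/2 ≤ 5/4` and `4|ξ| ≥ 3/2`, so the
fattened symbol equals one. Inserting it lets further multipliers act on a localised symbol. -/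
theorem psiS_mul_psiFat (η : Rn n) : psiS n hφ η * psiFat n hφ η = psiS n hφ η := by
  rw [psiS_apply, psiFat_apply, ← Complex.ofReal_mul]
  congr 1
  have h0 : 0 ≤ 2 * Real.pi * ‖η‖ := by positivity
  set r := 2 * Real.pi * ‖η‖
  rcases le_total (3 / 2) r with h | h
  · rw [hφ.eq_zero _ h, hφ.eq_zero (2 * r) (by linarith)]
    simp
  · rcases le_total r (5 / 8) with h' | h'
    · rw [hφ.eq_one _ h0 (by linarith), hφ.eq_one (2 * r) (by linarith) (by linarith)]
      simp
    · rw [hφ.eq_one (1 / 2 * r) (by linarith) (by linarith), hφ.eq_zero (4 * r) (by linarith)]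
      simp

theorem lowFreq_eq (f : TempDist n) :
    lowFreq φ f = TemperedDistribution.fourierMultiplierCLM (Cn n) (phiS n hφ) f :=
  fourierMultiplier_congr (fun η => (phiS_apply hφ η).symm) f

theorem pow_two_inv_pos (j : ℕ) : (0 : ℝ) < (2 ^ j)⁻¹ := by positivity

/-- The symbol `ψ(2^{-j} ξ)`. -/
def psiJ (n : ℕ) {φ : ℝ → ℝ} (hφ : IsCutoff φ) (j : ℕ) : 𝓢(Rn n, ℂ) :=
  dil (2 ^ j)⁻¹ (pow_two_inv_pos j).ne' (psiS n hφ)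

theorem psiJ_apply (j : ℕ) (η : Rn n) : psiJ n hφ j η =
    ((φ (2 * Real.pi * ‖η‖ / 2 ^ j) - φ (2 * (2 * Real.pi * ‖η‖ / 2 ^ j)) : ℝ) : ℂ) := by
  rw [psiJ, dil_apply, psiS_apply, norm_smul, Real.norm_of_nonneg (pow_two_inv_pos j).le]
  have : 2 * Real.pi * ((2 ^ j)⁻¹ * ‖η‖) = 2 * Real.pi * ‖η‖ / 2 ^ j := by
    rw [div_eq_mul_inv]
    ring
  rw [this]

theorem dyadicBlock_eq (j : ℕ) (f : TempDist n) :
    dyadicBlock φ j f = TemperedDistribution.fourierMultiplierCLM (Cn n) (psiJ n hφ j) f :=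
  fourierMultiplier_congr (fun η => (psiJ_apply hφ j η).symm) f

/-- The symbol of a block of frequencies around `2^j`. -/
def psiFatJ (n : ℕ) {φ : ℝ → ℝ} (hφ : IsCutoff φ) (j : ℕ) : 𝓢(Rn n, ℂ) :=
  dil (2 ^ j)⁻¹ (pow_two_inv_pos j).ne' (psiFat n hφ)

theorem psiJ_mul_psiFatJ (j : ℕ) (η : Rn n) : psiJ n hφ j η * psiFatJ n hφ j η = psiJ n hφ j η :=
  psiS_mul_psiFat hφ _

/-- The symbol `φ(2^{-j} |ξ|)`. -/
def phiJ (n : ℕ) {φ : ℝ → ℝ} (hφ : IsCutoff φ) (j : ℕ) : 𝓢(Rn n, ℂ) :=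
  dil (2 ^ j)⁻¹ (pow_two_inv_pos j).ne' (phiS n hφ)

theorem phiJ_succ (j : ℕ) (η : Rn n) :
    phiJ n hφ (j + 1) η = phiJ n hφ j η + psiJ n hφ (j + 1) η := by
  rw [psiJ_apply, phiJ, phiJ, dil_phiS_apply hφ _ (pow_two_inv_pos _),
    dil_phiS_apply hφ _ (pow_two_inv_pos _), ← Complex.ofReal_add]
  congr 1
  have h1 : 2 * (2 * Real.pi * ‖η‖ / 2 ^ (j + 1)) = (2 ^ j)⁻¹ * (2 * Real.pi * ‖η‖) := by
    rw [pow_succ]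
    field_simp
  rw [h1, div_eq_inv_mul]
  ring

theorem phiJ_eq_sum (j : ℕ) (η : Rn n) :
    phiJ n hφ j η = phiS n hφ η + ∑ i ∈ Finset.range j, psiJ n hφ (i + 1) η := by
  induction j with
  | zero => simp [phiJ, dil_apply]
  | succ j ih => rw [phiJ_succ, ih, Finset.sum_range_succ, add_assoc]

/-! ### Decay of the heat operator on frequency blocks -/

/-- The symbol `|η|^{-2N} (φ(|ξ|/2) - φ(4|ξ|))`. -/
theorem exists_inv_norm_pow_mul_psiFat (N : ℕ) :
    ∃ m : 𝓢(Rn n, ℂ), ∀ η, psiFat n hφ η = m η * ((‖η‖ ^ 2) ^ N : ℝ) := by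
  have h0 : (psiFat n hφ : Rn n → ℂ) =ᶠ[𝓝 0] 0 := by
    -- This radius means `|ξ| = 2π|η| ≤ 1/4`, where both cutoffs in the fattened symbol equal one
    -- and cancel.
    have hr : (0 : ℝ) < 1 / (8 * Real.pi) := by positivity
    filter_upwards [Metric.ball_mem_nhds (0 : Rn n) hr] with η hη
    rw [mem_ball_zero_iff, lt_div_iff₀ (by positivity)] at hη
    have h1 : 0 ≤ 2 * Real.pi * ‖η‖ := by positivity
    have h2 : 2 * Real.pi * ‖η‖ ≤ 1 / 4 := by linarith
    rw [psiFat_apply, hφ.eq_one _ (by linarith) (by linarith), hφ.eq_one _ (by linarith) (by linarith)]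
    simp
  have hs : ContDiff ℝ ∞ fun η : Rn n => psiFat n hφ η * ((((‖η‖ ^ 2) ^ N)⁻¹ : ℝ) : ℂ) := by
    rw [contDiff_iff_contDiffAt]
    intro η
    by_cases h : η = 0
    · subst h
      have : (fun η : Rn n => psiFat n hφ η * ((((‖η‖ ^ 2) ^ N)⁻¹ : ℝ) : ℂ)) =ᶠ[𝓝 0] fun _ => 0 := by
        filter_upwards [h0] with x hx
        rw [hx, Pi.zero_apply, zero_mul]
      exact contDiffAt_const.congr_of_eventuallyEq this
    · have h1 : ContDiffAt ℝ ∞ (fun η : Rn n => ((‖η‖ ^ 2) ^ N)⁻¹) η := by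
        refine ContDiffAt.inv (((contDiff_norm_sq ℝ).pow N).contDiffAt) ?_
        have : ‖η‖ ≠ 0 := norm_ne_zero_iff.2 h
        positivity
      exact ((psiFat n hφ).smooth ⊤).contDiffAt.mul (Complex.ofRealCLM.contDiff.contDiffAt.comp η h1)
  have hc : HasCompactSupport fun η : Rn n => psiFat n hφ η * ((((‖η‖ ^ 2) ^ N)⁻¹ : ℝ) : ℂ) := by
    refine HasCompactSupport.intro (isCompact_closedBall (0 : Rn n) 3) fun x hx => ?_
    rw [mem_closedBall_zero_iff, not_le] at hx
    have h2 : 3 ≤ 2 * Real.pi * ‖x‖ := by nlinarith [Real.pi_gt_three]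
    rw [psiFat_apply, hφ.eq_zero _ (by linarith), hφ.eq_zero _ (by linarith)]
    simp
  refine ⟨hc.toSchwartzMap hs, fun η => ?_⟩
  change _ = psiFat n hφ η * ((((‖η‖ ^ 2) ^ N)⁻¹ : ℝ) : ℂ) * _
  by_cases h : η = 0
  · subst h
    rw [h0.self_of_nhds]
    simp
  · have : ‖η‖ ≠ 0 := norm_ne_zero_iff.2 h
    rw [mul_assoc, ← Complex.ofReal_mul, inv_mul_cancel₀ (by positivity), Complex.ofReal_one, mul_one]

theorem norm_mult_dil_mulS_le (r : ℝ) (hr : 0 < r) (m₁ m₂ : 𝓢(Rn n, ℂ)) :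
    ‖mult V (dil r hr.ne' (mulS m₁ m₂))‖ ≤ ‖ker m₁‖ * ‖ker m₂‖ := by
  have h : mult V (dil r hr.ne' (mulS m₁ m₂)) = mult V (dil r hr.ne' m₂) ∘L mult V (dil r hr.ne' m₁) :=
    mult_mult fun η => mulS_apply m₁ m₂ _
  rw [h, mul_comm]
  refine (ContinuousLinearMap.opNorm_comp_le _ _).trans ?_
  exact mul_le_mul (norm_mult_dil_le r hr m₂) (norm_mult_dil_le r hr m₁) (norm_nonneg _) (norm_nonneg _)

/-- On an annulus `|η|^6` can be factored out of the symbol, and `t³|η|^6e^{-t|ξ|²}` is a dilate of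
a fixed Schwartz function; so `t³` times the norm is bounded, as is the norm itself. The power three
leaves `(1 + s4^j)^{-2}` after the later integration of third derivatives over `r > s`. -/
theorem exists_norm_mult_psiFat_heat_le :
    ∃ C, 0 < C ∧ ∀ (r : ℝ) (hr : 0 < r) (t : ℝ) (ht : 0 < t),
      ‖mult V (dil r hr.ne' (mulS (psiFat n hφ) (heatS n t ht)))‖ ≤ C * ((1 + t) ^ 3)⁻¹ := by
  obtain ⟨m, hm⟩ := exists_inv_norm_pow_mul_psiFat (n := n) hφ 3
  have hg : (fun η : Rn n => ((((‖η‖ ^ 2) ^ 3 : ℝ)) : ℂ)).HasTemperateGrowth :=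
    Function.Complex.hasTemperateGrowth_ofReal.comp ((Function.hasTemperateGrowth_norm_sq (Rn n)).pow 3)
  set G : 𝓢(Rn n, ℂ) := SchwartzMap.smulLeftCLM ℂ (fun η : Rn n => ((((‖η‖ ^ 2) ^ 3 : ℝ)) : ℂ)) (gauss n)
    with hG
  set C₁ := ‖ker (psiFat n hφ)‖ * ‖ker (gauss n)‖
  set C₂ := ‖ker m‖ * ‖ker G‖
  refine ⟨4 * (C₁ + C₂) + 1, by positivity, fun r hr t ht => ?_⟩
  set A := ‖mult V (dil r hr.ne' (mulS (psiFat n hφ) (heatS n t ht)))‖ with hA'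
  have h1 : A ≤ C₁ := by
    refine (norm_mult_dil_mulS_le r hr _ _).trans ?_
    rw [heatS, norm_ker_dil _ (Real.sqrt_pos.2 ht)]
  have h2 : t ^ 3 * A ≤ C₂ := by
    have h3 : ((t ^ 3 : ℝ) : ℂ) • dil r hr.ne' (mulS (psiFat n hφ) (heatS n t ht)) =
        dil r hr.ne' (mulS m (dil (√t) (Real.sqrt_pos.2 ht).ne' G)) := by
      ext η
      rw [_root_.smul_apply, dil_apply, dil_apply, mulS_apply, mulS_apply, hm, heatS, dil_apply,
        dil_apply, hG, SchwartzMap.smulLeftCLM_apply_apply hg, norm_smul (√t),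
        Real.norm_of_nonneg (Real.sqrt_nonneg t), mul_pow, Real.sq_sqrt ht.le, smul_eq_mul, smul_eq_mul]
      push_cast
      ring
    have h4 : t ^ 3 * A =
        ‖mult V (((t ^ 3 : ℝ) : ℂ) • dil r hr.ne' (mulS (psiFat n hφ) (heatS n t ht)))‖ := by
      rw [mult_smul, norm_smul, Complex.norm_real, Real.norm_of_nonneg (by positivity)]
    rw [h4, h3]
    refine (norm_mult_dil_mulS_le r hr _ _).trans ?_
    rw [norm_ker_dil _ (Real.sqrt_pos.2 ht)]
  have hA : 0 ≤ A := norm_nonneg _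
  rw [← div_eq_mul_inv, le_div_iff₀ (by positivity)]
  have h5 : (1 + t) ^ 3 ≤ 4 * (1 + t ^ 3) := by nlinarith [sq_nonneg (t - 1)]
  nlinarith [mul_le_mul_of_nonneg_left h5 hA]

/-- Parabolic scaling: frequency `2^j` at time `t` is unit frequency at time `t4^j`. -/
theorem mulS_psiFatJ_heatS (j : ℕ) (t : ℝ) (ht : 0 < t) :
    mulS (psiFatJ n hφ j) (heatS n t ht) =
      dil (2 ^ j)⁻¹ (pow_two_inv_pos j).ne'
        (mulS (psiFat n hφ) (heatS n (t * 4 ^ j) (by positivity))) := by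
  ext η
  rw [dil_apply, mulS_apply, mulS_apply, heatS_apply, heatS_apply, psiFatJ, dil_apply, norm_smul,
    Real.norm_of_nonneg (pow_two_inv_pos j).le]
  congr 4
  have : (4 : ℝ) ^ j = 2 ^ j * 2 ^ j := by rw [← mul_pow]; norm_num
  rw [this]
  field_simp

end NavierStokesBesov

namespace NavierStokesBesov

variable {n : ℕ} {V W : Type*} [NormedAddCommGroup V] [NormedSpace ℂ V] [CompleteSpace V]
  [NormedAddCommGroup W] [NormedSpace ℂ W] [CompleteSpace W]

/-! ### Convergence of frequency cutoffs -/

theorem exists_lipschitz_schwartz (Φ : 𝓢(Rn n, ℂ)) :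
    ∃ C, 0 ≤ C ∧ ∀ x, ‖Φ x - Φ 0‖ ≤ C * ‖x‖ := by
  refine ⟨SchwartzMap.seminorm ℝ 0 1 Φ, by positivity, fun x => ?_⟩
  have := Convex.norm_image_sub_le_of_norm_fderiv_le (𝕜 := ℝ) (f := Φ) (s := univ) (x := 0) (y := x)
    (C := SchwartzMap.seminorm ℝ 0 1 Φ) (fun y _ => (Φ.smooth 1).contDiffAt.differentiableAt (by simp))
    (fun y _ => by
      have := SchwartzMap.norm_iteratedFDeriv_le_seminorm ℝ Φ 1 y
      rwa [norm_iteratedFDeriv_one] at this) convex_univ (mem_univ _) (mem_univ _)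
  simpa using this

/-- Leibniz rule. The undifferentiated factor `Φ(εx) - 1` is at most `C₀ε|x|`, paid for with one
more power of `|x|` on `v`; each derivative of the cutoff brings a factor `ε`. -/
theorem norm_pow_mul_iteratedFDeriv_cutoff_le (Φ v : 𝓢(Rn n, ℂ)) (hΦ : Φ 0 = 1) (k l : ℕ) :
    ∃ C, 0 ≤ C ∧ ∀ ε : ℝ, ∀ hε : 0 < ε, ε ≤ 1 → ∀ x,
      ‖x‖ ^ k * ‖iteratedFDeriv ℝ l (mulS (dil ε hε.ne' Φ) v - v : 𝓢(Rn n, ℂ)) x‖ ≤ C * ε := by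
  obtain ⟨C₀, hC₀, h0⟩ := exists_lipschitz_schwartz Φ
  set a : ℕ → ℝ := fun i => SchwartzMap.seminorm ℝ 0 i Φ
  set b : ℕ → ℕ → ℝ := fun k i => SchwartzMap.seminorm ℝ k i v
  have ha : ∀ i, 0 ≤ a i := fun i => apply_nonneg _ _
  have hb : ∀ k i, 0 ≤ b k i := fun k i => apply_nonneg _ _
  refine ⟨∑ i ∈ Finset.range (l + 1), (l.choose i : ℝ) * (a i * b k (l - i) + C₀ * b (k + 1) (l - i)),
    Finset.sum_nonneg fun i _ => by positivity, fun ε hε hε1 x => ?_⟩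
  have hfun : ((mulS (dil ε hε.ne' Φ) v - v : 𝓢(Rn n, ℂ)) : Rn n → ℂ) =
      fun y => (Φ (ε • y) - 1) * v y := by
    ext y
    rw [_root_.sub_apply, mulS_apply, dil_apply]
    ring
  have hcd : ContDiff ℝ ∞ fun y : Rn n => Φ (ε • y) - 1 :=
    ((Φ.smooth ⊤).comp (contDiff_const_smul ε)).sub contDiff_const
  rw [hfun]
  have h1 := norm_iteratedFDeriv_mul_le (N := ∞) hcd (v.smooth ⊤) x (n := l) (by exact_mod_cast le_top)
  have h2 : ∀ i ∈ Finset.range (l + 1), ‖x‖ ^ k * ((l.choose i : ℝ) *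
      ‖iteratedFDeriv ℝ i (fun y : Rn n => Φ (ε • y) - 1) x‖ * ‖iteratedFDeriv ℝ (l - i) v x‖) ≤
      (l.choose i : ℝ) * (a i * b k (l - i) + C₀ * b (k + 1) (l - i)) * ε := by
    intro i _
    have hbk : ‖x‖ ^ k * ‖iteratedFDeriv ℝ (l - i) v x‖ ≤ b k (l - i) := SchwartzMap.le_seminorm ℝ _ _ v x
    have hbk1 : ‖x‖ ^ (k + 1) * ‖iteratedFDeriv ℝ (l - i) v x‖ ≤ b (k + 1) (l - i) :=
      SchwartzMap.le_seminorm ℝ _ _ v x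
    have key : ‖iteratedFDeriv ℝ i (fun y : Rn n => Φ (ε • y) - 1) x‖ *
        (‖x‖ ^ k * ‖iteratedFDeriv ℝ (l - i) v x‖) ≤ (a i * b k (l - i) + C₀ * b (k + 1) (l - i)) * ε := by
      rcases Nat.eq_zero_or_pos i with rfl | hi
      · rw [norm_iteratedFDeriv_zero]
        have h3 : ‖Φ (ε • x) - 1‖ ≤ C₀ * (ε * ‖x‖) := by
          have := h0 (ε • x)
          rwa [hΦ, norm_smul, Real.norm_of_nonneg hε.le] at this
        calc _ ≤ C₀ * (ε * ‖x‖) * (‖x‖ ^ k * ‖iteratedFDeriv ℝ (l - 0) v x‖) := by gcongr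
          _ = (C₀ * (‖x‖ ^ (k + 1) * ‖iteratedFDeriv ℝ (l - 0) v x‖)) * ε := by ring
          _ ≤ _ := by
              gcongr
              have := mul_nonneg (ha 0) (hb k (l - 0))
              have := mul_le_mul_of_nonneg_left hbk1 hC₀
              linarith
      · have h3 : ‖iteratedFDeriv ℝ i (fun y : Rn n => Φ (ε • y) - 1) x‖ ≤ a i * ε := by
          have h4 : iteratedFDeriv ℝ i (fun y : Rn n => Φ (ε • y) - 1) x =
              ε ^ i • iteratedFDeriv ℝ i Φ (ε • x) := by
            rw [← congrFun (iteratedFDeriv_comp_const_smul ε (Φ.smooth i)) x]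
            have h6 : iteratedFDeriv ℝ i (fun y : Rn n => Φ (ε • y) - 1) x =
                iteratedFDeriv ℝ i (fun y : Rn n => Φ (ε • y)) x - iteratedFDeriv ℝ i (fun _ : Rn n => (1 : ℂ)) x := by
              have h7 : ContDiff ℝ i fun y : Rn n => Φ (ε • y) := (Φ.smooth i).comp (contDiff_const_smul ε)
              exact congrFun (iteratedFDeriv_sub h7 contDiff_const) x
            rw [h6, iteratedFDeriv_const_of_ne (by omega)]
            simp
          rw [h4, norm_smul, Real.norm_of_nonneg (by positivity), mul_comm]
          have h5 : ε ^ i ≤ ε := pow_le_of_le_one hε.le hε1 (by omega)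
          gcongr
          exact SchwartzMap.norm_iteratedFDeriv_le_seminorm ℝ Φ i _
        calc _ ≤ a i * ε * (‖x‖ ^ k * ‖iteratedFDeriv ℝ (l - i) v x‖) := by gcongr
          _ ≤ a i * ε * b k (l - i) := mul_le_mul_of_nonneg_left hbk (mul_nonneg (ha i) hε.le)
          _ ≤ _ := by
              have := mul_nonneg (mul_nonneg hC₀ (hb (k + 1) (l - i))) hε.le
              linarith
    calc _ = (l.choose i : ℝ) * (‖iteratedFDeriv ℝ i (fun y : Rn n => Φ (ε • y) - 1) x‖ *
        (‖x‖ ^ k * ‖iteratedFDeriv ℝ (l - i) v x‖)) := by ring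
      _ ≤ _ := by
        rw [mul_assoc]
        exact mul_le_mul_of_nonneg_left key (by positivity)
  calc _ ≤ ‖x‖ ^ k * ∑ i ∈ Finset.range (l + 1), (l.choose i : ℝ) *
      ‖iteratedFDeriv ℝ i (fun y : Rn n => Φ (ε • y) - 1) x‖ * ‖iteratedFDeriv ℝ (l - i) v x‖ := by
        gcongr
    _ ≤ _ := by
        rw [Finset.mul_sum, Finset.sum_mul]
        exact Finset.sum_le_sum h2

theorem tendsto_cutoff (Φ v : 𝓢(Rn n, ℂ)) (hΦ : Φ 0 = 1) :
    Tendsto (fun J : ℕ => mulS (dil (2 ^ J)⁻¹ (pow_two_inv_pos J).ne' Φ) v) atTop (𝓝 v) := by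
  rw [(schwartz_withSeminorms ℝ (Rn n) ℂ).tendsto_nhds]
  rintro ⟨k, l⟩ δ hδ
  obtain ⟨C, hC, h⟩ := norm_pow_mul_iteratedFDeriv_cutoff_le Φ v hΦ k l
  have h1 : Tendsto (fun J : ℕ => C * ((2 : ℝ) ^ J)⁻¹) atTop (𝓝 0) := by
    have : Tendsto (fun J : ℕ => ((2 : ℝ) ^ J)⁻¹) atTop (𝓝 0) :=
      (tendsto_pow_atTop_atTop_of_one_lt one_lt_two).inv_tendsto_atTop
    simpa using this.const_mul C
  filter_upwards [h1.eventually (gt_mem_nhds hδ)] with J hJ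
  refine lt_of_le_of_lt ?_ hJ
  change SchwartzMap.seminorm ℝ k l _ ≤ _
  refine SchwartzMap.seminorm_le_bound ℝ k l _ (by positivity) fun x => ?_
  exact h _ (pow_two_inv_pos J) (inv_le_one_of_one_le₀ (one_le_pow₀ one_le_two)) x

/-! ### Bounds for multipliers in `L^∞` -/

theorem lpENorm_add_le (f g : TempDist n) : lpENorm ⊤ (f + g) ≤ lpENorm ⊤ f + lpENorm ⊤ g := by
  rcases eq_or_ne (lpENorm ⊤ f) ⊤ with h | h
  · simp [h]
  rcases eq_or_ne (lpENorm ⊤ g) ⊤ with h' | h'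
  · simp [h']
  obtain ⟨a, rfl⟩ := exists_of_lpENorm_lt_top (lt_top_iff_ne_top.2 h)
  obtain ⟨b, rfl⟩ := exists_of_lpENorm_lt_top (lt_top_iff_ne_top.2 h')
  have : (a : TempDist n) + (b : TempDist n) = ((a + b : Lp (Cn n) ⊤ (volume : Measure (Rn n))) : TempDist n) :=
    ((Lp.toTemperedDistributionCLM (Cn n) volume ⊤).map_add _ _).symm
  rw [this, lpENorm_coe, lpENorm_coe, lpENorm_coe]
  exact enorm_add_le a b

theorem lpENorm_neg (f : TempDist n) : lpENorm ⊤ (-f) = lpENorm ⊤ f := by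
  have key : ∀ f : TempDist n, lpENorm ⊤ (-f) ≤ lpENorm ⊤ f := by
    intro f
    rcases eq_or_ne (lpENorm ⊤ f) ⊤ with h | h
    · simp [h]
    obtain ⟨a, rfl⟩ := exists_of_lpENorm_lt_top (lt_top_iff_ne_top.2 h)
    have : -(a : TempDist n) = ((-a : Lp (Cn n) ⊤ (volume : Measure (Rn n))) : TempDist n) :=
      ((Lp.toTemperedDistributionCLM (Cn n) volume ⊤).map_neg _).symm
    rw [this, lpENorm_coe, lpENorm_coe, enorm_neg]
  refine le_antisymm (key f) ?_
  simpa using key (-f)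

theorem lpENorm_sub_le (f g : TempDist n) : lpENorm ⊤ (f - g) ≤ lpENorm ⊤ f + lpENorm ⊤ g := by
  rw [sub_eq_add_neg, ← lpENorm_neg g]
  exact lpENorm_add_le _ _

theorem exists_mult_of_lpENorm (m : 𝓢(Rn n, ℂ)) {f : TempDist n} (hf : lpENorm ⊤ f < ⊤) :
    ∃ g : Cb n (Cn n), toDist n (Cn n) g = TemperedDistribution.fourierMultiplierCLM (Cn n) m f ∧
      ‖g‖ₑ ≤ ‖ker m‖ₑ * lpENorm ⊤ f := by
  obtain ⟨a, rfl⟩ := exists_of_lpENorm_lt_top hf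
  obtain ⟨g, hg, hb⟩ := exists_mult_Linf m a
  refine ⟨g, hg, ?_⟩
  rw [lpENorm_coe]
  rw [← ofReal_norm, ← ofReal_norm, ← ofReal_norm, ← ENNReal.ofReal_mul (norm_nonneg _)]
  exact ENNReal.ofReal_le_ofReal hb

/-- The constant is strictly positive so that the right side is infinite when the norm of `f` is;
the bound then needs no membership hypothesis. -/
theorem lpENorm_multiplier_le (m : 𝓢(Rn n, ℂ)) {C : ℝ} (hC : 0 < C) (hm : ‖ker m‖ ≤ C) (f : TempDist n) :
    lpENorm ⊤ (TemperedDistribution.fourierMultiplierCLM (Cn n) m f) ≤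
      ENNReal.ofReal C * lpENorm ⊤ f := by
  rcases eq_or_ne (lpENorm ⊤ f) ⊤ with h | h
  · rw [h, ENNReal.mul_top (by simpa using hC)]
    exact le_top
  obtain ⟨g, hg, hb⟩ := exists_mult_of_lpENorm m (lt_top_iff_ne_top.2 h)
  rw [← hg, lpENorm_toDist]
  refine hb.trans ?_
  gcongr
  rw [← ofReal_norm]
  exact ENNReal.ofReal_le_ofReal hm

theorem exists_lpENorm_heat_le (n : ℕ) : ∃ C, 0 < C ∧ ∀ t : ℝ, 0 ≤ t → ∀ f : TempDist n,
    lpENorm ⊤ (heat t f) ≤ ENNReal.ofReal C * lpENorm ⊤ f := by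
  refine ⟨‖ker (gauss n)‖ + 1, by positivity, fun t ht f => ?_⟩
  rcases ht.eq_or_lt with rfl | ht
  · rw [heat_zero]
    refine le_mul_of_one_le_left zero_le ?_
    rw [ENNReal.one_le_ofReal]
    linarith [norm_nonneg (ker (gauss n))]
  · rw [heat_eq t ht]
    refine lpENorm_multiplier_le _ (by positivity) ?_ f
    rw [heatS, norm_ker_dil _ (Real.sqrt_pos.2 ht)]
    linarith

variable {φ : ℝ → ℝ}

/-- All operators are transposed to the test function, where the cutoffs converge in the Schwartz
topology and continuity of the distribution applies. -/
theorem tendsto_heat_cutoff (hφ : IsCutoff φ) (t : ℝ) (ht : 0 < t) (f : TempDist n) (w : 𝓢(Rn n, ℂ)) :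
    Tendsto (fun J : ℕ => heat t (TemperedDistribution.fourierMultiplierCLM (Cn n) (phiJ n hφ J) f) w)
      atTop (𝓝 (heat t f w)) := by
  have h1 : ∀ J : ℕ, heat t (TemperedDistribution.fourierMultiplierCLM (Cn n) (phiJ n hφ J) f) w =
      f (𝓕 (mulS (phiJ n hφ J) (mulS (heatS n t ht) (𝓕⁻ w)))) := by
    intro J
    rw [heat_eq t ht, TemperedDistribution.fourierMultiplierCLM_apply_apply,
      TemperedDistribution.fourierMultiplierCLM_apply_apply, FourierTransform.fourierInv_fourier_eq]
    rfl
  have h2 : heat t f w = f (𝓕 (mulS (heatS n t ht) (𝓕⁻ w))) := by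
    rw [heat_eq t ht, TemperedDistribution.fourierMultiplierCLM_apply_apply]
    rfl
  simp_rw [h1, h2]
  have hc : Continuous fun v : 𝓢(Rn n, ℂ) => f (𝓕 v) :=
    f.continuous.comp (FourierTransform.fourierCLM ℂ 𝓢(Rn n, ℂ)).continuous
  refine (hc.tendsto _).comp (tendsto_cutoff (phiS n hφ) _ ?_)
  rw [phiS_apply, norm_zero, mul_zero, hφ.eq_one 0 le_rfl (by norm_num), Complex.ofReal_one]

/-- A block is reproduced by its fattened multiplier, which turns bounded functions into continuous
ones. -/
theorem exists_toDist_eq_dyadicBlock (hφ : IsCutoff φ) {f : TempDist n} {j : ℕ}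
    (h : lpENorm ⊤ (dyadicBlock φ j f) < ⊤) :
    ∃ g : Cb n (Cn n), toDist n (Cn n) g = dyadicBlock φ j f := by
  obtain ⟨g, hg, -⟩ := exists_mult_of_lpENorm (psiFatJ n hφ j) h
  refine ⟨g, ?_⟩
  rw [hg, dyadicBlock_eq hφ, fourierMultiplier_mulS]
  exact fourierMultiplier_congr (fun η => by rw [mulS_apply, psiJ_mul_psiFatJ]) f

theorem exists_lpENorm_heat_dyadicBlock_le (n : ℕ) (hφ : IsCutoff φ) : ∃ C, 0 < C ∧ ∀ t : ℝ, 0 < t → ∀ (j : ℕ) (f : TempDist n),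
    lpENorm ⊤ (heat t (dyadicBlock φ j f)) ≤
      ENNReal.ofReal C * (ENNReal.ofReal (((1 + t * 4 ^ j) ^ 3)⁻¹) * lpENorm ⊤ (dyadicBlock φ j f)) := by
  obtain ⟨C, hC, h⟩ := exists_norm_mult_psiFat_heat_le (n := n) (V := Cn n) hφ
  refine ⟨C, hC, fun t ht j f => ?_⟩
  rcases eq_or_ne (lpENorm ⊤ (dyadicBlock φ j f)) ⊤ with hf | hf
  · rw [hf, ENNReal.mul_top (by simp; positivity), ENNReal.mul_top (by simpa using hC)]
    exact le_top
  obtain ⟨g, hg⟩ := exists_toDist_eq_dyadicBlock hφ (lt_top_iff_ne_top.2 hf)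
  have h1 : heat t (dyadicBlock φ j f) =
      toDist n (Cn n) (mult (Cn n) (mulS (psiFatJ n hφ j) (heatS n t ht)) g) := by
    rw [toDist_mult, hg, ← fourierMultiplier_mulS, heat_eq t ht]
    congr 1
    rw [dyadicBlock_eq hφ, fourierMultiplier_mulS]
    exact fourierMultiplier_congr (fun η => by rw [mulS_apply, psiJ_mul_psiFatJ]) f
  rw [h1, ← hg, lpENorm_toDist, lpENorm_toDist, ← ofReal_norm, ← ofReal_norm,
    ← ENNReal.ofReal_mul (by positivity), ← ENNReal.ofReal_mul hC.le]
  refine ENNReal.ofReal_le_ofReal ?_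
  refine (ContinuousLinearMap.le_opNorm _ g).trans ?_
  rw [← mul_assoc]
  gcongr
  rw [mulS_psiFatJ_heatS]
  exact h _ (pow_two_inv_pos j) (t * 4 ^ j) (by positivity)

theorem heat_add (t : ℝ) (f g : TempDist n) : heat t (f + g) = heat t f + heat t g := map_add _ f g

theorem heat_sub (t : ℝ) (f g : TempDist n) : heat t (f - g) = heat t f - heat t g := map_sub _ f g

theorem cutoff_eq_sum (hφ : IsCutoff φ) (J : ℕ) (f : TempDist n) :
    TemperedDistribution.fourierMultiplierCLM (Cn n) (phiJ n hφ J) f =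
      lowFreq φ f + ∑ j ∈ Finset.range J, dyadicBlock φ (j + 1) f := by
  induction J with
  | zero =>
    rw [Finset.sum_range_zero, add_zero, lowFreq_eq hφ]
    exact fourierMultiplier_congr (fun η => by simpa using phiJ_eq_sum hφ 0 η) f
  | succ J ih =>
    rw [Finset.sum_range_succ, ← add_assoc, ← ih, dyadicBlock_eq hφ]
    ext1 w
    rw [_root_.add_apply]
    simp only [TemperedDistribution.fourierMultiplierCLM_apply_apply]
    rw [← map_add, ← FourierTransform.fourier_add]
    refine congrArg (fun v : 𝓢(Rn n, ℂ) => f (𝓕 v)) (SchwartzMap.ext fun η => ?_)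
    rw [_root_.add_apply, SchwartzMap.smulLeftCLM_apply_apply (SchwartzMap.hasTemperateGrowth _),
      SchwartzMap.smulLeftCLM_apply_apply (SchwartzMap.hasTemperateGrowth _),
      SchwartzMap.smulLeftCLM_apply_apply (SchwartzMap.hasTemperateGrowth _), phiJ_succ, add_smul]

/-- The heat-evolved blocks are summed absolutely in `L^∞`. The sum is the heat extension because
its partial sums also converge weakly to it. -/
theorem exists_lpENorm_heat_le_besov (n : ℕ) (hφ : IsCutoff φ) : ∃ C, 0 < C ∧ ∀ t : ℝ, 0 < t → ∀ f : TempDist n,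
    lpENorm ⊤ (heat t f) ≤ ENNReal.ofReal C * (lpENorm ⊤ (lowFreq φ f) +
      ∑' j : ℕ, ENNReal.ofReal (((1 + t * 4 ^ (j + 1)) ^ 3)⁻¹) * lpENorm ⊤ (dyadicBlock φ (j + 1) f)) := by
  obtain ⟨C₁, hC₁, h1⟩ := exists_lpENorm_heat_le n
  obtain ⟨C₂, hC₂, h2⟩ := exists_lpENorm_heat_dyadicBlock_le n hφ
  refine ⟨max C₁ C₂, by positivity, fun t ht f => ?_⟩
  set S := ∑' j : ℕ, ENNReal.ofReal (((1 + t * 4 ^ (j + 1)) ^ 3)⁻¹) *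
    lpENorm ⊤ (dyadicBlock φ (j + 1) f) with hS
  rcases eq_or_ne (lpENorm ⊤ (lowFreq φ f)) ⊤ with h0 | h0
  · rw [h0, top_add, ENNReal.mul_top (by simp [hC₁])]
    exact le_top
  rcases eq_or_ne S ⊤ with h0' | h0'
  · rw [h0', add_top, ENNReal.mul_top (by simp [hC₁])]
    exact le_top
  have hl : lpENorm ⊤ (heat t (lowFreq φ f)) < ⊤ :=
    (h1 t ht.le _).trans_lt (ENNReal.mul_lt_top ENNReal.ofReal_lt_top (lt_top_iff_ne_top.2 h0))
  have hsum : ∑' j : ℕ, lpENorm ⊤ (heat t (dyadicBlock φ (j + 1) f)) ≤ ENNReal.ofReal C₂ * S := by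
    rw [hS, ← ENNReal.tsum_mul_left]
    exact ENNReal.tsum_le_tsum fun j => h2 t ht (j + 1) f
  have hsum' : ∑' j : ℕ, lpENorm ⊤ (heat t (dyadicBlock φ (j + 1) f)) ≠ ⊤ :=
    (hsum.trans_lt (ENNReal.mul_lt_top ENNReal.ofReal_lt_top (lt_top_iff_ne_top.2 h0'))).ne
  have hb : ∀ j : ℕ, lpENorm ⊤ (heat t (dyadicBlock φ (j + 1) f)) < ⊤ := fun j =>
    lt_top_iff_ne_top.2 (ENNReal.ne_top_of_tsum_ne_top hsum' j)
  obtain ⟨c₀, hc₀⟩ := exists_of_lpENorm_lt_top hl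
  choose c hc using fun j => exists_of_lpENorm_lt_top (hb j)
  have hcs : Summable c := by
    refine Summable.of_norm ?_
    have h3 : ∑' j : ℕ, ‖c j‖ₑ ≠ ⊤ := by
      simpa only [← hc, lpENorm_coe] using hsum'
    have h4 := ENNReal.summable_toReal h3
    simpa using h4
  -- Two limits of the same partial sums, one in `L^∞` and one in `S'`, are compared on each test
  -- function.
  have hlim : ((c₀ + ∑' j, c j : Lp (Cn n) ⊤ (volume : Measure (Rn n))) : TempDist n) = heat t f := by
    ext1 w
    refine tendsto_nhds_unique ?_ (tendsto_heat_cutoff hφ t ht f w)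
    have h5 : Tendsto (fun J : ℕ => c₀ + ∑ j ∈ Finset.range J, c j) atTop (𝓝 (c₀ + ∑' j, c j)) :=
      tendsto_const_nhds.add hcs.hasSum.tendsto_sum_nat
    have h6 : Continuous fun g : Lp (Cn n) ⊤ (volume : Measure (Rn n)) => (g : TempDist n) w :=
      (ContinuousEvalConst.continuous_eval_const w).comp
        (Lp.toTemperedDistributionCLM (Cn n) volume ⊤).continuous
    refine ((h6.tendsto _).comp h5).congr fun J => ?_
    rw [Function.comp_apply, cutoff_eq_sum hφ, heat_add, ← hc₀]
    congr 1
    have h7 : heat t (∑ j ∈ Finset.range J, dyadicBlock φ (j + 1) f) =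
        ∑ j ∈ Finset.range J, heat t (dyadicBlock φ (j + 1) f) := map_sum _ _ _
    rw [h7]
    simp_rw [← hc]
    rw [← Lp.toTemperedDistributionCLM_apply, map_add, map_sum]
    rfl
  rw [← hlim, lpENorm_coe, mul_add]
  refine (enorm_add_le _ _).trans (add_le_add ?_ ?_)
  · rw [← lpENorm_coe, hc₀]
    refine (h1 t ht.le _).trans ?_
    gcongr
    exact le_max_left _ _
  · have h8 : ‖∑' j, c j‖ₑ ≤ ∑' j, ‖c j‖ₑ := by
      exact enorm_tsum_le_tsum_enorm
    refine h8.trans ?_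
    simp_rw [← lpENorm_coe, hc]
    refine hsum.trans ?_
    gcongr
    exact le_max_right _ _

end NavierStokesBesov

namespace NavierStokesBesov

variable {n : ℕ} {V W : Type*} [NormedAddCommGroup V] [NormedSpace ℂ V] [CompleteSpace V]
  [NormedAddCommGroup W] [NormedSpace ℂ W] [CompleteSpace W]

/-! ### Kernels of dilated symbols -/

/-- The kernel of the symbol `m(r ·)`, `r > 0`. -/
def kerD (m : 𝓢(Rn n, ℂ)) (r : ℝ) : Lp ℂ 1 (volume : Measure (Rn n)) :=
  if h : 0 < r then ker (dil r h.ne' m) else 0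

theorem kerD_of_pos (m : 𝓢(Rn n, ℂ)) {r : ℝ} (h : 0 < r) : kerD m r = ker (dil r h.ne' m) := dif_pos h

theorem norm_kerD_le (m : 𝓢(Rn n, ℂ)) (r : ℝ) : ‖kerD m r‖ ≤ ‖ker m‖ := by
  rw [kerD]
  split_ifs with h
  · exact (norm_ker_dil r h m).le
  · simp

theorem continuousOn_kerD (m : 𝓢(Rn n, ℂ)) : ContinuousOn (kerD m) (Ioi 0) := by
  rw [continuousOn_iff_continuous_domRestrict]
  refine (continuousOn_ker_dil m).congr fun r => ?_
  rw [Set.domRestrict_apply, kerD_of_pos m r.2]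

/-! ### The Oseen kernel -/

theorem hasTemperateGrowth_coord (i : Fin n) :
    (fun η : Rn n => ((2 * Real.pi * η i : ℝ) : ℂ)).HasTemperateGrowth := by
  have h1 : (fun η : Rn n => η i).HasTemperateGrowth :=
    (EuclideanSpace.proj (𝕜 := ℝ) i : Rn n →L[ℝ] ℝ).hasTemperateGrowth
  have h2 : (fun η : Rn n => 2 * Real.pi * η i).HasTemperateGrowth :=
    (Function.HasTemperateGrowth.const (2 * Real.pi)).mul h1
  exact Function.Complex.hasTemperateGrowth_ofReal.comp h2

/-- The symbol `i ξ_k`. -/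
def poly1 (k : Fin n) (η : Rn n) : ℂ := Complex.I * ((2 * Real.pi * η k : ℝ) : ℂ)

/-- The symbol `-i ξ_i ξ_j ξ_k`. -/
def poly3 (i j k : Fin n) (η : Rn n) : ℂ :=
  -(((2 * Real.pi * η i : ℝ) : ℂ) * ((2 * Real.pi * η j : ℝ) : ℂ) * poly1 k η)

theorem temperate_poly1 (k : Fin n) : (poly1 k).HasTemperateGrowth :=
  (Function.HasTemperateGrowth.const Complex.I).mul (hasTemperateGrowth_coord k)

theorem temperate_poly3 (i j k : Fin n) : (poly3 i j k).HasTemperateGrowth :=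
  (((hasTemperateGrowth_coord i).mul (hasTemperateGrowth_coord j)).mul (temperate_poly1 k)).neg

theorem poly1_smul (k : Fin n) (r : ℝ) (η : Rn n) : poly1 k (r • η) = (r : ℂ) * poly1 k η := by
  simp only [poly1, PiLp.smul_apply, smul_eq_mul]
  push_cast
  ring

theorem poly3_smul (i j k : Fin n) (r : ℝ) (η : Rn n) :
    poly3 i j k (r • η) = (r : ℂ) ^ 3 * poly3 i j k η := by
  simp only [poly3, poly1_smul, PiLp.smul_apply, smul_eq_mul]
  push_cast
  ring

/-- Multiplication of a Schwartz symbol by a symbol of temperate growth. -/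
def polyS (p : Rn n → ℂ) (m : 𝓢(Rn n, ℂ)) : 𝓢(Rn n, ℂ) := SchwartzMap.smulLeftCLM ℂ p m

theorem polyS_apply {p : Rn n → ℂ} (hp : p.HasTemperateGrowth) (m : 𝓢(Rn n, ℂ)) (η : Rn n) :
    polyS p m η = p η * m η := by
  rw [polyS, SchwartzMap.smulLeftCLM_apply_apply hp, smul_eq_mul]

/-- The kernel of `∂_k e^{sΔ}`. -/
def kerGrad (k : Fin n) (s : ℝ) : Lp ℂ 1 (volume : Measure (Rn n)) :=
  (((√s)⁻¹ : ℝ) : ℂ) • kerD (polyS (poly1 k) (gauss n)) (√s)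

/-- The kernel of `∂_i ∂_j ∂_k e^{rΔ}`. -/
def kerThird (i j k : Fin n) (r : ℝ) : Lp ℂ 1 (volume : Measure (Rn n)) :=
  ((((√r) ^ 3)⁻¹ : ℝ) : ℂ) • kerD (polyS (poly3 i j k) (gauss n)) (√r)

/-- The kernel of `e^{sΔ} ℙ_{ij} ∂_k` as an element of `L¹`. -/
def kerOseen (i j k : Fin n) (s : ℝ) : Lp ℂ 1 (volume : Measure (Rn n)) :=
  (if i = j then kerGrad k s else 0) + ∫ r in Ioi s, kerThird i j k r

/-- The polynomial symbol is homogeneous of degree one, so the prefactor `1/√s` undoes the dilation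
of the polynomial and leaves only that of the Gaussian. -/
theorem kerGrad_eq (k : Fin n) {s : ℝ} (hs : 0 < s) :
    kerGrad k s = ker (polyS (poly1 k) (heatS n s hs)) := by
  rw [kerGrad, kerD_of_pos _ (Real.sqrt_pos.2 hs), ← ker_smul]
  congr 1
  ext η
  rw [_root_.smul_apply, dil_apply, polyS_apply (temperate_poly1 k), polyS_apply (temperate_poly1 k),
    poly1_smul, heatS, dil_apply, smul_eq_mul, mul_assoc, ← mul_assoc, ← Complex.ofReal_mul,
    inv_mul_cancel₀ (Real.sqrt_pos.2 hs).ne', Complex.ofReal_one, one_mul]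

theorem kerThird_eq (i j k : Fin n) {r : ℝ} (hr : 0 < r) :
    kerThird i j k r = ker (polyS (poly3 i j k) (heatS n r hr)) := by
  rw [kerThird, kerD_of_pos _ (Real.sqrt_pos.2 hr), ← ker_smul]
  congr 1
  ext η
  rw [_root_.smul_apply, dil_apply, polyS_apply (temperate_poly3 i j k),
    polyS_apply (temperate_poly3 i j k), poly3_smul, heatS, dil_apply, smul_eq_mul, mul_assoc,
    ← mul_assoc, ← Complex.ofReal_pow, ← Complex.ofReal_mul,
    inv_mul_cancel₀ (pow_pos (Real.sqrt_pos.2 hr) 3).ne', Complex.ofReal_one, one_mul]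

theorem norm_kerGrad_le (k : Fin n) (s : ℝ) :
    ‖kerGrad k s‖ ≤ ‖ker (polyS (poly1 k) (gauss n))‖ * (√s)⁻¹ := by
  rw [kerGrad, norm_smul, Complex.norm_real, Real.norm_of_nonneg (by positivity), mul_comm]
  gcongr
  exact norm_kerD_le _ _

theorem sqrt_pow_three_inv {r : ℝ} (hr : 0 < r) : ((√r) ^ 3)⁻¹ = r ^ (-(3 / 2) : ℝ) := by
  rw [Real.rpow_neg hr.le, Real.sqrt_eq_rpow, ← Real.rpow_natCast, ← Real.rpow_mul hr.le]
  norm_num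

theorem norm_kerThird_le (i j k : Fin n) {r : ℝ} (hr : 0 < r) :
    ‖kerThird i j k r‖ ≤ ‖ker (polyS (poly3 i j k) (gauss n))‖ * r ^ (-(3 / 2) : ℝ) := by
  rw [kerThird, norm_smul, Complex.norm_real, Real.norm_of_nonneg (by positivity), mul_comm,
    sqrt_pow_three_inv hr]
  gcongr
  exact norm_kerD_le _ _

theorem continuousOn_kerGrad (k : Fin n) : ContinuousOn (kerGrad k) (Ioi 0) := by
  have h1 : ContinuousOn (fun s : ℝ => √s) (Ioi 0) := Real.continuous_sqrt.continuousOn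
  have h2 : ContinuousOn (fun s : ℝ => (((√s)⁻¹ : ℝ) : ℂ)) (Ioi 0) :=
    Complex.continuous_ofReal.comp_continuousOn (h1.inv₀ fun s hs => (Real.sqrt_pos.2 hs).ne')
  exact h2.smul ((continuousOn_kerD _).comp h1 fun s hs => Real.sqrt_pos.2 hs)

theorem continuousOn_kerThird (i j k : Fin n) : ContinuousOn (kerThird i j k) (Ioi 0) := by
  have h1 : ContinuousOn (fun s : ℝ => √s) (Ioi 0) := Real.continuous_sqrt.continuousOn
  have h2 : ContinuousOn (fun s : ℝ => ((((√s) ^ 3)⁻¹ : ℝ) : ℂ)) (Ioi 0) :=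
    Complex.continuous_ofReal.comp_continuousOn
      ((h1.pow 3).inv₀ fun s hs => (pow_pos (Real.sqrt_pos.2 hs) 3).ne')
  exact h2.smul ((continuousOn_kerD _).comp h1 fun s hs => Real.sqrt_pos.2 hs)

theorem integrableOn_rpow_three_half {s : ℝ} (hs : 0 < s) :
    IntegrableOn (fun r : ℝ => r ^ (-(3 / 2) : ℝ)) (Ioi s) :=
  integrableOn_Ioi_rpow_of_lt (by norm_num) hs

theorem integrableOn_kerThird (i j k : Fin n) {s : ℝ} (hs : 0 < s) :
    IntegrableOn (kerThird i j k) (Ioi s) := by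
  refine Integrable.mono' ((integrableOn_rpow_three_half hs).const_mul
    ‖ker (polyS (poly3 i j k) (gauss n))‖) ?_ ?_
  · exact ((continuousOn_kerThird i j k).mono (Ioi_subset_Ioi hs.le)).aestronglyMeasurable
      measurableSet_Ioi
  · refine (ae_restrict_iff' measurableSet_Ioi).2 (Eventually.of_forall fun r hr => ?_)
    exact norm_kerThird_le i j k (hs.trans hr)

/-- The gradient part scales like `s^{-1/2}`. The third derivatives have size `r^{-3/2}`, whose
integral over `r > s` is `2s^{-1/2}`. -/
theorem exists_norm_kerOseen_le (n : ℕ) : ∃ C, 0 < C ∧ ∀ (i j k : Fin n) (s : ℝ), 0 < s →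
    ‖kerOseen i j k s‖ ≤ C * (√s)⁻¹ := by
  set A := ∑ k : Fin n, ‖ker (polyS (poly1 k) (gauss n))‖
  set B := ∑ i : Fin n, ∑ j : Fin n, ∑ k : Fin n, ‖ker (polyS (poly3 i j k) (gauss n))‖
  refine ⟨A + 2 * B + 1, by positivity, fun i j k s hs => ?_⟩
  have hA : ‖ker (polyS (poly1 k) (gauss n))‖ ≤ A :=
    Finset.single_le_sum (f := fun k : Fin n => ‖ker (polyS (poly1 k) (gauss n))‖)
      (fun _ _ => norm_nonneg _) (Finset.mem_univ k)
  have hB : ‖ker (polyS (poly3 i j k) (gauss n))‖ ≤ B := by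
    refine (Finset.single_le_sum (f := fun k : Fin n => ‖ker (polyS (poly3 i j k) (gauss n))‖)
      (fun _ _ => norm_nonneg _) (Finset.mem_univ k)).trans ?_
    refine (Finset.single_le_sum (f := fun j : Fin n => ∑ k : Fin n, ‖ker (polyS (poly3 i j k) (gauss n))‖)
      (fun _ _ => Finset.sum_nonneg fun _ _ => norm_nonneg _) (Finset.mem_univ j)).trans ?_
    exact Finset.single_le_sum
      (f := fun i : Fin n => ∑ j : Fin n, ∑ k : Fin n, ‖ker (polyS (poly3 i j k) (gauss n))‖)
      (fun _ _ => Finset.sum_nonneg fun _ _ => Finset.sum_nonneg fun _ _ => norm_nonneg _)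
      (Finset.mem_univ i)
  have h1 : ‖if i = j then kerGrad k s else 0‖ ≤ A * (√s)⁻¹ := by
    split_ifs
    · exact (norm_kerGrad_le k s).trans (by gcongr)
    · rw [norm_zero]; positivity
  have h2 : ‖∫ r in Ioi s, kerThird i j k r‖ ≤ 2 * B * (√s)⁻¹ := by
    have h3 : ‖∫ r in Ioi s, kerThird i j k r‖ ≤ ∫ r in Ioi s, B * r ^ (-(3 / 2) : ℝ) := by
      refine norm_integral_le_of_norm_le ((integrableOn_rpow_three_half hs).const_mul B) ?_
      refine (ae_restrict_iff' measurableSet_Ioi).2 (Eventually.of_forall fun r hr => ?_)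
      have hr' : 0 < r := hs.trans hr
      refine (norm_kerThird_le i j k hr').trans ?_
      gcongr
    rw [integral_const_mul, integral_Ioi_rpow_of_lt (by norm_num) hs] at h3
    refine h3.trans (le_of_eq ?_)
    rw [Real.sqrt_eq_rpow, ← Real.rpow_neg hs.le]
    norm_num
    ring
  have hs' : 0 ≤ (√s)⁻¹ := by positivity
  calc _ ≤ A * (√s)⁻¹ + 2 * B * (√s)⁻¹ := (norm_add_le _ _).trans (add_le_add h1 h2)
    _ ≤ _ := by nlinarith

theorem continuousOn_kerOseen (i j k : Fin n) : ContinuousOn (kerOseen i j k) (Ioi 0) := by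
  refine ContinuousOn.add ?_ ?_
  · split_ifs
    · exact continuousOn_kerGrad k
    · exact continuousOn_const
  intro s₀ hs₀
  have hs₀' : (0 : ℝ) < s₀ := hs₀
  refine ContinuousAt.continuousWithinAt ?_
  -- The moving domain is replaced by an indicator on the fixed domain `(s₀/2, ∞)`, so that
  -- dominated convergence applies; only `r = s₀` is exceptional.
  have h1 : ∀ᶠ s in 𝓝 s₀, (∫ r in Ioi (s₀ / 2), (Ioi s).indicator (kerThird i j k) r) =
      ∫ r in Ioi s, kerThird i j k r := by
    filter_upwards [lt_mem_nhds (show s₀ / 2 < s₀ by linarith)] with s hs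
    rw [setIntegral_indicator measurableSet_Ioi, Ioi_inter_Ioi, max_eq_right hs.le]
  refine ContinuousAt.congr ?_ h1
  refine continuousAt_of_dominated (bound := fun r => ‖kerThird i j k r‖) ?_ ?_ ?_ ?_
  · filter_upwards with s
    exact ((integrableOn_kerThird i j k (by linarith)).aestronglyMeasurable).indicator measurableSet_Ioi
  · filter_upwards with s
    filter_upwards with r
    exact norm_indicator_le_norm_self _ _
  · exact (integrableOn_kerThird i j k (by linarith)).norm
  · refine ae_restrict_of_ae ?_
    have : ∀ᵐ r : ℝ, r ≠ s₀ := by simp [ae_iff]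
    filter_upwards [this] with r hr
    rcases lt_or_gt_of_ne hr with h | h
    · have : (fun s => (Ioi s).indicator (kerThird i j k) r) =ᶠ[𝓝 s₀] fun _ => 0 := by
        filter_upwards [lt_mem_nhds h] with s hs
        rw [indicator_of_notMem]
        simpa using hs.le
      exact continuousAt_const.congr this.symm
    · have : (fun s => (Ioi s).indicator (kerThird i j k) r) =ᶠ[𝓝 s₀] fun _ => kerThird i j k r := by
        filter_upwards [gt_mem_nhds h] with s hs
        rw [indicator_of_mem]
        exact hs
      exact continuousAt_const.congr this.symm

end NavierStokesBesov

namespace NavierStokesBesov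

variable {n : ℕ} {V W : Type*} [NormedAddCommGroup V] [NormedSpace ℂ V] [CompleteSpace V]
  [NormedAddCommGroup W] [NormedSpace ℂ W] [CompleteSpace W]

/-! ### Identification of the Oseen kernel -/

/-- The character `x ↦ e^{2πi x·η}`. -/
def charB (η : Rn n) : Cb n ℂ :=
  BoundedContinuousFunction.ofNormedAddCommGroup (fun x => (Real.fourierChar (inner ℝ x η) : ℂ))
    ((continuous_subtype_val.comp Real.continuous_fourierChar).comp (by fun_prop)) 1
    (fun x => by rw [Circle.norm_coe])

/-- The value of the Fourier transform at a point, as a functional on `L¹`. -/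
def fourierAt (η : Rn n) : Lp ℂ 1 (volume : Measure (Rn n)) →L[ℂ] ℂ :=
  (BoundedContinuousFunction.evalCLM ℂ (0 : Rn n)) ∘L ((convL n ℂ).flip (charB η))

theorem fourierAt_apply (η : Rn n) (k : Lp ℂ 1 (volume : Measure (Rn n))) :
    fourierAt η k = 𝓕 (k : Rn n → ℂ) η := by
  rw [fourierAt, Real.fourier_eq]
  change ∫ y, k y • (Real.fourierChar (inner ℝ (0 - y) η) : ℂ) = _
  refine integral_congr_ae (Eventually.of_forall fun y => ?_)
  simp only [zero_sub, inner_neg_left, Circle.smul_def, smul_eq_mul]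
  rw [mul_comm]

theorem fourierAt_ker (η : Rn n) (m : 𝓢(Rn n, ℂ)) : fourierAt η (ker m) = m η := by
  rw [fourierAt_apply]
  have h1 : 𝓕 (ker m : Rn n → ℂ) η = 𝓕 ((𝓕⁻ m : 𝓢(Rn n, ℂ)) : Rn n → ℂ) η := by
    rw [Real.fourier_eq, Real.fourier_eq]
    refine integral_congr_ae ?_
    filter_upwards [coeFn_ker m] with y hy
    rw [hy]
  rw [h1, ← SchwartzMap.fourier_coe, FourierTransform.fourier_fourierInv_eq]

/-- An integrable function is determined by its Fourier transform, if the latter is integrable. -/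
theorem ae_eq_fourierInv {k : Rn n → ℂ} (hk : Integrable k) {m : Rn n → ℂ} (hm : Integrable m)
    (h : ∀ η, 𝓕 k η = m η) : k =ᵐ[volume] 𝓕⁻ m := by
  have hc : Continuous (𝓕⁻ m) := by
    have h1 : Continuous (𝓕 m) := VectorFourier.fourierIntegral_continuous Real.continuous_fourierChar
      (L := innerₗ (Rn n)) continuous_inner hm
    have h2 : 𝓕⁻ m = fun x => 𝓕 m (-x) := funext fun x => Real.fourierInv_eq_fourier_neg m x
    rw [h2]
    exact h1.comp continuous_neg
  refine ae_eq_of_integral_contDiff_smul_eq hk.locallyIntegrable hc.locallyIntegrable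
    fun g hg hgs => ?_
  have hgs' : HasCompactSupport fun x => (g x : ℂ) := hgs.comp_left (g := Complex.ofReal) Complex.ofReal_zero
  set w : 𝓢(Rn n, ℂ) := hgs'.toSchwartzMap (Complex.ofRealCLM.contDiff.comp hg) with hw
  have hwg : ∀ x, w x = g x := fun x => rfl
  have h1 := fourier_mul_fourierInv hm w.integrable 0
  have h2 := VectorFourier.integral_fourierIntegral_smul_eq_flip (L := innerₗ (Rn n))
    (μ := volume) (ν := volume) Real.continuous_fourierChar continuous_inner hk (𝓕⁻ w).integrable
  have h3 : 𝓕 (𝓕⁻ w : 𝓢(Rn n, ℂ)) = w := FourierTransform.fourier_fourierInv_eq w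
  have h4 : ∫ x, k x * w x = ∫ η, m η * 𝓕⁻ (w : Rn n → ℂ) η := by
    rw [← SchwartzMap.fourierInv_coe]
    simp_rw [← h]
    refine Eq.trans ?_ h2.symm
    refine integral_congr_ae (Eventually.of_forall fun x => ?_)
    simp only [smul_eq_mul]
    congr 1
    have h7 : innerₗ (Rn n) = (innerₗ (Rn n)).flip := by
      ext a b
      simp
    rw [← congrArg (fun v : 𝓢(Rn n, ℂ) => v x) h3, SchwartzMap.fourier_coe, ← h7]
    rfl
  have h5 : ∫ η, m η * 𝓕⁻ (w : Rn n → ℂ) η = ∫ x, 𝓕⁻ m x * w x := by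
    simpa [Real.fourier_eq] using h1
  have h6 := h4.trans h5
  simp only [hwg] at h6
  simp only [Complex.real_smul]
  simp_rw [mul_comm ((g _ : ℝ) : ℂ)]
  exact h6

theorem integral_exp_neg_mul_Ioi' {c : ℝ} (hc : 0 < c) (s : ℝ) :
    ∫ r in Ioi s, Real.exp (-(r * c)) = Real.exp (-(s * c)) / c := by
  have h := integral_exp_mul_Ioi (neg_lt_zero.2 hc) s
  rw [show -(s * c) = -c * s by ring, ← neg_div_neg_eq, ← h]
  refine setIntegral_congr_fun measurableSet_Ioi fun r _ => ?_
  congr 1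
  ring

/-- The singular factor of the Leray projector is resolved by `∫_s^∞ e^{-r|ξ|²}dr =
|ξ|^{-2}e^{-s|ξ|²}`. Evaluating the transform at a point is a continuous functional on `L¹`, so it
passes under the Bochner integral. -/
theorem fourierAt_kerOseen (i j k : Fin n) {s : ℝ} (hs : 0 < s) (η : Rn n) :
    fourierAt η (kerOseen i j k s) = oseenSymbol s i j k η := by
  have h1 : fourierAt η (∫ r in Ioi s, kerThird i j k r) =
      ∫ r in Ioi s, poly3 i j k η * ((Real.exp (-(r * (2 * Real.pi * ‖η‖) ^ 2)) : ℝ) : ℂ) := by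
    rw [← ContinuousLinearMap.integral_comp_comm _ (integrableOn_kerThird i j k hs)]
    refine setIntegral_congr_fun measurableSet_Ioi fun r hr => ?_
    rw [kerThird_eq i j k (hs.trans hr), fourierAt_ker, polyS_apply (temperate_poly3 i j k), heatS_apply]
  have h2 : fourierAt η (if i = j then kerGrad k s else 0) =
      (if i = j then 1 else 0) * (poly1 k η * ((Real.exp (-(s * (2 * Real.pi * ‖η‖) ^ 2)) : ℝ) : ℂ)) := by
    split_ifs
    · rw [kerGrad_eq k hs, fourierAt_ker, polyS_apply (temperate_poly1 k), heatS_apply, one_mul]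
    · rw [map_zero, zero_mul]
  rw [kerOseen, map_add, h1, h2, integral_const_mul, integral_complex_ofReal]
  rcases eq_or_ne η 0 with rfl | hη
  · simp [oseenSymbol, poly3, poly1]
  · have hη' : ‖η‖ ≠ 0 := norm_ne_zero_iff.2 hη
    rw [integral_exp_neg_mul_Ioi' (by positivity), oseenSymbol, poly3, poly1]
    have hη'' : (‖η‖ : ℂ) ≠ 0 := by exact_mod_cast hη'
    have hpi : (Real.pi : ℂ) ≠ 0 := by exact_mod_cast Real.pi_ne_zero
    push_cast
    field_simp
    split_ifs <;> push_cast <;> ring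

/-- The entries of the Leray symbol are measurable and bounded by two; the remaining factor is
Schwartz. -/
theorem integrable_oseenSymbol (i j k : Fin n) {s : ℝ} (hs : 0 < s) :
    Integrable (oseenSymbol s i j k) := by
  have h1 := (polyS (poly1 k) (heatS n s hs)).integrable (μ := (volume : Measure (Rn n)))
  have hm : Measurable fun η : Rn n => ((((if i = j then 1 else 0) - η i * η j / ‖η‖ ^ 2 : ℝ)) : ℂ) := by
    have h1 : ∀ i : Fin n, Measurable fun η : Rn n => η i := fun i => by fun_prop
    have := h1 i
    have := h1 j
    fun_prop
  have h2 := h1.bdd_mul (c := 2) hm.aestronglyMeasurable (Eventually.of_forall fun η => by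
    rw [Complex.norm_real]
    have h3 : |η i * η j / ‖η‖ ^ 2| ≤ 1 := by
      rw [abs_div, abs_mul, abs_of_nonneg (sq_nonneg ‖η‖)]
      refine div_le_one_of_le₀ ?_ (sq_nonneg _)
      rw [sq]
      exact mul_le_mul (PiLp.norm_apply_le η i) (PiLp.norm_apply_le η j) (abs_nonneg _) (norm_nonneg _)
    rw [Real.norm_eq_abs]
    refine (abs_sub _ _).trans ?_
    have : |if i = j then (1 : ℝ) else 0| ≤ 1 := by split_ifs <;> simp
    linarith)
  refine h2.congr (Eventually.of_forall fun η => ?_)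
  simp only
  rw [polyS_apply (temperate_poly1 k), heatS_apply, oseenSymbol, poly1]
  push_cast
  ring

/-- This ties the kernel in the statement, an inverse Fourier integral, to the `L¹`-valued kernel
for which norm bounds and continuity in `s` are available. -/
theorem coeFn_kerOseen (i j k : Fin n) {s : ℝ} (hs : 0 < s) :
    kerOseen i j k s =ᵐ[volume] oseenKernel s i j k :=
  ae_eq_fourierInv (L1.integrable_coeFn _) (integrable_oseenSymbol i j k hs) fun η => by
    rw [← fourierAt_apply, fourierAt_kerOseen i j k hs]

theorem integrable_oseenKernel (i j k : Fin n) {s : ℝ} (hs : 0 < s) :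
    Integrable (oseenKernel s i j k) :=
  (L1.integrable_coeFn _).congr (coeFn_kerOseen i j k hs)

theorem integral_norm_oseenKernel (i j k : Fin n) {s : ℝ} (hs : 0 < s) :
    ∫ x, ‖oseenKernel s i j k x‖ = ‖kerOseen i j k s‖ := by
  rw [L1.norm_eq_integral_norm]
  refine integral_congr_ae ?_
  filter_upwards [coeFn_kerOseen i j k hs] with x hx
  rw [hx]

theorem convL_kerOseen_apply (i j k : Fin n) {s : ℝ} (hs : 0 < s) (f : Cb n V) (x : Rn n) :
    convL n V (kerOseen i j k s) f x = ∫ y, oseenKernel s i j k (x - y) • f y := by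
  rw [convL_apply, integral_kernel_smul_swap]
  refine integral_congr_ae ?_
  filter_upwards [coeFn_kerOseen i j k hs] with y hy
  rw [hy]

end NavierStokesBesov

namespace NavierStokesBesov

variable {n : ℕ} {V W : Type*} [NormedAddCommGroup V] [NormedSpace ℂ V] [CompleteSpace V]
  [NormedAddCommGroup W] [NormedSpace ℂ W] [CompleteSpace W]

/-! ### The bilinear operator -/

variable (n) in
/-- The `i`-th component of a bounded continuous vector field. -/
def projB (i : Fin n) : Cb n (Cn n) →L[ℂ] Cb n ℂ :=
  (EuclideanSpace.proj (𝕜 := ℂ) i : Cn n →L[ℂ] ℂ).compLeftContinuousBounded (Rn n)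

theorem projB_apply (i : Fin n) (f : Cb n (Cn n)) (x : Rn n) : projB n i f x = f x i := rfl

/-- The inclusion of the `i`-th coordinate axis. -/
def singleL (i : Fin n) : ℂ →L[ℂ] Cn n :=
  LinearMap.toContinuousLinearMap
    { toFun := fun c => EuclideanSpace.single i c
      map_add' := fun a b => by ext j; by_cases h : j = i <;> simp [h]
      map_smul' := fun a b => by ext j; by_cases h : j = i <;> simp [h] }

/-- The vector field with a single component. -/
def embB (i : Fin n) : Cb n ℂ →L[ℂ] Cb n (Cn n) := (singleL i).compLeftContinuousBounded (Rn n)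

theorem embB_apply (i : Fin n) (f : Cb n ℂ) (x : Rn n) :
    embB i f x = EuclideanSpace.single i (f x) := rfl

theorem norm_projB_le (i : Fin n) (f : Cb n (Cn n)) : ‖projB n i f‖ ≤ ‖f‖ :=
  (BoundedContinuousFunction.norm_le (norm_nonneg _)).2 fun x =>
    (PiLp.norm_apply_le (f x) i).trans (f.norm_coe_le_norm x)

theorem norm_embB_le (i : Fin n) (f : Cb n ℂ) : ‖embB i f‖ ≤ ‖f‖ :=
  (BoundedContinuousFunction.norm_le (norm_nonneg _)).2 fun x => by
    rw [embB_apply, PiLp.norm_single]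
    exact f.norm_coe_le_norm x

/-- The product of two components. -/
def prodB (j k : Fin n) : Cb n (Cn n) →L[ℂ] Cb n (Cn n) →L[ℂ] Cb n ℂ :=
  (ContinuousLinearMap.mul ℂ (Cb n ℂ)).bilinearComp (projB n j) (projB n k)

theorem prodB_apply (j k : Fin n) (f g : Cb n (Cn n)) (x : Rn n) :
    prodB j k f g x = f x j * g x k := rfl

theorem norm_prodB_le (j k : Fin n) (f g : Cb n (Cn n)) : ‖prodB j k f g‖ ≤ ‖f‖ * ‖g‖ :=
  (norm_mul_le (projB n j f) (projB n k g)).trans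
    (mul_le_mul (norm_projB_le j f) (norm_projB_le k g) (norm_nonneg _) (norm_nonneg _))

/-- The bilinear map `(f, g) ↦ (κ * (f_j g_k)) e_i`, as a function of the kernel `κ`. -/
def convBil (i j k : Fin n) :
    Lp ℂ 1 (volume : Measure (Rn n)) →L[ℂ] Cb n (Cn n) →L[ℂ] Cb n (Cn n) →L[ℂ] Cb n (Cn n) :=
  ((ContinuousLinearMap.compL ℂ (Cb n (Cn n)) (Cb n (Cn n) →L[ℂ] Cb n ℂ)
      (Cb n (Cn n) →L[ℂ] Cb n (Cn n))).flip (prodB j k)) ∘L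
    (ContinuousLinearMap.compL ℂ (Cb n (Cn n)) (Cb n ℂ) (Cb n (Cn n))) ∘L
    ((ContinuousLinearMap.compL ℂ (Cb n ℂ) (Cb n ℂ) (Cb n (Cn n))) (embB i)) ∘L convL n ℂ

theorem convBil_apply (i j k : Fin n) (κ : Lp ℂ 1 (volume : Measure (Rn n))) (f g : Cb n (Cn n)) :
    convBil i j k κ f g = embB i (convL n ℂ κ (prodB j k f g)) := rfl

variable (n) in
/-- The bilinear form of `e^{sΔ} ℙ ∇·(f ⊗ g)`. -/
def oseenBil (s : ℝ) : Cb n (Cn n) →L[ℂ] Cb n (Cn n) →L[ℂ] Cb n (Cn n) :=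
  ∑ i : Fin n, ∑ j : Fin n, ∑ k : Fin n, convBil i j k (kerOseen i j k s)

theorem oseenBil_apply (s : ℝ) (f g : Cb n (Cn n)) :
    oseenBil n s f g = ∑ i : Fin n, ∑ j : Fin n, ∑ k : Fin n,
      embB i (convL n ℂ (kerOseen i j k s) (prodB j k f g)) := by
  simp only [oseenBil, _root_.sum_apply, convBil_apply]

theorem continuousOn_oseenBil : ContinuousOn (oseenBil n) (Ioi 0) :=
  continuousOn_finsetSum _ fun i _ => continuousOn_finsetSum _ fun j _ => continuousOn_finsetSum _
    fun k _ => (convBil i j k).continuous.comp_continuousOn (continuousOn_kerOseen i j k)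

theorem exists_norm_oseenBil_le (n : ℕ) : ∃ C, 0 < C ∧ ∀ s : ℝ, 0 < s →
    ‖oseenBil n s‖ ≤ C * (√s)⁻¹ := by
  obtain ⟨C, hC, h⟩ := exists_norm_kerOseen_le n
  refine ⟨(∑ i : Fin n, ∑ j : Fin n, ∑ k : Fin n, ‖convBil i j k‖) * C + 1, by positivity,
    fun s hs => ?_⟩
  have h1 : ‖oseenBil n s‖ ≤ ∑ i : Fin n, ∑ j : Fin n, ∑ k : Fin n, ‖convBil i j k‖ * (C * (√s)⁻¹) :=
    norm_sum_le_of_le _ fun i _ => norm_sum_le_of_le _ fun j _ => norm_sum_le_of_le _ fun k _ =>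
      (ContinuousLinearMap.le_opNorm _ _).trans
        (mul_le_mul_of_nonneg_left (h i j k s hs) (norm_nonneg _))
  refine h1.trans ?_
  simp only [← Finset.sum_mul]
  rw [← mul_assoc]
  gcongr
  linarith

theorem oseenBil_apply_apply {s : ℝ} (hs : 0 < s) (f g : Cb n (Cn n)) (x : Rn n) (i : Fin n) :
    oseenBil n s f g x i = ∑ j : Fin n, ∑ k : Fin n,
      ∫ y, oseenKernel s i j k (x - y) * (f y j * g y k) := by
  have h1 : ∀ h : Cb n (Cn n), h x i = projB n i h x := fun _ => rfl
  rw [h1, oseenBil_apply]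
  simp only [map_sum, BoundedContinuousFunction.coe_sum, Finset.sum_apply]
  rw [Finset.sum_eq_single i]
  · refine Finset.sum_congr rfl fun j _ => Finset.sum_congr rfl fun k _ => ?_
    rw [projB_apply, embB_apply, convL_kerOseen_apply i j k hs]
    simp [prodB_apply]
  · intro b _ hb
    refine Finset.sum_eq_zero fun j _ => Finset.sum_eq_zero fun k _ => ?_
    rw [projB_apply, embB_apply]
    simp [hb.symm]
  · simp

theorem oseenQuadratic_toLinf {s : ℝ} (hs : 0 < s) (f : Cb n (Cn n)) (x : Rn n) :
    oseenQuadratic s (toLinf f) x = oseenBil n s f f x := by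
  ext i
  rw [oseenBil_apply_apply hs, oseenQuadratic]
  simp only
  refine Finset.sum_congr rfl fun j _ => Finset.sum_congr rfl fun k _ => ?_
  refine integral_congr_ae ?_
  filter_upwards [coeFn_toLinf f] with y hy
  rw [hy]

/-- The quadratic operator is locally Lipschitz continuous on `L^∞`. -/
theorem exists_norm_oseenQuadratic_sub_le (n : ℕ) : ∃ C, 0 < C ∧ ∀ s : ℝ, 0 < s →
    ∀ (f g : Lp (Cn n) ⊤ (volume : Measure (Rn n))) (x : Rn n),
    ‖oseenQuadratic s f x - oseenQuadratic s g x‖ ≤ C * (√s)⁻¹ * ((‖f‖ + ‖g‖) * ‖f - g‖) := by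
  obtain ⟨C, hC, h⟩ := exists_norm_kerOseen_le n
  refine ⟨n * (n * (n * C)) + 1, by positivity, fun s hs f g x => ?_⟩
  have hq : Measure.QuasiMeasurePreserving (fun y : Rn n => x - y) volume volume :=
    quasiMeasurePreserving_sub_left_of_right_invariant volume x
  have hk : ∀ i j k, Integrable (fun y => oseenKernel s i j k (x - y)) := fun i j k =>
    (integrable_oseenKernel i j k hs).comp_sub_left x
  have hm : ∀ (f : Lp (Cn n) ⊤ (volume : Measure (Rn n))) (j k : Fin n),
      AEStronglyMeasurable (fun y => f y j * f y k) := fun f j k =>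
    ((EuclideanSpace.proj (𝕜 := ℂ) j : Cn n →L[ℂ] ℂ).continuous.comp_aestronglyMeasurable
      (Lp.aestronglyMeasurable f)).mul
    ((EuclideanSpace.proj (𝕜 := ℂ) k : Cn n →L[ℂ] ℂ).continuous.comp_aestronglyMeasurable
      (Lp.aestronglyMeasurable f))
  have hb : ∀ (f : Lp (Cn n) ⊤ (volume : Measure (Rn n))) (j k : Fin n),
      ∀ᵐ y, ‖f y j * f y k‖ ≤ ‖f‖ * ‖f‖ := fun f j k => by
    filter_upwards [ae_norm_le_Linf f] with y hy
    rw [norm_mul]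
    exact mul_le_mul ((PiLp.norm_apply_le _ j).trans hy) ((PiLp.norm_apply_le _ k).trans hy)
      (norm_nonneg _) (norm_nonneg _)
  have hi : ∀ (f : Lp (Cn n) ⊤ (volume : Measure (Rn n))) (i j k : Fin n),
      Integrable fun y => oseenKernel s i j k (x - y) * (f y j * f y k) := fun f i j k =>
    (hk i j k).mul_bdd (c := ‖f‖ * ‖f‖) (hm f j k) (hb f j k)
  set M := (‖f‖ + ‖g‖) * ‖f - g‖ with hM
  have hM0 : 0 ≤ M := by positivity
  have hs0 : 0 ≤ (√s)⁻¹ := by positivity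
  have h1 : ∀ i j k, ‖(∫ y, oseenKernel s i j k (x - y) * (f y j * f y k)) -
      ∫ y, oseenKernel s i j k (x - y) * (g y j * g y k)‖ ≤ C * ((√s)⁻¹ * M) := by
    intro i j k
    rw [← integral_sub (hi f i j k) (hi g i j k)]
    have h2 : ‖∫ y, (oseenKernel s i j k (x - y) * (f y j * f y k) -
        oseenKernel s i j k (x - y) * (g y j * g y k))‖ ≤ ∫ y, ‖oseenKernel s i j k (x - y)‖ * M := by
      refine norm_integral_le_of_norm_le ((hk i j k).norm.mul_const M) ?_
      filter_upwards [ae_norm_le_Linf f, ae_norm_le_Linf g, ae_norm_le_Linf (f - g),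
        Lp.coeFn_sub f g] with y hf hg hfg hs
      rw [hs, Pi.sub_apply] at hfg
      rw [← mul_sub, norm_mul]
      refine mul_le_mul_of_nonneg_left ?_ (norm_nonneg _)
      -- Polarisation: the difference of two squares is split into two products, each with one
      -- factor `f - g`.
      have h3 : f y j * f y k - g y j * g y k = f y j * (f y - g y) k + (f y - g y) j * g y k := by
        simp only [PiLp.sub_apply]
        ring
      rw [h3, hM, add_mul]
      refine (norm_add_le _ _).trans (add_le_add ?_ ?_)
      · rw [norm_mul]
        exact mul_le_mul ((PiLp.norm_apply_le _ j).trans hf) ((PiLp.norm_apply_le _ k).trans hfg)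
          (norm_nonneg _) (norm_nonneg _)
      · rw [norm_mul, mul_comm]
        exact mul_le_mul ((PiLp.norm_apply_le _ k).trans hg) ((PiLp.norm_apply_le _ j).trans hfg)
          (norm_nonneg _) (norm_nonneg _)
    rw [integral_mul_const, integral_sub_left_eq_self (fun y => ‖oseenKernel s i j k y‖),
      integral_norm_oseenKernel i j k hs] at h2
    refine h2.trans ?_
    rw [← mul_assoc C]
    exact mul_le_mul_of_nonneg_right (h i j k s hs) hM0
  have h2 : ∀ i, ‖(oseenQuadratic s f x - oseenQuadratic s g x) i‖ ≤ n * (n * (C * ((√s)⁻¹ * M))) := by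
    intro i
    simp only [oseenQuadratic, PiLp.sub_apply, ← Finset.sum_sub_distrib]
    refine (norm_sum_le_of_le _ fun j _ => norm_sum_le_of_le _ fun k _ => h1 i j k).trans ?_
    simp
  have h3 : oseenQuadratic s f x - oseenQuadratic s g x =
      ∑ i, EuclideanSpace.single i ((oseenQuadratic s f x - oseenQuadratic s g x) i) := by
    ext i
    simp
  rw [h3]
  refine (norm_sum_le_of_le _ fun i _ => (PiLp.norm_single 2 _ i _).le.trans (h2 i)).trans ?_
  simp only [Finset.sum_const, Finset.card_univ, Fintype.card_fin, nsmul_eq_mul]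
  have : 0 ≤ (√s)⁻¹ * M := by positivity
  nlinarith

end NavierStokesBesov

namespace NavierStokesBesov

variable {n : ℕ} {V W : Type*} [NormedAddCommGroup V] [NormedSpace ℂ V] [CompleteSpace V]
  [NormedAddCommGroup W] [NormedSpace ℂ W] [CompleteSpace W]

/-! ### Frequency blocks of the Oseen operator -/

variable {φ : ℝ → ℝ}

theorem hasDerivAt_inv_one_add_sq {a : ℝ} (ha : 0 < a) {r : ℝ} (hr : 0 ≤ r) :
    HasDerivAt (fun r : ℝ => -(2 * a)⁻¹ * ((1 + r * a) ^ 2)⁻¹) (((1 + r * a) ^ 3)⁻¹) r := by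
  have h0 : (1 + r * a) ≠ 0 := by positivity
  have h1 : HasDerivAt (fun r : ℝ => (1 + r * a) ^ 2) (2 * (1 + r * a) * a) r := by
    have := (((hasDerivAt_id r).mul_const a).const_add 1).pow 2
    exact this.congr_deriv (by simp)
  have h2 := (h1.inv (pow_ne_zero 2 h0)).const_mul (-(2 * a)⁻¹)
  refine h2.congr_deriv ?_
  field_simp

theorem tendsto_inv_one_add_sq {a : ℝ} (ha : 0 < a) :
    Tendsto (fun r : ℝ => -(2 * a)⁻¹ * ((1 + r * a) ^ 2)⁻¹) atTop (𝓝 0) := by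
  have h1 : Tendsto (fun r : ℝ => 1 + r * a) atTop atTop :=
    tendsto_atTop_add_const_left _ _ (tendsto_id.atTop_mul_const ha)
  have h2 := ((tendsto_pow_atTop two_ne_zero).comp h1).inv_tendsto_atTop
  simpa using h2.const_mul (-(2 * a)⁻¹)

theorem integrableOn_inv_one_add_cube {a : ℝ} (ha : 0 < a) {s : ℝ} (hs : 0 ≤ s) :
    IntegrableOn (fun r : ℝ => ((1 + r * a) ^ 3)⁻¹) (Ioi s) :=
  integrableOn_Ioi_deriv_of_nonneg' (fun r hr => hasDerivAt_inv_one_add_sq ha (hs.trans hr))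
    (fun r hr => by
      have : 0 < r := hs.trans_lt hr
      positivity) (tendsto_inv_one_add_sq ha)

theorem integral_inv_one_add_cube {a : ℝ} (ha : 0 < a) {s : ℝ} (hs : 0 ≤ s) :
    ∫ r in Ioi s, ((1 + r * a) ^ 3)⁻¹ = (2 * a)⁻¹ * ((1 + s * a) ^ 2)⁻¹ := by
  rw [integral_Ioi_of_hasDerivAt_of_tendsto' (fun r hr => hasDerivAt_inv_one_add_sq ha (hs.trans hr))
    (integrableOn_inv_one_add_cube ha hs) (tendsto_inv_one_add_sq ha)]
  ring

/-- By homogeneity the polynomial contributes `2^{jd}` times a dilate of a fixed symbol. The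
inserted fattened cutoff stays with the heat factor to retain its decay. -/
theorem mult_psiJ_comp_polyS_heatS (hφ : IsCutoff φ) {p : Rn n → ℂ} (hp : p.HasTemperateGrowth)
    {d : ℕ} (hd : ∀ (r : ℝ) (η : Rn n), p (r • η) = (r : ℂ) ^ d * p η) (j : ℕ) {s : ℝ} (hs : 0 < s) :
    mult V (psiJ n hφ j) ∘L mult V (polyS p (heatS n s hs)) =
      mult V (mulS (psiFatJ n hφ j) (heatS n s hs)) ∘L
        mult V (((((2 : ℝ) ^ j) ^ d : ℝ) : ℂ) • dil (2 ^ j)⁻¹ (pow_two_inv_pos j).ne' (polyS p (psiS n hφ))) := by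
  rw [← mult_mulS]
  refine mult_mult fun η => ?_
  rw [mulS_apply, mulS_apply, _root_.smul_apply, dil_apply, polyS_apply hp, polyS_apply hp, hd,
    smul_eq_mul]
  have h1 : psiS n hφ (((2 : ℝ) ^ j)⁻¹ • η) = psiJ n hφ j η := rfl
  have h2 : ((((2 : ℝ) ^ j) ^ d : ℝ) : ℂ) * (((((2 : ℝ) ^ j)⁻¹ : ℝ) : ℂ) ^ d) = 1 := by
    rw [← Complex.ofReal_pow, ← Complex.ofReal_mul, ← mul_pow, mul_inv_cancel₀ (by positivity), one_pow,
      Complex.ofReal_one]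
  rw [h1]
  have h3 := psiJ_mul_psiFatJ hφ j η
  calc p η * heatS n s hs η * psiJ n hφ j η = p η * heatS n s hs η * (psiJ n hφ j η * psiFatJ n hφ j η) := by
        rw [h3]
    _ = (((((2 : ℝ) ^ j) ^ d : ℝ) : ℂ) * (((((2 : ℝ) ^ j)⁻¹ : ℝ) : ℂ) ^ d)) *
        (p η * heatS n s hs η * (psiJ n hφ j η * psiFatJ n hφ j η)) := by rw [h2, one_mul]
    _ = _ := by ring

theorem exists_norm_mult_psiJ_comp_polyS_le (hφ : IsCutoff φ) {p : Rn n → ℂ} (hp : p.HasTemperateGrowth)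
    {d : ℕ} (hd : ∀ (r : ℝ) (η : Rn n), p (r • η) = (r : ℂ) ^ d * p η) :
    ∃ C, 0 < C ∧ ∀ (j : ℕ) (s : ℝ) (hs : 0 < s),
      ‖mult V (psiJ n hφ j) ∘L mult V (polyS p (heatS n s hs))‖ ≤
        C * ((2 ^ j) ^ d * ((1 + s * 4 ^ j) ^ 3)⁻¹) := by
  obtain ⟨C, hC, h⟩ := exists_norm_mult_psiFat_heat_le (n := n) (V := V) hφ
  refine ⟨C * (‖ker (polyS p (psiS n hφ))‖ + 1), by positivity, fun j s hs => ?_⟩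
  rw [mult_psiJ_comp_polyS_heatS hφ hp hd j hs]
  refine (ContinuousLinearMap.opNorm_comp_le _ _).trans ?_
  rw [mult_smul, norm_smul, mulS_psiFatJ_heatS]
  have h1 := h _ (pow_two_inv_pos j) (s * 4 ^ j) (by positivity)
  have h2 := norm_mult_dil_le (V := V) _ (pow_two_inv_pos j) (polyS p (psiS n hφ))
  rw [Complex.norm_real, Real.norm_of_nonneg (by positivity)]
  calc _ ≤ C * ((1 + s * 4 ^ j) ^ 3)⁻¹ * ((2 ^ j) ^ d * ‖ker (polyS p (psiS n hφ))‖) := by gcongr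
    _ = C * ‖ker (polyS p (psiS n hφ))‖ * ((2 ^ j) ^ d * ((1 + s * 4 ^ j) ^ 3)⁻¹) := by ring
    _ ≤ _ := by
      gcongr
      linarith

/-- Composition with a fixed multiplier, as a function of the kernel. -/
def multConv (m : 𝓢(Rn n, ℂ)) : Lp ℂ 1 (volume : Measure (Rn n)) →L[ℂ] Cb n ℂ →L[ℂ] Cb n ℂ :=
  (ContinuousLinearMap.compL ℂ (Cb n ℂ) (Cb n ℂ) (Cb n ℂ) (mult ℂ m)) ∘L convL n ℂ

theorem multConv_apply (m : 𝓢(Rn n, ℂ)) (κ : Lp ℂ 1 (volume : Measure (Rn n))) :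
    multConv m κ = mult ℂ m ∘L convL n ℂ κ := rfl

/-- Composition with a multiplier is a continuous linear function of the kernel and so enters the
integral over `r`; localised bounds are then needed only for Gaussians times polynomials. -/
theorem norm_multConv_kerOseen_le (m : 𝓢(Rn n, ℂ)) (i j k : Fin n) {s : ℝ} (hs : 0 < s)
    {A B : ℝ} {F : ℝ → ℝ} (hA : 0 ≤ A)
    (h1 : ‖mult ℂ m ∘L mult ℂ (polyS (poly1 k) (heatS n s hs))‖ ≤ A)
    (h3 : ∀ r (hr : 0 < r), s < r → ‖mult ℂ m ∘L mult ℂ (polyS (poly3 i j k) (heatS n r hr))‖ ≤ F r)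
    (hF : IntegrableOn F (Ioi s)) (hB : ∫ r in Ioi s, F r ≤ B) :
    ‖mult ℂ m ∘L convL n ℂ (kerOseen i j k s)‖ ≤ A + B := by
  rw [← multConv_apply, kerOseen, map_add,
    ← ContinuousLinearMap.integral_comp_comm _ (integrableOn_kerThird i j k hs)]
  refine (norm_add_le _ _).trans (add_le_add ?_ (le_trans ?_ hB))
  · split_ifs
    · rw [kerGrad_eq k hs]
      exact h1
    · rw [map_zero, norm_zero]
      exact hA
  · refine norm_integral_le_of_norm_le hF ?_
    refine (ae_restrict_iff' measurableSet_Ioi).2 (Eventually.of_forall fun r hr => ?_)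
    rw [kerThird_eq i j k (hs.trans hr)]
    exact h3 r (hs.trans hr) hr

/-- The third derivatives contribute `2^{3J}∫_s^∞(1 + r4^J)^{-3}dr`, which is half of `2^J(1 +
s4^J)^{-2}`. The gradient term decays one power faster than required. -/
theorem exists_norm_mult_psiJ_kerOseen_le (n : ℕ) (hφ : IsCutoff φ) : ∃ C, 0 < C ∧
    ∀ (J : ℕ) (i j k : Fin n) (s : ℝ), 0 < s →
      ‖mult ℂ (psiJ n hφ J) ∘L convL n ℂ (kerOseen i j k s)‖ ≤ C * (2 ^ J * ((1 + s * 4 ^ J) ^ 2)⁻¹) := by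
  choose A hA h1 using fun k : Fin n => exists_norm_mult_psiJ_comp_polyS_le (V := ℂ) hφ
    (temperate_poly1 k) (d := 1) (fun r η => by rw [poly1_smul, pow_one])
  choose B hB h3 using fun i j k : Fin n => exists_norm_mult_psiJ_comp_polyS_le (V := ℂ) hφ
    (temperate_poly3 i j k) (d := 3) (poly3_smul i j k)
  refine ⟨∑ k, A k + ∑ i, ∑ j, ∑ k, B i j k + 1, ?_, fun J i j k s hs => ?_⟩
  · have : 0 ≤ ∑ k, A k := Finset.sum_nonneg fun k _ => (hA k).le
    have : 0 ≤ ∑ i, ∑ j, ∑ k, B i j k := Finset.sum_nonneg fun i _ => Finset.sum_nonneg fun j _ =>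
      Finset.sum_nonneg fun k _ => (hB i j k).le
    linarith
  have hA' : A k ≤ ∑ k, A k := Finset.single_le_sum (fun k _ => (hA k).le) (Finset.mem_univ k)
  have hB' : B i j k ≤ ∑ i, ∑ j, ∑ k, B i j k := by
    refine (Finset.single_le_sum (f := fun k => B i j k) (fun k _ => (hB i j k).le) (Finset.mem_univ k)).trans ?_
    refine (Finset.single_le_sum (f := fun j => ∑ k, B i j k)
      (fun j _ => Finset.sum_nonneg fun k _ => (hB i j k).le) (Finset.mem_univ j)).trans ?_
    exact Finset.single_le_sum (f := fun i => ∑ j, ∑ k, B i j k)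
      (fun i _ => Finset.sum_nonneg fun j _ => Finset.sum_nonneg fun k _ => (hB i j k).le)
      (Finset.mem_univ i)
  have h4 : (0 : ℝ) < 4 ^ J := by positivity
  set D : ℝ := 2 ^ J * ((1 + s * 4 ^ J) ^ 2)⁻¹ with hD
  have hD0 : 0 ≤ D := by positivity
  have hA0 := (hA k).le
  have hB0 := (hB i j k).le
  have hone : 1 ≤ 1 + s * 4 ^ J := by nlinarith
  refine (norm_multConv_kerOseen_le (psiJ n hφ J) i j k hs (A := A k * D) (B := B i j k * D)
    (F := fun r => B i j k * ((2 ^ J) ^ 3 * ((1 + r * 4 ^ J) ^ 3)⁻¹)) (by positivity)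
    ((h1 k J s hs).trans ?_) (fun r hr _ => h3 i j k J r hr)
    (((integrableOn_inv_one_add_cube h4 hs.le).const_mul _).const_mul _) ?_).trans ?_
  · rw [pow_one, hD]
    gcongr A k * (2 ^ J * ?_⁻¹)
    exact pow_le_pow_right₀ hone (by norm_num)
  · rw [integral_const_mul, integral_const_mul, integral_inv_one_add_cube h4 hs.le]
    have h5 : ((2 : ℝ) ^ J) ^ 3 * ((2 * 4 ^ J)⁻¹ * ((1 + s * 4 ^ J) ^ 2)⁻¹) = D / 2 := by
      have : (4 : ℝ) ^ J = 2 ^ J * 2 ^ J := by rw [← mul_pow]; norm_num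
      rw [hD, this]
      field_simp
    rw [h5]
    gcongr
    linarith
  · nlinarith

theorem norm_mult_oseenBil_le {m : 𝓢(Rn n, ℂ)} {s D : ℝ}
    (h : ∀ i j k : Fin n, ‖mult ℂ m ∘L convL n ℂ (kerOseen i j k s)‖ ≤ D) (f g : Cb n (Cn n)) :
    ‖mult (Cn n) m (oseenBil n s f g)‖ ≤ n * (n * (n * (D * (‖f‖ * ‖g‖)))) := by
  rw [oseenBil_apply]
  simp only [map_sum]
  refine (norm_sum_le_of_le _ fun i _ => norm_sum_le_of_le _ fun j _ => norm_sum_le_of_le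
    (n := fun _ => D * (‖f‖ * ‖g‖)) _ fun k _ => ?_).trans ?_
  · have hD : 0 ≤ D := (norm_nonneg _).trans (h i j k)
    rw [embB, mult_comp]
    refine (norm_embB_le i _).trans ?_
    refine (ContinuousLinearMap.le_of_opNorm_le _ (h i j k) (prodB j k f g)).trans ?_
    exact mul_le_mul_of_nonneg_left (norm_prodB_le j k f g) hD
  · simp

theorem exists_norm_mult_psiJ_oseenBil_le (n : ℕ) (hφ : IsCutoff φ) : ∃ C, 0 < C ∧
    ∀ (J : ℕ) (s : ℝ), 0 < s → ∀ f g : Cb n (Cn n),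
      ‖mult (Cn n) (psiJ n hφ J) (oseenBil n s f g)‖ ≤
        C * (2 ^ J * ((1 + s * 4 ^ J) ^ 2)⁻¹) * (‖f‖ * ‖g‖) := by
  obtain ⟨C, hC, h⟩ := exists_norm_mult_psiJ_kerOseen_le n hφ
  refine ⟨n * (n * (n * C)) + 1, by positivity, fun J s hs f g => ?_⟩
  refine (norm_mult_oseenBil_le (fun i j k => h J i j k s hs) f g).trans ?_
  have : 0 ≤ (2 ^ J * ((1 + s * 4 ^ J) ^ 2)⁻¹) * (‖f‖ * ‖g‖) := by positivity
  nlinarith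

theorem integrableOn_one_add_rpow : IntegrableOn (fun r : ℝ => (1 + r) ^ (-(3 / 2) : ℝ)) (Ioi 0) := by
  have h := integrableOn_add_rpow_Ioi_of_lt (a := -(3 / 2)) (c := 0) (m := 1) (by norm_num) (by norm_num)
  simpa only [add_comm] using h

/-- At low frequency there is no singularity at `s = 0`, since derivatives may be put on the cutoff.
For large `r` the decay `r^{-3/2}` of the third derivatives makes the integral converge. -/
theorem exists_norm_mult_phiS_oseenBil_le (n : ℕ) (hφ : IsCutoff φ) : ∃ C, 0 < C ∧
    ∀ (s : ℝ), 0 < s → ∀ f g : Cb n (Cn n),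
      ‖mult (Cn n) (phiS n hφ) (oseenBil n s f g)‖ ≤ C * (‖f‖ * ‖g‖) := by
  have key : ∀ (p : Rn n → ℂ), p.HasTemperateGrowth → ∀ (r : ℝ) (hr : 0 < r),
      ‖mult ℂ (phiS n hφ) ∘L mult ℂ (polyS p (heatS n r hr))‖ ≤ ‖ker (gauss n)‖ * ‖ker (polyS p (phiS n hφ))‖ := by
    intro p hp r hr
    have h1 : mult ℂ (phiS n hφ) ∘L mult ℂ (polyS p (heatS n r hr)) =
        mult ℂ (heatS n r hr) ∘L mult ℂ (polyS p (phiS n hφ)) := by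
      rw [← mult_mulS]
      refine mult_mult fun η => ?_
      rw [mulS_apply, polyS_apply hp, polyS_apply hp]
      ring
    rw [h1]
    refine (ContinuousLinearMap.opNorm_comp_le _ _).trans ?_
    gcongr
    · exact norm_mult_dil_le _ (Real.sqrt_pos.2 hr) (gauss n)
    · exact norm_mult_le _
  set A : ℝ := ∑ k : Fin n, ‖ker (gauss n)‖ * ‖ker (polyS (poly1 k) (phiS n hφ))‖
  set K : ℝ := ∫ r in Ioi (0 : ℝ), (1 + r) ^ (-(3 / 2) : ℝ)
  set B : ℝ := ∑ i : Fin n, ∑ j : Fin n, ∑ k : Fin n,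
    (‖ker (gauss n)‖ * ‖ker (polyS (poly3 i j k) (phiS n hφ))‖ +
      ‖ker (phiS n hφ)‖ * ‖ker (polyS (poly3 i j k) (gauss n))‖)
  have hK : 0 ≤ K := setIntegral_nonneg measurableSet_Ioi fun r (hr : 0 < r) => by positivity
  have hA : 0 ≤ A := by positivity
  have hB : 0 ≤ B := by positivity
  have hD : ∀ s, 0 < s → ∀ i j k : Fin n, ‖mult ℂ (phiS n hφ) ∘L convL n ℂ (kerOseen i j k s)‖ ≤
      A + B * 4 * K := by
    intro s hs i j k
    have hA1 : ‖ker (gauss n)‖ * ‖ker (polyS (poly1 k) (phiS n hφ))‖ ≤ A :=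
      Finset.single_le_sum (f := fun k : Fin n => ‖ker (gauss n)‖ * ‖ker (polyS (poly1 k) (phiS n hφ))‖)
        (fun _ _ => by positivity) (Finset.mem_univ k)
    have hB1 : ‖ker (gauss n)‖ * ‖ker (polyS (poly3 i j k) (phiS n hφ))‖ +
      ‖ker (phiS n hφ)‖ * ‖ker (polyS (poly3 i j k) (gauss n))‖ ≤ B := by
      refine (Finset.single_le_sum (f := fun k : Fin n =>
        ‖ker (gauss n)‖ * ‖ker (polyS (poly3 i j k) (phiS n hφ))‖ +
        ‖ker (phiS n hφ)‖ * ‖ker (polyS (poly3 i j k) (gauss n))‖)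
        (fun k _ => by positivity) (Finset.mem_univ k)).trans ?_
      refine (Finset.single_le_sum (f := fun j : Fin n => ∑ k : Fin n,
        (‖ker (gauss n)‖ * ‖ker (polyS (poly3 i j k) (phiS n hφ))‖ +
        ‖ker (phiS n hφ)‖ * ‖ker (polyS (poly3 i j k) (gauss n))‖))
        (fun j _ => by positivity) (Finset.mem_univ j)).trans ?_
      exact Finset.single_le_sum (f := fun i : Fin n => ∑ j : Fin n, ∑ k : Fin n,
        (‖ker (gauss n)‖ * ‖ker (polyS (poly3 i j k) (phiS n hφ))‖ +
        ‖ker (phiS n hφ)‖ * ‖ker (polyS (poly3 i j k) (gauss n))‖))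
        (fun i _ => by positivity) (Finset.mem_univ i)
    refine norm_multConv_kerOseen_le (phiS n hφ) i j k hs (A := A) (B := B * 4 * K)
      (F := fun r => B * 4 * (1 + r) ^ (-(3 / 2) : ℝ)) hA ((key _ (temperate_poly1 k) s hs).trans hA1)
      ?_ ((integrableOn_one_add_rpow.mono_set (Ioi_subset_Ioi hs.le)).const_mul _) ?_
    · intro r hr _
      have h5 : (4 : ℝ) = 4 ^ (3 / 2 : ℝ) / 2 := by
        rw [show (4 : ℝ) = 2 ^ (2 : ℝ) by norm_num, ← Real.rpow_mul (by norm_num)]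
        norm_num
      have hpow : ∀ c : ℝ, 0 < c → 1 + r ≤ 2 * c → c ^ (-(3 / 2) : ℝ) ≤ 4 * (1 + r) ^ (-(3 / 2) : ℝ) := by
        intro c hc h
        rw [Real.rpow_neg hc.le, Real.rpow_neg (by positivity), ← div_eq_mul_inv, inv_eq_one_div,
          div_le_div_iff₀ (by positivity) (by positivity), one_mul]
        calc (1 + r) ^ (3 / 2 : ℝ) ≤ (2 * c) ^ (3 / 2 : ℝ) := by gcongr
          _ = 2 ^ (3 / 2 : ℝ) * c ^ (3 / 2 : ℝ) := Real.mul_rpow (by norm_num) hc.le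
          _ ≤ 4 * c ^ (3 / 2 : ℝ) := by
            gcongr
            calc (2 : ℝ) ^ (3 / 2 : ℝ) ≤ 2 ^ (2 : ℝ) :=
                  Real.rpow_le_rpow_of_exponent_le (by norm_num) (by norm_num)
              _ = 4 := by norm_num
      -- For `r ≤ 1` the polynomial is attached to the cutoff, for `r ≥ 1` to the Gaussian; `hpow`
      -- turns both bounds into multiples of `(1 + r)^{-3/2}`.
      rcases le_total r 1 with h | h
      · have h6 := hpow 1 one_pos (by linarith)
        rw [Real.one_rpow] at h6
        calc _ ≤ B * 1 := by
              rw [mul_one]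
              refine (key _ (temperate_poly3 i j k) r hr).trans (le_trans ?_ hB1)
              have : 0 ≤ ‖ker (phiS n hφ)‖ * ‖ker (polyS (poly3 i j k) (gauss n))‖ := by positivity
              linarith
          _ ≤ B * (4 * (1 + r) ^ (-(3 / 2) : ℝ)) := by gcongr
          _ = _ := by ring
      · have h6 := hpow r hr (by linarith)
        calc _ ≤ ‖ker (phiS n hφ)‖ * (‖ker (polyS (poly3 i j k) (gauss n))‖ * r ^ (-(3 / 2) : ℝ)) := by
              refine (ContinuousLinearMap.opNorm_comp_le _ _).trans ?_
              gcongr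
              · exact norm_mult_le _
              · refine (norm_mult_le _).trans ?_
                rw [← kerThird_eq i j k hr]
                exact norm_kerThird_le i j k hr
          _ = (‖ker (phiS n hφ)‖ * ‖ker (polyS (poly3 i j k) (gauss n))‖) * r ^ (-(3 / 2) : ℝ) := by ring
          _ ≤ B * (4 * (1 + r) ^ (-(3 / 2) : ℝ)) := by
              gcongr
              have : 0 ≤ ‖ker (gauss n)‖ * ‖ker (polyS (poly3 i j k) (phiS n hφ))‖ := by positivity
              linarith
          _ = _ := by ring
    · rw [integral_const_mul]
      gcongr
      refine setIntegral_mono_set integrableOn_one_add_rpow ?_ (Ioi_subset_Ioi hs.le).eventuallyLE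
      refine (ae_restrict_iff' measurableSet_Ioi).2 (Eventually.of_forall fun r (hr : 0 < r) => ?_)
      have : 0 < 1 + r := by linarith
      positivity
  refine ⟨n * (n * (n * (A + B * 4 * K))) + 1, by positivity, fun s hs f g => ?_⟩
  refine (norm_mult_oseenBil_le (hD s hs) f g).trans ?_
  have : 0 ≤ ‖f‖ * ‖g‖ := by positivity
  nlinarith

end NavierStokesBesov

namespace NavierStokesBesov

variable {n : ℕ} {V W : Type*} [NormedAddCommGroup V] [NormedSpace ℂ V] [CompleteSpace V]
  [NormedAddCommGroup W] [NormedSpace ℂ W] [CompleteSpace W]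

/-! ### Approximation by test functions -/

/-- Almost every value of a locally integrable function is a limit of averages against real test
functions of mass one. -/
theorem ae_exists_tendsto_average {g : Rn n → V} (hg : LocallyIntegrable g) :
    ∀ᵐ x, ∃ w : ℕ → 𝓢(Rn n, ℂ), (∀ k y, (w k y).im = 0) ∧ (∀ k, ∫ y, ‖w k y‖ = 1) ∧
      Tendsto (fun k => ∫ y, w k y • g y) atTop (𝓝 (g x)) := by
  let bump : ℕ → ContDiffBump (0 : Rn n) := fun k =>
    ⟨(1 / ((k : ℝ) + 1)), 2 * (1 / ((k : ℝ) + 1)), Nat.one_div_pos_of_nat,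
      lt_mul_of_one_lt_left Nat.one_div_pos_of_nat one_lt_two⟩
  have h1 : Tendsto (fun k => (bump k).rOut) atTop (𝓝 0) := by
    have := (tendsto_one_div_add_atTop_nhds_zero_nat (𝕜 := ℝ)).const_mul 2
    simpa [bump] using this
  have h2 := ContDiffBump.ae_convolution_tendsto_right_of_locallyIntegrable (φ := bump) (K := 2)
    (μ := (volume : Measure (Rn n))) h1 (Eventually.of_forall fun k => le_rfl) hg
  filter_upwards [h2] with x hx
  have hs : ∀ k, HasCompactSupport fun y => (((bump k).normed volume (x - y) : ℝ) : ℂ) := fun k =>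
    ((bump k).hasCompactSupport_normed.comp_homeomorph (Homeomorph.subLeft x)).comp_left
      (g := Complex.ofReal) Complex.ofReal_zero
  have hd : ∀ k, ContDiff ℝ ∞ fun y => (((bump k).normed volume (x - y) : ℝ) : ℂ) := fun k =>
    Complex.ofRealCLM.contDiff.comp ((bump k).contDiff_normed.comp (contDiff_const.sub contDiff_id))
  refine ⟨fun k => (hs k).toSchwartzMap (hd k), fun k y => Complex.ofReal_im _, fun k => ?_, ?_⟩
  · have : ∀ y, ‖(hs k).toSchwartzMap (hd k) y‖ = (bump k).normed volume (x - y) := fun y => by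
      change ‖(((bump k).normed volume (x - y) : ℝ) : ℂ)‖ = _
      rw [Complex.norm_real, Real.norm_of_nonneg ((bump k).nonneg_normed _)]
    simp_rw [this]
    rw [integral_sub_left_eq_self (fun y => (bump k).normed volume y), (bump k).integral_normed]
  · refine hx.congr fun k => ?_
    rw [convolution_eq_swap]
    refine integral_congr_ae (Eventually.of_forall fun y => ?_)
    change (bump k).normed volume (x - y) • g y = (((bump k).normed volume (x - y) : ℝ) : ℂ) • g y
    rw [Complex.coe_smul]

theorem locallyIntegrable_Linf (g : Lp V ⊤ (volume : Measure (Rn n))) : LocallyIntegrable g :=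
  (Lp.memLp g).locallyIntegrable le_top

/-- A bounded function is bounded by its norm as a functional on test functions. -/
theorem Linf_norm_le_of_pairing {g : Lp V ⊤ (volume : Measure (Rn n))} {R : ℝ} (hR : 0 ≤ R)
    (h : ∀ w : 𝓢(Rn n, ℂ), ‖∫ y, w y • g y‖ ≤ R * ∫ y, ‖w y‖) : ‖g‖ ≤ R := by
  refine Linf_norm_le hR ?_
  -- Averages against bumps of mass one recover almost every value, and each average is bounded by
  -- `R`.
  filter_upwards [ae_exists_tendsto_average (locallyIntegrable_Linf g)] with x ⟨w, _, hw, hx⟩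
  refine le_of_tendsto hx.norm (Eventually.of_forall fun k => ?_)
  have := h (w k)
  rwa [hw, mul_one] at this

/-! ### Closed subspaces that are preserved by the bilinear operator -/

variable (n) in
/-- The bounded continuous vector fields with real values. -/
def realB : Submodule ℝ (Cb n (Cn n)) where
  carrier := {f | ∀ x i, (f x i).im = 0}
  add_mem' hf hg x i := by
    simp [hf x i, hg x i]
  zero_mem' x i := by simp
  smul_mem' c f hf x i := by
    simp [hf x i]

theorem mem_realB {f : Cb n (Cn n)} : f ∈ realB n ↔ ∀ x i, (f x i).im = 0 := Iff.rfl

theorem isClosed_realB : IsClosed (realB n : Set (Cb n (Cn n))) := by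
  have : (realB n : Set (Cb n (Cn n))) = ⋂ x : Rn n, ⋂ i : Fin n, {f | (f x i).im = 0} := by
    ext f
    simp [mem_realB]
  rw [this]
  refine isClosed_iInter fun x => isClosed_iInter fun i => isClosed_eq ?_ continuous_const
  have h1 : Continuous fun f : Cb n (Cn n) => f x :=
    (BoundedContinuousFunction.evalCLM ℂ x).continuous
  exact Complex.continuous_im.comp ((EuclideanSpace.proj (𝕜 := ℂ) i : Cn n →L[ℂ] ℂ).continuous.comp h1)

/-- A symbol with Hermitian symmetry has a real kernel. -/
theorem fourierInv_im_eq_zero {m : Rn n → ℂ} (hm : ∀ η, (starRingEnd ℂ) (m (-η)) = m η) (x : Rn n) :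
    (𝓕⁻ m x).im = 0 := by
  rw [← Complex.conj_eq_iff_im, Real.fourierInv_eq, ← integral_conj, ← integral_neg_eq_self]
  refine integral_congr_ae (Eventually.of_forall fun η => ?_)
  have h1 : (starRingEnd ℂ) (Real.fourierChar (inner ℝ (-η) x) : ℂ) = Real.fourierChar (inner ℝ η x) := by
    rw [← Circle.coe_inv_eq_conj, ← AddChar.map_neg_eq_inv, inner_neg_left, neg_neg]
  simp only [Circle.smul_def, smul_eq_mul]
  rw [map_mul, h1, hm]

theorem oseenKernel_im (i j k : Fin n) (s : ℝ) (x : Rn n) : (oseenKernel s i j k x).im = 0 :=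
  fourierInv_im_eq_zero (fun η => by
    rw [oseenSymbol, map_mul, map_mul, Complex.conj_ofReal, Complex.conj_ofReal, Complex.conj_I]
    simp [oseenSymbol]) x

theorem integral_im_eq_zero {α : Type*} [MeasurableSpace α] {μ : Measure α} {f : α → ℂ}
    (hf : ∀ y, (f y).im = 0) : (∫ y, f y ∂μ).im = 0 := by
  have h : f = fun y => ((f y).re : ℂ) := funext fun y => (Complex.conj_eq_iff_re.1
    (Complex.conj_eq_iff_im.2 (hf y))).symm
  rw [h, integral_complex_ofReal, Complex.ofReal_im]

theorem oseenBil_mem_realB {s : ℝ} (hs : 0 < s) {f g : Cb n (Cn n)} (hf : f ∈ realB n)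
    (hg : g ∈ realB n) : oseenBil n s f g ∈ realB n := by
  intro x i
  rw [oseenBil_apply_apply hs, Complex.im_sum]
  refine Finset.sum_eq_zero fun j _ => ?_
  rw [Complex.im_sum]
  refine Finset.sum_eq_zero fun k _ => integral_im_eq_zero fun y => ?_
  simp [Complex.mul_im, oseenKernel_im, hf y j, hg y k]

variable (n) in
/-- The uniform closure of the Schwartz class. -/
def schwartzB : Submodule ℝ (Cb n (Cn n)) :=
  (LinearMap.range (SchwartzMap.toBoundedContinuousFunctionCLM ℝ (Rn n) (Cn n)).toLinearMap).topologicalClosure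

theorem isClosed_schwartzB : IsClosed (schwartzB n : Set (Cb n (Cn n))) :=
  Submodule.isClosed_topologicalClosure _

theorem toBCF_mem_schwartzB (g : 𝓢(Rn n, Cn n)) : g.toBoundedContinuousFunction ∈ schwartzB n :=
  Submodule.le_topologicalClosure _ ⟨g, rfl⟩

theorem exists_schwartz_norm_sub_lt {f : Cb n (Cn n)} (hf : f ∈ schwartzB n) {ε : ℝ} (hε : 0 < ε) :
    ∃ g : 𝓢(Rn n, Cn n), ‖f - g.toBoundedContinuousFunction‖ < ε := by
  have h : f ∈ closure (Set.range fun g : 𝓢(Rn n, Cn n) => g.toBoundedContinuousFunction) := hf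
  obtain ⟨_, ⟨g, rfl⟩, hg⟩ := Metric.mem_closure_iff.1 h ε hε
  exact ⟨g, by rwa [← dist_eq_norm]⟩

/-- The kernel is merely integrable, but the Schwartz class is dense in `L¹` and the target subspace
is closed. For a Schwartz kernel the convolution is a multiplier, which preserves Schwartz
functions. -/
theorem convBil_schwartz_mem (i j k : Fin n) (κ : Lp ℂ 1 (volume : Measure (Rn n)))
    (f g : 𝓢(Rn n, Cn n)) :
    convBil i j k κ f.toBoundedContinuousFunction g.toBoundedContinuousFunction ∈ schwartzB n := by
  have hc : IsClosed {κ : Lp ℂ 1 (volume : Measure (Rn n)) |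
      convBil i j k κ f.toBoundedContinuousFunction g.toBoundedContinuousFunction ∈ schwartzB n} := by
    refine isClosed_schwartzB.preimage ?_
    fun_prop
  refine (SchwartzMap.denseRange_toLpCLM (F := ℂ) (E := Rn n) (p := 1) (μ := volume)
    ENNReal.one_ne_top).induction_on κ hc fun a => ?_
  have ha : SchwartzMap.toLpCLM ℝ ℂ 1 volume a = ker (𝓕 a : 𝓢(Rn n, ℂ)) := by
    rw [ker, FourierTransform.fourierInv_fourier_eq]
    rfl
  set fj : 𝓢(Rn n, ℂ) := SchwartzMap.postcompCLM (𝕜 := ℂ) (EuclideanSpace.proj (𝕜 := ℂ) j : Cn n →L[ℂ] ℂ) f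
  set gk : 𝓢(Rn n, ℂ) := SchwartzMap.postcompCLM (𝕜 := ℂ) (EuclideanSpace.proj (𝕜 := ℂ) k : Cn n →L[ℂ] ℂ) g
  have h1 : prodB j k f.toBoundedContinuousFunction g.toBoundedContinuousFunction =
      (mulS fj gk).toBoundedContinuousFunction := by
    ext x
    rw [prodB_apply]
    exact (mulS_apply fj gk x).symm
  rw [ha, convBil_apply, h1]
  have h2 : convL n ℂ (ker (𝓕 a : 𝓢(Rn n, ℂ))) (mulS fj gk).toBoundedContinuousFunction =
    (SchwartzMap.fourierMultiplierCLM ℂ ((𝓕 a : 𝓢(Rn n, ℂ)) : Rn n → ℂ) (mulS fj gk)).toBoundedContinuousFunction :=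
    mult_schwartz _ _
  rw [h2]
  set v := SchwartzMap.fourierMultiplierCLM ℂ ((𝓕 a : 𝓢(Rn n, ℂ)) : Rn n → ℂ) (mulS fj gk)
  have h3 : embB i v.toBoundedContinuousFunction =
      (SchwartzMap.postcompCLM (𝕜 := ℂ) (singleL i) v).toBoundedContinuousFunction := by
    ext1 x
    rfl
  rw [h3]
  exact toBCF_mem_schwartzB _

theorem oseenBil_mem_schwartzB (s : ℝ) {f g : Cb n (Cn n)} (hf : f ∈ schwartzB n)
    (hg : g ∈ schwartzB n) : oseenBil n s f g ∈ schwartzB n := by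
  have key : ∀ f' g' : 𝓢(Rn n, Cn n), oseenBil n s f'.toBoundedContinuousFunction
      g'.toBoundedContinuousFunction ∈ schwartzB n := fun f' g' => by
    rw [oseenBil_apply]
    exact Submodule.sum_mem _ fun i _ => Submodule.sum_mem _ fun j _ => Submodule.sum_mem _
      fun k _ => convBil_schwartz_mem i j k _ f' g'
  have h1 : ∀ f' : 𝓢(Rn n, Cn n), ∀ g ∈ schwartzB n,
      oseenBil n s f'.toBoundedContinuousFunction g ∈ schwartzB n := fun f' g hg =>
    closure_minimal (t := {g | oseenBil n s f'.toBoundedContinuousFunction g ∈ schwartzB n})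
      (by rintro _ ⟨g', rfl⟩; exact key f' g')
      (isClosed_schwartzB.preimage (oseenBil n s f'.toBoundedContinuousFunction).continuous) hg
  exact closure_minimal (t := {f | oseenBil n s f g ∈ schwartzB n})
      (by rintro _ ⟨f', rfl⟩; exact h1 f' g hg)
      (isClosed_schwartzB.preimage ((oseenBil n s).flip g).continuous) hf

/-! ### Divergence-free fields -/

/-- The range of the Leray symbol is orthogonal to `ξ`. -/
theorem sum_coord_mul_oseenSymbol (s : ℝ) (j k : Fin n) (η : Rn n) :
    ∑ i, (η i : ℂ) * oseenSymbol s i j k η = 0 := by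
  have h1 : ∀ i, (η i : ℂ) * oseenSymbol s i j k η =
      ((η i * ((if i = j then 1 else 0) - η i * η j / ‖η‖ ^ 2) : ℝ) : ℂ) *
      (((Real.exp (-(s * (2 * Real.pi * ‖η‖) ^ 2)) : ℝ) : ℂ) * (Complex.I * ((2 * Real.pi * η k : ℝ) : ℂ))) := by
    intro i
    rw [oseenSymbol]
    push_cast
    ring
  simp_rw [h1]
  rw [← Finset.sum_mul, ← Complex.ofReal_sum]
  have h2 : ∑ i, η i * ((if i = j then 1 else 0) - η i * η j / ‖η‖ ^ 2) = 0 := by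
    rcases eq_or_ne η 0 with rfl | hη
    · simp
    have h3 : ∑ i, η i * (η i * η j / ‖η‖ ^ 2) = (∑ i, η i ^ 2) * (η j / ‖η‖ ^ 2) := by
      rw [Finset.sum_mul]
      exact Finset.sum_congr rfl fun i _ => by ring
    have h4 : ∑ i, η i ^ 2 = ‖η‖ ^ 2 := by
      rw [EuclideanSpace.norm_sq_eq]
      simp
    simp_rw [mul_sub]
    rw [Finset.sum_sub_distrib, h3, h4]
    have : ‖η‖ ≠ 0 := norm_ne_zero_iff.2 hη
    simp
    field_simp
    simp
  rw [h2, Complex.ofReal_zero, zero_mul]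

theorem fourierInv_lineDeriv_apply (i : Fin n) (w : 𝓢(Rn n, ℂ)) (η : Rn n) :
    𝓕⁻ (∂_{EuclideanSpace.single i (1 : ℝ)} w : 𝓢(Rn n, ℂ)) η =
      -(2 * Real.pi * Complex.I) * ((η i : ℂ) * 𝓕⁻ w η) := by
  rw [SchwartzMap.fourierInv_lineDerivOp_eq, _root_.smul_apply,
    SchwartzMap.smulLeftCLM_apply_apply (by fun_prop)]
  simp [EuclideanSpace.inner_single_right]

/-- After Fubini the divergence sits on the kernel. There it is the Fourier transform of `η_i` times
the symbol times `𝓕⁻ w`, and the sum over `i` vanishes pointwise. No differentiability of the kernel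
is used. -/
theorem isDivFree_oseenBil {s : ℝ} (hs : 0 < s) (f g : Cb n (Cn n)) :
    IsDivFree (toDist n (Cn n) (oseenBil n s f g)) := by
  intro w
  set w' : Fin n → 𝓢(Rn n, ℂ) := fun i => ∂_{EuclideanSpace.single i (1 : ℝ)} w
  have hi : ∀ i, Integrable fun x => w' i x • oseenBil n s f g x := fun i =>
    (w' i).integrable.smul_bdd _ (oseenBil n s f g).continuous.aestronglyMeasurable
      (Eventually.of_forall (oseenBil n s f g).norm_coe_le_norm)
  have hP : ∀ (j k : Fin n), AEStronglyMeasurable (fun y => f y j * g y k) (volume : Measure (Rn n)) :=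
    fun j k => (prodB j k f g).continuous.aestronglyMeasurable
  have hPb : ∀ j k : Fin n, ∀ᵐ y : Rn n, ‖f y j * g y k‖ ≤ ‖prodB j k f g‖ := fun j k =>
    Eventually.of_forall (prodB j k f g).norm_coe_le_norm
  have h1 : ∀ i, (toDist n (Cn n) (oseenBil n s f g) (w' i)) i =
      ∑ j, ∑ k, ∫ y, (∫ x, oseenKernel s i j k (x - y) * w' i x) * (f y j * g y k) := by
    intro i
    rw [toDist_apply]
    have h2 := ContinuousLinearMap.integral_comp_comm (EuclideanSpace.proj (𝕜 := ℂ) i : Cn n →L[ℂ] ℂ) (hi i)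
    refine h2.symm.trans ?_
    have h3 : ∀ x, (EuclideanSpace.proj (𝕜 := ℂ) i : Cn n →L[ℂ] ℂ) (w' i x • oseenBil n s f g x) =
        ∑ j, ∑ k, w' i x • (convL n ℂ (kerOseen i j k s) (prodB j k f g)) x := by
      intro x
      rw [map_smul]
      change w' i x • (oseenBil n s f g x i) = _
      rw [oseenBil_apply_apply hs, Finset.smul_sum]
      refine Finset.sum_congr rfl fun j _ => ?_
      rw [Finset.smul_sum]
      refine Finset.sum_congr rfl fun k _ => ?_
      rw [convL_kerOseen_apply i j k hs]
      rfl
    simp_rw [h3]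
    have hint : ∀ j k, Integrable fun x => w' i x • (convL n ℂ (kerOseen i j k s) (prodB j k f g)) x :=
      fun j k => (w' i).integrable.smul_bdd _ (BoundedContinuousFunction.continuous _).aestronglyMeasurable
        (Eventually.of_forall (BoundedContinuousFunction.norm_coe_le_norm _))
    rw [integral_finsetSum _ fun j _ => integrable_finsetSum _ fun k _ => hint j k]
    refine Finset.sum_congr rfl fun j _ => ?_
    rw [integral_finsetSum _ fun k _ => hint j k]
    refine Finset.sum_congr rfl fun k _ => ?_
    simp_rw [convL_kerOseen_apply i j k hs]
    exact integral_smul_conv (integrable_oseenKernel i j k hs) (w' i).integrable (hP j k) (hPb j k)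
  have h2 : ∀ i j k y, ∫ x, oseenKernel s i j k (x - y) * w' i x =
      𝓕 (fun η => -(2 * Real.pi * Complex.I) * 𝓕⁻ w η * ((η i : ℂ) * oseenSymbol s i j k η)) y := by
    intro i j k y
    rw [oseenKernel, ← fourier_mul_fourierInv (integrable_oseenSymbol i j k hs) (w' i).integrable]
    refine congrArg (fun h : Rn n → ℂ => 𝓕 h y) (funext fun η => ?_)
    rw [← SchwartzMap.fourierInv_coe, fourierInv_lineDeriv_apply]
    ring
  have h3 : ∀ i j k, Integrable fun η : Rn n =>
      -(2 * Real.pi * Complex.I) * 𝓕⁻ w η * ((η i : ℂ) * oseenSymbol s i j k η) := by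
    intro i j k
    have hb : ∀ η, ‖(𝓕⁻ (w' i) : 𝓢(Rn n, ℂ)) η‖ ≤ ‖(𝓕⁻ (w' i) : 𝓢(Rn n, ℂ)).toBoundedContinuousFunction‖ :=
      fun η => BoundedContinuousFunction.norm_coe_le_norm
        (𝓕⁻ (w' i) : 𝓢(Rn n, ℂ)).toBoundedContinuousFunction η
    refine ((integrable_oseenSymbol i j k hs).bdd_mul
      (𝓕⁻ (w' i) : 𝓢(Rn n, ℂ)).continuous.aestronglyMeasurable (Eventually.of_forall hb)).congr
      (Eventually.of_forall fun η => ?_)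
    simp only
    rw [fourierInv_lineDeriv_apply]
    ring
  have h4 : ∀ j k y, ∑ i, ∫ x, oseenKernel s i j k (x - y) * w' i x = 0 := by
    intro j k y
    simp_rw [h2, Real.fourier_eq]
    rw [← integral_finsetSum]
    · simp_rw [Circle.smul_def, ← Finset.smul_sum, ← Finset.mul_sum, sum_coord_mul_oseenSymbol]
      simp
    · intro i _
      exact (Real.fourierIntegral_convergent_iff y).2 (h3 i j k)
  have h5 : ∀ i j k, Integrable fun y => (∫ x, oseenKernel s i j k (x - y) * w' i x) * (f y j * g y k) := by
    intro i j k
    have h6 : Integrable (fun p : Rn n × Rn n => w' i p.1 * oseenKernel s i j k (p.1 - p.2))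
        (volume.prod volume) := by
      have := ((w' i).integrable (μ := volume) |>.convolution_integrand (ContinuousLinearMap.mul ℝ ℂ)
        (integrable_oseenKernel i j k hs).comp_neg).swap
      refine this.congr (Eventually.of_forall fun p => ?_)
      simp
    have h7 : Integrable fun y => ∫ x, oseenKernel s i j k (x - y) * w' i x := by
      refine h6.integral_prod_right.congr (Eventually.of_forall fun y => ?_)
      exact integral_congr_ae (Eventually.of_forall fun x => mul_comm _ _)
    exact h7.mul_bdd (hP j k) (hPb j k)
  refine (Finset.sum_congr rfl fun i _ => h1 i).trans ?_
  rw [Finset.sum_comm]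
  refine Finset.sum_eq_zero fun j _ => ?_
  rw [Finset.sum_comm]
  refine Finset.sum_eq_zero fun k _ => ?_
  rw [← integral_finsetSum _ fun i _ => h5 i j k]
  simp_rw [← Finset.sum_mul]
  refine integral_eq_zero_of_ae (Eventually.of_forall fun y => ?_)
  simp only
  rw [h4, zero_mul]
  rfl

theorem IsDivFree.heat {f : TempDist n} (hf : IsDivFree f) {t : ℝ} (ht : 0 < t) :
    IsDivFree (heat t f) := by
  intro w
  rw [heat_eq t ht]
  have h : ∀ i : Fin n, 𝓕 (SchwartzMap.smulLeftCLM ℂ (heatS n t ht)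
      (𝓕⁻ (∂_{EuclideanSpace.single i (1 : ℝ)} w : 𝓢(Rn n, ℂ)))) =
      (∂_{EuclideanSpace.single i (1 : ℝ)} (𝓕 (SchwartzMap.smulLeftCLM ℂ (heatS n t ht) (𝓕⁻ w))) : 𝓢(Rn n, ℂ)) := by
    intro i
    rw [SchwartzMap.lineDerivOp_fourier_eq]
    congr 1
    ext η
    rw [_root_.smul_apply, SchwartzMap.smulLeftCLM_apply_apply (SchwartzMap.hasTemperateGrowth _),
      SchwartzMap.smulLeftCLM_apply_apply (by fun_prop),
      SchwartzMap.smulLeftCLM_apply_apply (SchwartzMap.hasTemperateGrowth _), fourierInv_lineDeriv_apply]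
    simp [EuclideanSpace.inner_single_right]
    ring
  simp_rw [TemperedDistribution.fourierMultiplierCLM_apply_apply, h]
  exact hf _

variable (n) in
/-- The divergence-free bounded continuous vector fields. -/
def divFreeB : Submodule ℝ (Cb n (Cn n)) where
  carrier := {f | IsDivFree (toDist n (Cn n) f)}
  add_mem' hf hg w := by
    have h1 := hf w
    have h2 := hg w
    simp only [map_add, _root_.add_apply, PiLp.add_apply, Finset.sum_add_distrib, h1, h2, add_zero]
  zero_mem' w := by simp
  smul_mem' c f hf w := by
    have h1 := hf w
    have h2 : c • f = (c : ℂ) • f := by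
      ext1 x
      simp
    rw [h2]
    simp only [map_smul, _root_.smul_apply, PiLp.smul_apply, ← Finset.smul_sum, h1, smul_zero]

theorem mem_divFreeB {f : Cb n (Cn n)} : f ∈ divFreeB n ↔ IsDivFree (toDist n (Cn n) f) := Iff.rfl

theorem isClosed_divFreeB : IsClosed (divFreeB n : Set (Cb n (Cn n))) := by
  have : (divFreeB n : Set (Cb n (Cn n))) = ⋂ w : 𝓢(Rn n, ℂ),
      {f | ∑ i, (pairL (∂_{EuclideanSpace.single i (1 : ℝ)} w : 𝓢(Rn n, ℂ)) f : Cn n) i = 0} := by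
    ext f
    simp only [mem_iInter, SetLike.mem_coe]
    rfl
  rw [this]
  refine isClosed_iInter fun w => isClosed_eq (continuous_finsetSum _ fun i _ => ?_) continuous_const
  exact (EuclideanSpace.proj (𝕜 := ℂ) i : Cn n →L[ℂ] ℂ).continuous.comp (ContinuousLinearMap.continuous _)

/-! ### Real distributions -/

theorem IsRealDist.heat {f : TempDist n} (hf : IsRealDist f) {t : ℝ} (ht : 0 < t) :
    IsRealDist (heat t f) := by
  intro w hw i
  rw [heat_eq t ht, TemperedDistribution.fourierMultiplierCLM_apply_apply]
  refine hf _ (fun y => ?_) i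
  rw [fourier_smulLeft_fourierInv]
  refine integral_im_eq_zero fun x => ?_
  have h1 : ((𝓕⁻ (heatS n t ht) : 𝓢(Rn n, ℂ)) (x - y)).im = 0 := by
    rw [SchwartzMap.fourierInv_coe]
    refine fourierInv_im_eq_zero (fun η => ?_) _
    rw [heatS_apply, heatS_apply, Complex.conj_ofReal, norm_neg]
  rw [Complex.mul_im, h1, hw x, mul_zero, zero_mul, add_zero]

theorem isRealDist_toDist {f : Cb n (Cn n)} (hf : f ∈ realB n) : IsRealDist (toDist n (Cn n) f) := by
  intro w hw i
  have hi : Integrable fun x => w x • f x := w.integrable.smul_bdd _ f.continuous.aestronglyMeasurable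
      (Eventually.of_forall f.norm_coe_le_norm)
  rw [toDist_apply]
  have h := ContinuousLinearMap.integral_comp_comm (EuclideanSpace.proj (𝕜 := ℂ) i : Cn n →L[ℂ] ℂ) hi
  refine (congrArg Complex.im h.symm).trans ?_
  refine integral_im_eq_zero fun x => ?_
  simp [Complex.mul_im, hw x, hf x i]

/-- Averages against real test functions are real, hence so is almost every value; continuity gives
the rest. -/
theorem mem_realB_of_isRealDist {f : Cb n (Cn n)} (hf : IsRealDist (toDist n (Cn n) f)) : f ∈ realB n := by
  have h1 : ∀ᵐ x, ∀ i, (f x i).im = 0 := by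
    filter_upwards [ae_exists_tendsto_average (g := f) (f.continuous.locallyIntegrable)] with x ⟨w, hw, _, hx⟩ i
    have h2 : Continuous fun v : Cn n => (v i).im :=
      Complex.continuous_im.comp (EuclideanSpace.proj (𝕜 := ℂ) i : Cn n →L[ℂ] ℂ).continuous
    refine tendsto_nhds_unique ((h2.tendsto _).comp hx) ?_
    refine tendsto_const_nhds.congr fun k => ?_
    have := hf (w k) (hw k) i
    rw [toDist_apply] at this
    exact this.symm
  have hc : IsClosed {x | ∀ i, (f x i).im = 0} := by
    simp only [Set.ofPred_forall]
    refine isClosed_iInter fun i => isClosed_eq ?_ continuous_const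
    exact Complex.continuous_im.comp (projB n i f).continuous
  intro x
  have := hc.closure_eq ▸ (Measure.dense_of_ae h1) x
  exact this

end NavierStokesBesov

namespace NavierStokesBesov

/-! ### Schur's test -/

/-- Hölder's inequality after splitting the kernel as `k^{1/q'} k^{1/q}`. -/
theorem lintegral_mul_rpow_le {α : Type*} [MeasurableSpace α] {μ : Measure α} {k b : α → ℝ≥0∞}
    (hk : AEMeasurable k μ) (hb : AEMeasurable b μ) {q : ℝ} (hq : 1 ≤ q) :
    (∫⁻ x, k x * b x ∂μ) ^ q ≤ (∫⁻ x, k x ∂μ) ^ (q - 1) * ∫⁻ x, k x * b x ^ q ∂μ := by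
  rcases hq.eq_or_lt with rfl | hq
  · simp
  have hc : q.HolderConjugate (q / (q - 1)) := Real.HolderConjugate.conjExponent hq
  have hq0 : 0 < q := by linarith
  have h1 : ∀ x, k x * b x = k x ^ (1 / (q / (q - 1))) * (k x ^ (1 / q) * b x) := by
    intro x
    rw [← mul_assoc, ← ENNReal.rpow_add_of_nonneg _ _ (by have := hc.symm.pos; positivity) (by positivity)]
    have : 1 / (q / (q - 1)) + 1 / q = 1 := by
      have := hc.inv_add_inv_eq_one
      rw [one_div, one_div]
      linarith
    rw [this, ENNReal.rpow_one]
  have h2 := ENNReal.lintegral_mul_le_Lp_mul_Lq μ hc.symm (hk.pow_const (1 / (q / (q - 1))))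
    ((hk.pow_const (1 / q)).mul hb)
  simp only [Pi.mul_apply] at h2
  simp_rw [← h1] at h2
  have h3 : ∀ x, (k x ^ (1 / (q / (q - 1)))) ^ (q / (q - 1)) = k x := fun x => by
    rw [← ENNReal.rpow_mul, one_div_mul_cancel hc.symm.pos.ne', ENNReal.rpow_one]
  have h4 : ∀ x, (k x ^ (1 / q) * b x) ^ q = k x * b x ^ q := fun x => by
    rw [ENNReal.mul_rpow_of_nonneg _ _ hq0.le, ← ENNReal.rpow_mul, one_div_mul_cancel hq0.ne',
      ENNReal.rpow_one]
  simp_rw [h3, h4] at h2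
  calc _ ≤ ((∫⁻ x, k x ∂μ) ^ (1 / (q / (q - 1))) * (∫⁻ x, k x * b x ^ q ∂μ) ^ (1 / q)) ^ q := by
        gcongr
    _ = _ := by
        rw [ENNReal.mul_rpow_of_nonneg _ _ hq0.le, ← ENNReal.rpow_mul, ← ENNReal.rpow_mul,
          one_div_mul_cancel hq0.ne', ENNReal.rpow_one]
        congr 2
        field_simp

/-- Schur's test for integral operators with non-negative kernels. -/
theorem lintegral_schur_le {α β : Type*} [MeasurableSpace α] [MeasurableSpace β] {μ : Measure α}
    {ν : Measure β} [SFinite μ] [SFinite ν] {k : α → β → ℝ≥0∞} (hk : Measurable (Function.uncurry k))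
    {b : β → ℝ≥0∞} (hb : AEMeasurable b ν) {M : ℝ≥0∞}
    (h1 : ∀ᵐ x ∂μ, ∫⁻ y, k x y ∂ν ≤ M) (h2 : ∀ᵐ y ∂ν, ∫⁻ x, k x y ∂μ ≤ M) {q : ℝ} (hq : 1 ≤ q) :
    (∫⁻ x, (∫⁻ y, k x y * b y ∂ν) ^ q ∂μ) ^ (1 / q) ≤ M * (∫⁻ y, b y ^ q ∂ν) ^ (1 / q) := by
  have hq0 : 0 < q := by linarith
  have hk1 : ∀ x, Measurable (k x) := fun x => hk.comp measurable_prodMk_left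
  have h3 : ∫⁻ x, (∫⁻ y, k x y * b y ∂ν) ^ q ∂μ ≤ M ^ q * ∫⁻ y, b y ^ q ∂ν := by
    calc ∫⁻ x, (∫⁻ y, k x y * b y ∂ν) ^ q ∂μ
        ≤ ∫⁻ x, M ^ (q - 1) * ∫⁻ y, k x y * b y ^ q ∂ν ∂μ := by
          refine lintegral_mono_ae ?_
          filter_upwards [h1] with x hx
          refine (lintegral_mul_rpow_le (hk1 x).aemeasurable hb hq).trans ?_
          gcongr
      _ ≤ M ^ (q - 1) * ∫⁻ x, ∫⁻ y, k x y * b y ^ q ∂ν ∂μ := by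
          rw [lintegral_const_mul'']
          exact ((hk.aemeasurable.mul (hb.pow_const q).comp_snd).lintegral_prod_right')
      _ = M ^ (q - 1) * ∫⁻ y, ∫⁻ x, k x y * b y ^ q ∂μ ∂ν := by
          rw [lintegral_lintegral_swap]
          exact hk.aemeasurable.mul (hb.pow_const q).comp_snd
      _ ≤ M ^ (q - 1) * ∫⁻ y, M * b y ^ q ∂ν := by
          refine mul_le_mul_right (lintegral_mono_ae ?_) _
          filter_upwards [h2] with y hy
          have hk2 : Measurable fun x => k x y := hk.comp measurable_prodMk_right
          rw [lintegral_mul_const'' _ hk2.aemeasurable]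
          gcongr
      _ = M ^ q * ∫⁻ y, b y ^ q ∂ν := by
          rw [lintegral_const_mul'' _ (hb.pow_const q), ← mul_assoc]
          congr 1
          nth_rewrite 2 [← ENNReal.rpow_one M]
          rw [← ENNReal.rpow_add_of_nonneg _ _ (by linarith) zero_le_one, sub_add_cancel]
  calc _ ≤ (M ^ q * ∫⁻ y, b y ^ q ∂ν) ^ (1 / q) := by gcongr
    _ = _ := by
      rw [ENNReal.mul_rpow_of_nonneg _ _ (by positivity), ← ENNReal.rpow_mul, mul_one_div_cancel hq0.ne',
        ENNReal.rpow_one]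

/-! ### The logarithmic weight -/

/-- The function `1 + log (T / t) = |log (t / (e T))|`. -/
def ell (T t : ℝ) : ℝ := 1 + Real.log (T / t)

theorem one_le_ell {T t : ℝ} (ht : 0 < t) (htT : t ≤ T) : 1 ≤ ell T t := by
  rw [ell, le_add_iff_nonneg_right]
  exact Real.log_nonneg ((one_le_div ht).2 htT)

theorem ell_pos {T t : ℝ} (ht : 0 < t) (htT : t ≤ T) : 0 < ell T t := one_pos.trans_le (one_le_ell ht htT)

theorem abs_log_eq_ell {T t : ℝ} (ht : 0 < t) (htT : t ≤ T) :
    |Real.log (t / (Real.exp 1 * T))| = ell T t := by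
  have hT : 0 < T := ht.trans_le htT
  have h : Real.log (t / (Real.exp 1 * T)) = -ell T t := by
    rw [ell, Real.log_div ht.ne' (by positivity), Real.log_mul (Real.exp_pos 1).ne' hT.ne',
      Real.log_exp, Real.log_div hT.ne' ht.ne']
    ring
  rw [h, abs_neg, abs_of_pos (ell_pos ht htT)]

theorem ell_anti {T τ t : ℝ} (hτ : 0 < τ) (h : τ ≤ t) (htT : t ≤ T) : ell T t ≤ ell T τ := by
  have ht := hτ.trans_le h
  have hT := ht.trans_le htT
  rw [ell, ell]
  gcongr

theorem hasDerivAt_ell {T t : ℝ} (hT : 0 < T) (ht : 0 < t) : HasDerivAt (ell T) (-(1 / t)) t := by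
  have h : HasDerivAt (fun t => 1 + (Real.log T - Real.log t)) (-(1 / t)) t := by
    have := ((Real.hasDerivAt_log ht.ne').const_sub (Real.log T)).const_add 1
    rwa [one_div]
  refine h.congr_of_eventuallyEq ?_
  filter_upwards [lt_mem_nhds ht] with s hs
  rw [ell, Real.log_div hT.ne' hs.ne']

theorem measurable_ell (T : ℝ) : Measurable (ell T) := by
  unfold ell
  fun_prop

/-- Powers of the logarithmic weight. -/
def lw (T e t : ℝ) : ℝ≥0∞ := ENNReal.ofReal (ell T t ^ e)

theorem measurable_lw (T e : ℝ) : Measurable (lw T e) :=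
  ((measurable_ell T).pow_const e).ennreal_ofReal

section

variable {T t : ℝ}

theorem lw_zero : lw T 0 t = 1 := by simp [lw]

theorem lw_ne_top {e : ℝ} : lw T e t ≠ ⊤ := ENNReal.ofReal_ne_top

theorem lw_mul (ht : 0 < t) (htT : t ≤ T) (e e' : ℝ) : lw T e t * lw T e' t = lw T (e + e') t := by
  have := ell_pos ht htT
  rw [lw, lw, lw, ← ENNReal.ofReal_mul (by positivity), ← Real.rpow_add this]

theorem lw_rpow (ht : 0 < t) (htT : t ≤ T) (e : ℝ) {q : ℝ} (hq : 0 ≤ q) :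
    lw T e t ^ q = lw T (e * q) t := by
  have := ell_pos ht htT
  rw [lw, lw, ENNReal.ofReal_rpow_of_nonneg (by positivity) hq, ← Real.rpow_mul this.le]

theorem lw_mono_exp (ht : 0 < t) (htT : t ≤ T) {e e' : ℝ} (h : e ≤ e') : lw T e t ≤ lw T e' t :=
  ENNReal.ofReal_le_ofReal (Real.rpow_le_rpow_of_exponent_le (one_le_ell ht htT) h)

theorem lw_le_one (ht : 0 < t) (htT : t ≤ T) {e : ℝ} (h : e ≤ 0) : lw T e t ≤ 1 := by
  rw [← lw_zero (T := T) (t := t)]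
  exact lw_mono_exp ht htT h

theorem one_le_lw (ht : 0 < t) (htT : t ≤ T) {e : ℝ} (h : 0 ≤ e) : 1 ≤ lw T e t := by
  rw [← lw_zero (T := T) (t := t)]
  exact lw_mono_exp ht htT h

theorem lw_anti {τ : ℝ} (hτ : 0 < τ) (h : τ ≤ t) (htT : t ≤ T) {e : ℝ} (he : 0 ≤ e) :
    lw T e t ≤ lw T e τ :=
  ENNReal.ofReal_le_ofReal (Real.rpow_le_rpow (ell_pos (hτ.trans_le h) htT).le (ell_anti hτ h htT) he)

theorem lw_mono {τ : ℝ} (hτ : 0 < τ) (h : τ ≤ t) (htT : t ≤ T) {e : ℝ} (he : e ≤ 0) :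
    lw T e τ ≤ lw T e t :=
  ENNReal.ofReal_le_ofReal (Real.rpow_le_rpow_of_nonpos (ell_pos (hτ.trans_le h) htT)
    (ell_anti hτ h htT) he)

end

/-- The measure `dt/t` on `(0,T)`. -/
def nu (T : ℝ) : Measure ℝ :=
  (volume.restrict (Ioo 0 T)).withDensity fun t => ENNReal.ofReal (1 / t)

instance (T : ℝ) : SFinite (nu T) := by unfold nu; infer_instance

theorem lintegral_nu (T : ℝ) (f : ℝ → ℝ≥0∞) :
    ∫⁻ t, f t ∂nu T = ∫⁻ t in Ioo 0 T, f t * ENNReal.ofReal (1 / t) := by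
  rw [nu, lintegral_withDensity_eq_lintegral_mul_non_measurable _ (by fun_prop)
    (Eventually.of_forall fun t => ENNReal.ofReal_lt_top)]
  simp only [Pi.mul_apply, mul_comm]

theorem setLIntegral_nu (T : ℝ) {s : Set ℝ} (hs : MeasurableSet s) (f : ℝ → ℝ≥0∞) :
    ∫⁻ t in s, f t ∂nu T = ∫⁻ t in Ioo 0 T ∩ s, f t * ENNReal.ofReal (1 / t) := by
  rw [← lintegral_indicator hs, lintegral_nu, inter_comm, ← Measure.restrict_restrict hs,
    ← lintegral_indicator hs]
  refine lintegral_congr fun t => ?_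
  by_cases h : t ∈ s <;> simp [h]

theorem ae_nu_of_ae {T : ℝ} {p : ℝ → Prop} (h : ∀ᵐ t ∂volume.restrict (Ioo 0 T), p t) :
    ∀ᵐ t ∂nu T, p t := (withDensity_absolutelyContinuous _ _) h

theorem ae_nu_mem (T : ℝ) : ∀ᵐ t ∂nu T, t ∈ Ioo 0 T := ae_nu_of_ae (ae_restrict_mem measurableSet_Ioo)

/-- Integrals of functions of the logarithmic weight. -/
theorem setLIntegral_nu_ell_le {T : ℝ} (hT : 0 < T) {s r : Set ℝ} (hs : MeasurableSet s) (hsT : s ⊆ Ioo 0 T)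
    (hr : ∀ t ∈ s, ell T t ∈ r) (g : ℝ → ℝ≥0∞) :
    ∫⁻ t in s, g (ell T t) ∂nu T ≤ ∫⁻ x in r, g x := by
  rw [setLIntegral_nu T hs, inter_eq_self_of_subset_right hsT]
  -- The substitution `x = ℓ(t)` turns `dt/t` into Lebesgue measure.
  have hinj : InjOn (ell T) s := by
    intro a ha b hb hab
    have ha0 : 0 < a := (hsT ha).1
    have hb0 : 0 < b := (hsT hb).1
    rw [ell, ell, add_right_inj] at hab
    have := Real.log_injOn_pos (show T / a ∈ Ioi 0 from div_pos hT ha0) (show T / b ∈ Ioi 0 from div_pos hT hb0) hab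
    field_simp at this
    exact this.symm
  have h := lintegral_image_eq_lintegral_abs_deriv_mul hs
    (fun t ht => (hasDerivAt_ell hT (hsT ht).1).hasDerivWithinAt) hinj g
  have h2 : ∫⁻ t in s, g (ell T t) * ENNReal.ofReal (1 / t) =
      ∫⁻ t in s, ENNReal.ofReal |-(1 / t)| * g (ell T t) := by
    refine setLIntegral_congr_fun hs fun t ht => ?_
    rw [abs_neg, abs_of_pos (one_div_pos.2 (hsT ht).1), mul_comm]
  rw [h2, ← h]
  exact lintegral_mono_set (by rintro _ ⟨t, ht, rfl⟩; exact hr t ht)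

theorem setLIntegral_lw_neg_le {T t p : ℝ} (ht : 0 < t) (htT : t ≤ T) (hp : 1 < p) :
    ∫⁻ τ in Ioo 0 t, lw T (-p) τ ∂nu T ≤ ENNReal.ofReal (1 / (p - 1)) * lw T (1 - p) t := by
  have hT := ht.trans_le htT
  refine (setLIntegral_nu_ell_le (r := Ioi (ell T t)) hT measurableSet_Ioo (Ioo_subset_Ioo_right htT)
    (fun τ hτ => ?_) (fun x => ENNReal.ofReal (x ^ (-p)))).trans (le_of_eq ?_)
  · rw [mem_Ioi, ell, ell, add_lt_add_iff_left]
    exact Real.log_lt_log (div_pos hT ht) (div_lt_div_of_pos_left hT hτ.1 hτ.2)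
  · have h1 := ell_pos ht htT
    rw [← ofReal_integral_eq_lintegral_ofReal (integrableOn_Ioi_rpow_of_lt (by linarith) h1)
      ((ae_restrict_iff' measurableSet_Ioi).2 (Eventually.of_forall fun x hx =>
        Real.rpow_nonneg (h1.le.trans (le_of_lt hx)) _)), integral_Ioi_rpow_of_lt (by linarith) h1, lw,
      ← ENNReal.ofReal_mul (by have : 0 < p - 1 := by linarith
                               positivity)]
    congr 1
    rw [show -p + 1 = -(p - 1) by ring, show 1 - p = -(p - 1) by ring, neg_div_neg_eq]
    ring

theorem setLIntegral_lw_le {T τ e : ℝ} (hτ : 0 < τ) (hτT : τ < T) (he : 0 ≤ e) :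
    ∫⁻ t in Ioo τ T, lw T e t ∂nu T ≤ lw T (e + 1) τ := by
  have hT := hτ.trans hτT
  refine (setLIntegral_nu_ell_le (r := Ioo 0 (ell T τ)) hT measurableSet_Ioo (Ioo_subset_Ioo_left hτ.le)
    (fun t ht => ⟨ell_pos (hτ.trans ht.1) ht.2.le, ?_⟩) (fun x => ENNReal.ofReal (x ^ e))).trans ?_
  · rw [ell, ell, add_lt_add_iff_left]
    exact Real.log_lt_log (div_pos hT (hτ.trans ht.1)) (div_lt_div_of_pos_left hT hτ ht.1)
  · have h1 := ell_pos hτ hτT.le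
    calc ∫⁻ x in Ioo 0 (ell T τ), ENNReal.ofReal (x ^ e)
        ≤ ∫⁻ x in Ioo 0 (ell T τ), ENNReal.ofReal (ell T τ ^ e) := by
          refine setLIntegral_mono' measurableSet_Ioo fun x hx => ?_
          exact ENNReal.ofReal_le_ofReal (Real.rpow_le_rpow hx.1.le hx.2.le he)
      _ = lw T (e + 1) τ := by
          rw [setLIntegral_const, Real.volume_Ioo, sub_zero, ← ENNReal.ofReal_mul (by positivity), lw,
            Real.rpow_add_one h1.ne']

end NavierStokesBesov

namespace NavierStokesBesov

/-! ### Weighted norms -/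

/-- The weight `√t |ln(t/(eT))|^σ`. -/
def wt (σ T t : ℝ) : ℝ≥0∞ :=
  ENNReal.ofReal (√t * |Real.log (t / (Real.exp 1 * T))| ^ σ)

theorem measurable_wt (σ T : ℝ) : Measurable (wt σ T) := by
  unfold wt
  have h1 : Measurable fun t : ℝ => |Real.log (t / (Real.exp 1 * T))| :=
    (Real.measurable_log.comp (by fun_prop)).abs
  have := h1.pow_const σ
  fun_prop

theorem wt_eq {σ T t : ℝ} (ht : 0 < t) (htT : t ≤ T) : wt σ T t = ENNReal.ofReal (√t) * lw T σ t := by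
  rw [wt, lw, abs_log_eq_ell ht htT, ENNReal.ofReal_mul (Real.sqrt_nonneg t)]

theorem wt_ne_top {σ T t : ℝ} : wt σ T t ≠ ⊤ := ENNReal.ofReal_ne_top

/-- The weighted supremum of a function on `(0,T)`. -/
def supW (σ T : ℝ) (A : ℝ → ℝ≥0∞) : ℝ≥0∞ := ⨆ t ∈ Ioo 0 T, wt σ T t * A t

/-- The weighted `L^q(dt/t)` norm of a function on `(0,t)`, where the weight is that of `(0,T)`. -/
def lqOn (σ q T t : ℝ) (A : ℝ → ℝ≥0∞) : ℝ≥0∞ :=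
  (∫⁻ τ in Ioo 0 t, (wt σ T τ * A τ) ^ q ∂nu T) ^ (1 / q)

/-- The weighted `L^q(dt/t)` norm of a function on `(0,T)`. -/
def lqW (σ q T : ℝ) (A : ℝ → ℝ≥0∞) : ℝ≥0∞ := lqOn σ q T T A

/-- The sum of the two weighted norms. -/
def normW (σ q T : ℝ) (A : ℝ → ℝ≥0∞) : ℝ≥0∞ := supW σ T A + lqW σ q T A

/-! ### The weighted functionals and their duality -/

section

variable {σ q T t : ℝ} {A B : ℝ → ℝ≥0∞}

theorem wt_mul_le_supW (ht : t ∈ Ioo 0 T) : wt σ T t * A t ≤ supW σ T A :=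
  le_iSup₂ (f := fun t (_ : t ∈ Ioo 0 T) => wt σ T t * A t) t ht

theorem supW_le_iff {M : ℝ≥0∞} : supW σ T A ≤ M ↔ ∀ t ∈ Ioo 0 T, wt σ T t * A t ≤ M := iSup₂_le_iff

theorem nu_restrict_Ioo : (nu T).restrict (Ioo 0 T) = nu T :=
  Measure.restrict_eq_self_of_ae_mem (ae_nu_mem T)

theorem lqW_eq : lqW σ q T A = (∫⁻ τ, (wt σ T τ * A τ) ^ q ∂nu T) ^ (1 / q) := by
  rw [lqW, lqOn, nu_restrict_Ioo]

theorem lqOn_le_lqW (hq : 1 ≤ q) : lqOn σ q T t A ≤ lqW σ q T A := by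
  rw [lqW_eq, lqOn]
  exact ENNReal.rpow_le_rpow (setLIntegral_le_lintegral _ _) (by positivity)

/-- The squared weight is `tℓ^{2σ}`, so a product of two weighted functions is integrated against
`dt/t` with the logarithmic gain `ℓ^{-2σ}`. All later estimates use up this gain. -/
theorem mul_eq_weighted (ht : 0 < t) (htT : t ≤ T) (a b : ℝ≥0∞) :
    (wt σ T t * a) * (wt σ T t * b) * lw T (-2 * σ) t * ENNReal.ofReal (1 / t) = a * b := by
  have h1 : wt σ T t * wt σ T t * lw T (-2 * σ) t * ENNReal.ofReal (1 / t) = 1 := by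
    rw [wt_eq ht htT]
    calc _ = (ENNReal.ofReal (√t) * ENNReal.ofReal (√t) * ENNReal.ofReal (1 / t)) *
          (lw T σ t * lw T σ t * lw T (-2 * σ) t) := by ring
      _ = 1 := by
        rw [lw_mul ht htT, lw_mul ht htT, show σ + σ + -2 * σ = 0 by ring, lw_zero, mul_one,
          ← ENNReal.ofReal_mul (Real.sqrt_nonneg t), Real.mul_self_sqrt ht.le,
          ← ENNReal.ofReal_mul ht.le, mul_one_div_cancel ht.ne', ENNReal.ofReal_one]
  calc _ = (wt σ T t * wt σ T t * lw T (-2 * σ) t * ENNReal.ofReal (1 / t)) * (a * b) := by ring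
    _ = _ := by rw [h1, one_mul]

theorem lintegral_mul_eq (htT : t ≤ T) : ∫⁻ τ in Ioo 0 t, A τ * B τ =
    ∫⁻ τ in Ioo 0 t, (wt σ T τ * A τ) * (wt σ T τ * B τ) * lw T (-2 * σ) τ ∂nu T := by
  rw [setLIntegral_nu T measurableSet_Ioo, inter_eq_self_of_subset_right (Ioo_subset_Ioo_right htT)]
  refine setLIntegral_congr_fun measurableSet_Ioo fun τ hτ => ?_
  exact (mul_eq_weighted hτ.1 (hτ.2.le.trans htT) _ _).symm

theorem aemeasurable_weighted (hA : AEMeasurable A (volume.restrict (Ioo 0 T))) :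
    AEMeasurable (fun τ => wt σ T τ * A τ) (nu T) :=
  ((measurable_wt σ T).aemeasurable.mul hA).mono_ac (withDensity_absolutelyContinuous _ _)

/-! ### Hölder bounds at the critical logarithmic exponent -/

/-- The critical exponent. -/
def sigmaCrit (q : ℝ) : ℝ := 1 - min (1 - 1 / q) (1 / q)

theorem inv_le_sigmaCrit : 1 / q ≤ sigmaCrit q := by
  have := min_le_left (1 - 1 / q) (1 / q)
  rw [sigmaCrit]
  linarith

theorem one_sub_inv_le_sigmaCrit : 1 - 1 / q ≤ sigmaCrit q := by
  have := min_le_right (1 - 1 / q) (1 / q)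
  rw [sigmaCrit]
  linarith

theorem half_le_sigmaCrit : 1 / 2 ≤ sigmaCrit q := by
  have h1 := inv_le_sigmaCrit (q := q)
  have h2 := one_sub_inv_le_sigmaCrit (q := q)
  linarith

/-- The bound of `∫ A B` by a weighted `L^q` norm of `A` and a weighted supremum of `B`. -/
theorem lintegral_mul_le_lq_sup (hq : 1 ≤ q) (hσ : sigmaCrit q ≤ σ) (ht : 0 < t) (htT : t ≤ T)
    (hA : AEMeasurable A (volume.restrict (Ioo 0 T))) {M : ℝ≥0∞}
    (hM : ∀ τ ∈ Ioo 0 t, wt σ T τ * B τ ≤ M) :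
    ∫⁻ τ in Ioo 0 t, A τ * B τ ≤ lw T (-σ) t * (lqOn σ q T t A * M) := by
  have ha := (aemeasurable_weighted (σ := σ) hA).mono_measure (Measure.restrict_le_self (s := Ioo 0 t))
  have hσ1 := inv_le_sigmaCrit.trans hσ
  have hσ2 := one_sub_inv_le_sigmaCrit.trans hσ
  have hσ0 := half_le_sigmaCrit.trans hσ
  have h1 : ∫⁻ τ in Ioo 0 t, A τ * B τ ≤
      M * ∫⁻ τ in Ioo 0 t, (wt σ T τ * A τ) * lw T (-2 * σ) τ ∂nu T := by
    rw [lintegral_mul_eq (σ := σ) htT, ← lintegral_const_mul'' _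
      (show AEMeasurable (fun τ => wt σ T τ * A τ * lw T (-2 * σ) τ) _ from
        ha.mul (measurable_lw T _).aemeasurable)]
    refine setLIntegral_mono' measurableSet_Ioo fun τ hτ => ?_
    calc _ = (wt σ T τ * B τ) * (wt σ T τ * A τ * lw T (-2 * σ) τ) := by ring
      _ ≤ _ := by gcongr; exact hM τ hτ
  have h2 : ∫⁻ τ in Ioo 0 t, (wt σ T τ * A τ) * lw T (-2 * σ) τ ∂nu T ≤ lqOn σ q T t A * lw T (-σ) t := by
    rcases hq.eq_or_lt with rfl | hq
    · rw [lqOn]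
      simp only [ENNReal.rpow_one, div_one]
      rw [← lintegral_mul_const'' _ ha]
      refine setLIntegral_mono' measurableSet_Ioo fun τ hτ => ?_
      gcongr
      exact (lw_mono hτ.1 hτ.2.le htT (by linarith)).trans (lw_mono_exp ht htT (by linarith))
    · set p := q / (q - 1) with hp
      have hc : q.HolderConjugate p := Real.HolderConjugate.conjExponent hq
      have hp0 : 0 < p := hc.symm.pos
      have hp1 : 1 / p = 1 - 1 / q := by
        have := hc.inv_add_inv_eq_one
        rw [one_div, one_div]
        linarith
      -- This is where `σ ≥ 1 - 1/q` is used: the power `2σp` of `ℓ` is at least two, hence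
      -- integrable at infinity with constant at most one.
      have h2p : 2 ≤ 2 * σ * p := by
        have : 1 ≤ σ * p := by
          rw [← hp1] at hσ2
          rwa [div_le_iff₀ hp0] at hσ2
        linarith
      refine (ENNReal.lintegral_mul_le_Lp_mul_Lq _ hc ha (measurable_lw T _).aemeasurable).trans ?_
      rw [lqOn]
      gcongr
      have h3 : ∫⁻ τ in Ioo 0 t, lw T (-2 * σ) τ ^ p ∂nu T ≤ lw T (1 - 2 * σ * p) t := by
        calc _ = ∫⁻ τ in Ioo 0 t, lw T (-(2 * σ * p)) τ ∂nu T := by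
              refine setLIntegral_congr_fun measurableSet_Ioo fun τ hτ => ?_
              rw [lw_rpow hτ.1 (hτ.2.le.trans htT) _ hp0.le]
              congr 1
              ring
          _ ≤ ENNReal.ofReal (1 / (2 * σ * p - 1)) * lw T (1 - 2 * σ * p) t :=
              setLIntegral_lw_neg_le ht htT (by linarith)
          _ ≤ 1 * _ := by
              gcongr
              rw [← ENNReal.ofReal_one]
              refine ENNReal.ofReal_le_ofReal ?_
              rw [div_le_one (by linarith)]
              linarith
          _ = _ := one_mul _
      calc _ ≤ (lw T (1 - 2 * σ * p) t) ^ (1 / p) := by gcongr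
        _ = lw T ((1 - 2 * σ * p) * (1 / p)) t := lw_rpow ht htT _ (by positivity)
        _ ≤ _ := by
            refine lw_mono_exp ht htT ?_
            have : (1 - 2 * σ * p) * (1 / p) = 1 / p - 2 * σ := by field_simp
            rw [this, hp1]
            linarith
  calc _ ≤ M * (lqOn σ q T t A * lw T (-σ) t) := h1.trans (by gcongr)
    _ = _ := by ring

/-- Both norms of `a` are traded for its `L^{q'}` norm with weight `ℓ^{-1}`. If `q ≤ 2` then `q' ≥
q` and one interpolates between `L^q` and `L^∞`, the weight giving `ℓ^{-1/q'}`. If `q > 2` then `q'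
< q`, Hölder is used and the integrable weight gives `ℓ^{-1/q}`. In either case the gain is
`ℓ^{-(1-σ_q)}`, which is the origin of the minimum in the critical exponent. -/
theorem lintegral_conj_le (hq : 1 < q) (ht : 0 < t) (htT : t ≤ T) {a : ℝ → ℝ≥0∞}
    (ha : AEMeasurable a (nu T)) {M : ℝ≥0∞} (hM : ∀ τ ∈ Ioo 0 t, a τ ≤ M)
    (hL : (∫⁻ τ in Ioo 0 t, a τ ^ q ∂nu T) ^ (1 / q) ≤ M) :
    (∫⁻ τ in Ioo 0 t, a τ ^ (q / (q - 1)) * lw T (-1) τ ∂nu T) ^ (1 - 1 / q) ≤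
      ENNReal.ofReal (max 1 q) * (M * lw T (-(1 - sigmaCrit q)) t) := by
  set p := q / (q - 1) with hp
  have hc : q.HolderConjugate p := Real.HolderConjugate.conjExponent hq
  have hp0 : 0 < p := hc.symm.pos
  have hq0 : 0 < q := by linarith
  have hp1 : 1 - 1 / q = 1 / p := by
    have := hc.inv_add_inv_eq_one
    rw [one_div, one_div]
    linarith
  have ha' := ha.mono_measure (Measure.restrict_le_self (s := Ioo 0 t))
  have hLq : ∫⁻ τ in Ioo 0 t, a τ ^ q ∂nu T ≤ M ^ q := by
    rwa [one_div, ENNReal.rpow_inv_le_iff hq0] at hL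
  have hC : (1 : ℝ≥0∞) ≤ ENNReal.ofReal (max 1 q) := by
    rw [← ENNReal.ofReal_one]
    exact ENNReal.ofReal_le_ofReal (le_max_left _ _)
  rw [hp1]
  rcases le_or_gt q 2 with h2 | h2
  · have hqp : q ≤ p := by
      rw [hp, le_div_iff₀ (by linarith)]
      nlinarith
    have hs : 1 - sigmaCrit q = 1 / p := by
      rw [sigmaCrit, min_eq_left, ← hp1]
      · ring
      · have : 1 / 2 ≤ 1 / q := one_div_le_one_div_of_le hq0 h2
        linarith
    have h3 : ∫⁻ τ in Ioo 0 t, a τ ^ p * lw T (-1) τ ∂nu T ≤ M ^ p * lw T (-1) t := by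
      calc _ ≤ ∫⁻ τ in Ioo 0 t, (M ^ (p - q) * lw T (-1) t) * a τ ^ q ∂nu T := by
            refine setLIntegral_mono' measurableSet_Ioo fun τ hτ => ?_
            calc a τ ^ p * lw T (-1) τ = a τ ^ (p - q) * a τ ^ q * lw T (-1) τ := by
                  rw [← ENNReal.rpow_add_of_nonneg _ _ (by linarith) hq0.le, sub_add_cancel]
              _ ≤ M ^ (p - q) * a τ ^ q * lw T (-1) t := by
                  have h4 := hM τ hτ
                  have h5 := lw_mono hτ.1 hτ.2.le htT (show (-1 : ℝ) ≤ 0 by norm_num)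
                  have h6 : 0 ≤ p - q := by linarith
                  gcongr
              _ = _ := by ring
        _ = (M ^ (p - q) * lw T (-1) t) * ∫⁻ τ in Ioo 0 t, a τ ^ q ∂nu T :=
            lintegral_const_mul'' _ (ha'.pow_const q)
        _ ≤ (M ^ (p - q) * lw T (-1) t) * M ^ q := by gcongr
        _ = M ^ (p - q) * M ^ q * lw T (-1) t := by ring
        _ = _ := by rw [← ENNReal.rpow_add_of_nonneg _ _ (by linarith) hq0.le, sub_add_cancel]
    calc _ ≤ (M ^ p * lw T (-1) t) ^ (1 / p) := by gcongr
      _ = M * lw T (-(1 - sigmaCrit q)) t := by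
          rw [ENNReal.mul_rpow_of_nonneg _ _ (by positivity), ← ENNReal.rpow_mul,
            mul_one_div_cancel hp0.ne', ENNReal.rpow_one, lw_rpow ht htT _ (by positivity), hs]
          congr 2
          ring
      _ ≤ _ := le_mul_of_one_le_left zero_le hC
  · have hpq : p < q := by
      rw [hp, div_lt_iff₀ (by linarith)]
      nlinarith
    have hs : 1 - sigmaCrit q = 1 / q := by
      rw [sigmaCrit, min_eq_right]
      · ring
      · have : 1 / q ≤ 1 / 2 := one_div_le_one_div_of_le (by norm_num) h2.le
        linarith
    -- The exponent conjugate to `q - 1`, chosen because `q'(q - 1) = q`: Hölder then produces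
    -- exactly the `L^q` norm of `a`.
    set r := (q - 1) / (q - 2) with hr
    have hcr : (q - 1).HolderConjugate r := by
      have := Real.HolderConjugate.conjExponent (show 1 < q - 1 by linarith)
      rwa [Real.conjExponent, show q - 1 - 1 = q - 2 by ring] at this
    have hr0 : 0 < r := hcr.symm.pos
    have hpq1 : p * (q - 1) = q := by
      rw [hp]
      field_simp [show q - 1 ≠ 0 by linarith]
    have h3 := ENNReal.lintegral_mul_le_Lp_mul_Lq ((nu T).restrict (Ioo 0 t)) hcr (ha'.pow_const p)
      (measurable_lw T (-1)).aemeasurable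
    simp only [Pi.mul_apply, ← ENNReal.rpow_mul, hpq1] at h3
    have h4 : ∫⁻ τ in Ioo 0 t, lw T (-1) τ ^ r ∂nu T ≤ ENNReal.ofReal (q - 2) * lw T (1 - r) t := by
      calc _ = ∫⁻ τ in Ioo 0 t, lw T (-r) τ ∂nu T := by
            refine setLIntegral_congr_fun measurableSet_Ioo fun τ hτ => ?_
            rw [lw_rpow hτ.1 (hτ.2.le.trans htT) _ hr0.le, neg_one_mul]
        _ ≤ ENNReal.ofReal (1 / (r - 1)) * lw T (1 - r) t := setLIntegral_lw_neg_le ht htT hcr.symm.lt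
        _ = _ := by
            congr 2
            rw [hr]
            field_simp [show q - 2 ≠ 0 by linarith]
            ring
    have hrp : 1 / r * (1 / p) ≤ 1 := by
      have h5 : 1 / r ≤ 1 := by
        rw [div_le_one hr0]
        exact hcr.symm.lt.le
      have h6 : 1 / p ≤ 1 := by
        rw [div_le_one hp0]
        exact hc.symm.lt.le
      have : 0 ≤ 1 / p := by positivity
      nlinarith [show 0 ≤ 1 / r by positivity]
    calc _ ≤ (((M ^ q) ^ (1 / (q - 1))) * (ENNReal.ofReal (q - 2) * lw T (1 - r) t) ^ (1 / r)) ^ (1 / p) := by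
          refine ENNReal.rpow_le_rpow (h3.trans ?_) (by positivity)
          gcongr
      _ = ENNReal.ofReal (q - 2) ^ (1 / r * (1 / p)) * (M * lw T (-(1 - sigmaCrit q)) t) := by
          rw [ENNReal.mul_rpow_of_nonneg _ _ (by positivity), ENNReal.mul_rpow_of_nonneg _ _ (by positivity),
            ENNReal.mul_rpow_of_nonneg _ _ (by positivity), ← ENNReal.rpow_mul, ← ENNReal.rpow_mul,
            ← ENNReal.rpow_mul, lw_rpow ht htT _ (by positivity), lw_rpow ht htT _ (by positivity), hs]
          have e1 : q * (1 / (q - 1) * (1 / p)) = 1 := by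
            rw [hp]
            field_simp [show q - 1 ≠ 0 by linarith]
          have e2 : (1 - r) * (1 / r) * (1 / p) = -(1 / q) := by
            rw [hp, hr]
            field_simp [show q - 1 ≠ 0 by linarith, show q - 2 ≠ 0 by linarith]
            ring
          rw [e1, e2, ENNReal.rpow_one]
          ring
      _ ≤ _ := by
          gcongr
          calc _ ≤ ENNReal.ofReal (max 1 q) ^ (1 / r * (1 / p)) := by
                refine ENNReal.rpow_le_rpow (ENNReal.ofReal_le_ofReal ?_) (by positivity)
                exact le_trans (by linarith) (le_max_right _ _)
            _ ≤ ENNReal.ofReal (max 1 q) ^ (1 : ℝ) := ENNReal.rpow_le_rpow_of_exponent_le hC hrp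
            _ = _ := ENNReal.rpow_one _

/-- The bound of `∫ A B` by the norm of `A` and an `L^q` norm of `B` with a logarithmic weight. -/
theorem lintegral_mul_le_norm_lq (hq : 1 ≤ q) (hσ : sigmaCrit q ≤ σ) (ht : 0 < t) (htT : t ≤ T)
    (hA : AEMeasurable A (volume.restrict (Ioo 0 T))) (hB : AEMeasurable B (volume.restrict (Ioo 0 T))) :
    ∫⁻ τ in Ioo 0 t, A τ * B τ ≤ ENNReal.ofReal (max 1 q) * (normW σ q T A * lw T (-(1 - sigmaCrit q)) t) *
      (∫⁻ τ in Ioo 0 t, lw T (-2 * σ * q + q - 1) τ * (wt σ T τ * B τ) ^ q ∂nu T) ^ (1 / q) := by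
  have ha := (aemeasurable_weighted (σ := σ) hA)
  have hb := (aemeasurable_weighted (σ := σ) hB)
  have ha' := ha.mono_measure (Measure.restrict_le_self (s := Ioo 0 t))
  have hb' := hb.mono_measure (Measure.restrict_le_self (s := Ioo 0 t))
  have hM : ∀ τ ∈ Ioo 0 t, wt σ T τ * A τ ≤ normW σ q T A := fun τ hτ =>
    (wt_mul_le_supW ⟨hτ.1, hτ.2.trans_le htT⟩).trans le_self_add
  rw [lintegral_mul_eq (σ := σ) htT]
  rcases hq.eq_or_lt with rfl | hq
  -- For `q = 1` the conjugate exponent is infinite, so the supremum of the first factor is used and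
  -- there is no logarithmic gain.
  · have h1 : sigmaCrit 1 = 1 := by simp [sigmaCrit]
    simp only [h1, sub_self, neg_zero, lw_zero, mul_one, div_one, ENNReal.rpow_one, max_self,
      ENNReal.ofReal_one, one_mul, add_sub_cancel_right]
    rw [← lintegral_const_mul'' _
      (show AEMeasurable (fun τ => lw T (-2 * σ) τ * (wt σ T τ * B τ)) _ from
        (measurable_lw T _).aemeasurable.mul hb')]
    refine setLIntegral_mono' measurableSet_Ioo fun τ hτ => ?_
    calc _ = (wt σ T τ * A τ) * (lw T (-2 * σ) τ * (wt σ T τ * B τ)) := by ring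
      _ ≤ _ := by gcongr; exact hM τ hτ
  · set p := q / (q - 1) with hp
    have hc : q.HolderConjugate p := Real.HolderConjugate.conjExponent hq
    have hp0 : 0 < p := hc.symm.pos
    have hq0 : 0 < q := by linarith
    have hp1 : 1 / p = 1 - 1 / q := by
      have := hc.inv_add_inv_eq_one
      rw [one_div, one_div]
      linarith
    -- The weight `ℓ^{-2σ}` is divided between the factors so that the first receives precisely
    -- `ℓ^{-1/p}`, as required by `lintegral_conj_le`.
    have h1 : ∫⁻ τ in Ioo 0 t, (wt σ T τ * A τ) * (wt σ T τ * B τ) * lw T (-2 * σ) τ ∂nu T =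
        ∫⁻ τ in Ioo 0 t, ((wt σ T τ * A τ) * lw T (-(1 / p)) τ) *
          (lw T (-2 * σ + 1 / p) τ * (wt σ T τ * B τ)) ∂nu T := by
      refine setLIntegral_congr_fun measurableSet_Ioo fun τ hτ => ?_
      have : lw T (-2 * σ) τ = lw T (-(1 / p)) τ * lw T (-2 * σ + 1 / p) τ := by
        rw [lw_mul hτ.1 (hτ.2.le.trans htT)]
        congr 1
        ring
      rw [this]
      ring
    rw [h1]
    refine (ENNReal.lintegral_mul_le_Lp_mul_Lq _ hc.symm (ha'.mul (measurable_lw T _).aemeasurable)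
      ((measurable_lw T _).aemeasurable.mul hb')).trans ?_
    gcongr ?_ * ?_
    · have h2 := lintegral_conj_le hq ht htT ha (M := normW σ q T A) hM
        ((lqOn_le_lqW hq.le).trans le_add_self)
      rw [← hp, ← hp1] at h2
      refine le_trans (le_of_eq ?_) h2
      congr 1
      refine setLIntegral_congr_fun measurableSet_Ioo fun τ hτ => ?_
      simp only [Pi.mul_apply]
      rw [ENNReal.mul_rpow_of_nonneg _ _ hp0.le, lw_rpow hτ.1 (hτ.2.le.trans htT) _ hp0.le]
      congr 2
      field_simp
    · refine le_of_eq ?_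
      congr 1
      refine setLIntegral_congr_fun measurableSet_Ioo fun τ hτ => ?_
      simp only [Pi.mul_apply]
      rw [ENNReal.mul_rpow_of_nonneg _ _ hq0.le, lw_rpow hτ.1 (hτ.2.le.trans htT) _ hq0.le, hp1]
      congr 2
      field_simp
      ring

/-- The remaining weight has a non-positive exponent, hence is largest at `τ = t` and comes out of
the integral. The total power is `σ_q - 2σ - 1/q ≤ -σ - 1/q`; the surplus `1/q` is what pays for the
number of low blocks in the Besov norm. -/
theorem lintegral_mul_le_norm_lqOn (hq : 1 ≤ q) (hσ : sigmaCrit q ≤ σ) (ht : 0 < t) (htT : t ≤ T)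
    (hA : AEMeasurable A (volume.restrict (Ioo 0 T))) (hB : AEMeasurable B (volume.restrict (Ioo 0 T))) :
    ∫⁻ τ in Ioo 0 t, A τ * B τ ≤ lw T (-σ - 1 / q) t *
      (ENNReal.ofReal (max 1 q) * normW σ q T A * lqOn σ q T t B) := by
  have hq0 : 0 < q := by linarith
  have hb' := (aemeasurable_weighted (σ := σ) hB).mono_measure (Measure.restrict_le_self (s := Ioo 0 t))
  refine (lintegral_mul_le_norm_lq hq hσ ht htT hA hB).trans ?_
  have hσ0 := half_le_sigmaCrit.trans hσ
  have h1 : (∫⁻ τ in Ioo 0 t, lw T (-2 * σ * q + q - 1) τ * (wt σ T τ * B τ) ^ q ∂nu T) ^ (1 / q) ≤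
      lw T (-2 * σ + 1 - 1 / q) t * lqOn σ q T t B := by
    calc _ ≤ (lw T (-2 * σ * q + q - 1) t * ∫⁻ τ in Ioo 0 t, (wt σ T τ * B τ) ^ q ∂nu T) ^ (1 / q) := by
          refine ENNReal.rpow_le_rpow ?_ (by positivity)
          rw [← lintegral_const_mul'' _ (hb'.pow_const q)]
          refine setLIntegral_mono' measurableSet_Ioo fun τ hτ => ?_
          gcongr
          exact lw_mono hτ.1 hτ.2.le htT (by nlinarith)
      _ = _ := by
          rw [ENNReal.mul_rpow_of_nonneg _ _ (by positivity), lw_rpow ht htT _ (by positivity), lqOn]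
          congr 2
          field_simp
  calc _ ≤ ENNReal.ofReal (max 1 q) * (normW σ q T A * lw T (-(1 - sigmaCrit q)) t) *
        (lw T (-2 * σ + 1 - 1 / q) t * lqOn σ q T t B) := by gcongr
    _ = (lw T (-(1 - sigmaCrit q)) t * lw T (-2 * σ + 1 - 1 / q) t) *
        (ENNReal.ofReal (max 1 q) * normW σ q T A * lqOn σ q T t B) := by ring
    _ ≤ _ := by
        gcongr
        rw [lw_mul ht htT]
        exact lw_mono_exp ht htT (by linarith)

/-- The `L^q` bound for the integral `∫_0^t A B`. -/
theorem lintegral_rpow_lintegral_mul_le (hq : 1 ≤ q) (hσ : sigmaCrit q ≤ σ)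
    (hA : AEMeasurable A (volume.restrict (Ioo 0 T))) (hB : AEMeasurable B (volume.restrict (Ioo 0 T))) :
    (∫⁻ t, (lw T σ t * ∫⁻ τ in Ioo 0 t, A τ * B τ) ^ q ∂nu T) ^ (1 / q) ≤
      ENNReal.ofReal (max 1 q) * normW σ q T A * lqW σ q T B := by
  have hq0 : 0 < q := by linarith
  have hσ0 := half_le_sigmaCrit.trans hσ
  have hs0 := half_le_sigmaCrit (q := q)
  have hb := (aemeasurable_weighted (σ := σ) hB)
  set K := ENNReal.ofReal (max 1 q) * normW σ q T A
  -- After exchanging the integrals, the integral of `ℓ(t)^e` over `t > τ` is at most `ℓ(τ)^{e+1}`,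
  -- and `e + 1 + d = (σ_q - σ)q ≤ 0`. The hypothesis on `σ` is exactly what makes this exponent
  -- non-positive.
  set e := (σ - 1 + sigmaCrit q) * q with he
  set d := -2 * σ * q + q - 1 with hd
  have he0 : 0 ≤ e := mul_nonneg (by linarith) hq0.le
  set F : ℝ → ℝ → ℝ≥0∞ := fun t τ =>
    (Ioo 0 t).indicator (fun τ => lw T e t * (lw T d τ * (wt σ T τ * B τ) ^ q)) τ with hF
  have hmeas : AEMeasurable (Function.uncurry F) ((nu T).prod (nu T)) := by
    have h1 : AEMeasurable (fun p : ℝ × ℝ => lw T e p.1 * (lw T d p.2 * (wt σ T p.2 * B p.2) ^ q))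
        ((nu T).prod (nu T)) :=
      (measurable_lw T e).aemeasurable.comp_fst.mul
        (((measurable_lw T d).aemeasurable.mul (hb.pow_const q)).comp_snd)
    have h2 : MeasurableSet {p : ℝ × ℝ | p.2 ∈ Ioo 0 p.1} :=
      (measurableSet_lt measurable_const measurable_snd).inter (measurableSet_lt measurable_snd measurable_fst)
    refine (h1.indicator h2).congr (Eventually.of_forall fun p => ?_)
    simp only [hF, Function.uncurry, indicator]
    rfl
  have h1 : ∫⁻ t, (lw T σ t * ∫⁻ τ in Ioo 0 t, A τ * B τ) ^ q ∂nu T ≤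
      K ^ q * ∫⁻ t, ∫⁻ τ, F t τ ∂nu T ∂nu T := by
    rw [← lintegral_const_mul'' _
      (show AEMeasurable (fun t => ∫⁻ τ, F t τ ∂nu T) _ from hmeas.lintegral_prod_right')]
    refine lintegral_mono_ae ?_
    filter_upwards [ae_nu_mem T] with t ht
    have h2 := lintegral_mul_le_norm_lq hq hσ ht.1 ht.2.le hA hB
    calc (lw T σ t * ∫⁻ τ in Ioo 0 t, A τ * B τ) ^ q
        ≤ (lw T σ t * (ENNReal.ofReal (max 1 q) * (normW σ q T A * lw T (-(1 - sigmaCrit q)) t) *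
          (∫⁻ τ in Ioo 0 t, lw T d τ * (wt σ T τ * B τ) ^ q ∂nu T) ^ (1 / q))) ^ q := by gcongr
      _ = (lw T σ t * lw T (-(1 - sigmaCrit q)) t * (K *
          (∫⁻ τ in Ioo 0 t, lw T d τ * (wt σ T τ * B τ) ^ q ∂nu T) ^ (1 / q))) ^ q := by
          congr 1
          ring
      _ = K ^ q * (lw T e t * (∫⁻ τ in Ioo 0 t, lw T d τ * (wt σ T τ * B τ) ^ q ∂nu T)) := by
          rw [lw_mul ht.1 ht.2.le, ENNReal.mul_rpow_of_nonneg _ _ hq0.le, ENNReal.mul_rpow_of_nonneg _ _ hq0.le,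
            ← ENNReal.rpow_mul, one_div_mul_cancel hq0.ne', ENNReal.rpow_one, lw_rpow ht.1 ht.2.le _ hq0.le,
            show (σ + -(1 - sigmaCrit q)) * q = e by rw [he]; ring]
          ring
      _ = _ := by
          simp only [hF]
          rw [lintegral_indicator measurableSet_Ioo, lintegral_const_mul' _ _ lw_ne_top]
  have h2 : ∫⁻ t, ∫⁻ τ, F t τ ∂nu T ∂nu T ≤ ∫⁻ τ, (wt σ T τ * B τ) ^ q ∂nu T := by
    rw [lintegral_lintegral_swap hmeas]
    refine lintegral_mono_ae ?_
    filter_upwards [ae_nu_mem T] with τ hτ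
    calc ∫⁻ t, F t τ ∂nu T = ∫⁻ t in Ioi τ, lw T e t * (lw T d τ * (wt σ T τ * B τ) ^ q) ∂nu T := by
          rw [← lintegral_indicator measurableSet_Ioi]
          refine lintegral_congr fun t => ?_
          simp only [hF, indicator, mem_Ioo, mem_Ioi, hτ.1, true_and]
      _ = (∫⁻ t in Ioi τ, lw T e t ∂nu T) * (lw T d τ * (wt σ T τ * B τ) ^ q) :=
          lintegral_mul_const _ (measurable_lw T e)
      _ = (∫⁻ t in Ioo τ T, lw T e t ∂nu T) * (lw T d τ * (wt σ T τ * B τ) ^ q) := by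
          congr 2
          rw [← nu_restrict_Ioo (T := T), Measure.restrict_restrict measurableSet_Ioi,
            Measure.restrict_restrict measurableSet_Ioo]
          congr 1
          ext t
          simp only [mem_inter_iff, mem_Ioi, mem_Ioo]
          constructor
          · rintro ⟨h1, h2, h3⟩
            exact ⟨⟨h1, h3⟩, h2, h3⟩
          · rintro ⟨⟨h1, h3⟩, h2, -⟩
            exact ⟨h1, h2, h3⟩
      _ ≤ lw T (e + 1) τ * (lw T d τ * (wt σ T τ * B τ) ^ q) := by
          gcongr
          exact setLIntegral_lw_le hτ.1 hτ.2 he0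
      _ = (lw T (e + 1) τ * lw T d τ) * (wt σ T τ * B τ) ^ q := by ring
      _ ≤ 1 * _ := by
          gcongr
          rw [lw_mul hτ.1 hτ.2.le]
          refine lw_le_one hτ.1 hτ.2.le ?_
          rw [he, hd]
          nlinarith
      _ = _ := one_mul _
  calc _ ≤ (K ^ q * ∫⁻ τ, (wt σ T τ * B τ) ^ q ∂nu T) ^ (1 / q) := by
        refine ENNReal.rpow_le_rpow (h1.trans ?_) (by positivity)
        gcongr
    _ = _ := by
        rw [ENNReal.mul_rpow_of_nonneg _ _ (by positivity), ← ENNReal.rpow_mul, mul_one_div_cancel hq0.ne',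
          ENNReal.rpow_one, lqW_eq]

end

end NavierStokesBesov

namespace NavierStokesBesov

/-! ### Bounds for the weakly singular integral -/

theorem lintegral_inv_sqrt_sub {a t : ℝ} (h : a ≤ t) :
    ∫⁻ τ in Ioo a t, ENNReal.ofReal (√(t - τ))⁻¹ = ENNReal.ofReal (2 * √(t - a)) := by
  have h1 := (volume.measurePreserving_sub_left t).setLIntegral_comp_preimage (s := Ioo 0 (t - a))
    measurableSet_Ioo (f := fun s : ℝ => ENNReal.ofReal (√s)⁻¹) (by fun_prop)
  have h2 : (fun τ : ℝ => t - τ) ⁻¹' Ioo 0 (t - a) = Ioo a t := by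
    ext τ
    simp only [mem_preimage, mem_Ioo]
    constructor <;> rintro ⟨h1, h2⟩ <;> constructor <;> linarith
  rw [h2] at h1
  rw [h1]
  have ha : 0 ≤ t - a := sub_nonneg.2 h
  have h3 : ∀ s ∈ Ioo 0 (t - a), ENNReal.ofReal (√s)⁻¹ = ENNReal.ofReal (s ^ (-(1 / 2) : ℝ)) := by
    intro s hs
    rw [Real.sqrt_eq_rpow, Real.rpow_neg hs.1.le]
  rw [setLIntegral_congr_fun measurableSet_Ioo h3, ← ofReal_integral_eq_lintegral_ofReal]
  · congr 1
    rw [← integral_Ioc_eq_integral_Ioo, ← intervalIntegral.integral_of_le ha,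
      integral_rpow (Or.inl (by norm_num)), Real.sqrt_eq_rpow]
    norm_num
    ring
  · have := intervalIntegral.intervalIntegrable_rpow' (a := 0) (b := t - a) (r := -(1 / 2)) (by norm_num)
    rw [intervalIntegrable_iff_integrableOn_Ioo_of_le ha] at this
    exact this
  · exact (ae_restrict_iff' measurableSet_Ioo).2 (Eventually.of_forall fun s hs => Real.rpow_nonneg hs.1.le _)

/-- The weakly singular integral `∫_0^t (t - τ)^{-1/2} A B dτ`. -/
def gInt (A B : ℝ → ℝ≥0∞) (t : ℝ) : ℝ≥0∞ :=
  ∫⁻ τ in Ioo 0 t, ENNReal.ofReal (√(t - τ))⁻¹ * (A τ * B τ)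

/-- The kernel of the part of the weakly singular integral near the singularity. -/
def nearKer (t τ : ℝ) : ℝ≥0∞ :=
  {p : ℝ × ℝ | 0 < p.2 ∧ p.1 / 2 < p.2 ∧ p.2 < p.1}.indicator
    (fun p => ENNReal.ofReal (√p.2 * (√(p.1 - p.2))⁻¹)) (t, τ)

theorem measurable_nearKer : Measurable (Function.uncurry nearKer) := by
  have hs : MeasurableSet {p : ℝ × ℝ | 0 < p.2 ∧ p.1 / 2 < p.2 ∧ p.2 < p.1} :=
    (measurableSet_lt measurable_const measurable_snd).inter
      ((measurableSet_lt (measurable_fst.div_const 2) measurable_snd).inter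
        (measurableSet_lt measurable_snd measurable_fst))
  have : Measurable fun p : ℝ × ℝ => ENNReal.ofReal (√p.2 * (√(p.1 - p.2))⁻¹) := by fun_prop
  exact this.indicator hs

theorem nearKer_of_mem {t τ : ℝ} (h0 : 0 < τ) (h1 : t / 2 < τ) (h2 : τ < t) :
    nearKer t τ = ENNReal.ofReal (√τ * (√(t - τ))⁻¹) :=
  indicator_of_mem (s := {p : ℝ × ℝ | 0 < p.2 ∧ p.1 / 2 < p.2 ∧ p.2 < p.1}) ⟨h0, h1, h2⟩ _

theorem nearKer_of_notMem {t τ : ℝ} (h : ¬(0 < τ ∧ t / 2 < τ ∧ τ < t)) : nearKer t τ = 0 :=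
  indicator_of_notMem (s := {p : ℝ × ℝ | 0 < p.2 ∧ p.1 / 2 < p.2 ∧ p.2 < p.1}) h _

/-- For `τ > t/2` the factor `√τ/τ` is at most `(t/2)^{-1/2}`, and the singularity integrates to
`2(t/2)^{1/2}`. The bound is scale invariant, as Schur's test for `dt/t` requires. -/
theorem lintegral_nearKer_le (T : ℝ) {t : ℝ} (ht : 0 < t) : ∫⁻ τ, nearKer t τ ∂nu T ≤ 2 := by
  calc ∫⁻ τ, nearKer t τ ∂nu T = ∫⁻ τ in Ioo 0 T, nearKer t τ * ENNReal.ofReal (1 / τ) := lintegral_nu T _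
    _ ≤ ∫⁻ τ, nearKer t τ * ENNReal.ofReal (1 / τ) := setLIntegral_le_lintegral _ _
    _ ≤ ∫⁻ τ, (Ioo (t / 2) t).indicator (fun τ => ENNReal.ofReal (√(t / 2))⁻¹ * ENNReal.ofReal (√(t - τ))⁻¹) τ := by
        refine lintegral_mono fun τ => ?_
        by_cases h : 0 < τ ∧ t / 2 < τ ∧ τ < t
        · rw [indicator_of_mem (show τ ∈ Ioo (t / 2) t from h.2), nearKer_of_mem h.1 h.2.1 h.2.2,
            ← ENNReal.ofReal_mul (by positivity), ← ENNReal.ofReal_mul (by positivity)]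
          refine ENNReal.ofReal_le_ofReal ?_
          have h0 := h.1
          have h3 : √τ * (1 / τ) = (√τ)⁻¹ := by
            have := Real.mul_self_sqrt h.1.le
            field_simp
            nlinarith
          calc √τ * (√(t - τ))⁻¹ * (1 / τ) = (√τ)⁻¹ * (√(t - τ))⁻¹ := by rw [← h3]; ring
            _ ≤ (√(t / 2))⁻¹ * (√(t - τ))⁻¹ := by
                gcongr
                exact h.2.1.le
        · rw [nearKer_of_notMem h, zero_mul]
          exact zero_le
    _ = 2 := by
        rw [lintegral_indicator measurableSet_Ioo, lintegral_const_mul' _ _ ENNReal.ofReal_ne_top,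
          lintegral_inv_sqrt_sub (by linarith), ← ENNReal.ofReal_mul (by positivity),
          show t - t / 2 = t / 2 by ring]
        have : √(t / 2) ≠ 0 := (Real.sqrt_pos.2 (by linarith)).ne'
        rw [show (√(t / 2))⁻¹ * (2 * √(t / 2)) = 2 by field_simp]
        simp

theorem lintegral_nearKer_le' (T : ℝ) {τ : ℝ} (hτ : 0 < τ) : ∫⁻ t, nearKer t τ ∂nu T ≤ 2 := by
  calc ∫⁻ t, nearKer t τ ∂nu T = ∫⁻ t in Ioo 0 T, nearKer t τ * ENNReal.ofReal (1 / t) := lintegral_nu T _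
    _ ≤ ∫⁻ t, nearKer t τ * ENNReal.ofReal (1 / t) := setLIntegral_le_lintegral _ _
    _ ≤ ∫⁻ t, (Ioo τ (2 * τ)).indicator (fun t => ENNReal.ofReal (√τ)⁻¹ * ENNReal.ofReal (√(t - τ))⁻¹) t := by
        refine lintegral_mono fun t => ?_
        by_cases h : 0 < τ ∧ t / 2 < τ ∧ τ < t
        · rw [indicator_of_mem (show t ∈ Ioo τ (2 * τ) from ⟨h.2.2, by linarith⟩),
            nearKer_of_mem h.1 h.2.1 h.2.2,
            ← ENNReal.ofReal_mul (by positivity), ← ENNReal.ofReal_mul (by positivity)]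
          refine ENNReal.ofReal_le_ofReal ?_
          have h0 := h.1
          have h3 : √τ * (1 / τ) = (√τ)⁻¹ := by
            have := Real.mul_self_sqrt h.1.le
            field_simp
            nlinarith
          calc √τ * (√(t - τ))⁻¹ * (1 / t) ≤ √τ * (√(t - τ))⁻¹ * (1 / τ) := by
                gcongr
                exact h.2.2.le
            _ = (√τ)⁻¹ * (√(t - τ))⁻¹ := by rw [← h3]; ring
        · rw [nearKer_of_notMem h, zero_mul]
          exact zero_le
    _ = 2 := by
        rw [lintegral_indicator measurableSet_Ioo, lintegral_const_mul' _ _ ENNReal.ofReal_ne_top]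
        have h1 : ∫⁻ t in Ioo τ (2 * τ), ENNReal.ofReal (√(t - τ))⁻¹ = ENNReal.ofReal (2 * √τ) := by
          -- The reflection `t ↦ 3τ - t` of `(τ, 2τ)` moves the singularity to the right endpoint.
          have h2 := (volume.measurePreserving_sub_left (3 * τ)).setLIntegral_comp_preimage
            (s := Ioo τ (2 * τ)) measurableSet_Ioo (f := fun s : ℝ => ENNReal.ofReal (√(s - τ))⁻¹) (by fun_prop)
          have h3 : (fun t : ℝ => 3 * τ - t) ⁻¹' Ioo τ (2 * τ) = Ioo τ (2 * τ) := by
            ext t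
            simp only [mem_preimage, mem_Ioo]
            constructor <;> rintro ⟨h1, h2⟩ <;> constructor <;> linarith
          rw [h3] at h2
          rw [← h2]
          have h4 := lintegral_inv_sqrt_sub (a := τ) (t := 2 * τ) (by linarith)
          rw [show 2 * τ - τ = τ by ring] at h4
          rw [← h4]
          refine lintegral_congr fun t => ?_
          rw [show 3 * τ - t - τ = 2 * τ - t by ring]
        rw [h1, ← ENNReal.ofReal_mul (by positivity)]
        have : √τ ≠ 0 := (Real.sqrt_pos.2 hτ).ne'
        rw [show (√τ)⁻¹ * (2 * √τ) = 2 by field_simp]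
        simp

/-! ### Splitting at half time and the bilinear estimate -/

section

variable {σ q T t : ℝ} {A B : ℝ → ℝ≥0∞}

/-- For `τ ≤ t/2` the factor `√t` cancels the singular kernel up to the constant two and a plain
integral of the product remains. For `τ > t/2` the weights at `t` and `τ` are comparable, which
leaves the scale invariant kernel `nearKer`. -/
theorem wt_mul_gInt_le (hσ : 0 ≤ σ) (ht : t ∈ Ioc 0 T) :
    wt σ T t * gInt A B t ≤ 2 * (lw T σ t * ∫⁻ τ in Ioo 0 t, A τ * B τ) +
      2 * ∫⁻ τ, nearKer t τ * (lw T (-σ) τ * ((wt σ T τ * A τ) * (wt σ T τ * B τ))) ∂nu T := by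
  have ht0 := ht.1
  have hunion : Ioo 0 t ⊆ Ioc 0 (t / 2) ∪ Ioo (t / 2) t := fun τ hτ => by
    rcases le_or_gt τ (t / 2) with h | h
    · exact Or.inl ⟨hτ.1, h⟩
    · exact Or.inr ⟨h, hτ.2⟩
  have h1 : gInt A B t ≤ (∫⁻ τ in Ioc 0 (t / 2), ENNReal.ofReal (√(t - τ))⁻¹ * (A τ * B τ)) +
      ∫⁻ τ in Ioo (t / 2) t, ENNReal.ofReal (√(t - τ))⁻¹ * (A τ * B τ) :=
    (lintegral_mono_set hunion).trans (lintegral_union_le _ _ _)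
  refine (mul_le_mul_right h1 _).trans ?_
  rw [mul_add]
  refine add_le_add ?_ ?_
  · rw [← lintegral_const_mul' _ _ wt_ne_top, ← mul_assoc, ← lintegral_const_mul' _ _
      (ENNReal.mul_ne_top (by simp) lw_ne_top)]
    refine (setLIntegral_mono' measurableSet_Ioc fun τ hτ => ?_).trans
      (lintegral_mono_set (fun τ hτ => ⟨hτ.1, by have := hτ.2; linarith⟩))
    rw [← mul_assoc]
    refine mul_le_mul_left ?_ _
    rw [wt_eq ht.1 ht.2, mul_right_comm]
    refine mul_le_mul_left ?_ _
    rw [← ENNReal.ofReal_mul (Real.sqrt_nonneg t), show (2 : ℝ≥0∞) = ENNReal.ofReal 2 by simp]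
    refine ENNReal.ofReal_le_ofReal ?_
    have h2 : 0 < t - τ := by have := hτ.2; linarith
    rw [← div_eq_mul_inv, div_le_iff₀ (Real.sqrt_pos.2 h2)]
    calc √t ≤ √(2 ^ 2 * (t - τ)) := Real.sqrt_le_sqrt (by have := hτ.2; linarith)
      _ = 2 * √(t - τ) := by rw [Real.sqrt_mul (by positivity), Real.sqrt_sq (by norm_num)]
  · rw [← lintegral_const_mul' _ _ wt_ne_top, ← lintegral_const_mul' _ _ (by simp)]
    rw [lintegral_nu]
    refine le_trans ?_ (lintegral_mono_set (Ioo_subset_Ioo (show (0 : ℝ) ≤ t / 2 by linarith) ht.2))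
    refine setLIntegral_mono' measurableSet_Ioo fun τ hτ => ?_
    have hτ0 : 0 < τ := lt_trans (by linarith) hτ.1
    have hτT : τ ≤ T := hτ.2.le.trans ht.2
    have h2 : wt σ T t ≤ 2 * wt σ T τ := by
      rw [wt_eq ht.1 ht.2, wt_eq hτ0 hτT, ← mul_assoc]
      refine mul_le_mul' ?_ (lw_anti hτ0 hτ.2.le ht.2 hσ)
      rw [show (2 : ℝ≥0∞) = ENNReal.ofReal 2 by simp, ← ENNReal.ofReal_mul (by norm_num)]
      refine ENNReal.ofReal_le_ofReal ?_
      calc √t ≤ √(2 ^ 2 * τ) := Real.sqrt_le_sqrt (by have := hτ.1; linarith)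
        _ = 2 * √τ := by rw [Real.sqrt_mul (by positivity), Real.sqrt_sq (by norm_num)]
    have h3 : wt σ T τ * (ENNReal.ofReal (√(t - τ))⁻¹ * (A τ * B τ)) =
        nearKer t τ * (lw T (-σ) τ * ((wt σ T τ * A τ) * (wt σ T τ * B τ))) * ENNReal.ofReal (1 / τ) := by
      rw [nearKer_of_mem hτ0 hτ.1 hτ.2, ← mul_eq_weighted (σ := σ) hτ0 hτT (A τ) (B τ)]
      have h4 : lw T σ τ * lw T (-2 * σ) τ = lw T (-σ) τ := by
        rw [lw_mul hτ0 hτT]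
        congr 1
        ring
      rw [ENNReal.ofReal_mul (Real.sqrt_nonneg τ), ← h4]
      nth_rewrite 1 [wt_eq hτ0 hτT]
      ring
    calc _ ≤ 2 * wt σ T τ * (ENNReal.ofReal (√(t - τ))⁻¹ * (A τ * B τ)) := by gcongr
      _ = 2 * (wt σ T τ * (ENNReal.ofReal (√(t - τ))⁻¹ * (A τ * B τ))) := by ring
      _ ≤ _ := by rw [h3, mul_assoc 2]

/-- Here the factor multiplying `M` is kept explicit: it tends to zero with `t` for every `A` of
finite norm. Uniqueness without smallness rests on this form. -/
theorem wt_mul_gInt_le_sup (hq : 1 ≤ q) (hσ : sigmaCrit q ≤ σ) (ht : t ∈ Ioc 0 T)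
    (hA : AEMeasurable A (volume.restrict (Ioo 0 T))) {M : ℝ≥0∞}
    (hM : ∀ τ ∈ Ioo 0 t, wt σ T τ * B τ ≤ M) :
    wt σ T t * gInt A B t ≤ (2 * lqOn σ q T t A + 4 * (lw T (-σ) t * supW σ T A)) * M := by
  have hσ0 := half_le_sigmaCrit.trans hσ
  refine (wt_mul_gInt_le (by linarith) ht).trans ?_
  rw [add_mul]
  refine add_le_add ?_ ?_
  · rw [mul_assoc]
    refine mul_le_mul_right ?_ _
    calc _ ≤ lw T σ t * (lw T (-σ) t * (lqOn σ q T t A * M)) := by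
          gcongr
          exact lintegral_mul_le_lq_sup hq hσ ht.1 ht.2 hA hM
      _ = _ := by rw [← mul_assoc, lw_mul ht.1 ht.2, add_neg_cancel, lw_zero, one_mul]
  · calc _ ≤ 2 * ∫⁻ τ, nearKer t τ * (lw T (-σ) t * (supW σ T A * M)) ∂nu T := by
          refine mul_le_mul_right (lintegral_mono_ae ?_) _
          filter_upwards [ae_nu_mem T] with τ hτ
          by_cases h : 0 < τ ∧ t / 2 < τ ∧ τ < t
          · have h1 := hM τ ⟨h.1, h.2.2⟩
            have h2 := wt_mul_le_supW (σ := σ) (A := A) hτ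
            have h3 := lw_mono h.1 h.2.2.le ht.2 (show -σ ≤ 0 by linarith)
            gcongr
          · rw [nearKer_of_notMem h, zero_mul, zero_mul]
      _ = 2 * ((∫⁻ τ, nearKer t τ ∂nu T) * (lw T (-σ) t * (supW σ T A * M))) := by
          rw [lintegral_mul_const _ (show Measurable fun τ => nearKer t τ from measurable_nearKer.comp measurable_prodMk_left)]
      _ ≤ 2 * (2 * (lw T (-σ) t * (supW σ T A * M))) := by
          gcongr
          exact lintegral_nearKer_le T ht.1
      _ = _ := by ring

/-- The pointwise bound for the weakly singular integral. -/
theorem wt_mul_gInt_le_normW (hq : 1 ≤ q) (hσ : sigmaCrit q ≤ σ) (ht : t ∈ Ioc 0 T)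
    (hA : AEMeasurable A (volume.restrict (Ioo 0 T))) (hB : AEMeasurable B (volume.restrict (Ioo 0 T))) :
    wt σ T t * gInt A B t ≤ ENNReal.ofReal (2 * max 1 q + 4) * (normW σ q T A * normW σ q T B) := by
  have hq0 : 0 < q := by linarith
  have hσ0 := half_le_sigmaCrit.trans hσ
  set c := ENNReal.ofReal (max 1 q)
  set NA := normW σ q T A
  set NB := normW σ q T B
  have hlB : lqW σ q T B ≤ NB := le_add_self
  have hsB : supW σ T B ≤ NB := le_self_add
  have hsA : supW σ T A ≤ NA := le_self_add
  have hE : ENNReal.ofReal (2 * max 1 q + 4) * (NA * NB) = 2 * (c * NA * NB) + 4 * (NA * NB) := by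
    rw [ENNReal.ofReal_add (by positivity) (by norm_num), ENNReal.ofReal_mul (by norm_num)]
    simp only [ENNReal.ofReal_ofNat, c]
    ring
  rw [hE]
  refine (wt_mul_gInt_le (by linarith) ht).trans (add_le_add ?_ ?_)
  · refine mul_le_mul_right ?_ _
    calc _ ≤ lw T σ t * (lw T (-σ - 1 / q) t * (c * NA * lqOn σ q T t B)) := by
          gcongr
          exact lintegral_mul_le_norm_lqOn hq hσ ht.1 ht.2 hA hB
      _ = lw T (-(1 / q)) t * (c * NA * lqOn σ q T t B) := by
          rw [← mul_assoc, lw_mul ht.1 ht.2]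
          congr 2
          ring
      _ ≤ 1 * (c * NA * NB) := by
          gcongr
          · refine lw_le_one ht.1 ht.2 ?_
            have : 0 ≤ 1 / q := by positivity
            linarith
          · exact (lqOn_le_lqW hq).trans hlB
      _ = _ := one_mul _
  · calc _ ≤ 2 * ∫⁻ τ, nearKer t τ * (NA * NB) ∂nu T := by
          refine mul_le_mul_right (lintegral_mono_ae ?_) _
          filter_upwards [ae_nu_mem T] with τ hτ
          have h1 := (wt_mul_le_supW (σ := σ) (A := A) hτ).trans hsA
          have h2 := (wt_mul_le_supW (σ := σ) (A := B) hτ).trans hsB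
          have h3 := lw_le_one hτ.1 hτ.2.le (show -σ ≤ 0 by linarith)
          calc _ ≤ nearKer t τ * (1 * (NA * NB)) := by gcongr
            _ = _ := by rw [one_mul]
      _ = 2 * ((∫⁻ τ, nearKer t τ ∂nu T) * (NA * NB)) := by
          rw [lintegral_mul_const _ (show Measurable fun τ => nearKer t τ from measurable_nearKer.comp measurable_prodMk_left)]
      _ ≤ 2 * (2 * (NA * NB)) := by
          gcongr
          exact lintegral_nearKer_le T ht.1
      _ = _ := by ring

/-- The weakly singular integral is bounded in the weighted norms. -/
theorem normW_gInt_le (hq : 1 ≤ q) (hσ : sigmaCrit q ≤ σ)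
    (hA : AEMeasurable A (volume.restrict (Ioo 0 T))) (hB : AEMeasurable B (volume.restrict (Ioo 0 T))) :
    normW σ q T (gInt A B) ≤ ENNReal.ofReal (4 * max 1 q + 8) * (normW σ q T A * normW σ q T B) := by
  have hq0 : 0 < q := by linarith
  have hσ0 := half_le_sigmaCrit.trans hσ
  have ha := (aemeasurable_weighted (σ := σ) hA)
  have hb := (aemeasurable_weighted (σ := σ) hB)
  set c := ENNReal.ofReal (max 1 q)
  set NA := normW σ q T A
  set NB := normW σ q T B
  have hlB : lqW σ q T B ≤ NB := le_add_self
  have hsB : supW σ T B ≤ NB := le_self_add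
  have hsA : supW σ T A ≤ NA := le_self_add
  have hsup : supW σ T (gInt A B) ≤ 2 * (c * NA * NB) + 4 * (NA * NB) := by
    rw [supW_le_iff]
    intro t ht
    refine (wt_mul_gInt_le_normW hq hσ ⟨ht.1, ht.2.le⟩ hA hB).trans (le_of_eq ?_)
    rw [ENNReal.ofReal_add (by positivity) (by norm_num), ENNReal.ofReal_mul (by norm_num)]
    simp only [ENNReal.ofReal_ofNat, c, NA, NB]
    ring
  have hlq : lqW σ q T (gInt A B) ≤ 2 * (c * NA * NB) + 4 * (NA * NB) := by
    have hm1 : AEMeasurable (fun t => 2 * (lw T σ t * ∫⁻ τ in Ioo 0 t, A τ * B τ)) (nu T) := by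
      have : Monotone fun t => ∫⁻ τ in Ioo 0 t, A τ * B τ := fun s t hst =>
        lintegral_mono_set (Ioo_subset_Ioo_right hst)
      exact (((measurable_lw T σ).mul this.measurable).const_mul 2).aemeasurable
    have hm2' : AEMeasurable (fun p : ℝ × ℝ => nearKer p.1 p.2 *
        (lw T (-σ) p.2 * ((wt σ T p.2 * A p.2) * (wt σ T p.2 * B p.2)))) ((nu T).prod (nu T)) :=
      measurable_nearKer.aemeasurable.mul
        (((measurable_lw T (-σ)).aemeasurable.mul (ha.mul hb)).comp_snd)
    have hm2 : AEMeasurable (fun t => 2 * ∫⁻ τ, nearKer t τ *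
        (lw T (-σ) τ * ((wt σ T τ * A τ) * (wt σ T τ * B τ))) ∂nu T) (nu T) :=
      hm2'.lintegral_prod_right'.const_mul 2
    have h2q : ∀ f : ℝ → ℝ≥0∞, (∫⁻ t, (2 * f t) ^ q ∂nu T) ^ (1 / q) = 2 * (∫⁻ t, f t ^ q ∂nu T) ^ (1 / q) := by
      intro f
      simp_rw [ENNReal.mul_rpow_of_nonneg _ _ hq0.le]
      rw [lintegral_const_mul' _ _ (by simp), ENNReal.mul_rpow_of_nonneg _ _ (by positivity),
        ← ENNReal.rpow_mul, mul_one_div_cancel hq0.ne', ENNReal.rpow_one]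
    rw [lqW_eq]
    calc _ ≤ (∫⁻ t, ((fun t => 2 * (lw T σ t * ∫⁻ τ in Ioo 0 t, A τ * B τ)) + fun t => 2 * ∫⁻ τ, nearKer t τ *
          (lw T (-σ) τ * ((wt σ T τ * A τ) * (wt σ T τ * B τ))) ∂nu T) t ^ q ∂nu T) ^ (1 / q) := by
          refine ENNReal.rpow_le_rpow (lintegral_mono_ae ?_) (by positivity)
          filter_upwards [ae_nu_mem T] with t ht
          exact ENNReal.rpow_le_rpow (wt_mul_gInt_le (by linarith) ⟨ht.1, ht.2.le⟩) hq0.le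
      _ ≤ _ := ENNReal.lintegral_Lp_add_le hm1 hm2 hq
      _ ≤ 2 * (c * NA * NB) + 4 * (NA * NB) := by
          rw [h2q, h2q]
          refine add_le_add ?_ ?_
          · gcongr
            refine (lintegral_rpow_lintegral_mul_le hq hσ hA hB).trans ?_
            gcongr
          · have h1 : (∫⁻ t, (∫⁻ τ, nearKer t τ * (lw T (-σ) τ * ((wt σ T τ * A τ) * (wt σ T τ * B τ))) ∂nu T) ^ q
                ∂nu T) ^ (1 / q) ≤ (∫⁻ t, (∫⁻ τ, nearKer t τ * (NA * (wt σ T τ * B τ)) ∂nu T) ^ q ∂nu T) ^ (1 / q) := by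
              refine ENNReal.rpow_le_rpow (lintegral_mono fun t => ENNReal.rpow_le_rpow
                (lintegral_mono_ae ?_) hq0.le) (by positivity)
              filter_upwards [ae_nu_mem T] with τ hτ
              have h1 := (wt_mul_le_supW (σ := σ) (A := A) hτ).trans hsA
              have h3 := lw_le_one hτ.1 hτ.2.le (show -σ ≤ 0 by linarith)
              calc _ ≤ nearKer t τ * (1 * (NA * (wt σ T τ * B τ))) := by gcongr
                _ = _ := by rw [one_mul]
            -- The first factor enters the near part only through its supremum, so Schur's test acts
            -- on the second alone.
            have h2 := lintegral_schur_le (μ := nu T) (ν := nu T) measurable_nearKer (hb.const_mul NA) (M := 2)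
              (by filter_upwards [ae_nu_mem T] with t ht using lintegral_nearKer_le T ht.1)
              (by filter_upwards [ae_nu_mem T] with t ht using lintegral_nearKer_le' T ht.1) hq
            have h3 : (∫⁻ τ, (NA * (wt σ T τ * B τ)) ^ q ∂nu T) ^ (1 / q) = NA * lqW σ q T B := by
              simp_rw [fun τ => ENNReal.mul_rpow_of_nonneg NA (wt σ T τ * B τ) hq0.le]
              rw [lintegral_const_mul'' _ (hb.pow_const q), ENNReal.mul_rpow_of_nonneg _ _ (by positivity),
                ← ENNReal.rpow_mul, mul_one_div_cancel hq0.ne', ENNReal.rpow_one, lqW_eq]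
            calc _ ≤ 2 * (2 * (NA * lqW σ q T B)) := by
                  gcongr
                  exact h1.trans (h2.trans (by rw [h3]))
              _ ≤ 2 * (2 * (NA * NB)) := by gcongr
              _ = _ := by ring
  calc normW σ q T (gInt A B) ≤ (2 * (c * NA * NB) + 4 * (NA * NB)) + (2 * (c * NA * NB) + 4 * (NA * NB)) :=
        add_le_add hsup hlq
    _ = (4 * c + 8) * (NA * NB) := by ring
    _ = _ := by
      congr 1
      rw [ENNReal.ofReal_add (by positivity) (by norm_num), ENNReal.ofReal_mul (by norm_num)]
      simp [c]

end

end NavierStokesBesov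

namespace NavierStokesBesov

/-! ### Dyadic sums -/

/-- The kernel `min (x^{1/4}, x^{-1/4})`. -/
def kap (x : ℝ) : ℝ := Real.exp (-(|Real.log x| / 4))

theorem kap_pos (x : ℝ) : 0 < kap x := Real.exp_pos _

theorem measurable_kap : Measurable kap := by
  unfold kap
  fun_prop

theorem kap_le_one (x : ℝ) : kap x ≤ 1 := by
  rw [kap, Real.exp_le_one_iff]
  have := abs_nonneg (Real.log x)
  linarith

theorem kap_le_rpow {x : ℝ} (hx : 0 < x) : kap x ≤ x ^ (1 / 4 : ℝ) := by
  rw [kap, Real.rpow_def_of_pos hx, Real.exp_le_exp]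
  have := neg_abs_le (Real.log x)
  linarith

theorem kap_le_rpow_neg {x : ℝ} (hx : 0 < x) : kap x ≤ x ^ (-(1 / 4) : ℝ) := by
  rw [kap, Real.rpow_def_of_pos hx, Real.exp_le_exp]
  have := le_abs_self (Real.log x)
  linarith

/-- Logarithmic powers are absorbed into a quarter power. The available decay has exponent one half,
so a quarter is left over, which explains the exponent in `kap`. -/
theorem one_add_rpow_le {σ : ℝ} (hσ : 0 < σ) {x : ℝ} (hx : 0 ≤ x) :
    (1 + x) ^ σ ≤ (max 1 (4 * σ)) ^ σ * Real.exp (x / 4) := by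
  have h1 : 1 + x ≤ max 1 (4 * σ) * Real.exp (x / (4 * σ)) := by
    have h2 := Real.add_one_le_exp (x / (4 * σ))
    have h3 : 0 ≤ x / (4 * σ) := by positivity
    calc 1 + x = 1 + (4 * σ) * (x / (4 * σ)) := by field_simp
      _ ≤ max 1 (4 * σ) + max 1 (4 * σ) * (x / (4 * σ)) := by
          gcongr
          · exact le_max_left _ _
          · exact le_max_right _ _
      _ = max 1 (4 * σ) * (x / (4 * σ) + 1) := by ring
      _ ≤ _ := by gcongr
  calc (1 + x) ^ σ ≤ (max 1 (4 * σ) * Real.exp (x / (4 * σ))) ^ σ :=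
        Real.rpow_le_rpow (by linarith) h1 hσ.le
    _ = _ := by
        rw [Real.mul_rpow (by positivity) (Real.exp_pos _).le, ← Real.exp_mul]
        congr 2
        field_simp

/-- The measure `dt/t` is scale invariant, so the bound is uniform in `a`; each side of `t = 1/a`
contributes four. -/
theorem setLIntegral_kap_le {a : ℝ} (ha : 0 < a) (T : ℝ) :
    ∫⁻ t, ENNReal.ofReal (kap (t * a)) ∂nu T ≤ 8 := by
  have hI1 : ∫⁻ t in Ioc 0 a⁻¹, ENNReal.ofReal (a ^ (1 / 4 : ℝ) * t ^ (-(3 / 4) : ℝ)) = 4 := by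
    have hint : IntegrableOn (fun t : ℝ => t ^ (-(3 / 4) : ℝ)) (Ioc 0 a⁻¹) := by
      have := intervalIntegral.intervalIntegrable_rpow' (a := 0) (b := a⁻¹) (r := -(3 / 4)) (by norm_num)
      rwa [intervalIntegrable_iff_integrableOn_Ioc_of_le (by positivity)] at this
    rw [← ofReal_integral_eq_lintegral_ofReal (hint.const_mul _)
      ((ae_restrict_iff' measurableSet_Ioc).2 (Eventually.of_forall fun t ht => by
        have := ht.1
        simp only [Pi.zero_apply]
        positivity)), integral_const_mul, ← intervalIntegral.integral_of_le (by positivity),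
      integral_rpow (Or.inl (by norm_num))]
    rw [show (-(3 / 4) + 1 : ℝ) = 1 / 4 by norm_num, Real.zero_rpow (by norm_num), sub_zero,
      Real.inv_rpow ha.le, ← mul_div_assoc, mul_inv_cancel₀ (by positivity)]
    norm_num
  have hI2 : ∫⁻ t in Ioi a⁻¹, ENNReal.ofReal (a ^ (-(1 / 4) : ℝ) * t ^ (-(5 / 4) : ℝ)) = 4 := by
    have hint := integrableOn_Ioi_rpow_of_lt (a := -(5 / 4)) (by norm_num) (inv_pos.2 ha)
    rw [← ofReal_integral_eq_lintegral_ofReal (hint.const_mul _)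
      ((ae_restrict_iff' measurableSet_Ioi).2 (Eventually.of_forall fun t ht => by
        have : 0 < t := (inv_pos.2 ha).trans ht
        simp only [Pi.zero_apply]
        positivity)), integral_const_mul, integral_Ioi_rpow_of_lt (by norm_num) (inv_pos.2 ha)]
    rw [show (-(5 / 4) + 1 : ℝ) = -(1 / 4) by norm_num, Real.inv_rpow ha.le, Real.rpow_neg ha.le, inv_inv]
    have : a ^ (1 / 4 : ℝ) ≠ 0 := by positivity
    rw [show (a ^ (1 / 4 : ℝ))⁻¹ * (-a ^ (1 / 4 : ℝ) / -(1 / 4)) = 4 by field_simp]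
    norm_num
  rw [lintegral_nu]
  have hsub : Ioo 0 T ⊆ Ioc 0 a⁻¹ ∪ Ioi a⁻¹ := fun t ht => by
    rcases le_or_gt t a⁻¹ with h | h
    · exact Or.inl ⟨ht.1, h⟩
    · exact Or.inr h
  have key : ∀ t : ℝ, 0 < t → ∀ e : ℝ, kap (t * a) ≤ (t * a) ^ e →
      ENNReal.ofReal (kap (t * a)) * ENNReal.ofReal (1 / t) ≤ ENNReal.ofReal (a ^ e * t ^ (e - 1)) := by
    intro t ht e h
    rw [← ENNReal.ofReal_mul (kap_pos _).le]
    refine ENNReal.ofReal_le_ofReal ?_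
    calc kap (t * a) * (1 / t) ≤ (t * a) ^ e * (1 / t) := by gcongr
      _ = _ := by
        rw [Real.mul_rpow ht.le ha.le, Real.rpow_sub_one ht.ne']
        ring
  calc _ ≤ ∫⁻ t in Ioc 0 a⁻¹ ∪ Ioi a⁻¹, ENNReal.ofReal (kap (t * a)) * ENNReal.ofReal (1 / t) :=
        lintegral_mono_set hsub
    _ ≤ _ := lintegral_union_le _ _ _
    _ ≤ 4 + 4 := by
        refine add_le_add ?_ ?_
        · rw [← hI1]
          refine setLIntegral_mono' measurableSet_Ioc fun t ht => ?_
          have h := key t ht.1 (1 / 4) (kap_le_rpow (mul_pos ht.1 ha))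
          rwa [show (1 / 4 - 1 : ℝ) = -(3 / 4) by norm_num] at h
        · rw [← hI2]
          refine setLIntegral_mono' measurableSet_Ioi fun t ht => ?_
          have ht0 : 0 < t := (inv_pos.2 ha).trans ht
          have h := key t ht0 (-(1 / 4)) (kap_le_rpow_neg (mul_pos ht0 ha))
          rwa [show (-(1 / 4) - 1 : ℝ) = -(5 / 4) by norm_num] at h
    _ = 8 := by norm_num

/-- The sequence `x r^j` crosses one at most once, and on either side of the crossing the terms are
dominated by a geometric series. -/
theorem tsum_min_geometric_le {x : ℝ} (hx : 0 < x) {r : ℝ} (hr : 1 < r) :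
    ∑' j : ℕ, ENNReal.ofReal (min (x * r ^ j) (x * r ^ j)⁻¹) ≤ 2 * ∑' j : ℕ, ENNReal.ofReal (r⁻¹ ^ j) := by
  have hr0 : 0 < r := by linarith
  have hpos : ∀ j : ℕ, 0 < r ^ j := fun j => pow_pos hr0 j
  rcases le_or_gt 1 x with h | h
  · rw [two_mul]
    refine le_add_right (ENNReal.tsum_le_tsum fun j => ENNReal.ofReal_le_ofReal ?_)
    refine (min_le_right _ _).trans ?_
    rw [inv_pow]
    refine inv_anti₀ (hpos j) ?_
    nlinarith [hpos j]
  · obtain ⟨k, hk1, hk2⟩ := exists_nat_pow_near (one_le_inv_iff₀.2 ⟨hx, h.le⟩) hr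
    have hk1' : x * r ^ k ≤ 1 := by
      have := mul_le_mul_of_nonneg_left hk1 hx.le
      rwa [mul_inv_cancel₀ hx.ne'] at this
    have hk2' : 1 ≤ x * r ^ (k + 1) := by
      have := mul_le_mul_of_nonneg_left hk2.le hx.le
      rwa [mul_inv_cancel₀ hx.ne'] at this
    rw [← Summable.sum_add_tsum_nat_add' (k := k + 1) ENNReal.summable, two_mul]
    refine add_le_add ?_ (ENNReal.tsum_le_tsum fun j => ENNReal.ofReal_le_ofReal ?_)
    · refine le_trans ?_ (ENNReal.sum_le_tsum (Finset.range (k + 1)))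
      rw [← Finset.sum_range_reflect]
      refine Finset.sum_le_sum fun j hj => ENNReal.ofReal_le_ofReal ?_
      have hjk : j ≤ k := by
        have := Finset.mem_range.1 hj
        omega
      refine (min_le_left _ _).trans ?_
      rw [show k + 1 - 1 - j = k - j by omega, inv_pow, le_inv_comm₀ (by positivity) (hpos j)]
      rw [← one_div, le_div_iff₀ (by positivity)]
      calc r ^ j * (x * r ^ (k - j)) = x * (r ^ (k - j) * r ^ j) := by ring
        _ = x * r ^ k := by rw [← pow_add, Nat.sub_add_cancel hjk]
        _ ≤ 1 := hk1'
    · refine (min_le_right _ _).trans ?_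
      rw [inv_pow]
      refine inv_anti₀ (hpos j) ?_
      have h3 := mul_le_mul_of_nonneg_right hk2' (hpos j).le
      rw [one_mul, mul_assoc, ← pow_add, add_comm (k + 1)] at h3
      exact h3

theorem exists_tsum_kap_le : ∃ M : ℝ, 0 < M ∧ ∀ t : ℝ, 0 < t →
    ∑' j : ℕ, ENNReal.ofReal (kap (t * 4 ^ (j + 1))) ≤ ENNReal.ofReal M := by
  set r : ℝ := 4 ^ (1 / 4 : ℝ)
  have hr : 1 < r := Real.one_lt_rpow (by norm_num) (by norm_num)
  have hs : Summable fun j : ℕ => r⁻¹ ^ j :=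
    summable_geometric_of_lt_one (by positivity) (inv_lt_one_of_one_lt₀ hr)
  refine ⟨2 * ∑' j : ℕ, r⁻¹ ^ j, mul_pos two_pos
    (hs.tsum_pos (fun j => by positivity) 0 (by simp)), fun t ht => ?_⟩
  have hx : 0 < (t * 4) ^ (1 / 4 : ℝ) := by positivity
  rw [ENNReal.ofReal_mul (by norm_num), ENNReal.ofReal_tsum_of_nonneg (fun j => by positivity) hs]
  have h := tsum_min_geometric_le hx hr
  rw [show ENNReal.ofReal 2 = 2 by simp]
  refine le_trans (ENNReal.tsum_le_tsum fun j => ENNReal.ofReal_le_ofReal ?_) h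
  have h1 : (t * 4 ^ (j + 1)) ^ (1 / 4 : ℝ) = (t * 4) ^ (1 / 4 : ℝ) * r ^ j := by
    rw [pow_succ, show t * (4 ^ j * 4) = t * 4 * 4 ^ j by ring, Real.mul_rpow (by positivity) (by positivity),
      ← Real.rpow_natCast, ← Real.rpow_natCast, ← Real.rpow_mul (by norm_num), ← Real.rpow_mul (by norm_num),
      mul_comm (j : ℝ)]
  refine le_min ?_ ?_
  · rw [← h1]
    exact kap_le_rpow (by positivity)
  · rw [← h1, ← Real.rpow_neg (by positivity)]
    exact kap_le_rpow_neg (by positivity)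

/-- The dyadic index is controlled by the logarithmic weight. -/
theorem nat_le_ell {T t : ℝ} (ht : 0 < t) (htT : t ≤ T) (j : ℕ) :
    (j : ℝ) ≤ (1 + |Real.log T|) * (ell T t * (1 + max 0 (Real.log (t * 4 ^ j)))) := by
  have hT : 0 < T := ht.trans_le htT
  have h1 := one_le_ell ht htT
  -- Because `log 4 ≥ 1`, the index satisfies `j ≤ j log 4 = log(t4^j) - log t`.
  have h4 : (1 : ℝ) ≤ Real.log 4 := by
    rw [Real.le_log_iff_exp_le (by norm_num)]
    linarith [Real.exp_one_lt_d9]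
  have h2 : Real.log (t * 4 ^ j) = Real.log t + j * Real.log 4 := by
    rw [Real.log_mul ht.ne' (by positivity), Real.log_pow]
  have h3 : ell T t = 1 + (Real.log T - Real.log t) := by rw [ell, Real.log_div hT.ne' ht.ne']
  have h5 : (j : ℝ) ≤ j * Real.log 4 := le_mul_of_one_le_right (by positivity) h4
  have h6 := neg_abs_le (Real.log T)
  have h7 := le_max_right 0 (Real.log (t * 4 ^ j))
  have h8 := le_max_left 0 (Real.log (t * 4 ^ j))
  have h9 := abs_nonneg (Real.log T)
  set m := max 0 (Real.log (t * 4 ^ j))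
  have h10 : (j : ℝ) ≤ m + ell T t + |Real.log T| := by linarith
  nlinarith [mul_nonneg h8 (sub_nonneg.2 h1), mul_nonneg h9 (sub_nonneg.2 h1),
    mul_nonneg h9 (mul_nonneg h8 (zero_le_one.trans h1))]

/-- The logarithmic weight is controlled by the dyadic index. -/
theorem ell_le_nat {T₀ T t : ℝ} (ht : 0 < t) (htT : t ≤ T) (hT : T ≤ T₀) (j : ℕ) :
    ell T t ≤ (3 + |Real.log T₀|) * ((j + 1 : ℕ) * (1 + |Real.log (t * 4 ^ (j + 1))|)) := by
  have hT0 : 0 < T := ht.trans_le htT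
  have h4 : Real.log 4 ≤ 2 := by
    rw [show (4 : ℝ) = 2 ^ 2 by norm_num, Real.log_pow]
    have := Real.log_two_lt_d9
    push_cast
    linarith
  have h2 : Real.log (t * 4 ^ (j + 1)) = Real.log t + (j + 1 : ℕ) * Real.log 4 := by
    rw [Real.log_mul ht.ne' (by positivity), Real.log_pow]
  have h3 : ell T t = 1 + (Real.log T - Real.log t) := by rw [ell, Real.log_div hT0.ne' ht.ne']
  have h5 : Real.log T ≤ Real.log T₀ := Real.log_le_log hT0 hT
  have h6 := le_abs_self (Real.log T₀)
  have h7 := neg_abs_le (Real.log (t * 4 ^ (j + 1)))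
  have h9 := abs_nonneg (Real.log T₀)
  have h8 := abs_nonneg (Real.log (t * 4 ^ (j + 1)))
  have hj : (1 : ℝ) ≤ (j + 1 : ℕ) := by
    push_cast
    have : (0 : ℝ) ≤ j := by positivity
    linarith
  have h5' : ((j + 1 : ℕ) : ℝ) * Real.log 4 ≤ (j + 1 : ℕ) * 2 := mul_le_mul_of_nonneg_left h4 (by positivity)
  set J : ℝ := ((j + 1 : ℕ) : ℝ)
  set m := |Real.log (t * 4 ^ (j + 1))|
  have h10 : ell T t ≤ 1 + |Real.log T₀| + J * 2 + m := by linarith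
  nlinarith [mul_nonneg h8 (sub_nonneg.2 hj), mul_nonneg h9 (sub_nonneg.2 hj),
    mul_nonneg h9 (mul_nonneg h8 (zero_le_one.trans hj))]

/-! ### The weighted norms of constants and of dyadic sums -/

/-- The weight is at most `D√T(t/T)^{1/4}`, once half of the power of `t/T` has absorbed the
logarithm. The factor `√T` provides smallness on short intervals. -/
theorem exists_normW_const_le {σ q : ℝ} (hσ : 0 < σ) (hq : 1 ≤ q) : ∃ C, 0 < C ∧ ∀ T : ℝ, 0 < T → ∀ a : ℝ≥0∞,
    normW σ q T (fun _ => a) ≤ ENNReal.ofReal (C * √T) * a := by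
  have hq0 : 0 < q := by linarith
  set D : ℝ := (max 1 (4 * σ)) ^ σ
  have hD : 0 < D := Real.rpow_pos_of_pos (by positivity) _
  refine ⟨D + D * 8, by positivity, fun T hT a => ?_⟩
  have hw : ∀ t ∈ Ioo 0 T, wt σ T t ≤ ENNReal.ofReal (D * √T) * ENNReal.ofReal (kap (t * T⁻¹)) := by
    intro t ht
    rw [wt_eq ht.1 ht.2.le, lw, ← ENNReal.ofReal_mul (by positivity), ← ENNReal.ofReal_mul (by positivity)]
    refine ENNReal.ofReal_le_ofReal ?_
    have h1 : 0 ≤ Real.log (T / t) := Real.log_nonneg ((one_le_div ht.1).2 ht.2.le)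
    have h2 : Real.log (t * T⁻¹) = -Real.log (T / t) := by
      rw [← Real.log_inv, inv_div, div_eq_mul_inv]
    have h3 : √t = √T * Real.exp (-(Real.log (T / t) / 2)) := by
      have h4 : Real.exp (-(Real.log (T / t) / 2)) = √(t / T) := by
        rw [Real.sqrt_eq_rpow, Real.rpow_def_of_pos (by have := ht.1; positivity), div_eq_mul_inv t, h2]
        congr 1
        ring
      rw [h4, ← Real.sqrt_mul hT.le]
      congr 1
      field_simp
    rw [kap, h2, abs_neg, abs_of_nonneg h1, ell, h3]
    calc √T * Real.exp (-(Real.log (T / t) / 2)) * (1 + Real.log (T / t)) ^ σ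
        ≤ √T * Real.exp (-(Real.log (T / t) / 2)) * (D * Real.exp (Real.log (T / t) / 4)) := by
          gcongr
          exact one_add_rpow_le hσ h1
      _ = D * √T * (Real.exp (-(Real.log (T / t) / 2)) * Real.exp (Real.log (T / t) / 4)) := by ring
      _ = _ := by
          rw [← Real.exp_add]
          congr 2
          ring
  have h1 : supW σ T (fun _ => a) ≤ ENNReal.ofReal (D * √T) * a := by
    rw [supW_le_iff]
    intro t ht
    refine mul_le_mul_left ((hw t ht).trans ?_) a
    calc _ ≤ ENNReal.ofReal (D * √T) * ENNReal.ofReal 1 := by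
          gcongr
          exact kap_le_one _
      _ = _ := by simp
  have h2 : lqW σ q T (fun _ => a) ≤ ENNReal.ofReal (D * √T) * 8 * a := by
    -- Schur's test with a one-point space interpolates the `L^q` norm of the kernel between its
    -- supremum and its integral.
    have hs := lintegral_schur_le (μ := nu T) (ν := Measure.dirac (0 : ℝ)) (M := 8)
      (k := fun t _ => ENNReal.ofReal (kap (t * T⁻¹)))
      (by
        have := measurable_kap
        exact ENNReal.measurable_ofReal.comp (this.comp (measurable_fst.mul_const _)))
      (b := fun _ => ENNReal.ofReal (D * √T) * a) aemeasurable_const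
      (by
        refine Eventually.of_forall fun t => ?_
        rw [lintegral_const, measure_univ, mul_one]
        calc ENNReal.ofReal (kap (t * T⁻¹)) ≤ ENNReal.ofReal 1 := ENNReal.ofReal_le_ofReal (kap_le_one _)
          _ ≤ 8 := by simp)
      (Eventually.of_forall fun _ => setLIntegral_kap_le (inv_pos.2 hT) T) hq
    simp only [lintegral_const, measure_univ, mul_one] at hs
    rw [← ENNReal.rpow_mul, mul_one_div_cancel hq0.ne', ENNReal.rpow_one] at hs
    rw [lqW_eq]
    refine le_trans (ENNReal.rpow_le_rpow (lintegral_mono_ae ?_) (by positivity)) (hs.trans (le_of_eq (by ring)))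
    filter_upwards [ae_nu_mem T] with t ht
    refine ENNReal.rpow_le_rpow ?_ hq0.le
    calc _ ≤ ENNReal.ofReal (D * √T) * ENNReal.ofReal (kap (t * T⁻¹)) * a := mul_le_mul_left (hw t ht) a
      _ = _ := by ring
  calc normW σ q T (fun _ => a) ≤ ENNReal.ofReal (D * √T) * a + ENNReal.ofReal (D * √T) * 8 * a := add_le_add h1 h2
    _ = _ := by
      rw [add_mul D, mul_right_comm D 8, ENNReal.ofReal_add (by positivity) (by positivity),
        ENNReal.ofReal_mul (p := D * √T) (by positivity)]
      simp
      ring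

end NavierStokesBesov

namespace NavierStokesBesov

variable {n : ℕ} {V W : Type*} [NormedAddCommGroup V] [NormedSpace ℂ V] [CompleteSpace V]
  [NormedAddCommGroup W] [NormedSpace ℂ W] [CompleteSpace W]

/-! ### The Besov norm -/

section BesovNorm

variable {φ : ℝ → ℝ} {σ q : ℝ}

/-- The weight of the dyadic block with index `j + 1`. -/
def bw (σ : ℝ) (j : ℕ) : ℝ≥0∞ :=
  ENNReal.ofReal ((2 : ℝ) ^ (((j + 1 : ℕ) : ℝ) * (-1)) * ((j + 1 : ℕ) : ℝ) ^ σ)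

theorem bw_eq (σ : ℝ) (j : ℕ) :
    bw σ j = ENNReal.ofReal (((2 : ℝ) ^ (j + 1))⁻¹ * ((j + 1 : ℕ) : ℝ) ^ σ) := by
  rw [bw, mul_neg_one, Real.rpow_neg (by norm_num), Real.rpow_natCast]

/-- The weighted sequence norm of the Besov space. -/
def seqB (σ q : ℝ) (D : ℕ → ℝ≥0∞) : ℝ≥0∞ := (∑' j, (bw σ j * D j) ^ q) ^ (1 / q)

theorem normB_eq (f : TempDist n) :
    normB φ σ q f = lpENorm ⊤ (lowFreq φ f) + seqB σ q fun j => lpENorm ⊤ (dyadicBlock φ (j + 1) f) := rfl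

theorem seqB_mono (hq : 1 ≤ q) {D D' : ℕ → ℝ≥0∞} (h : ∀ j, D j ≤ D' j) : seqB σ q D ≤ seqB σ q D' := by
  have hq0 : 0 < q := by linarith
  refine ENNReal.rpow_le_rpow (ENNReal.tsum_le_tsum fun j => ENNReal.rpow_le_rpow ?_ hq0.le) (by positivity)
  exact mul_le_mul_right (h j) _

/-- Minkowski's inequality for counting measure. -/
theorem tsum_rpow_add_le (hq : 1 ≤ q) (a b : ℕ → ℝ≥0∞) :
    (∑' j, (a j + b j) ^ q) ^ (1 / q) ≤ (∑' j, a j ^ q) ^ (1 / q) + (∑' j, b j ^ q) ^ (1 / q) := by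
  have h := ENNReal.lintegral_Lp_add_le (μ := (Measure.count : Measure ℕ)) (f := a) (g := b)
    (measurable_of_countable _).aemeasurable (measurable_of_countable _).aemeasurable hq
  simpa only [lintegral_count, Pi.add_apply] using h

theorem seqB_add_le (hq : 1 ≤ q) (D D' : ℕ → ℝ≥0∞) :
    seqB σ q (fun j => D j + D' j) ≤ seqB σ q D + seqB σ q D' := by
  unfold seqB
  simp_rw [mul_add]
  exact tsum_rpow_add_le hq _ _

theorem tsum_rpow_const_mul (hq : 1 ≤ q) (c : ℝ≥0∞) (a : ℕ → ℝ≥0∞) :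
    (∑' j, (c * a j) ^ q) ^ (1 / q) = c * (∑' j, a j ^ q) ^ (1 / q) := by
  have hq0 : 0 < q := by linarith
  simp_rw [fun j => ENNReal.mul_rpow_of_nonneg c (a j) hq0.le]
  rw [ENNReal.tsum_mul_left, ENNReal.mul_rpow_of_nonneg _ _ (by positivity),
    ← ENNReal.rpow_mul, mul_one_div_cancel hq0.ne', ENNReal.rpow_one]

theorem seqB_const_mul (hq : 1 ≤ q) (c : ℝ≥0∞) (D : ℕ → ℝ≥0∞) :
    seqB σ q (fun j => c * D j) = c * seqB σ q D := by
  unfold seqB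
  simp_rw [mul_left_comm _ c]
  exact tsum_rpow_const_mul hq c _

theorem le_tsum_rpow (hq : 1 ≤ q) (a : ℕ → ℝ≥0∞) (j : ℕ) : a j ≤ (∑' j, a j ^ q) ^ (1 / q) := by
  have hq0 : 0 < q := by linarith
  calc a j = (a j ^ q) ^ (1 / q) := by rw [← ENNReal.rpow_mul, mul_one_div_cancel hq0.ne', ENNReal.rpow_one]
    _ ≤ _ := ENNReal.rpow_le_rpow (ENNReal.le_tsum j) (by positivity)

theorem lowFreq_add (f g : TempDist n) : lowFreq φ (f + g) = lowFreq φ f + lowFreq φ g := map_add _ f g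

theorem dyadicBlock_add (j : ℕ) (f g : TempDist n) :
    dyadicBlock φ j (f + g) = dyadicBlock φ j f + dyadicBlock φ j g := map_add _ f g

theorem normB_add_le (hq : 1 ≤ q) (f g : TempDist n) :
    normB φ σ q (f + g) ≤ normB φ σ q f + normB φ σ q g := by
  simp only [normB_eq, lowFreq_add, dyadicBlock_add]
  refine (add_le_add (lpENorm_add_le _ _) ((seqB_mono hq fun j => lpENorm_add_le _ _).trans
    (seqB_add_le hq _ _))).trans (le_of_eq (by ring))

theorem normB_neg (f : TempDist n) : normB φ σ q (-f) = normB φ σ q f := by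
  have h1 : lowFreq φ (-f) = -lowFreq φ f := map_neg _ f
  have h2 : ∀ j, dyadicBlock φ j (-f) = -dyadicBlock φ j f := fun j => map_neg _ f
  simp only [normB_eq, h1, h2, lpENorm_neg]

theorem normB_sub_comm (f g : TempDist n) : normB φ σ q (f - g) = normB φ σ q (g - f) := by
  rw [← normB_neg, neg_sub]

theorem normB_sub_le (hq : 1 ≤ q) (f g : TempDist n) :
    normB φ σ q (f - g) ≤ normB φ σ q f + normB φ σ q g := by
  rw [sub_eq_add_neg, ← normB_neg g]
  exact normB_add_le hq _ _

theorem normB_sub_le_sub_add_sub (hq : 1 ≤ q) (f g h : TempDist n) :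
    normB φ σ q (f - h) ≤ normB φ σ q (f - g) + normB φ σ q (g - h) := by
  rw [← sub_add_sub_cancel f g h]
  exact normB_add_le hq _ _

theorem lowFreq_heat (hφ : IsCutoff φ) {t : ℝ} (ht : 0 ≤ t) (f : TempDist n) :
    lowFreq φ (heat t f) = heat t (lowFreq φ f) := by
  rcases ht.eq_or_lt with rfl | ht
  · rw [heat_zero, heat_zero]
  · rw [lowFreq_eq hφ, lowFreq_eq hφ, heat_eq t ht, heat_eq t ht, fourierMultiplier_comm]

theorem dyadicBlock_heat (hφ : IsCutoff φ) (j : ℕ) {t : ℝ} (ht : 0 ≤ t) (f : TempDist n) :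
    dyadicBlock φ j (heat t f) = heat t (dyadicBlock φ j f) := by
  rcases ht.eq_or_lt with rfl | ht
  · rw [heat_zero, heat_zero]
  · rw [dyadicBlock_eq hφ, dyadicBlock_eq hφ, heat_eq t ht, heat_eq t ht, fourierMultiplier_comm]

/-- The heat semigroup is bounded on the Besov space. -/
theorem exists_normB_heat_le (n : ℕ) (hφ : IsCutoff φ) (σ : ℝ) (hq : 1 ≤ q) : ∃ C, 0 < C ∧ ∀ t : ℝ, 0 ≤ t →
    ∀ f : TempDist n, normB φ σ q (heat t f) ≤ ENNReal.ofReal C * normB φ σ q f := by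
  obtain ⟨C, hC, h⟩ := exists_lpENorm_heat_le n
  refine ⟨C, hC, fun t ht f => ?_⟩
  simp only [normB_eq, lowFreq_heat hφ ht, dyadicBlock_heat hφ _ ht]
  rw [mul_add, ← seqB_const_mul hq]
  exact add_le_add (h t ht _) (seqB_mono hq fun j => h t ht _)

/-- The factor `2^{-j}` beats `j^σ`. Since the weights are summable, bounded functions embed into
the Besov space. -/
theorem tsum_bw_lt_top (hσ : 0 < σ) (hq : 1 ≤ q) : seqB σ q (fun _ => 1) < ⊤ := by
  have hq0 : 0 < q := by linarith
  set D : ℝ := (max 1 (4 * σ)) ^ σ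
  have hD : 0 < D := Real.rpow_pos_of_pos (by positivity) _
  set r : ℝ := Real.exp (1 / 4) / 2
  have hr0 : 0 < r := by positivity
  have hr1 : r < 1 := by
    rw [div_lt_one two_pos, ← Real.lt_log_iff_exp_lt two_pos]
    linarith [Real.log_two_gt_d9]
  have hb : ∀ j, bw σ j ≤ ENNReal.ofReal D * ENNReal.ofReal (r ^ j) := by
    intro j
    rw [bw_eq, ← ENNReal.ofReal_mul hD.le]
    refine ENNReal.ofReal_le_ofReal ?_
    have h1 := one_add_rpow_le hσ (Nat.cast_nonneg (α := ℝ) j)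
    have h2 : r ^ j = (2 ^ j)⁻¹ * Real.exp (j / 4) := by
      rw [div_pow, ← Real.exp_nat_mul, mul_one_div, div_eq_inv_mul]
    have h3 : ((2 : ℝ) ^ (j + 1))⁻¹ ≤ (2 ^ j)⁻¹ :=
      inv_anti₀ (by positivity) (pow_le_pow_right₀ one_le_two (Nat.le_succ j))
    rw [h2]
    calc ((2 : ℝ) ^ (j + 1))⁻¹ * ((j + 1 : ℕ) : ℝ) ^ σ = ((2 : ℝ) ^ (j + 1))⁻¹ * (1 + (j : ℝ)) ^ σ := by
          push_cast
          rw [add_comm (j : ℝ)]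
      _ ≤ (2 ^ j)⁻¹ * (D * Real.exp (j / 4)) := mul_le_mul h3 h1 (by positivity) (by positivity)
      _ = _ := by ring
  have hs : (∑' j : ℕ, ENNReal.ofReal (r ^ j)) < ⊤ := by
    rw [← ENNReal.ofReal_tsum_of_nonneg (fun j => by positivity) (summable_geometric_of_lt_one hr0.le hr1)]
    exact ENNReal.ofReal_lt_top
  have h1 : seqB σ q (fun _ => 1) ≤ ENNReal.ofReal D * (∑' j : ℕ, ENNReal.ofReal (r ^ j) ^ q) ^ (1 / q) := by
    rw [← tsum_rpow_const_mul hq]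
    refine ENNReal.rpow_le_rpow (ENNReal.tsum_le_tsum fun j => ENNReal.rpow_le_rpow ?_ hq0.le) (by positivity)
    rw [mul_one]
    exact hb j
  refine h1.trans_lt (ENNReal.mul_lt_top ENNReal.ofReal_lt_top
    (ENNReal.rpow_lt_top_of_nonneg (by positivity) (lt_of_le_of_lt (ENNReal.tsum_le_tsum fun j => ?_) hs).ne))
  calc ENNReal.ofReal (r ^ j) ^ q ≤ ENNReal.ofReal (r ^ j) ^ (1 : ℝ) := by
        refine ENNReal.rpow_le_rpow_of_exponent_ge ?_ hq
        rw [← ENNReal.ofReal_one]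
        exact ENNReal.ofReal_le_ofReal (pow_le_one₀ hr0.le hr1.le)
    _ = _ := ENNReal.rpow_one _

/-- Bounded functions belong to the Besov space. -/
theorem exists_normB_toDist_le (n : ℕ) (hφ : IsCutoff φ) (hσ : 0 < σ) (hq : 1 ≤ q) : ∃ C, 0 < C ∧ ∀ f : Cb n (Cn n),
    normB φ σ q (toDist n (Cn n) f) ≤ ENNReal.ofReal C * ‖f‖ₑ := by
  have hS := tsum_bw_lt_top hσ hq
  set S := (seqB σ q fun _ => 1).toReal
  set C := ‖ker (phiS n hφ)‖ + 1
  set C' := ‖ker (psiS n hφ)‖ + 1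
  have hC : 0 < C := by positivity
  have hC' : 0 < C' := by positivity
  have hS0 : 0 ≤ S := ENNReal.toReal_nonneg
  refine ⟨C + C' * S, by positivity, fun f => ?_⟩
  have h1 : lpENorm ⊤ (lowFreq φ (toDist n (Cn n) f)) ≤ ENNReal.ofReal C * ‖f‖ₑ := by
    rw [lowFreq_eq hφ, ← lpENorm_toDist f]
    exact lpENorm_multiplier_le _ hC (le_add_of_nonneg_right zero_le_one) _
  have h2 : ∀ j, lpENorm ⊤ (dyadicBlock φ (j + 1) (toDist n (Cn n) f)) ≤ ENNReal.ofReal C' * ‖f‖ₑ * 1 := by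
    intro j
    rw [dyadicBlock_eq hφ, ← lpENorm_toDist f, mul_one]
    refine lpENorm_multiplier_le _ hC' ?_ _
    rw [psiJ, norm_ker_dil _ (pow_two_inv_pos _)]
    exact le_add_of_nonneg_right zero_le_one
  calc _ ≤ ENNReal.ofReal C * ‖f‖ₑ + seqB σ q fun j => ENNReal.ofReal C' * ‖f‖ₑ * 1 := add_le_add h1 (seqB_mono hq h2)
    _ = ENNReal.ofReal C * ‖f‖ₑ + ENNReal.ofReal C' * ‖f‖ₑ * ENNReal.ofReal S := by
        rw [seqB_const_mul hq, ENNReal.ofReal_toReal hS.ne]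
    _ = _ := by
        rw [ENNReal.ofReal_add hC.le (by positivity), ENNReal.ofReal_mul hC'.le]
        ring

/-- With `x = t4^{j+1}` one has `√t = 2^{-(j+1)}√x` and `ℓ^σ ≤ C(j+1)^σ(1 + |log x|)^σ`. The
quantity `√x(1 + x)^{-3}` decays at least like `x^{±1/2}` away from `x = 1`, enough to absorb the
logarithm and leave `kap x`. Time and frequency weights thus match up to an almost diagonal kernel.
-/
theorem wt_mul_inv_le (hσ : 0 < σ) {T₀ T t : ℝ} (ht : t ∈ Ioo 0 T) (hT : T ≤ T₀) (j : ℕ) :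
    wt σ T t * ENNReal.ofReal (((1 + t * 4 ^ (j + 1)) ^ 3)⁻¹) ≤
      ENNReal.ofReal ((3 + |Real.log T₀|) ^ σ * (max 1 (4 * σ)) ^ σ) *
        ENNReal.ofReal (kap (t * 4 ^ (j + 1))) * bw σ j := by
  have ht0 := ht.1
  have h9 := abs_nonneg (Real.log T₀)
  have hell := ell_pos ht.1 ht.2.le
  have hkp := kap_pos (t * 4 ^ (j + 1))
  rw [wt_eq ht.1 ht.2.le, lw, bw_eq, ← ENNReal.ofReal_mul (by positivity), ← ENNReal.ofReal_mul (by positivity),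
    ← ENNReal.ofReal_mul (by positivity), ← ENNReal.ofReal_mul (by positivity)]
  refine ENNReal.ofReal_le_ofReal ?_
  set x := t * 4 ^ (j + 1) with hx
  have hx0 : 0 < x := by positivity
  have h8 := abs_nonneg (Real.log x)
  have h1 : ell T t ^ σ ≤ (3 + |Real.log T₀|) ^ σ * (((j + 1 : ℕ) : ℝ) ^ σ *
      ((max 1 (4 * σ)) ^ σ * Real.exp (|Real.log x| / 4))) := by
    calc ell T t ^ σ ≤ ((3 + |Real.log T₀|) * ((j + 1 : ℕ) * (1 + |Real.log x|))) ^ σ :=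
          Real.rpow_le_rpow hell.le (ell_le_nat ht.1 ht.2.le hT j) hσ.le
      _ = (3 + |Real.log T₀|) ^ σ * (((j + 1 : ℕ) : ℝ) ^ σ * (1 + |Real.log x|) ^ σ) := by
          rw [Real.mul_rpow (by positivity) (by positivity), Real.mul_rpow (by positivity) (by positivity)]
      _ ≤ _ := by
          gcongr
          exact one_add_rpow_le hσ h8
  have h2 : √t = √x * ((2 : ℝ) ^ (j + 1))⁻¹ := by
    rw [hx, Real.sqrt_mul ht0.le, show (4 : ℝ) ^ (j + 1) = (2 ^ (j + 1)) ^ 2 by rw [← pow_mul, mul_comm, pow_mul]; norm_num,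
      Real.sqrt_sq (by positivity)]
    field_simp
  have h3 : √x * ((1 + x) ^ 3)⁻¹ * Real.exp (|Real.log x| / 4) ≤ kap x := by
    have hsx : √x = Real.exp (Real.log x / 2) := by
      rw [Real.sqrt_eq_rpow, Real.rpow_def_of_pos hx0]
      congr 1
      ring
    rw [kap]
    rcases le_or_gt 1 x with h | h
    · have hl := Real.log_nonneg h
      rw [abs_of_nonneg hl, hsx]
      have : ((1 + x) ^ 3)⁻¹ ≤ Real.exp (-Real.log x) := by
        rw [Real.exp_neg, Real.exp_log hx0]
        refine inv_anti₀ hx0 ?_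
        nlinarith [sq_nonneg x, pow_pos hx0 3]
      calc _ ≤ Real.exp (Real.log x / 2) * Real.exp (-Real.log x) * Real.exp (Real.log x / 4) := by gcongr
        _ = _ := by
          rw [← Real.exp_add, ← Real.exp_add]
          congr 1
          ring
    · have hl := Real.log_nonpos hx0.le h.le
      rw [abs_of_nonpos hl, hsx]
      have : ((1 + x) ^ 3)⁻¹ ≤ 1 := inv_le_one_of_one_le₀ (one_le_pow₀ (by linarith))
      calc _ ≤ Real.exp (Real.log x / 2) * 1 * Real.exp (-Real.log x / 4) := by gcongr
        _ = _ := by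
          rw [mul_one, ← Real.exp_add]
          congr 1
          ring
  calc √t * ell T t ^ σ * ((1 + x) ^ 3)⁻¹
      ≤ √t * ((3 + |Real.log T₀|) ^ σ * (((j + 1 : ℕ) : ℝ) ^ σ *
      ((max 1 (4 * σ)) ^ σ * Real.exp (|Real.log x| / 4)))) * ((1 + x) ^ 3)⁻¹ := by gcongr
    _ = (3 + |Real.log T₀|) ^ σ * (max 1 (4 * σ)) ^ σ * (√x * ((1 + x) ^ 3)⁻¹ * Real.exp (|Real.log x| / 4)) *
        (((2 : ℝ) ^ (j + 1))⁻¹ * ((j + 1 : ℕ) : ℝ) ^ σ) := by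
        rw [h2]
        ring
    _ ≤ _ := by gcongr

/-- The weighted norms of the heat extension are controlled by the Besov norm of the datum. -/
theorem exists_normW_heat_le (n : ℕ) (hφ : IsCutoff φ) (hσ : 0 < σ) (hq : 1 ≤ q) (T₀ : ℝ) :
    ∃ C, 0 < C ∧ ∀ T : ℝ, 0 < T → T ≤ T₀ → ∀ f : TempDist n,
      normW σ q T (fun t => lpENorm ⊤ (heat t f)) ≤ ENNReal.ofReal C * normB φ σ q f := by
  have hq0 : 0 < q := by linarith
  obtain ⟨C, hC, hH⟩ := exists_lpENorm_heat_le_besov n hφ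
  obtain ⟨C₁, hC₁, hW⟩ := exists_normW_const_le hσ hq
  obtain ⟨M, hM, hK⟩ := exists_tsum_kap_le
  set D : ℝ := (3 + |Real.log T₀|) ^ σ * (max 1 (4 * σ)) ^ σ
  have hD : 0 < D := by positivity
  refine ⟨C * (C₁ * √T₀ + 2 * (D * (M + 8))), by positivity, fun T hT hTT f => ?_⟩
  set D₀ := lpENorm ⊤ (lowFreq φ f)
  set a : ℕ → ℝ≥0∞ := fun j => bw σ j * lpENorm ⊤ (dyadicBlock φ (j + 1) f)
  set N := seqB σ q fun j => lpENorm ⊤ (dyadicBlock φ (j + 1) f)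
  have hN : N = (∑' j, a j ^ q) ^ (1 / q) := rfl
  set G : ℝ → ℝ≥0∞ := fun t => ∑' j, ENNReal.ofReal (D * kap (t * 4 ^ (j + 1))) * a j
  have hpt : ∀ t ∈ Ioo 0 T, wt σ T t * lpENorm ⊤ (heat t f) ≤
      ENNReal.ofReal C * (wt σ T t * D₀) + ENNReal.ofReal C * G t := by
    intro t ht
    calc _ ≤ wt σ T t * (ENNReal.ofReal C * (D₀ + ∑' j : ℕ, ENNReal.ofReal (((1 + t * 4 ^ (j + 1)) ^ 3)⁻¹) *
          lpENorm ⊤ (dyadicBlock φ (j + 1) f))) := mul_le_mul_right (hH t ht.1 f) _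
      _ = ENNReal.ofReal C * (wt σ T t * D₀) + ENNReal.ofReal C * ∑' j : ℕ, wt σ T t *
          (ENNReal.ofReal (((1 + t * 4 ^ (j + 1)) ^ 3)⁻¹) * lpENorm ⊤ (dyadicBlock φ (j + 1) f)) := by
          rw [ENNReal.tsum_mul_left]
          ring
      _ ≤ _ := by
          refine add_le_add le_rfl (mul_le_mul_right (ENNReal.tsum_le_tsum fun j => ?_) _)
          calc _ = wt σ T t * ENNReal.ofReal (((1 + t * 4 ^ (j + 1)) ^ 3)⁻¹) *
                lpENorm ⊤ (dyadicBlock φ (j + 1) f) := by ring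
            _ ≤ _ := mul_le_mul_left (wt_mul_inv_le hσ ht hTT j) _
            _ = _ := by
              rw [ENNReal.ofReal_mul hD.le]
              simp only [a]
              ring
  have hmk : ∀ j : ℕ, Measurable fun t : ℝ => ENNReal.ofReal (D * kap (t * 4 ^ (j + 1))) := fun j =>
    ENNReal.measurable_ofReal.comp ((measurable_kap.comp (measurable_id.mul_const _)).const_mul D)
  have hG1 : ∀ t, 0 < t → ∑' j, ENNReal.ofReal (D * kap (t * 4 ^ (j + 1))) ≤ ENNReal.ofReal (D * (M + 8)) := by
    intro t ht
    simp_rw [ENNReal.ofReal_mul hD.le]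
    rw [ENNReal.tsum_mul_left]
    gcongr
    exact (hK t ht).trans (ENNReal.ofReal_le_ofReal (by linarith))
  have hsup : supW σ T (fun t => lpENorm ⊤ (heat t f)) ≤
      ENNReal.ofReal C * supW σ T (fun _ => D₀) + ENNReal.ofReal C * (ENNReal.ofReal (D * (M + 8)) * N) := by
    rw [supW_le_iff]
    intro t ht
    refine (hpt t ht).trans (add_le_add (mul_le_mul_right (wt_mul_le_supW (A := fun _ => D₀) ht) _)
      (mul_le_mul_right ?_ _))
    calc G t ≤ ∑' j, ENNReal.ofReal (D * kap (t * 4 ^ (j + 1))) * N :=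
          ENNReal.tsum_le_tsum fun j => mul_le_mul_right (le_tsum_rpow hq a j) _
      _ ≤ _ := by
          rw [ENNReal.tsum_mul_right]
          exact mul_le_mul_left (hG1 t ht.1) _
  have hlq : lqW σ q T (fun t => lpENorm ⊤ (heat t f)) ≤
      ENNReal.ofReal C * lqW σ q T (fun _ => D₀) + ENNReal.ofReal C * (ENNReal.ofReal (D * (M + 8)) * N) := by
    have hconst : ∀ g : ℝ → ℝ≥0∞, (∫⁻ t, (ENNReal.ofReal C * g t) ^ q ∂nu T) ^ (1 / q) =
        ENNReal.ofReal C * (∫⁻ t, g t ^ q ∂nu T) ^ (1 / q) := by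
      intro g
      simp_rw [fun t => ENNReal.mul_rpow_of_nonneg (ENNReal.ofReal C) (g t) hq0.le]
      rw [lintegral_const_mul' _ _ (ENNReal.rpow_ne_top_of_nonneg hq0.le ENNReal.ofReal_ne_top), ENNReal.mul_rpow_of_nonneg _ _ (by positivity),
        ← ENNReal.rpow_mul, mul_one_div_cancel hq0.ne', ENNReal.rpow_one]
    have hschur : (∫⁻ t, G t ^ q ∂nu T) ^ (1 / q) ≤ ENNReal.ofReal (D * (M + 8)) * N := by
      -- Schur's test between `dt/t` and counting measure; the row and column sums are those of
      -- `kap`.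
      have h := lintegral_schur_le (μ := nu T) (ν := (Measure.count : Measure ℕ)) (M := ENNReal.ofReal (D * (M + 8)))
        (k := fun t j => ENNReal.ofReal (D * kap (t * 4 ^ (j + 1))))
        (measurable_from_prod_countable_left hmk)
        (b := a) (measurable_of_countable a).aemeasurable
        (by
          filter_upwards [ae_nu_mem T] with t ht
          rw [lintegral_count]
          exact hG1 t ht.1)
        (Eventually.of_forall fun j => by
          simp_rw [ENNReal.ofReal_mul hD.le]
          rw [lintegral_const_mul' _ _ ENNReal.ofReal_ne_top]
          gcongr
          refine (setLIntegral_kap_le (by positivity) T).trans ?_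
          rw [show (8 : ℝ≥0∞) = ENNReal.ofReal 8 by simp]
          exact ENNReal.ofReal_le_ofReal (by linarith)) hq
      simp only [lintegral_count] at h
      exact h
    have hGm : Measurable G := Measurable.tsum fun j => (hmk j).mul_const _
    rw [lqW_eq, lqW_eq]
    calc _ ≤ (∫⁻ t, ((fun t => ENNReal.ofReal C * (wt σ T t * D₀)) + fun t => ENNReal.ofReal C * G t) t ^ q
          ∂nu T) ^ (1 / q) := by
          refine ENNReal.rpow_le_rpow (lintegral_mono_ae ?_) (by positivity)
          filter_upwards [ae_nu_mem T] with t ht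
          exact ENNReal.rpow_le_rpow (hpt t ht) hq0.le
      _ ≤ _ := ENNReal.lintegral_Lp_add_le
          ((((measurable_wt σ T).mul_const D₀).const_mul _).aemeasurable) ((hGm.const_mul _).aemeasurable) hq
      _ ≤ _ := by
          rw [hconst, hconst]
          exact add_le_add le_rfl (mul_le_mul_right hschur _)
  have hE : ENNReal.ofReal (C * (C₁ * √T₀ + 2 * (D * (M + 8)))) =
      ENNReal.ofReal C * ENNReal.ofReal (C₁ * √T₀) + 2 * (ENNReal.ofReal C * ENNReal.ofReal (D * (M + 8))) := by
    rw [ENNReal.ofReal_mul hC.le, ENNReal.ofReal_add (by positivity) (by positivity),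
      ENNReal.ofReal_mul (p := 2) (by norm_num)]
    simp
    ring
  calc normW σ q T (fun t => lpENorm ⊤ (heat t f))
      ≤ (ENNReal.ofReal C * supW σ T (fun _ => D₀) + ENNReal.ofReal C * (ENNReal.ofReal (D * (M + 8)) * N)) +
        (ENNReal.ofReal C * lqW σ q T (fun _ => D₀) + ENNReal.ofReal C * (ENNReal.ofReal (D * (M + 8)) * N)) :=
        add_le_add hsup hlq
    _ = ENNReal.ofReal C * normW σ q T (fun _ => D₀) +
        2 * (ENNReal.ofReal C * ENNReal.ofReal (D * (M + 8))) * N := by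
        rw [normW]
        ring
    _ ≤ ENNReal.ofReal C * (ENNReal.ofReal (C₁ * √T₀) * (D₀ + N)) +
        2 * (ENNReal.ofReal C * ENNReal.ofReal (D * (M + 8))) * (D₀ + N) := by
        refine add_le_add (mul_le_mul_right ((hW T hT D₀).trans (mul_le_mul' ?_ le_self_add)) _)
          (mul_le_mul_right le_add_self _)
        exact ENNReal.ofReal_le_ofReal (mul_le_mul_of_nonneg_left (Real.sqrt_le_sqrt hTT) hC₁.le)
    _ = _ := by
        rw [hE, normB_eq]
        ring

/-- The weighted norms of the heat extension of a bounded function are small on short intervals. -/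
theorem exists_normW_heat_toDist_le (n : ℕ) (hσ : 0 < σ) (hq : 1 ≤ q) :
    ∃ C, 0 < C ∧ ∀ T : ℝ, 0 < T → ∀ f : Cb n (Cn n),
      normW σ q T (fun t => lpENorm ⊤ (heat t (toDist n (Cn n) f))) ≤ ENNReal.ofReal (C * √T) * ‖f‖ₑ := by
  have hq0 : 0 < q := by linarith
  obtain ⟨C, hC, hH⟩ := exists_lpENorm_heat_le n
  obtain ⟨C₁, hC₁, hW⟩ := exists_normW_const_le hσ hq
  refine ⟨C₁ * C, by positivity, fun T hT f => ?_⟩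
  have h := hW T hT (ENNReal.ofReal C * ‖f‖ₑ)
  rw [← mul_assoc, ← ENNReal.ofReal_mul (by positivity), mul_right_comm] at h
  refine le_trans (add_le_add ?_ ?_) h
  · refine iSup₂_mono fun t ht => mul_le_mul_right ?_ _
    rw [← lpENorm_toDist f]
    exact hH t ht.1.le _
  · rw [lqW_eq, lqW_eq]
    refine ENNReal.rpow_le_rpow (lintegral_mono_ae ?_) (by positivity)
    filter_upwards [ae_nu_mem T] with t ht
    refine ENNReal.rpow_le_rpow (mul_le_mul_right ?_ _) hq0.le
    rw [← lpENorm_toDist f]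
    exact hH t ht.1.le _

end BesovNorm

end NavierStokesBesov

namespace NavierStokesBesov

/-! ### The dyadic norm of the quadratic term -/

/-- The size of the dyadic block `j + 1` of the quadratic term at time `t`. -/
def blockInt (A B : ℝ → ℝ≥0∞) (t : ℝ) (j : ℕ) : ℝ≥0∞ :=
  ∫⁻ τ in Ioo 0 t, ENNReal.ofReal (((1 + (t - τ) * 4 ^ (j + 1)) ^ 2)⁻¹) * (A τ * B τ)

theorem lintegral_inv_one_add_sq_le {t a : ℝ} (ha : 0 < a) :
    ∫⁻ τ in Ioo (t / 2) t, ENNReal.ofReal (((1 + (t - τ) * a) ^ 2)⁻¹) ≤ ENNReal.ofReal a⁻¹ := by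
  have h1 := (volume.measurePreserving_sub_left t).setLIntegral_comp_preimage (s := Ioi 0)
    measurableSet_Ioi (f := fun s : ℝ => ENNReal.ofReal (((1 + s * a) ^ 2)⁻¹)) (by fun_prop)
  have hd : ∀ s ∈ Ioi (0 : ℝ), HasDerivAt (fun s : ℝ => -a⁻¹ * (1 + s * a)⁻¹) (((1 + s * a) ^ 2)⁻¹) s := by
    intro s hs
    have hs0 : 0 < s := hs
    have h2 : 1 + s * a ≠ 0 := by positivity
    have h3 : HasDerivAt (fun s : ℝ => 1 + s * a) a s := by
      simpa using ((hasDerivAt_id s).mul_const a).const_add 1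
    have h4 : ((1 + s * a) ^ 2)⁻¹ = -a⁻¹ * (-a / (1 + s * a) ^ 2) := by field_simp
    rw [h4]
    exact (h3.inv h2).const_mul (-a⁻¹)
  have hc : ContinuousWithinAt (fun s : ℝ => -a⁻¹ * (1 + s * a)⁻¹) (Ici 0) 0 := by
    have : ContinuousAt (fun s : ℝ => -a⁻¹ * (1 + s * a)⁻¹) 0 := by
      refine continuousAt_const.mul (ContinuousAt.inv₀ (by fun_prop) (by simp))
    exact this.continuousWithinAt
  have ht : Tendsto (fun s : ℝ => -a⁻¹ * (1 + s * a)⁻¹) atTop (𝓝 0) := by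
    have : Tendsto (fun s : ℝ => 1 + s * a) atTop atTop :=
      tendsto_atTop_add_const_left _ _ (tendsto_id.atTop_mul_const ha)
    simpa using (tendsto_inv_atTop_zero.comp this).const_mul (-a⁻¹)
  have hnn : ∀ s ∈ Ioi (0 : ℝ), 0 ≤ ((1 + s * a) ^ 2)⁻¹ := fun s _ => by positivity
  have hi := integrableOn_Ioi_deriv_of_nonneg hc hd hnn ht
  have hI := integral_Ioi_of_hasDerivAt_of_nonneg hc hd hnn ht
  calc _ ≤ ∫⁻ τ in (fun τ : ℝ => t - τ) ⁻¹' Ioi 0, ENNReal.ofReal (((1 + (t - τ) * a) ^ 2)⁻¹) :=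
        lintegral_mono_set fun τ hτ => by
          have := hτ.2
          simp only [mem_preimage, mem_Ioi]
          linarith
    _ = ∫⁻ s in Ioi 0, ENNReal.ofReal (((1 + s * a) ^ 2)⁻¹) := h1
    _ = ENNReal.ofReal (∫ s in Ioi 0, ((1 + s * a) ^ 2)⁻¹) :=
        (ofReal_integral_eq_lintegral_ofReal hi
          ((ae_restrict_iff' measurableSet_Ioi).2 (Eventually.of_forall hnn))).symm
    _ = _ := by
        rw [hI]
        simp

/-! ### Low and high blocks of the quadratic term -/

section

variable {σ q T t : ℝ} {A B : ℝ → ℝ≥0∞}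

theorem blockInt_le_lintegral (j : ℕ) : blockInt A B t j ≤ ∫⁻ τ in Ioo 0 t, A τ * B τ := by
  refine setLIntegral_mono' measurableSet_Ioo fun τ hτ => ?_
  have h1 : 0 < t - τ := sub_pos.2 hτ.2
  calc _ ≤ ENNReal.ofReal 1 * (A τ * B τ) := by
        gcongr
        exact inv_le_one_of_one_le₀ (one_le_pow₀ (by
          have : 0 < (t - τ) * 4 ^ (j + 1) := by positivity
          linarith))
    _ = _ := by simp

/-- Meant for `t4^{j+1} ≥ 1`. For `τ ≤ t/2` the kernel is at most `(t4^{j+1})^{-1}`. For `τ > t/2`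
the product is at most `(2/t)ℓ^{-2σ}` times the suprema, and the kernel has integral at most
`4^{-(j+1)}`. -/
theorem blockInt_le (hσ : 0 ≤ σ) (ht : 0 < t) (htT : t ≤ T) (j : ℕ) :
    blockInt A B t j ≤ ENNReal.ofReal (t * 4 ^ (j + 1))⁻¹ *
      ((∫⁻ τ in Ioo 0 t, A τ * B τ) + 2 * (lw T (-2 * σ) t * (supW σ T A * supW σ T B))) := by
  set a : ℝ := 4 ^ (j + 1) with ha
  have ha0 : 0 < a := by positivity
  have hunion : Ioo 0 t ⊆ Ioc 0 (t / 2) ∪ Ioo (t / 2) t := fun τ hτ => by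
    rcases le_or_gt τ (t / 2) with h | h
    · exact Or.inl ⟨hτ.1, h⟩
    · exact Or.inr ⟨h, hτ.2⟩
  refine (lintegral_mono_set hunion).trans ((lintegral_union_le _ _ _).trans ?_)
  rw [mul_add]
  refine add_le_add ?_ ?_
  · rw [← lintegral_const_mul' _ _ ENNReal.ofReal_ne_top]
    refine (setLIntegral_mono' measurableSet_Ioc fun τ hτ => ?_).trans
      (lintegral_mono_set (fun τ hτ => ⟨hτ.1, by have := hτ.2; linarith⟩))
    refine mul_le_mul_left (ENNReal.ofReal_le_ofReal (inv_anti₀ (by positivity) ?_)) _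
    have h2 : t / 2 * a ≤ (t - τ) * a := mul_le_mul_of_nonneg_right (by have := hτ.2; linarith) ha0.le
    have h3 : 0 < t * a := by positivity
    nlinarith
  · calc _ ≤ ∫⁻ τ in Ioo (t / 2) t, ENNReal.ofReal (((1 + (t - τ) * a) ^ 2)⁻¹) *
          (ENNReal.ofReal (2 / t) * (lw T (-2 * σ) t * (supW σ T A * supW σ T B))) := by
          refine setLIntegral_mono' measurableSet_Ioo fun τ hτ => mul_le_mul_right ?_ _
          have hτ0 : 0 < τ := lt_trans (by linarith) hτ.1
          have hτT : τ < T := hτ.2.trans_le htT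
          rw [← mul_eq_weighted (σ := σ) hτ0 hτT.le (A τ) (B τ)]
          have h1 := wt_mul_le_supW (σ := σ) (A := A) ⟨hτ0, hτT⟩
          have h2 := wt_mul_le_supW (σ := σ) (A := B) ⟨hτ0, hτT⟩
          have h3 := lw_mono hτ0 hτ.2.le htT (show -2 * σ ≤ 0 by linarith)
          have h4 : ENNReal.ofReal (1 / τ) ≤ ENNReal.ofReal (2 / t) := by
            refine ENNReal.ofReal_le_ofReal ?_
            rw [div_le_div_iff₀ hτ0 ht]
            have := hτ.1
            linarith
          calc _ ≤ supW σ T A * supW σ T B * lw T (-2 * σ) t * ENNReal.ofReal (2 / t) :=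
                mul_le_mul' (mul_le_mul' (mul_le_mul' h1 h2) h3) h4
            _ = _ := by ring
      _ = (∫⁻ τ in Ioo (t / 2) t, ENNReal.ofReal (((1 + (t - τ) * a) ^ 2)⁻¹)) *
          (ENNReal.ofReal (2 / t) * (lw T (-2 * σ) t * (supW σ T A * supW σ T B))) :=
          lintegral_mul_const _ (by fun_prop)
      _ ≤ ENNReal.ofReal a⁻¹ *
          (ENNReal.ofReal (2 / t) * (lw T (-2 * σ) t * (supW σ T A * supW σ T B))) :=
          mul_le_mul_left (lintegral_inv_one_add_sq_le ha0) _
      _ = _ := by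
          rw [← mul_assoc, ← ENNReal.ofReal_mul (by positivity),
            show a⁻¹ * (2 / t) = (t * a)⁻¹ * 2 by field_simp, ENNReal.ofReal_mul (by positivity)]
          simp only [ENNReal.ofReal_ofNat]
          ring

theorem tsum_indicator_le (y : ℝ) (hy : 0 ≤ y) :
    ∑' j : ℕ, (if ((j + 1 : ℕ) : ℝ) ≤ y then (1 : ℝ≥0∞) else 0) ≤ ENNReal.ofReal y := by
  rw [tsum_eq_sum (s := Finset.range ⌊y⌋₊)]
  · refine (Finset.sum_le_card_nsmul _ _ 1 fun j _ => ?_).trans ?_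
    · split_ifs <;> simp
    · rw [Finset.card_range, nsmul_one, ← ENNReal.ofReal_natCast]
      exact ENNReal.ofReal_le_ofReal (Nat.floor_le hy)
  · intro j hj
    rw [if_neg]
    intro h
    exact hj (Finset.mem_range.2 (Nat.lt_of_succ_le (Nat.le_floor h)))

/-- The dyadic norm of the quadratic term. -/
theorem exists_seqB_blockInt_le (hq : 1 ≤ q) (hσ : 0 < σ) (T : ℝ) : ∃ C, 0 < C ∧
    ∀ (A B : ℝ → ℝ≥0∞) (t : ℝ), 0 < t → t ≤ T →
      seqB σ q (fun j => ENNReal.ofReal (2 ^ (j + 1)) * blockInt A B t j) ≤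
        ENNReal.ofReal C * (lw T (σ + 1 / q) t * (∫⁻ τ in Ioo 0 t, A τ * B τ) +
          lw T (-σ) t * (supW σ T A * supW σ T B)) := by
  have hq0 : 0 < q := by linarith
  obtain ⟨M, hM, hK⟩ := exists_tsum_kap_le
  set c : ℝ := 1 + |Real.log T| with hc
  have hc0 : 0 < c := by positivity
  set D : ℝ := c ^ σ * (max 1 (4 * σ)) ^ σ with hD
  have hD0 : 0 < D := by positivity
  refine ⟨D * c ^ (1 / q) + 2 * (D * M ^ (1 / q)), by positivity, fun A B t ht htT => ?_⟩
  set I := ∫⁻ τ in Ioo 0 t, A τ * B τ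
  set S := supW σ T A * supW σ T B
  have hell := one_le_ell ht htT
  have hell0 := ell_pos ht htT
  have hcσ : c ^ σ ≤ D := le_mul_of_one_le_right (by positivity) (Real.one_le_rpow (le_max_left _ _) hσ.le)
  -- the weights
  have hpow : ∀ j : ℕ, ((j + 1 : ℕ) : ℝ) ^ σ ≤ c ^ σ * ell T t ^ σ * (1 + max 0 (Real.log (t * 4 ^ (j + 1)))) ^ σ := by
    intro j
    rw [← Real.mul_rpow hc0.le hell0.le, ← Real.mul_rpow (by positivity) (by positivity), mul_assoc]
    exact Real.rpow_le_rpow (by positivity) (nat_le_ell ht htT (j + 1)) hσ.le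
  have hbig : ∀ j : ℕ, 1 ≤ t * 4 ^ (j + 1) → ENNReal.ofReal (((j + 1 : ℕ) : ℝ) ^ σ) *
      ENNReal.ofReal (t * 4 ^ (j + 1))⁻¹ ≤ ENNReal.ofReal D * lw T σ t * ENNReal.ofReal (kap (t * 4 ^ (j + 1))) := by
    intro j hx
    rw [lw, ← ENNReal.ofReal_mul (by positivity), ← ENNReal.ofReal_mul hD0.le, ← ENNReal.ofReal_mul (by positivity)]
    refine ENNReal.ofReal_le_ofReal ?_
    have h1 := hpow j
    set x := t * 4 ^ (j + 1)
    have hx0 : 0 < x := by positivity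
    have hl := Real.log_nonneg hx
    rw [max_eq_right hl] at h1
    have h2 := one_add_rpow_le hσ hl
    have h3 : Real.exp (Real.log x / 4) * x⁻¹ ≤ kap x := by
      rw [kap, abs_of_nonneg hl]
      nth_rewrite 2 [← Real.exp_log hx0]
      rw [← Real.exp_neg, ← Real.exp_add, Real.exp_le_exp]
      linarith
    calc _ ≤ c ^ σ * ell T t ^ σ * ((max 1 (4 * σ)) ^ σ * Real.exp (Real.log x / 4)) * x⁻¹ := by
          refine mul_le_mul_of_nonneg_right (h1.trans (mul_le_mul_of_nonneg_left h2 (by positivity))) (by positivity)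
      _ = D * ell T t ^ σ * (Real.exp (Real.log x / 4) * x⁻¹) := by rw [hD]; ring
      _ ≤ _ := mul_le_mul_of_nonneg_left h3 (by positivity)
  have hbw : ∀ j : ℕ, bw σ j * ENNReal.ofReal (2 ^ (j + 1)) = ENNReal.ofReal (((j + 1 : ℕ) : ℝ) ^ σ) := by
    intro j
    rw [bw_eq, ← ENNReal.ofReal_mul (by positivity)]
    congr 1
    field_simp
  set k : ℕ → ℝ≥0∞ := fun j => ENNReal.ofReal (kap (t * 4 ^ (j + 1)))
  -- This selects the blocks with `t4^{j+1} < 1` and possibly a few more. There are at most `cℓ` of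
  -- them, so their `ℓ^q` sum costs `ℓ^{1/q}`.
  set χ : ℕ → ℝ≥0∞ := fun j => if ((j + 1 : ℕ) : ℝ) ≤ c * ell T t then 1 else 0
  set c₁ : ℝ≥0∞ := ENNReal.ofReal D * lw T σ t * I
  set c₂ : ℝ≥0∞ := ENNReal.ofReal D * lw T σ t * (I + 2 * (lw T (-2 * σ) t * S))
  have hterm : ∀ j, bw σ j * (ENNReal.ofReal (2 ^ (j + 1)) * blockInt A B t j) ≤ c₁ * χ j + c₂ * k j := by
    intro j
    rw [← mul_assoc, hbw]
    -- High blocks gain from the time decay of the kernel and are summed by `kap`; for low blocks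
    -- the kernel is simply bounded by one and the index by `cℓ`.
    rcases le_or_gt 1 (t * 4 ^ (j + 1)) with hx | hx
    · refine le_add_left ?_
      calc _ ≤ ENNReal.ofReal (((j + 1 : ℕ) : ℝ) ^ σ) * (ENNReal.ofReal (t * 4 ^ (j + 1))⁻¹ *
            (I + 2 * (lw T (-2 * σ) t * S))) := mul_le_mul_right (blockInt_le hσ.le ht htT j) _
        _ = ENNReal.ofReal (((j + 1 : ℕ) : ℝ) ^ σ) * ENNReal.ofReal (t * 4 ^ (j + 1))⁻¹ *
            (I + 2 * (lw T (-2 * σ) t * S)) := by ring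
        _ ≤ _ := mul_le_mul_left (hbig j hx) _
        _ = _ := by
          simp only [c₂, k]
          ring
    · refine le_add_right ?_
      have hx0 : 0 < t * 4 ^ (j + 1) := by positivity
      have hl := Real.log_nonpos hx0.le hx.le
      have h1 := hpow j
      have h2 := nat_le_ell ht htT (j + 1)
      rw [max_eq_left hl, add_zero, Real.one_rpow, mul_one] at h1
      rw [max_eq_left hl, add_zero, mul_one] at h2
      have hχ : χ j = 1 := if_pos h2
      rw [hχ, mul_one]
      refine mul_le_mul' ?_ (blockInt_le_lintegral j)
      rw [lw, ← ENNReal.ofReal_mul hD0.le]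
      exact ENNReal.ofReal_le_ofReal (h1.trans (mul_le_mul_of_nonneg_right hcσ (by positivity)))
  have hχ : (∑' j, χ j ^ q) ^ (1 / q) ≤ ENNReal.ofReal (c ^ (1 / q)) * lw T (1 / q) t := by
    rw [lw, ← ENNReal.ofReal_mul (by positivity), ← Real.mul_rpow hc0.le hell0.le,
      ← ENNReal.ofReal_rpow_of_nonneg (by positivity) (by positivity)]
    refine ENNReal.rpow_le_rpow (le_trans (ENNReal.tsum_le_tsum fun j => ?_)
      (tsum_indicator_le (c * ell T t) (by positivity))) (by positivity)
    simp only [χ]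
    split_ifs
    · simp
    · simp [hq0]
  have hk : (∑' j, k j ^ q) ^ (1 / q) ≤ ENNReal.ofReal (M ^ (1 / q)) := by
    rw [← ENNReal.ofReal_rpow_of_nonneg hM.le (by positivity)]
    refine ENNReal.rpow_le_rpow (le_trans (ENNReal.tsum_le_tsum fun j => ?_) (hK t ht)) (by positivity)
    calc k j ^ q ≤ k j ^ (1 : ℝ) := by
          refine ENNReal.rpow_le_rpow_of_exponent_ge ?_ hq
          rw [← ENNReal.ofReal_one]
          exact ENNReal.ofReal_le_ofReal (kap_le_one _)
      _ = _ := ENNReal.rpow_one _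
  have hl1 : lw T σ t ≤ lw T (σ + 1 / q) t := lw_mono_exp ht htT (le_add_of_nonneg_right (by positivity))
  calc _ ≤ (∑' j, (c₁ * χ j + c₂ * k j) ^ q) ^ (1 / q) :=
        ENNReal.rpow_le_rpow (ENNReal.tsum_le_tsum fun j => ENNReal.rpow_le_rpow (hterm j) hq0.le) (by positivity)
    _ ≤ c₁ * (ENNReal.ofReal (c ^ (1 / q)) * lw T (1 / q) t) + c₂ * ENNReal.ofReal (M ^ (1 / q)) := by
        refine (tsum_rpow_add_le hq _ _).trans ?_
        rw [tsum_rpow_const_mul hq, tsum_rpow_const_mul hq]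
        exact add_le_add (mul_le_mul_right hχ _) (mul_le_mul_right hk _)
    _ = ENNReal.ofReal (D * c ^ (1 / q)) * (lw T (σ + 1 / q) t * I) +
        ENNReal.ofReal (D * M ^ (1 / q)) * (lw T σ t * I) +
        2 * ENNReal.ofReal (D * M ^ (1 / q)) * (lw T (-σ) t * S) := by
        have e1 : lw T (σ + 1 / q) t = lw T σ t * lw T (1 / q) t := (lw_mul ht htT _ _).symm
        have e2 : lw T (-σ) t = lw T σ t * lw T (-2 * σ) t := by
          rw [lw_mul ht htT]
          congr 1
          ring
        rw [e1, e2, ENNReal.ofReal_mul hD0.le, ENNReal.ofReal_mul hD0.le]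
        simp only [c₁, c₂]
        ring
    _ ≤ ENNReal.ofReal (D * c ^ (1 / q)) * (lw T (σ + 1 / q) t * I) +
        2 * ENNReal.ofReal (D * M ^ (1 / q)) * (lw T (σ + 1 / q) t * I) +
        (ENNReal.ofReal (D * c ^ (1 / q)) * (lw T (-σ) t * S) +
        2 * ENNReal.ofReal (D * M ^ (1 / q)) * (lw T (-σ) t * S)) := by
        refine add_le_add (add_le_add le_rfl ?_) le_add_self
        refine mul_le_mul' ?_ (mul_le_mul_left hl1 _)
        rw [two_mul]
        exact le_self_add
    _ = _ := by
        rw [ENNReal.ofReal_add (by positivity) (by positivity), ENNReal.ofReal_mul (p := 2) (by norm_num)]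
        simp only [ENNReal.ofReal_ofNat]
        ring

end

end NavierStokesBesov

namespace NavierStokesBesov

/-! ### The Duhamel integral of a singular bilinear family -/

/-- The quotient map by a closed subspace is continuous and linear, so it commutes with the integral
and annihilates the integrand. If the integral is undefined its default value zero also lies in the
subspace. -/
theorem integral_mem_submodule {α E : Type*} [MeasurableSpace α] {μ : Measure α} [NormedAddCommGroup E]
    [NormedSpace ℝ E] [CompleteSpace E] {F : Submodule ℝ E} (hF : IsClosed (F : Set E)) {f : α → E}
    (hf : ∀ᵐ x ∂μ, f x ∈ F) : ∫ x, f x ∂μ ∈ F := by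
  by_cases hi : Integrable f μ
  · have hF' : IsClosed (F : Set E) := hF
    rw [← Submodule.Quotient.mk_eq_zero]
    have h := (F.mkQL).integral_comp_comm hi
    have h0 : ∀ᵐ x ∂μ, F.mkQL (f x) = 0 := hf.mono fun x hx => (Submodule.Quotient.mk_eq_zero F).2 hx
    rw [integral_congr_ae h0, integral_zero] at h
    exact h.symm
  · rw [integral_undef hi]
    exact F.zero_mem

section Duhamel

variable {E : Type*} [NormedAddCommGroup E] [NormedSpace ℂ E]
  {Q : ℝ → E →L[ℂ] E →L[ℂ] E} {C σ q T t : ℝ} {u v : ℝ → E}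

/-- The Duhamel integral `∫_0^t Q(t - τ)(u(τ), v(τ)) dτ`. -/
def duh (Q : ℝ → E →L[ℂ] E →L[ℂ] E) (u v : ℝ → E) (t : ℝ) : E :=
  ∫ τ in Ioo 0 t, Q (t - τ) (u τ) (v τ)

/-- A family of bilinear maps with an integrable singularity at the origin. -/
structure IsSingularBil (Q : ℝ → E →L[ℂ] E →L[ℂ] E) (C : ℝ) : Prop where
  cont : ContinuousOn Q (Ioi 0)
  pos : 0 < C
  bound : ∀ s, 0 < s → ‖Q s‖ ≤ C * (√s)⁻¹

/-- The norm of a curve as an extended number. -/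
abbrev en (u : ℝ → E) (t : ℝ) : ℝ≥0∞ := ‖u t‖ₑ

theorem IsSingularBil.norm_apply_le (hQ : IsSingularBil Q C) {s : ℝ} (hs : 0 < s) (f g : E) :
    ‖Q s f g‖ ≤ C * (√s)⁻¹ * (‖f‖ * ‖g‖) := by
  calc ‖Q s f g‖ ≤ ‖Q s‖ * ‖f‖ * ‖g‖ := (Q s).le_opNorm₂ f g
    _ = ‖Q s‖ * (‖f‖ * ‖g‖) := by ring
    _ ≤ _ := mul_le_mul_of_nonneg_right (hQ.bound s hs) (by positivity)

theorem IsSingularBil.enorm_apply_le (hQ : IsSingularBil Q C) {s : ℝ} (hs : 0 < s) (f g : E) :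
    ‖Q s f g‖ₑ ≤ ENNReal.ofReal C * (ENNReal.ofReal (√s)⁻¹ * (‖f‖ₑ * ‖g‖ₑ)) := by
  have hC := hQ.pos
  rw [← ofReal_norm (Q s f g), ← ofReal_norm f, ← ofReal_norm g, ← ENNReal.ofReal_mul (norm_nonneg _),
    ← ENNReal.ofReal_mul (by positivity), ← ENNReal.ofReal_mul hC.le, ← mul_assoc]
  exact ENNReal.ofReal_le_ofReal (hQ.norm_apply_le hs f g)

theorem aemeasurable_en (hu : ContinuousOn u (Ioc 0 T)) : AEMeasurable (en u) (volume.restrict (Ioo 0 T)) :=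
  ((hu.mono Ioo_subset_Ioc_self).aestronglyMeasurable measurableSet_Ioo).enorm

theorem IsSingularBil.continuousOn_integrand (hQ : IsSingularBil Q C) (hu : ContinuousOn u (Ioc 0 T))
    (hv : ContinuousOn v (Ioc 0 T)) (htT : t ≤ T) :
    ContinuousOn (fun τ => Q (t - τ) (u τ) (v τ)) (Ioo 0 t) := by
  have h1 : ContinuousOn (fun τ => Q (t - τ)) (Ioo 0 t) :=
    hQ.cont.comp (by fun_prop) fun τ hτ => sub_pos.2 hτ.2
  have hs : Ioo 0 t ⊆ Ioc 0 T := fun τ hτ => ⟨hτ.1, hτ.2.le.trans htT⟩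
  exact (h1.clm_apply (hu.mono hs)).clm_apply (hv.mono hs)

theorem IsSingularBil.integrableOn (hQ : IsSingularBil Q C) (hu : ContinuousOn u (Ioc 0 T))
    (hv : ContinuousOn v (Ioc 0 T)) (htT : t ≤ T) (h : gInt (en u) (en v) t < ⊤) :
    IntegrableOn (fun τ => Q (t - τ) (u τ) (v τ)) (Ioo 0 t) := by
  refine ⟨(hQ.continuousOn_integrand hu hv htT).aestronglyMeasurable measurableSet_Ioo, ?_⟩
  refine lt_of_le_of_lt (setLIntegral_mono' measurableSet_Ioo fun τ hτ =>
    hQ.enorm_apply_le (sub_pos.2 hτ.2) _ _) ?_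
  rw [lintegral_const_mul' _ _ ENNReal.ofReal_ne_top]
  exact ENNReal.mul_lt_top ENNReal.ofReal_lt_top h

theorem wt_pos (ht : 0 < t) (htT : t ≤ T) : wt σ T t ≠ 0 := by
  rw [wt_eq ht htT, lw, ← ENNReal.ofReal_mul (Real.sqrt_nonneg t)]
  have := ell_pos ht htT
  have := Real.sqrt_pos.2 ht
  rw [ne_eq, ENNReal.ofReal_eq_zero, not_le]
  positivity

theorem lt_top_of_wt_mul_lt_top {x : ℝ≥0∞} (ht : 0 < t) (htT : t ≤ T) (h : wt σ T t * x < ⊤) : x < ⊤ := by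
  by_contra hx
  rw [not_lt_top_iff.1 hx, ENNReal.mul_top (wt_pos ht htT)] at h
  exact lt_irrefl _ h

theorem gInt_lt_top {A B : ℝ → ℝ≥0∞} (hq : 1 ≤ q) (hσ : sigmaCrit q ≤ σ) (ht : t ∈ Ioc 0 T)
    (hA : AEMeasurable A (volume.restrict (Ioo 0 T))) (hB : AEMeasurable B (volume.restrict (Ioo 0 T)))
    (hNA : normW σ q T A < ⊤) (hNB : normW σ q T B < ⊤) : gInt A B t < ⊤ :=
  lt_top_of_wt_mul_lt_top ht.1 ht.2 ((wt_mul_gInt_le_normW hq hσ ht hA hB).trans_lt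
    (ENNReal.mul_lt_top ENNReal.ofReal_lt_top (ENNReal.mul_lt_top hNA hNB)))

theorem IsSingularBil.duh_sub_duh (hQ : IsSingularBil Q C) (hu : ContinuousOn u (Ioc 0 T))
    (hv : ContinuousOn v (Ioc 0 T)) (htT : t ≤ T) (h1 : gInt (en u) (en u) t < ⊤) (h2 : gInt (en v) (en v) t < ⊤) :
    ‖duh Q u u t - duh Q v v t‖ₑ ≤
      ENNReal.ofReal C * gInt (fun τ => en u τ + en v τ) (fun τ => ‖u τ - v τ‖ₑ) t := by
  rw [duh, duh, ← integral_sub (hQ.integrableOn hu hu htT h1) (hQ.integrableOn hv hv htT h2)]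
  refine (enorm_integral_le_lintegral_enorm _).trans ?_
  rw [gInt, ← lintegral_const_mul' _ _ ENNReal.ofReal_ne_top]
  refine setLIntegral_mono' measurableSet_Ioo fun τ hτ => ?_
  have hs : 0 < t - τ := sub_pos.2 hτ.2
  have he : Q (t - τ) (u τ) (u τ) - Q (t - τ) (v τ) (v τ) =
      Q (t - τ) (u τ) (u τ - v τ) + Q (t - τ) (u τ - v τ) (v τ) := by
    simp only [map_sub, _root_.sub_apply]
    abel
  rw [he]
  refine (enorm_add_le _ _).trans ((add_le_add (hQ.enorm_apply_le hs _ _) (hQ.enorm_apply_le hs _ _)).trans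
    (le_of_eq ?_))
  ring

theorem IsSingularBil.duh_mem [CompleteSpace E] {F : Submodule ℝ E} (hF : IsClosed (F : Set E))
    (hFQ : ∀ s, 0 < s → ∀ f ∈ F, ∀ g ∈ F, Q s f g ∈ F) (htT : t ≤ T) (hu : ∀ τ ∈ Ioc 0 T, u τ ∈ F)
    (hv : ∀ τ ∈ Ioc 0 T, v τ ∈ F) : duh Q u v t ∈ F := by
  refine integral_mem_submodule hF ?_
  filter_upwards [ae_restrict_mem measurableSet_Ioo] with τ hτ
  have h : τ ∈ Ioc 0 T := ⟨hτ.1, hτ.2.le.trans htT⟩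
  exact hFQ _ (sub_pos.2 hτ.2) _ (hu τ h) _ (hv τ h)

/-- The Duhamel integral is continuous at positive times. -/
theorem IsSingularBil.continuousOn_duh (hQ : IsSingularBil Q C) (hu : ContinuousOn u (Ioc 0 T))
    (hv : ContinuousOn v (Ioc 0 T)) (h : ∀ t ∈ Ioc 0 T, gInt (en u) (en v) t < ⊤) :
    ContinuousOn (duh Q u v) (Ioc 0 T) := by
  have hC := hQ.pos
  intro t₀ ht₀
  obtain ⟨h0, hT⟩ := ht₀
  set c := t₀ / 2 with hc
  have hc0 : 0 < c := by positivity
  have hct : c < t₀ := by linarith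
  -- integrability of the product on `(0, c)`
  have hprod : IntegrableOn (fun τ => ‖u τ‖ * ‖v τ‖) (Ioo 0 c) := by
    have hcont : ContinuousOn (fun τ => ‖u τ‖ * ‖v τ‖) (Ioo 0 c) :=
      ((hu.mono fun τ hτ => ⟨hτ.1, by have := hτ.2; linarith⟩).norm).mul
        ((hv.mono fun τ hτ => ⟨hτ.1, by have := hτ.2; linarith⟩).norm)
    refine ⟨hcont.aestronglyMeasurable measurableSet_Ioo, ?_⟩
    have h1 : ∀ τ ∈ Ioo 0 c, ‖‖u τ‖ * ‖v τ‖‖ₑ ≤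
        ENNReal.ofReal (√c) * (ENNReal.ofReal (√(c - τ))⁻¹ * (en u τ * en v τ)) := by
      intro τ hτ
      have h2 : 0 < c - τ := sub_pos.2 hτ.2
      rw [enorm_mul, enorm_norm, enorm_norm, ← mul_assoc, ← ENNReal.ofReal_mul (Real.sqrt_nonneg c)]
      refine le_mul_of_one_le_left zero_le ?_
      rw [← ENNReal.ofReal_one]
      refine ENNReal.ofReal_le_ofReal ?_
      rw [← div_eq_mul_inv, one_le_div (Real.sqrt_pos.2 h2)]
      exact Real.sqrt_le_sqrt (by linarith [hτ.1])
    refine lt_of_le_of_lt (setLIntegral_mono' measurableSet_Ioo h1) ?_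
    rw [lintegral_const_mul' _ _ ENNReal.ofReal_ne_top]
    exact ENNReal.mul_lt_top ENNReal.ofReal_lt_top (h c ⟨hc0, by linarith⟩)
  have hnear : ∀ᶠ t in 𝓝[Ioc 0 T] t₀, 3 * t₀ / 4 < t ∧ t ∈ Ioc 0 T := by
    have h1 : ∀ᶠ t in 𝓝 t₀, 3 * t₀ / 4 < t := Ioi_mem_nhds (by linarith)
    filter_upwards [nhdsWithin_le_nhds h1, self_mem_nhdsWithin] with t ht ht' using ⟨ht, ht'⟩
  -- the part away from the singularity
  have hfar : ContinuousWithinAt (fun t => ∫ τ in Ioo 0 c, Q (t - τ) (u τ) (v τ)) (Ioc 0 T) t₀ := by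
    refine continuousWithinAt_of_dominated (bound := fun τ => C * (√(t₀ / 4))⁻¹ * (‖u τ‖ * ‖v τ‖)) ?_ ?_
      (hprod.const_mul _) ?_
    · filter_upwards [hnear] with t ht
      have : ContinuousOn (fun τ => Q (t - τ) (u τ) (v τ)) (Ioo 0 c) :=
        (hQ.continuousOn_integrand hu hv ht.2.2).mono (Ioo_subset_Ioo_right (by linarith [ht.1]))
      exact this.aestronglyMeasurable measurableSet_Ioo
    · filter_upwards [hnear] with t ht
      filter_upwards [ae_restrict_mem measurableSet_Ioo] with τ hτ
      have h1 : t₀ / 4 ≤ t - τ := by linarith [ht.1, hτ.2]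
      refine (hQ.norm_apply_le (by linarith) _ _).trans ?_
      gcongr
    · filter_upwards [ae_restrict_mem measurableSet_Ioo] with τ hτ
      have h1 : ContinuousAt (fun t => Q (t - τ)) t₀ :=
        ContinuousAt.comp (f := fun t : ℝ => t - τ)
          (hQ.cont.continuousAt (Ioi_mem_nhds (by linarith [hτ.2]))) (by fun_prop)
      exact ((h1.clm_apply continuousAt_const).clm_apply continuousAt_const).continuousWithinAt
  -- the part near the singularity
  have hIcc : Icc c T ⊆ Ioc 0 T := fun τ hτ => ⟨hc0.trans_le hτ.1, hτ.2⟩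
  obtain ⟨M₁, hM₁⟩ := isCompact_Icc.exists_bound_of_continuousOn (hu.mono hIcc)
  obtain ⟨M₂, hM₂⟩ := isCompact_Icc.exists_bound_of_continuousOn (hv.mono hIcc)
  have hM₁0 : 0 ≤ M₁ := (norm_nonneg _).trans (hM₁ c ⟨le_rfl, by linarith⟩)
  -- Substituting `s = t - τ` fixes the singularity at `s = 0`, so that `t` enters only through the
  -- continuous curves and a moving endpoint handled by an indicator.
  have hclose : ContinuousWithinAt (fun t => ∫ s in Ioo 0 T,
      (Iio (t - c)).indicator (fun s => Q s (u (t - s)) (v (t - s))) s) (Ioc 0 T) t₀ := by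
    have hsing : IntegrableOn (fun s : ℝ => (√s)⁻¹) (Ioo 0 T) := by
      have := intervalIntegral.intervalIntegrable_rpow' (a := 0) (b := T) (r := -(1 / 2)) (by norm_num)
      rw [intervalIntegrable_iff_integrableOn_Ioo_of_le (h0.le.trans hT)] at this
      refine this.congr_fun (fun s hs => ?_) measurableSet_Ioo
      simp only [Real.sqrt_eq_rpow, Real.rpow_neg hs.1.le]
    refine continuousWithinAt_of_dominated (bound := fun s => C * (√s)⁻¹ * (M₁ * M₂)) ?_ ?_
      ((hsing.const_mul C).mul_const _) ?_
    · filter_upwards [hnear] with t ht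
      rw [aestronglyMeasurable_indicator_iff measurableSet_Iio, Measure.restrict_restrict measurableSet_Iio]
      have hsub : MapsTo (fun s => t - s) (Iio (t - c) ∩ Ioo 0 T) (Ioc 0 T) := fun s hs => by
        have h1 := hs.1
        have h2 := hs.2.1
        have h3 := ht.2.2
        simp only [mem_Iio] at h1
        exact ⟨by linarith, by linarith⟩
      have h1 : ContinuousOn (fun s => Q s) (Iio (t - c) ∩ Ioo 0 T) := hQ.cont.mono fun s hs => hs.2.1
      have : ContinuousOn (fun s => Q s (u (t - s)) (v (t - s))) (Iio (t - c) ∩ Ioo 0 T) :=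
        (h1.clm_apply (hu.comp (by fun_prop) hsub)).clm_apply (hv.comp (by fun_prop) hsub)
      exact this.aestronglyMeasurable (measurableSet_Iio.inter measurableSet_Ioo)
    · filter_upwards [hnear] with t ht
      filter_upwards [ae_restrict_mem measurableSet_Ioo] with s hs
      by_cases h1 : s < t - c
      · rw [indicator_of_mem (show s ∈ Iio (t - c) from h1)]
        have h2 : t - s ∈ Icc c T := ⟨by linarith, by linarith [hs.1, ht.2.2]⟩
        refine (hQ.norm_apply_le hs.1 _ _).trans ?_
        have h3 := hM₁ _ h2
        have h4 := hM₂ _ h2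
        gcongr
      · rw [indicator_of_notMem (show s ∉ Iio (t - c) from h1), norm_zero]
        have hM₂0 : 0 ≤ M₂ := (norm_nonneg _).trans (hM₂ c ⟨le_rfl, by linarith⟩)
        positivity
    · have hne : ∀ᵐ s ∂volume.restrict (Ioo 0 T), s ≠ t₀ - c :=
        ae_restrict_of_ae (Measure.ae_ne volume _)
      filter_upwards [hne, ae_restrict_mem measurableSet_Ioo] with s hs hs0
      rcases lt_or_gt_of_ne hs with h1 | h1
      · have hev : ∀ᶠ t in 𝓝[Ioc 0 T] t₀, s < t - c := by
          have : ∀ᶠ t in 𝓝 t₀, s + c < t := Ioi_mem_nhds (by linarith)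
          exact nhdsWithin_le_nhds (this.mono fun t ht => by linarith)
        have hmap : Tendsto (fun t => t - s) (𝓝[Ioc 0 T] t₀) (𝓝[Ioc 0 T] (t₀ - s)) := by
          refine tendsto_nhdsWithin_iff.2 ⟨(tendsto_id.mono_left nhdsWithin_le_nhds).sub_const s, ?_⟩
          filter_upwards [hev, self_mem_nhdsWithin] with t ht ht'
          exact ⟨by linarith, by linarith [ht'.2, hs0.1]⟩
        have hmem : t₀ - s ∈ Ioc 0 T := ⟨by linarith, by linarith [hs0.1]⟩
        have hu' : ContinuousWithinAt (fun t => u (t - s)) (Ioc 0 T) t₀ :=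
          Tendsto.comp (hu _ hmem) hmap
        have hv' : ContinuousWithinAt (fun t => v (t - s)) (Ioc 0 T) t₀ :=
          Tendsto.comp (hv _ hmem) hmap
        have h2 : ContinuousWithinAt (fun t => Q s (u (t - s)) (v (t - s))) (Ioc 0 T) t₀ :=
          ((continuousWithinAt_const (b := Q s)).clm_apply hu').clm_apply hv'
        refine h2.congr_of_eventuallyEq (hev.mono fun t ht => ?_) ?_
        · exact indicator_of_mem (show s ∈ Iio (t - c) from ht) _
        · exact indicator_of_mem (show s ∈ Iio (t₀ - c) from h1) _
      · have hev : ∀ᶠ t in 𝓝[Ioc 0 T] t₀, t - c < s := by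
          have : ∀ᶠ t in 𝓝 t₀, t < s + c := Iio_mem_nhds (by linarith)
          exact nhdsWithin_le_nhds (this.mono fun t ht => by linarith)
        refine (continuousWithinAt_const (b := (0 : E))).congr_of_eventuallyEq (hev.mono fun t ht => ?_) ?_
        · exact indicator_of_notMem (show s ∉ Iio (t - c) from not_lt.2 ht.le) _
        · exact indicator_of_notMem (show s ∉ Iio (t₀ - c) from not_lt.2 h1.le) _
  refine (hfar.add hclose).congr_of_eventuallyEq ?_ ?_
  all_goals
    have hsplit : ∀ t ∈ Ioc 0 T, c < t → duh Q u v t = (∫ τ in Ioo 0 c, Q (t - τ) (u τ) (v τ)) +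
        ∫ s in Ioo 0 T, (Iio (t - c)).indicator (fun s => Q s (u (t - s)) (v (t - s))) s := by
      intro t ht hct
      have hint := hQ.integrableOn hu hv ht.2 (h t ht)
      have e1 : duh Q u v t = (∫ τ in Ioo 0 c, Q (t - τ) (u τ) (v τ)) + ∫ τ in Ico c t, Q (t - τ) (u τ) (v τ) := by
        rw [duh, ← setIntegral_union (disjoint_left.2 fun τ h1 h2 => not_lt.2 h2.1 h1.2) measurableSet_Ico
          (hint.mono_set (Ioo_subset_Ioo_right hct.le)) (hint.mono_set fun τ hτ => ⟨hc0.trans_le hτ.1, hτ.2⟩),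
          Ioo_union_Ico_eq_Ioo hc0 hct.le]
      have e2 : ∫ τ in Ico c t, Q (t - τ) (u τ) (v τ) =
          ∫ s in Ioc 0 (t - c), Q s (u (t - s)) (v (t - s)) := by
        have h1 := (volume.measurePreserving_sub_left t).setIntegral_preimage_emb
          (Homeomorph.subLeft t).measurableEmbedding (fun s => Q s (u (t - s)) (v (t - s))) (Ioc 0 (t - c))
        have h2 : (fun τ : ℝ => t - τ) ⁻¹' Ioc 0 (t - c) = Ico c t := by
          ext τ
          simp only [mem_preimage, mem_Ioc, mem_Ico]
          constructor <;> rintro ⟨h1, h2⟩ <;> constructor <;> linarith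
        rw [h2] at h1
        rw [← h1]
        simp only [sub_sub_cancel]
      rw [e1, e2, integral_Ioc_eq_integral_Ioo, setIntegral_indicator measurableSet_Iio]
      congr 3
      ext s
      simp only [mem_Ioo, mem_inter_iff, mem_Iio]
      exact ⟨fun h => ⟨⟨h.1, by linarith [h.2, ht.2]⟩, h.2⟩, fun h => ⟨h.1.1, h.2⟩⟩
  · filter_upwards [hnear] with t ht
    exact hsplit t ht.2 (by linarith [ht.1])
  · exact hsplit t₀ ⟨h0, hT⟩ hct

end Duhamel

end NavierStokesBesov

namespace NavierStokesBesov

/-! ### The fixed point argument -/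

section

variable {σ q T : ℝ} {A B : ℝ → ℝ≥0∞}

theorem normW_mono (hq : 1 ≤ q) (h : ∀ t ∈ Ioo 0 T, A t ≤ B t) : normW σ q T A ≤ normW σ q T B := by
  have hq0 : 0 < q := by linarith
  refine add_le_add (iSup₂_mono fun t ht => mul_le_mul_right (h t ht) _) ?_
  rw [lqW_eq, lqW_eq]
  refine ENNReal.rpow_le_rpow (lintegral_mono_ae ?_) (by positivity)
  filter_upwards [ae_nu_mem T] with t ht
  exact ENNReal.rpow_le_rpow (mul_le_mul_right (h t ht) _) hq0.le

theorem normW_congr (hq : 1 ≤ q) (h : ∀ t ∈ Ioo 0 T, A t = B t) : normW σ q T A = normW σ q T B :=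
  le_antisymm (normW_mono hq fun t ht => (h t ht).le) (normW_mono hq fun t ht => (h t ht).ge)

theorem normW_add_le (hq : 1 ≤ q) (hA : AEMeasurable A (volume.restrict (Ioo 0 T)))
    (hB : AEMeasurable B (volume.restrict (Ioo 0 T))) :
    normW σ q T (fun t => A t + B t) ≤ normW σ q T A + normW σ q T B := by
  have h1 : supW σ T (fun t => A t + B t) ≤ supW σ T A + supW σ T B := by
    rw [supW_le_iff]
    intro t ht
    rw [mul_add]
    exact add_le_add (wt_mul_le_supW ht) (wt_mul_le_supW ht)
  have h2 : lqW σ q T (fun t => A t + B t) ≤ lqW σ q T A + lqW σ q T B := by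
    rw [lqW_eq, lqW_eq, lqW_eq]
    simp_rw [mul_add]
    exact ENNReal.lintegral_Lp_add_le (aemeasurable_weighted hA) (aemeasurable_weighted hB) hq
  exact (add_le_add h1 h2).trans (le_of_eq (by simp only [normW]; ring))

theorem normW_const_mul (hq : 1 ≤ q) {c : ℝ≥0∞} (hc : c ≠ ⊤) :
    normW σ q T (fun t => c * A t) = c * normW σ q T A := by
  have hq0 : 0 < q := by linarith
  have h1 : supW σ T (fun t => c * A t) = c * supW σ T A := by
    simp only [supW, ENNReal.mul_iSup, mul_left_comm c]
  have h2 : lqW σ q T (fun t => c * A t) = c * lqW σ q T A := by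
    rw [lqW_eq, lqW_eq]
    simp_rw [mul_left_comm _ c, fun t => ENNReal.mul_rpow_of_nonneg c (wt σ T t * A t) hq0.le]
    rw [lintegral_const_mul' _ _ (ENNReal.rpow_ne_top_of_nonneg hq0.le hc),
      ENNReal.mul_rpow_of_nonneg _ _ (by positivity), ← ENNReal.rpow_mul, mul_one_div_cancel hq0.ne',
      ENNReal.rpow_one]
  rw [normW, h1, h2, ← mul_add, normW]

theorem normW_zero (hq : 1 ≤ q) : normW σ q T (fun _ => 0) = 0 := by
  have h := normW_const_mul (σ := σ) (T := T) (A := fun _ => 0) hq (c := 0) (by simp)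
  simpa using h

/-- Lower semicontinuity by Fatou. The factor two appears because each of the two summands of the
norm is bounded by `M` separately. -/
theorem normW_le_of_tendsto (hq : 1 ≤ q) {A' : ℕ → ℝ → ℝ≥0∞}
    (hA : ∀ k, AEMeasurable (A' k) (volume.restrict (Ioo 0 T))) {M : ℝ≥0∞} (hM : ∀ k, normW σ q T (A' k) ≤ M)
    (h : ∀ t ∈ Ioo 0 T, Tendsto (fun k => A' k t) atTop (𝓝 (A t))) : normW σ q T A ≤ 2 * M := by
  have hq0 : 0 < q := by linarith
  have h0 : ∀ t ∈ Ioo 0 T, Tendsto (fun k => wt σ T t * A' k t) atTop (𝓝 (wt σ T t * A t)) := fun t ht =>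
    ENNReal.Tendsto.const_mul (h t ht) (Or.inr wt_ne_top)
  rw [two_mul]
  refine add_le_add ?_ ?_
  · rw [supW_le_iff]
    intro t ht
    exact le_of_tendsto' (h0 t ht) fun k => (wt_mul_le_supW ht).trans (le_self_add.trans (hM k))
  · rw [lqW_eq, one_div, ENNReal.rpow_inv_le_iff hq0]
    have h1 : ∀ k, ∫⁻ t, (wt σ T t * A' k t) ^ q ∂nu T ≤ M ^ q := by
      intro k
      rw [← ENNReal.rpow_inv_le_iff hq0, ← one_div, ← lqW_eq]
      exact le_add_self.trans (hM k)
    calc _ = ∫⁻ t, liminf (fun k => (wt σ T t * A' k t) ^ q) atTop ∂nu T := by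
          refine lintegral_congr_ae ?_
          filter_upwards [ae_nu_mem T] with t ht
          exact (((ENNReal.continuous_rpow_const (y := q)).tendsto _).comp (h0 t ht)).liminf_eq.symm
      _ ≤ liminf (fun k => ∫⁻ t, (wt σ T t * A' k t) ^ q ∂nu T) atTop :=
          lintegral_liminf_le' fun k => (aemeasurable_weighted (hA k)).pow_const q
      _ ≤ M ^ q := liminf_le_of_frequently_le' (Frequently.of_forall h1)

end

/-! ### Picard iteration and stability of small fixed points -/

section Picard

variable {E : Type*} [NormedAddCommGroup E] [NormedSpace ℂ E]
  {Q : ℝ → E →L[ℂ] E →L[ℂ] E} {C σ q T t : ℝ} {u v h g : ℝ → E}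

/-- The norm of a curve in the weighted path space. -/
abbrev pn (σ q T : ℝ) (u : ℝ → E) : ℝ≥0∞ := normW σ q T (en u)

/-- The constant in the bilinear estimate. -/
def bilC (C q : ℝ) : ℝ := C * (4 * max 1 q + 8)

theorem bilC_pos (hC : 0 < C) : 0 < bilC C q := by
  unfold bilC
  positivity

theorem en_sub_comm (u v : ℝ → E) : en (fun τ => u τ - v τ) = en fun τ => v τ - u τ := by
  funext τ
  exact enorm_sub_rev _ _

theorem pn_sub_le (hq : 1 ≤ q) (hu : ContinuousOn u (Ioc 0 T)) (hv : ContinuousOn v (Ioc 0 T)) :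
    pn σ q T (fun τ => u τ - v τ) ≤ pn σ q T u + pn σ q T v :=
  (normW_mono hq fun _ _ => enorm_sub_le).trans (normW_add_le hq (aemeasurable_en hu) (aemeasurable_en hv))

theorem pn_sub_triangle (hq : 1 ≤ q) (hu : ContinuousOn u (Ioc 0 T)) (hv : ContinuousOn v (Ioc 0 T))
    (hg : ContinuousOn g (Ioc 0 T)) :
    pn σ q T (fun τ => u τ - g τ) ≤ pn σ q T (fun τ => u τ - v τ) + pn σ q T (fun τ => v τ - g τ) := by
  refine (normW_mono hq fun t _ => ?_).trans (normW_add_le hq (aemeasurable_en (hu.sub hv)) (aemeasurable_en (hv.sub hg)))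
  have : u t - g t = (u t - v t) + (v t - g t) := by abel
  calc en (fun τ => u τ - g τ) t = ‖(u t - v t) + (v t - g t)‖ₑ := by rw [← this]
    _ ≤ _ := enorm_add_le _ _

theorem IsSingularBil.gInt_lt_top (_hQ : IsSingularBil Q C) (hq : 1 ≤ q) (hσ : sigmaCrit q ≤ σ)
    (hu : ContinuousOn u (Ioc 0 T)) (hNu : pn σ q T u < ⊤) (ht : t ∈ Ioc 0 T) : gInt (en u) (en u) t < ⊤ :=
  NavierStokesBesov.gInt_lt_top hq hσ ht (aemeasurable_en hu) (aemeasurable_en hu) hNu hNu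

/-- A pointwise version valid up to and including `t = T`, where the weighted supremum over the open
interval says nothing. It supplies the locally uniform convergence of the iterates. -/
theorem IsSingularBil.wt_duh_sub_le (hQ : IsSingularBil Q C) (hq : 1 ≤ q) (hσ : sigmaCrit q ≤ σ)
    (hu : ContinuousOn u (Ioc 0 T)) (hv : ContinuousOn v (Ioc 0 T)) (hNu : pn σ q T u < ⊤) (hNv : pn σ q T v < ⊤)
    (ht : t ∈ Ioc 0 T) :
    wt σ T t * ‖duh Q u u t - duh Q v v t‖ₑ ≤
      ENNReal.ofReal (bilC C q) * ((pn σ q T u + pn σ q T v) * pn σ q T fun τ => u τ - v τ) := by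
  have hC := hQ.pos
  have h1 := hQ.duh_sub_duh hu hv ht.2 (hQ.gInt_lt_top hq hσ hu hNu ht) (hQ.gInt_lt_top hq hσ hv hNv ht)
  have hsum : AEMeasurable (fun τ => en u τ + en v τ) (volume.restrict (Ioo 0 T)) :=
    (aemeasurable_en hu).add (aemeasurable_en hv)
  have h2 := wt_mul_gInt_le_normW hq hσ ht hsum (aemeasurable_en (hu.sub hv))
  have h3 := normW_add_le (σ := σ) hq (aemeasurable_en hu) (aemeasurable_en hv)
  calc _ ≤ wt σ T t * (ENNReal.ofReal C * gInt (fun τ => en u τ + en v τ) (fun τ => ‖u τ - v τ‖ₑ) t) :=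
        mul_le_mul_right h1 _
    _ = ENNReal.ofReal C * (wt σ T t * gInt (fun τ => en u τ + en v τ) (fun τ => ‖u τ - v τ‖ₑ) t) := by ring
    _ ≤ ENNReal.ofReal C * (ENNReal.ofReal (2 * max 1 q + 4) *
        ((pn σ q T u + pn σ q T v) * pn σ q T fun τ => u τ - v τ)) :=
        mul_le_mul_right (h2.trans (mul_le_mul_right (mul_le_mul_left h3 _) _)) _
    _ ≤ _ := by
        rw [← mul_assoc, ← ENNReal.ofReal_mul hC.le]
        refine mul_le_mul_left (ENNReal.ofReal_le_ofReal (mul_le_mul_of_nonneg_left ?_ hC.le)) _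
        have : 1 ≤ max 1 q := le_max_left _ _
        linarith

theorem IsSingularBil.pn_duh_sub_le (hQ : IsSingularBil Q C) (hq : 1 ≤ q) (hσ : sigmaCrit q ≤ σ)
    (hu : ContinuousOn u (Ioc 0 T)) (hv : ContinuousOn v (Ioc 0 T)) (hNu : pn σ q T u < ⊤) (hNv : pn σ q T v < ⊤) :
    pn σ q T (fun t => duh Q u u t - duh Q v v t) ≤
      ENNReal.ofReal (bilC C q) * ((pn σ q T u + pn σ q T v) * pn σ q T fun τ => u τ - v τ) := by
  have hC := hQ.pos
  have hsum : AEMeasurable (fun τ => en u τ + en v τ) (volume.restrict (Ioo 0 T)) :=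
    (aemeasurable_en hu).add (aemeasurable_en hv)
  have h2 := normW_gInt_le (σ := σ) hq hσ hsum (aemeasurable_en (hu.sub hv))
  have h3 := normW_add_le (σ := σ) hq (aemeasurable_en hu) (aemeasurable_en hv)
  have h4 : pn σ q T (fun t => duh Q u u t - duh Q v v t) ≤ ENNReal.ofReal C *
      normW σ q T (gInt (fun τ => en u τ + en v τ) (en fun τ => u τ - v τ)) := by
    rw [← normW_const_mul hq ENNReal.ofReal_ne_top]
    exact normW_mono hq fun t ht => hQ.duh_sub_duh hu hv ht.2.le
      (hQ.gInt_lt_top hq hσ hu hNu ⟨ht.1, ht.2.le⟩) (hQ.gInt_lt_top hq hσ hv hNv ⟨ht.1, ht.2.le⟩)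
  refine h4.trans ((mul_le_mul_right (h2.trans (mul_le_mul_right (mul_le_mul_left h3 _) _)) _).trans (le_of_eq ?_))
  rw [← mul_assoc, ← ENNReal.ofReal_mul hC.le, bilC]
  rfl

theorem duh_zero (Q : ℝ → E →L[ℂ] E →L[ℂ] E) (t : ℝ) : duh Q (fun _ => 0) (fun _ => 0) t = 0 := by
  simp [duh]

theorem IsSingularBil.pn_duh_le (hQ : IsSingularBil Q C) (hq : 1 ≤ q) (hσ : sigmaCrit q ≤ σ)
    (hu : ContinuousOn u (Ioc 0 T)) (hNu : pn σ q T u < ⊤) :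
    pn σ q T (duh Q u u) ≤ ENNReal.ofReal (bilC C q) * (pn σ q T u * pn σ q T u) := by
  have h0 : pn σ q T (fun _ => (0 : E)) = 0 := by
    have : en (fun _ : ℝ => (0 : E)) = fun _ => 0 := by
      funext t
      exact enorm_zero
    rw [pn, this, normW_zero hq]
  have h1 := hQ.pn_duh_sub_le hq hσ hu continuousOn_const hNu (v := fun _ => 0) (by rw [h0]; exact ENNReal.zero_lt_top)
  simp only [duh_zero, sub_zero, h0, add_zero] at h1
  exact h1

/-- Stability of fixed points of small norm. -/
theorem IsSingularBil.pn_sub_le_of_eq (hQ : IsSingularBil Q C) (hq : 1 ≤ q) (hσ : sigmaCrit q ≤ σ) {η : ℝ≥0∞}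
    (hη : ENNReal.ofReal (bilC C q) * (16 * η) ≤ 1) (hηt : η < ⊤)
    (hu : ContinuousOn u (Ioc 0 T)) (hv : ContinuousOn v (Ioc 0 T)) (hh : ContinuousOn h (Ioc 0 T))
    (hg : ContinuousOn g (Ioc 0 T)) (hNu : pn σ q T u ≤ 4 * η) (hNv : pn σ q T v ≤ 4 * η)
    (eu : ∀ t ∈ Ioo 0 T, u t = h t - duh Q u u t) (ev : ∀ t ∈ Ioo 0 T, v t = g t - duh Q v v t) :
    pn σ q T (fun t => u t - v t) ≤ 2 * pn σ q T fun t => h t - g t := by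
  have h4 : 4 * η < ⊤ := ENNReal.mul_lt_top (by simp) hηt
  have hNu' := hNu.trans_lt h4
  have hNv' := hNv.trans_lt h4
  have hcu := hQ.continuousOn_duh hu hu fun t ht => hQ.gInt_lt_top hq hσ hu hNu' ht
  have hcv := hQ.continuousOn_duh hv hv fun t ht => hQ.gInt_lt_top hq hσ hv hNv' ht
  set N := pn σ q T fun t => u t - v t
  set H := pn σ q T fun t => h t - g t
  have hN : N < ⊤ := (pn_sub_le hq hu hv).trans_lt (ENNReal.add_lt_top.2 ⟨hNu', hNv'⟩)
  have h1 : N ≤ H + pn σ q T fun t => duh Q u u t - duh Q v v t := by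
    refine le_trans (le_of_eq (normW_congr hq fun t ht => ?_)) (pn_sub_le hq (hh.sub hg) (hcu.sub hcv))
    change ‖u t - v t‖ₑ = ‖(h t - g t) - (duh Q u u t - duh Q v v t)‖ₑ
    rw [eu t ht, ev t ht]
    congr 1
    abel
  have h2 : 2 * (pn σ q T fun t => duh Q u u t - duh Q v v t) ≤ N := by
    -- With both norms at most `4η` the Lipschitz constant is `8η` times the bilinear constant, at
    -- most one half; the finite norm of the difference can then be absorbed.
    calc _ ≤ 2 * (ENNReal.ofReal (bilC C q) * ((4 * η + 4 * η) * N)) := by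
          refine mul_le_mul_right ((hQ.pn_duh_sub_le hq hσ hu hv hNu' hNv').trans ?_) _
          exact mul_le_mul_right (mul_le_mul_left (add_le_add hNu hNv) _) _
      _ = ENNReal.ofReal (bilC C q) * (16 * η) * N := by ring
      _ ≤ 1 * N := mul_le_mul_left hη _
      _ = N := one_mul N
  have h3 : N + N ≤ N + 2 * H := by
    calc N + N = 2 * N := (two_mul N).symm
      _ ≤ 2 * (H + pn σ q T fun t => duh Q u u t - duh Q v v t) := mul_le_mul_right h1 _
      _ = 2 * (pn σ q T fun t => duh Q u u t - duh Q v v t) + 2 * H := by ring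
      _ ≤ _ := add_le_add h2 le_rfl
  exact (ENNReal.add_le_add_iff_left hN.ne).1 h3

/-- The Picard iterates. -/
def picard (Q : ℝ → E →L[ℂ] E →L[ℂ] E) (h : ℝ → E) : ℕ → ℝ → E
  | 0 => h
  | k + 1 => fun t => h t - duh Q (picard Q h k) (picard Q h k) t

theorem picard_succ (k : ℕ) (t : ℝ) :
    picard Q h (k + 1) t = h t - duh Q (picard Q h k) (picard Q h k) t := rfl

/-- The ball of radius `2η` is preserved: the quadratic term is at most `4η²` times the bilinear
constant, well below `η`. -/
theorem IsSingularBil.picard_bound (hQ : IsSingularBil Q C) (hq : 1 ≤ q) (hσ : sigmaCrit q ≤ σ) {η : ℝ≥0∞}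
    (hη : ENNReal.ofReal (bilC C q) * (16 * η) ≤ 1) (hηt : η < ⊤)
    (hh : ContinuousOn h (Ioc 0 T)) (hNh : pn σ q T h ≤ η) (k : ℕ) :
    ContinuousOn (picard Q h k) (Ioc 0 T) ∧ pn σ q T (picard Q h k) ≤ 2 * η := by
  have h2 : 2 * η < ⊤ := ENNReal.mul_lt_top (by simp) hηt
  induction k with
  | zero => exact ⟨hh, hNh.trans (by rw [two_mul]; exact le_self_add)⟩
  | succ k ih =>
    obtain ⟨hc, hN⟩ := ih
    have hN' := hN.trans_lt h2
    have hcd := hQ.continuousOn_duh hc hc fun t ht => hQ.gInt_lt_top hq hσ hc hN' ht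
    refine ⟨hh.sub hcd, ?_⟩
    calc pn σ q T (picard Q h (k + 1)) ≤ pn σ q T h + pn σ q T (duh Q (picard Q h k) (picard Q h k)) :=
          pn_sub_le hq hh hcd
      _ ≤ η + ENNReal.ofReal (bilC C q) * ((2 * η) * (2 * η)) :=
          add_le_add hNh ((hQ.pn_duh_le hq hσ hc hN').trans (mul_le_mul_right (mul_le_mul' hN hN) _))
      _ ≤ η + ENNReal.ofReal (bilC C q) * (16 * η) * η := by
          refine add_le_add le_rfl ?_
          calc _ = ENNReal.ofReal (bilC C q) * (4 * η) * η := by ring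
            _ ≤ _ := mul_le_mul_left (mul_le_mul_right (mul_le_mul_left (by norm_num) _) _) _
      _ ≤ η + 1 * η := add_le_add le_rfl (mul_le_mul_left hη _)
      _ = 2 * η := by ring

/-- On the ball of radius `2η` the contraction factor is `4η` times the bilinear constant, at most
one quarter. -/
theorem IsSingularBil.picard_diff (hQ : IsSingularBil Q C) (hq : 1 ≤ q) (hσ : sigmaCrit q ≤ σ) {η : ℝ≥0∞}
    (hη : ENNReal.ofReal (bilC C q) * (16 * η) ≤ 1) (hηt : η < ⊤)
    (hh : ContinuousOn h (Ioc 0 T)) (hNh : pn σ q T h ≤ η) (k : ℕ) :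
    pn σ q T (fun t => picard Q h (k + 1) t - picard Q h k t) ≤ 4⁻¹ ^ k * (4 * η) := by
  have h2 : 2 * η < ⊤ := ENNReal.mul_lt_top (by simp) hηt
  have hb := hQ.picard_bound hq hσ hη hηt hh hNh
  induction k with
  | zero =>
    refine (pn_sub_le hq (hb 1).1 (hb 0).1).trans ((add_le_add (hb 1).2 (hb 0).2).trans (le_of_eq ?_))
    ring
  | succ k ih =>
    have h1 := hQ.pn_duh_sub_le hq hσ (hb k).1 (hb (k + 1)).1 ((hb k).2.trans_lt h2) ((hb (k + 1)).2.trans_lt h2)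
    have h3 : pn σ q T (fun t => picard Q h (k + 1 + 1) t - picard Q h (k + 1) t) =
        pn σ q T (fun t => duh Q (picard Q h k) (picard Q h k) t -
          duh Q (picard Q h (k + 1)) (picard Q h (k + 1)) t) := by
      refine normW_congr hq fun t _ => ?_
      change ‖picard Q h (k + 1 + 1) t - picard Q h (k + 1) t‖ₑ = ‖_‖ₑ
      rw [picard_succ (k + 1), picard_succ k, sub_sub_sub_cancel_left]
    rw [h3]
    have h5 : pn σ q T (fun τ => picard Q h k τ - picard Q h (k + 1) τ) ≤ 4⁻¹ ^ k * (4 * η) := by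
      rw [pn, en_sub_comm]
      exact ih
    calc _ ≤ ENNReal.ofReal (bilC C q) * ((2 * η + 2 * η) * (4⁻¹ ^ k * (4 * η))) :=
          h1.trans (mul_le_mul_right (mul_le_mul' (add_le_add (hb k).2 (hb (k + 1)).2) h5) _)
      _ = 4⁻¹ ^ k * (ENNReal.ofReal (bilC C q) * (16 * η) * η) := by ring
      _ ≤ 4⁻¹ ^ k * (1 * η) := mul_le_mul_right (mul_le_mul_left hη _) _
      _ = 4⁻¹ ^ (k + 1) * (4 * η) := by
        rw [pow_succ, mul_assoc, ← mul_assoc 4⁻¹, ENNReal.inv_mul_cancel (by simp) (by simp)]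

theorem IsSingularBil.picard_diff_add (hQ : IsSingularBil Q C) (hq : 1 ≤ q) (hσ : sigmaCrit q ≤ σ) {η : ℝ≥0∞}
    (hη : ENNReal.ofReal (bilC C q) * (16 * η) ≤ 1) (hηt : η < ⊤)
    (hh : ContinuousOn h (Ioc 0 T)) (hNh : pn σ q T h ≤ η) (m k : ℕ) :
    pn σ q T (fun t => picard Q h (k + m) t - picard Q h k t) ≤ 4⁻¹ ^ k * (8 * η) := by
  have hb := hQ.picard_bound hq hσ hη hηt hh hNh
  induction m generalizing k with
  | zero =>
    have : en (fun t => picard Q h (k + 0) t - picard Q h k t) = fun _ => 0 := by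
      funext t
      simp [en]
    rw [pn, this, normW_zero hq]
    exact zero_le
  | succ m ih =>
    have h1 := ih (k + 1)
    rw [show k + 1 + m = k + (m + 1) by ring] at h1
    calc _ ≤ 4⁻¹ ^ (k + 1) * (8 * η) + 4⁻¹ ^ k * (4 * η) :=
          (pn_sub_triangle hq (hb _).1 (hb (k + 1)).1 (hb k).1).trans
            (add_le_add h1 (hQ.picard_diff hq hσ hη hηt hh hNh k))
      _ = 4⁻¹ ^ k * ((4⁻¹ * 4) * (2 * η)) + 4⁻¹ ^ k * (4 * η) := by ring
      _ = 4⁻¹ ^ k * (6 * η) := by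
          rw [ENNReal.inv_mul_cancel (by simp) (by simp)]
          ring
      _ ≤ _ := mul_le_mul_right (mul_le_mul_left (by norm_num) _) _

/-- Existence of a fixed point of small norm. -/
theorem IsSingularBil.exists_fixed_point [CompleteSpace E] (hQ : IsSingularBil Q C) (hq : 1 ≤ q)
    (hσ : sigmaCrit q ≤ σ) {η : ℝ≥0∞}
    (hη : ENNReal.ofReal (bilC C q) * (16 * η) ≤ 1) (hηt : η < ⊤)
    (hh : ContinuousOn h (Ioc 0 T)) (hNh : pn σ q T h ≤ η) :
    ∃ u : ℝ → E, ContinuousOn u (Ioc 0 T) ∧ pn σ q T u ≤ 4 * η ∧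
      (∀ t ∈ Ioc 0 T, u t = h t - duh Q u u t) ∧
      ∀ F : Submodule ℝ E, IsClosed (F : Set E) → (∀ s, 0 < s → ∀ f ∈ F, ∀ g ∈ F, Q s f g ∈ F) →
        (∀ t ∈ Ioc 0 T, h t ∈ F) → ∀ t ∈ Ioc 0 T, u t ∈ F := by
  have h2 : 2 * η < ⊤ := ENNReal.mul_lt_top (by simp) hηt
  have hb := hQ.picard_bound hq hσ hη hηt hh hNh
  have hd := hQ.picard_diff hq hσ hη hηt hh hNh
  set w : ℕ → ℝ → E := picard Q h
  -- locally uniform geometric convergence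
  have hgeo : ∀ δ, 0 < δ → ∃ a : ℝ, ∀ t ∈ Icc δ T, ∀ k : ℕ, dist (w (k + 1) t) (w (k + 1 + 1) t) ≤ a * (1 / 4) ^ k := by
    intro δ hδ
    have hsδ : ENNReal.ofReal (√δ) ≠ 0 := by
      rw [ne_eq, ENNReal.ofReal_eq_zero, not_le]
      exact Real.sqrt_pos.2 hδ
    -- On `[δ, T]` the weight is at least `√δ`, which converts weighted bounds into uniform ones.
    refine ⟨(η / ENNReal.ofReal (√δ)).toReal, fun t ht k => ?_⟩
    have ht0 : 0 < t := hδ.trans_le ht.1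
    have hw : ENNReal.ofReal (√δ) ≤ wt σ T t := by
      rw [wt_eq ht0 ht.2]
      refine (ENNReal.ofReal_le_ofReal (Real.sqrt_le_sqrt ht.1)).trans ?_
      exact le_mul_of_one_le_right zero_le (one_le_lw ht0 ht.2
        (le_trans (by norm_num) (half_le_sigmaCrit.trans hσ)))
    have h1 := hQ.wt_duh_sub_le hq hσ (hb (k + 1)).1 (hb k).1 ((hb (k + 1)).2.trans_lt h2) ((hb k).2.trans_lt h2)
      (t := t) ⟨ht0, ht.2⟩
    -- The sequence is started at index one because this formula needs a predecessor of both
    -- iterates.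
    have h3 : w (k + 1) t - w (k + 1 + 1) t = duh Q (w (k + 1)) (w (k + 1)) t - duh Q (w k) (w k) t := by
      simp only [w, picard_succ (k + 1), picard_succ k, sub_sub_sub_cancel_left]
    have h4 : ENNReal.ofReal (√δ) * ‖w (k + 1) t - w (k + 1 + 1) t‖ₑ ≤ 4⁻¹ ^ k * η := by
      calc _ ≤ wt σ T t * ‖w (k + 1) t - w (k + 1 + 1) t‖ₑ := mul_le_mul_left hw _
        _ ≤ ENNReal.ofReal (bilC C q) * ((2 * η + 2 * η) * (4⁻¹ ^ k * (4 * η))) := by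
            rw [h3]
            exact h1.trans (mul_le_mul_right (mul_le_mul' (add_le_add (hb (k + 1)).2 (hb k).2) (hd k)) _)
        _ = 4⁻¹ ^ k * (ENNReal.ofReal (bilC C q) * (16 * η) * η) := by ring
        _ ≤ 4⁻¹ ^ k * (1 * η) := mul_le_mul_right (mul_le_mul_left hη _) _
        _ = _ := by rw [one_mul]
    have h5 : ‖w (k + 1) t - w (k + 1 + 1) t‖ₑ ≤ η / ENNReal.ofReal (√δ) * 4⁻¹ ^ k := by
      rw [mul_comm] at h4
      have := (ENNReal.le_div_iff_mul_le (Or.inl hsδ) (Or.inl ENNReal.ofReal_ne_top)).2 h4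
      rwa [mul_comm, div_eq_mul_inv, mul_right_comm, ← div_eq_mul_inv] at this
    have hfin : η / ENNReal.ofReal (√δ) ≠ ⊤ := ENNReal.div_ne_top hηt.ne hsδ
    rw [dist_eq_norm, ← toReal_enorm]
    have := ENNReal.toReal_mono (ENNReal.mul_ne_top hfin (ENNReal.pow_ne_top (by simp))) h5
    simpa [ENNReal.toReal_mul] using this
  have hlim : ∀ t : ℝ, ∃ x : E, t ∈ Ioc 0 T → Tendsto (fun k => w (k + 1) t) atTop (𝓝 x) := by
    intro t
    by_cases ht : t ∈ Ioc 0 T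
    · obtain ⟨a, ha⟩ := hgeo t ht.1
      obtain ⟨x, hx⟩ := cauchySeq_tendsto_of_complete
        (cauchySeq_of_le_geometric (1 / 4) a (by norm_num) (ha t ⟨le_rfl, ht.2⟩))
      exact ⟨x, fun _ => hx⟩
    · exact ⟨0, fun h => absurd h ht⟩
  choose u hu using hlim
  have hcu : ContinuousOn u (Ioc 0 T) := by
    intro t₀ ht₀
    obtain ⟨a, ha⟩ := hgeo (t₀ / 2) (half_pos ht₀.1)
    have hsub : Icc (t₀ / 2) T ⊆ Ioc 0 T := fun t ht => ⟨(half_pos ht₀.1).trans_le ht.1, ht.2⟩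
    have hunif : TendstoUniformlyOn (fun k t => w (k + 1) t) u atTop (Icc (t₀ / 2) T) := by
      rw [Metric.tendstoUniformlyOn_iff]
      intro ε hε
      have hz : Tendsto (fun k : ℕ => a * (1 / 4) ^ k / (1 - 1 / 4)) atTop (𝓝 0) := by
        have := ((tendsto_pow_atTop_nhds_zero_of_lt_one (r := (1 / 4 : ℝ)) (by norm_num) (by norm_num)).const_mul
          a).div_const (1 - 1 / 4)
        simpa using this
      filter_upwards [hz.eventually (gt_mem_nhds hε)] with k hk t ht
      rw [dist_comm]
      exact (dist_le_of_le_geometric_of_tendsto (1 / 4) a (by norm_num) (ha t ht) (hu t (hsub ht)) k).trans_lt hk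
    have hc := hunif.continuousOn (Frequently.of_forall fun k => (hb (k + 1)).1.mono hsub)
    refine (hc t₀ ⟨by linarith [ht₀.1], ht₀.2⟩).mono_of_mem_nhdsWithin ?_
    have : Ioi (t₀ / 2) ∈ 𝓝 t₀ := Ioi_mem_nhds (by linarith [ht₀.1])
    filter_upwards [nhdsWithin_le_nhds this, self_mem_nhdsWithin] with t h1 h2 using ⟨le_of_lt h1, h2.2⟩
  have hIoo : ∀ t ∈ Ioo 0 T, Tendsto (fun k => w (k + 1) t) atTop (𝓝 (u t)) := fun t ht => hu t ⟨ht.1, ht.2.le⟩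
  -- The iterates have norm at most `2η`, and the limit loses a further factor two in
  -- `normW_le_of_tendsto`; hence the radius `4η`.
  have hNu : pn σ q T u ≤ 4 * η := by
    refine (normW_le_of_tendsto hq (fun k => aemeasurable_en (hb (k + 1)).1) (fun k => (hb (k + 1)).2)
      fun t ht => (hIoo t ht).enorm).trans (le_of_eq (by ring))
  have h4 : 4 * η < ⊤ := ENNReal.mul_lt_top (by simp) hηt
  have hdiff : ∀ k, pn σ q T (fun t => u t - w k t) ≤ 2 * (4⁻¹ ^ k * (8 * η)) := by
    intro k
    refine normW_le_of_tendsto hq (A' := fun m => en fun t => w (k + (m + 1)) t - w k t)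
      (fun m => aemeasurable_en ((hb _).1.sub (hb k).1))
      (fun m => hQ.picard_diff_add hq hσ hη hηt hh hNh (m + 1) k) fun t ht => ?_
    have h1 : Tendsto (fun m => w (k + (m + 1)) t) atTop (𝓝 (u t)) := by
      have := (hIoo t ht).comp (tendsto_add_atTop_nat k)
      refine this.congr fun m => ?_
      simp only [Function.comp_apply]
      congr 1
      ring
    exact (h1.sub_const _).enorm
  refine ⟨u, hcu, hNu, fun t ht => ?_, fun F hF hFQ hFh t ht => ?_⟩
  · refine tendsto_nhds_unique (hu t ht) ?_
    have hz : Tendsto (fun k => duh Q (w k) (w k) t) atTop (𝓝 (duh Q u u t)) := by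
      rw [tendsto_iff_enorm_sub_tendsto_zero]
      have hbd : ∀ k, ‖duh Q (w k) (w k) t - duh Q u u t‖ₑ ≤ (wt σ T t)⁻¹ * (ENNReal.ofReal (bilC C q) *
          ((2 * η + 4 * η) * (2 * (4⁻¹ ^ k * (8 * η))))) := by
        intro k
        have h1 := hQ.wt_duh_sub_le hq hσ (hb k).1 hcu ((hb k).2.trans_lt h2) (hNu.trans_lt h4) ht
        have h5 : pn σ q T (fun τ => w k τ - u τ) ≤ 2 * (4⁻¹ ^ k * (8 * η)) := by
          rw [pn, en_sub_comm]
          exact hdiff k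
        have h3 := h1.trans (mul_le_mul_right (mul_le_mul' (add_le_add (hb k).2 hNu) h5) _)
        calc _ = (wt σ T t)⁻¹ * (wt σ T t * ‖duh Q (w k) (w k) t - duh Q u u t‖ₑ) := by
              rw [← mul_assoc, ENNReal.inv_mul_cancel (wt_pos ht.1 ht.2) wt_ne_top, one_mul]
          _ ≤ _ := mul_le_mul_right h3 _
      refine tendsto_of_tendsto_of_tendsto_of_le_of_le tendsto_const_nhds ?_ (fun _ => zero_le) hbd
      have hp : Tendsto (fun k : ℕ => (4⁻¹ : ℝ≥0∞) ^ k) atTop (𝓝 0) :=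
        ENNReal.tendsto_pow_atTop_nhds_zero_of_lt_one (by simp)
      set c : ℝ≥0∞ := (wt σ T t)⁻¹ * (ENNReal.ofReal (bilC C q) * ((2 * η + 4 * η) * (2 * (8 * η))))
      have hc : c ≠ ⊤ := by
        have h8 : 8 * η < ⊤ := ENNReal.mul_lt_top (by simp) hηt
        exact ENNReal.mul_ne_top (ENNReal.inv_ne_top.2 (wt_pos ht.1 ht.2)) (ENNReal.mul_lt_top ENNReal.ofReal_lt_top
          (ENNReal.mul_lt_top (ENNReal.add_lt_top.2 ⟨h2, h4⟩) (ENNReal.mul_lt_top (by simp) h8))).ne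
      have := ENNReal.Tendsto.const_mul hp (Or.inr hc)
      rw [mul_zero] at this
      refine this.congr fun k => ?_
      simp only [c]
      ring
    have := hz.const_sub (h t)
    exact this
  · refine hF.mem_of_tendsto (hu t ht) (Eventually.of_forall fun k => ?_)
    have hmem : ∀ k, ∀ t ∈ Ioc 0 T, w k t ∈ F := by
      intro k
      induction k with
      | zero => exact hFh
      | succ k ih => exact fun t ht => F.sub_mem (hFh t ht) (IsSingularBil.duh_mem hF hFQ ht.2 ih ih)
    exact hmem _ t ht

end Picard

end NavierStokesBesov

namespace NavierStokesBesov

variable {n : ℕ} {V W : Type*} [NormedAddCommGroup V] [NormedSpace ℂ V] [CompleteSpace V]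
  [NormedAddCommGroup W] [NormedSpace ℂ W] [CompleteSpace W]

/-! ### Uniqueness -/

section Gronwall

variable {σ q T : ℝ} {A m : ℝ → ℝ≥0∞}

/-- Absolute continuity of the integral. -/
theorem tendsto_lqOn_zero (hq : 1 ≤ q) (h : lqW σ q T A < ⊤) :
    Tendsto (fun t => lqOn σ q T t A) (𝓝[>] 0) (𝓝 0) := by
  have hq0 : 0 < q := by linarith
  set f : ℝ → ℝ≥0∞ := fun τ => (wt σ T τ * A τ) ^ q * ENNReal.ofReal (1 / τ)
  have hf : ∫⁻ τ in Ioo 0 T, f τ ≠ ⊤ := by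
    rw [lqW_eq, lintegral_nu] at h
    intro hf
    rw [hf, ENNReal.top_rpow_of_pos (by positivity)] at h
    exact lt_irrefl _ h
  have hs : Tendsto (volume.restrict (Ioo 0 T) ∘ fun t : ℝ => Ioo 0 t) (𝓝[>] 0) (𝓝 0) := by
    have h1 : Tendsto (fun t : ℝ => ENNReal.ofReal t) (𝓝[>] 0) (𝓝 0) := by
      simpa using (ENNReal.continuous_ofReal.tendsto 0).mono_left nhdsWithin_le_nhds
    refine tendsto_of_tendsto_of_tendsto_of_le_of_le tendsto_const_nhds h1 (fun _ => zero_le) fun t => ?_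
    exact (Measure.restrict_apply_le _ _).trans (by simp)
  have h2 := (tendsto_setLIntegral_zero hf hs).ennrpow_const (1 / q)
  rw [ENNReal.zero_rpow_of_pos (by positivity)] at h2
  refine h2.congr fun t => ?_
  rw [lqOn, setLIntegral_nu T measurableSet_Ioo, Measure.restrict_restrict measurableSet_Ioo, inter_comm]

theorem tendsto_lw_neg (hT : 0 < T) {e : ℝ} (he : 0 < e) : Tendsto (lw T (-e)) (𝓝[>] 0) (𝓝 0) := by
  have h1 : Tendsto (ell T) (𝓝[>] 0) atTop := by
    refine tendsto_atTop_add_const_left _ _ (Real.tendsto_log_atTop.comp ?_)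
    exact (tendsto_inv_nhdsGT_zero.const_mul_atTop hT).congr fun t => (div_eq_mul_inv T t).symm
  have h2 := (tendsto_rpow_neg_atTop he).comp h1
  have h3 := (ENNReal.continuous_ofReal.tendsto 0).comp h2
  rwa [ENNReal.ofReal_zero] at h3

/-- The small factor in the pointwise bound of the weakly singular integral. -/
theorem eventually_factor_le (hq : 1 ≤ q) (hσ : sigmaCrit q ≤ σ) (hT : 0 < T) (hA : normW σ q T A < ⊤)
    {c ε : ℝ≥0∞} (hc : c ≠ ⊤) (hε : 0 < ε) :
    ∀ᶠ t in 𝓝[>] 0, c * (2 * lqOn σ q T t A + 4 * (lw T (-σ) t * supW σ T A)) ≤ ε := by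
  have hσ0 := half_le_sigmaCrit.trans hσ
  have h1 := tendsto_lqOn_zero hq (lt_of_le_of_lt le_add_self hA)
  have hs : supW σ T A ≠ ⊤ := (lt_of_le_of_lt le_self_add hA).ne
  have h2 := ENNReal.Tendsto.mul_const (tendsto_lw_neg hT (show 0 < σ by linarith)) (Or.inr hs)
  have h3 := ENNReal.Tendsto.const_mul ((ENNReal.Tendsto.const_mul h1 (Or.inr (show (2 : ℝ≥0∞) ≠ ⊤ by simp))).add
    (ENNReal.Tendsto.const_mul h2 (Or.inr (show (4 : ℝ≥0∞) ≠ ⊤ by simp)))) (Or.inr hc)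
  simp only [mul_zero, zero_mul, add_zero] at h3
  exact h3.eventually_le_const hε

theorem le_half_eq_zero {x : ℝ≥0∞} (hx : x ≠ ⊤) (h : x ≤ 2⁻¹ * x) : x = 0 := by
  by_contra h0
  have := ENNReal.half_lt_self h0 hx
  rw [div_eq_mul_inv, mul_comm] at this
  exact absurd h (not_le.2 this)

/-- A Gronwall lemma for the weakly singular integral. -/
theorem eq_zero_of_le_gInt (hq : 1 ≤ q) (hσ : sigmaCrit q ≤ σ) (hA : AEMeasurable A (volume.restrict (Ioo 0 T)))
    (hNA : normW σ q T A < ⊤) (hmA : ∀ t ∈ Ioo 0 T, m t ≤ A t) {c : ℝ≥0∞} (hc : c ≠ ⊤)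
    (h : ∀ t ∈ Ioo 0 T, m t ≤ c * gInt A m t) : ∀ t ∈ Ioo 0 T, m t = 0 := by
  intro t₁ ht₁
  have hT : 0 < T := ht₁.1.trans ht₁.2
  have hσ0 : 0 < σ := lt_of_lt_of_le (by norm_num) (half_le_sigmaCrit.trans hσ)
  have hsA : supW σ T A < ⊤ := lt_of_le_of_lt le_self_add hNA
  -- vanishing on a short interval
  obtain ⟨s₀, hs₀, hstart⟩ : ∃ s₀, 0 < s₀ ∧ ∀ t ∈ Ioo 0 T, t < s₀ → m t = 0 := by
    have hev := (eventually_factor_le hq hσ hT hNA (ε := 2⁻¹) hc (by simp)).and (Ioo_mem_nhdsGT hT)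
    obtain ⟨s₀, hs₀, hfac⟩ := (nhdsGT_basis (0 : ℝ)).eventually_iff.1 hev
    refine ⟨s₀, hs₀, fun t ht hts => ?_⟩
    set M := ⨆ τ ∈ Ioo 0 s₀ ∩ Ioo 0 T, wt σ T τ * m τ
    have hM1 : ∀ τ ∈ Ioo 0 s₀ ∩ Ioo 0 T, wt σ T τ * m τ ≤ M := fun τ hτ =>
      le_iSup₂ (f := fun τ (_ : τ ∈ Ioo 0 s₀ ∩ Ioo 0 T) => wt σ T τ * m τ) τ hτ
    -- Finiteness is inherited from `A`; without it `M ≤ M/2` would not force `M = 0`.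
    have hMt : M ≠ ⊤ := by
      refine (lt_of_le_of_lt (iSup₂_le fun τ hτ => ?_) hsA).ne
      exact (mul_le_mul_right (hmA τ hτ.2) _).trans (wt_mul_le_supW hτ.2)
    have hM2 : M ≤ 2⁻¹ * M := by
      refine iSup₂_le fun τ hτ => ?_
      have h1 := wt_mul_gInt_le_sup hq hσ ⟨hτ.2.1, hτ.2.2.le⟩ hA (M := M) (B := m)
        fun r hr => hM1 r ⟨⟨hr.1, hr.2.trans hτ.1.2⟩, hr.1, hr.2.trans hτ.2.2⟩
      calc _ ≤ wt σ T τ * (c * gInt A m τ) := mul_le_mul_right (h τ hτ.2) _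
        _ = c * (wt σ T τ * gInt A m τ) := by ring
        _ ≤ c * ((2 * lqOn σ q T τ A + 4 * (lw T (-σ) τ * supW σ T A)) * M) := mul_le_mul_right h1 _
        _ ≤ 2⁻¹ * M := by
            rw [← mul_assoc]
            exact mul_le_mul_left (hfac hτ.1).1 _
    have h0 := le_half_eq_zero hMt hM2
    have := hM1 t ⟨⟨ht.1, hts⟩, ht⟩
    rw [h0, nonpos_iff_eq_zero, mul_eq_zero] at this
    exact this.resolve_left (wt_pos ht.1 ht.2.le)
  -- continuation with a fixed step
  set K : ℝ≥0∞ := supW σ T A / ENNReal.ofReal (√s₀)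
  have hs₀' : ENNReal.ofReal (√s₀) ≠ 0 := by simpa using Real.sqrt_pos.2 hs₀
  have hK : K ≠ ⊤ := ENNReal.div_ne_top hsA.ne hs₀'
  have hAK : ∀ t ∈ Ioo 0 T, s₀ ≤ t → A t ≤ K := by
    intro t ht hst
    rw [ENNReal.le_div_iff_mul_le (Or.inl hs₀') (Or.inl ENNReal.ofReal_ne_top), mul_comm]
    refine le_trans (mul_le_mul_left ?_ _) (wt_mul_le_supW (σ := σ) ht)
    rw [wt_eq ht.1 ht.2.le]
    exact (ENNReal.ofReal_le_ofReal (Real.sqrt_le_sqrt hst)).trans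
      (le_mul_of_one_le_right zero_le (one_le_lw ht.1 ht.2.le hσ0.le))
  -- The step depends only on the bound `K` of `A` beyond `s₀`, so every time is reached after
  -- finitely many steps.
  obtain ⟨d, hd, hdK⟩ : ∃ d, 0 < d ∧ c * K * ENNReal.ofReal (2 * √d) ≤ 2⁻¹ := by
    have h1 : Tendsto (fun d : ℝ => c * K * ENNReal.ofReal (2 * √d)) (𝓝[>] 0) (𝓝 0) := by
      have h2 : Tendsto (fun d : ℝ => ENNReal.ofReal (2 * √d)) (𝓝[>] 0) (𝓝 0) := by
        have : Continuous fun d : ℝ => ENNReal.ofReal (2 * √d) := ENNReal.continuous_ofReal.comp (by fun_prop)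
        simpa using (this.tendsto 0).mono_left nhdsWithin_le_nhds
      simpa using ENNReal.Tendsto.const_mul h2 (Or.inr (ENNReal.mul_ne_top hc hK))
    obtain ⟨d, h2, h3⟩ := ((h1.eventually_le_const (show (0 : ℝ≥0∞) < 2⁻¹ by simp)).and self_mem_nhdsWithin).exists
    exact ⟨d, h3, h2⟩
  have hstep : ∀ k : ℕ, ∀ t ∈ Ioo 0 T, t < s₀ + k * d → m t = 0 := by
    intro k
    induction k with
    | zero => simpa using hstart
    | succ k ih =>
      intro t ht htk
      set a := s₀ + k * d with ha
      have has : s₀ ≤ a := by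
        rw [ha]
        have : 0 ≤ (k : ℝ) * d := by positivity
        linarith
      set S := ⨆ τ ∈ Ioo 0 (a + d) ∩ Ioo 0 T, m τ
      have hS1 : ∀ τ ∈ Ioo 0 (a + d) ∩ Ioo 0 T, m τ ≤ S := fun τ hτ =>
        le_iSup₂ (f := fun τ (_ : τ ∈ Ioo 0 (a + d) ∩ Ioo 0 T) => m τ) τ hτ
      have hSK : S ≠ ⊤ := by
        refine (lt_of_le_of_lt (iSup₂_le fun τ hτ => ?_) hK.lt_top).ne
        rcases lt_or_ge τ a with h1 | h1
        · rw [ih τ hτ.2 h1]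
          exact zero_le
        · exact (hmA τ hτ.2).trans (hAK τ hτ.2 (has.trans h1))
      have hS2 : S ≤ 2⁻¹ * S := by
        refine iSup₂_le fun τ hτ => ?_
        rcases lt_or_ge τ a with h1 | h1
        · rw [ih τ hτ.2 h1]
          exact zero_le
        · have hg : gInt A m τ ≤ K * S * ENNReal.ofReal (2 * √d) := by
            calc gInt A m τ ≤ ∫⁻ r, (Ioo a τ).indicator (fun r => K * S * ENNReal.ofReal (√(τ - r))⁻¹) r ∂volume.restrict (Ioo 0 τ ∩ {a}ᶜ) := by
                  rw [gInt, Measure.restrict_congr_set (show (Ioo 0 τ ∩ {a}ᶜ : Set ℝ) =ᵐ[volume] Ioo 0 τ from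
                    inter_ae_eq_left_of_ae_eq_univ (by simp))]
                  refine lintegral_mono_ae ?_
                  filter_upwards [ae_restrict_mem measurableSet_Ioo, ae_restrict_of_ae (Measure.ae_ne volume a)] with r hr hra
                  have hrT : r ∈ Ioo 0 T := ⟨hr.1, hr.2.trans hτ.2.2⟩
                  rcases lt_or_gt_of_ne hra with h2 | h2
                  · rw [ih r hrT h2]
                    simp
                  · rw [indicator_of_mem (show r ∈ Ioo a τ from ⟨h2, hr.2⟩), mul_comm]
                    exact mul_le_mul_left (mul_le_mul' (hAK r hrT (has.trans h2.le))
                      (hS1 r ⟨⟨hr.1, hr.2.trans hτ.1.2⟩, hrT⟩)) _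
              _ ≤ ∫⁻ r, (Ioo a τ).indicator (fun r => K * S * ENNReal.ofReal (√(τ - r))⁻¹) r :=
                  setLIntegral_le_lintegral _ _
              _ = K * S * ENNReal.ofReal (2 * √(τ - a)) := by
                  rw [lintegral_indicator measurableSet_Ioo, lintegral_const_mul' _ _ (ENNReal.mul_ne_top hK hSK),
                    lintegral_inv_sqrt_sub h1]
              _ ≤ _ := by
                  refine mul_le_mul_right (ENNReal.ofReal_le_ofReal ?_) _
                  have : √(τ - a) ≤ √d := Real.sqrt_le_sqrt (by linarith [hτ.1.2])
                  linarith
          calc m τ ≤ c * (K * S * ENNReal.ofReal (2 * √d)) := (h τ hτ.2).trans (mul_le_mul_right hg _)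
            _ = c * K * ENNReal.ofReal (2 * √d) * S := by ring
            _ ≤ _ := mul_le_mul_left hdK _
      have := hS1 t ⟨⟨ht.1, by rw [ha]; push_cast at htk; linarith⟩, ht⟩
      rw [le_half_eq_zero hSK hS2] at this
      exact nonpos_iff_eq_zero.1 this
  obtain ⟨k, hk⟩ := exists_nat_gt ((t₁ - s₀) / d)
  rw [div_lt_iff₀ hd] at hk
  exact hstep k t₁ ht₁ (by linarith)

end Gronwall

/-! ### The integral inequality for two mild solutions -/

theorem exists_of_memLinftyLoc {T : ℝ} {u : ℝ → TempDist n} (hu : MemLinftyLoc T u) {t : ℝ} (ht : t ∈ Ioo 0 T) :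
    lpENorm ⊤ (u t) < ⊤ := by
  obtain ⟨g, hg, -⟩ := hu.1.choose_spec.2 t ht
  rw [← hg, lpENorm_coe]
  exact enorm_lt_top

/-- The norms of a jointly measurable family of bounded functions are measurable. -/
theorem aemeasurable_lpENorm {T : ℝ} {u : ℝ → TempDist n} {U : ℝ × Rn n → Cn n}
    (hU : AEStronglyMeasurable U ((volume.restrict (Ioo 0 T)).prod volume))
    (h : ∀ t ∈ Ioo 0 T, ∃ g : Lp (Cn n) ⊤ (volume : Measure (Rn n)), (g : TempDist n) = u t ∧ ∀ᵐ x, g x = U (t, x)) :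
    AEMeasurable (fun t => lpENorm ⊤ (u t)) (volume.restrict (Ioo 0 T)) := by
  set W := hU.mk U
  have hW : Measurable fun p : ℝ × Rn n => ‖W p‖ₑ := hU.stronglyMeasurable_mk.enorm
  -- The essential supremum of a slice is at most `c` exactly when the slice of `{‖W‖ₑ > c}` is
  -- null, and measures of slices depend measurably on `t`.
  refine ⟨fun t => essSup (fun x => ‖W (t, x)‖ₑ) volume, ?_, ?_⟩
  · refine measurable_of_Iic fun c => ?_
    have hs : MeasurableSet {p : ℝ × Rn n | ¬‖W p‖ₑ ≤ c} := (measurableSet_le hW measurable_const).compl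
    have h1 := measurable_measure_prodMk_left (ν := (volume : Measure (Rn n))) hs
    have h2 := h1 (measurableSet_singleton 0)
    refine (congrArg MeasurableSet (Set.ext fun t => ⟨fun ht => ?_, fun ht => ?_⟩)).mp h2
    · exact essSup_le_of_ae_le _ (ae_iff.2 ht)
    · exact ae_iff.1 ((ENNReal.ae_le_essSup fun x => ‖W (t, x)‖ₑ).mono fun x hx => hx.trans ht)
  · filter_upwards [Measure.ae_ae_of_ae_prod hU.ae_eq_mk, ae_restrict_mem measurableSet_Ioo] with t ht htT
    obtain ⟨g, hg, hgU⟩ := h t htT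
    rw [← hg, lpENorm_coe, Lp.enorm_def, eLpNorm_exponent_top, eLpNormEssSup]
    refine essSup_congr_ae ?_
    filter_upwards [ht, hgU] with x h1 h2
    rw [h2, h1]

theorem aestronglyMeasurable_oseenQuadratic {s : ℝ} (hs : 0 < s) (f : Lp (Cn n) ⊤ (volume : Measure (Rn n))) :
    AEStronglyMeasurable (oseenQuadratic s f) := by
  refine (PiLp.continuous_toLp 2 _).comp_aestronglyMeasurable
    (aemeasurable_pi_lambda _ fun i => AEStronglyMeasurable.aemeasurable ?_).aestronglyMeasurable
  refine Finset.aestronglyMeasurable_fun_sum _ fun j _ => Finset.aestronglyMeasurable_fun_sum _ fun k _ => ?_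
  have hf : AEStronglyMeasurable (fun y => f y j * f y k) :=
    ((EuclideanSpace.proj (𝕜 := ℂ) j : Cn n →L[ℂ] ℂ).continuous.comp_aestronglyMeasurable
      (Lp.aestronglyMeasurable f)).mul
    ((EuclideanSpace.proj (𝕜 := ℂ) k : Cn n →L[ℂ] ℂ).continuous.comp_aestronglyMeasurable
      (Lp.aestronglyMeasurable f))
  have hk := (integrable_oseenKernel i j k hs).aestronglyMeasurable
  have h1 := hf.convolution_integrand (ContinuousLinearMap.mul ℂ ℂ).flip hk (μ := volume)
  exact h1.integral_prod_right'

theorem integrable_smul_oseenQuadratic {s : ℝ} (hs : 0 < s) (f : Lp (Cn n) ⊤ (volume : Measure (Rn n)))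
    (w : 𝓢(Rn n, ℂ)) : Integrable fun x => w x • oseenQuadratic s f x := by
  obtain ⟨C, -, h⟩ := exists_norm_oseenQuadratic_sub_le n
  have h0 : ∀ x, oseenQuadratic s (0 : Lp (Cn n) ⊤ (volume : Measure (Rn n))) x = 0 := by
    intro x
    ext i
    simp only [oseenQuadratic, PiLp.zero_apply]
    refine Finset.sum_eq_zero fun j _ => Finset.sum_eq_zero fun k _ => ?_
    refine integral_eq_zero_of_ae ?_
    filter_upwards [Lp.coeFn_zero (Cn n) ⊤ (volume : Measure (Rn n))] with y hy
    simp
  refine (w.integrable.norm.mul_const (C * (√s)⁻¹ * ((‖f‖ + ‖(0 : Lp (Cn n) ⊤ (volume : Measure (Rn n)))‖) * ‖f - 0‖))).mono'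
    (w.continuous.aestronglyMeasurable.smul (aestronglyMeasurable_oseenQuadratic hs f)) (Eventually.of_forall fun x => ?_)
  have := h s hs f 0 x
  rw [h0, sub_zero (oseenQuadratic s f x)] at this
  rw [norm_smul]
  exact mul_le_mul_of_nonneg_left this (norm_nonneg _)

/-- The difference of two mild solutions with the same initial value. -/
theorem exists_lpENorm_sub_le_gInt (n : ℕ) : ∃ C : ℝ, 0 < C ∧ ∀ (I : Set ℝ) (u₀ : TempDist n) (T : ℝ)
    (u v : ℝ → TempDist n), MemLinftyLoc T u → MemLinftyLoc T v → IsMildSolution I u₀ u → IsMildSolution I u₀ v →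
    ∀ t ∈ I, t ∈ Ioo 0 T → lpENorm ⊤ (u t - v t) ≤ ENNReal.ofReal C *
      gInt (fun τ => lpENorm ⊤ (u τ) + lpENorm ⊤ (v τ)) (fun τ => lpENorm ⊤ (u τ - v τ)) t := by
  obtain ⟨C, hC, h⟩ := exists_norm_oseenQuadratic_sub_le n
  refine ⟨C, hC, fun I u₀ T u v hu hv mu mv t htI ht => ?_⟩
  set G := gInt (fun τ => lpENorm ⊤ (u τ) + lpENorm ⊤ (v τ)) (fun τ => lpENorm ⊤ (u τ - v τ)) t
  -- An infinite right side makes the claim trivial; otherwise real-valued estimates are available.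
  by_cases hG : G = ⊤
  · rw [hG, ENNReal.mul_top (by simpa using hC)]
    exact le_top
  have hrep : ∀ τ ∈ Ioo 0 T, (linftyRep (u τ) : TempDist n) = u τ ∧ (linftyRep (v τ) : TempDist n) = v τ :=
    fun τ hτ => ⟨linftyRep_spec (exists_of_memLinftyLoc hu hτ), linftyRep_spec (exists_of_memLinftyLoc hv hτ)⟩
  have hsub : ∀ f g : Lp (Cn n) ⊤ (volume : Measure (Rn n)), ((f - g : Lp (Cn n) ⊤ (volume : Measure (Rn n))) : TempDist n) = f - g :=
    fun f g => map_sub (Lp.toTemperedDistributionCLM (Cn n) (volume : Measure (Rn n)) ⊤) f g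
  set g := linftyRep (u t) - linftyRep (v t)
  have hg : (g : TempDist n) = u t - v t := by rw [hsub, (hrep t ht).1, (hrep t ht).2]
  set R := (ENNReal.ofReal C * G).toReal
  have hR : ENNReal.ofReal C * G ≠ ⊤ := ENNReal.mul_ne_top ENNReal.ofReal_ne_top hG
  have hmain : ‖g‖ ≤ R := by
    -- The mild equation is only known after pairing, so the norm is computed by duality with test
    -- functions.
    refine Linf_norm_le_of_pairing ENNReal.toReal_nonneg fun w => ?_
    have h1 : ∫ y, w y • g y = (u t - v t) w := by rw [← hg, Lp.toTemperedDistribution_apply]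
    obtain ⟨iu, eu⟩ := mu t htI w
    obtain ⟨iv, ev⟩ := mv t htI w
    rw [h1, _root_.sub_apply, eu, ev, sub_sub_sub_cancel_left, ← intervalIntegral.integral_sub iv iu,
      intervalIntegral.integral_of_le ht.1.le, integral_Ioc_eq_integral_Ioo]
    have hw0 : 0 ≤ ∫ y, ‖w y‖ := integral_nonneg fun _ => norm_nonneg _
    have h2 : ‖∫ τ in Ioo 0 t, ((∫ x, w x • oseenQuadratic (t - τ) (linftyRep (v τ)) x) -
        ∫ x, w x • oseenQuadratic (t - τ) (linftyRep (u τ)) x)‖ₑ ≤ ENNReal.ofReal C * G * ENNReal.ofReal (∫ y, ‖w y‖) := by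
      refine (enorm_integral_le_lintegral_enorm _).trans ?_
      simp only [G]
      rw [gInt, ← lintegral_const_mul' _ _ ENNReal.ofReal_ne_top, ← lintegral_mul_const' _ _ ENNReal.ofReal_ne_top]
      refine setLIntegral_mono' measurableSet_Ioo fun τ hτ => ?_
      have hs : 0 < t - τ := sub_pos.2 hτ.2
      have hτT : τ ∈ Ioo 0 T := ⟨hτ.1, hτ.2.trans ht.2⟩
      have hnorm : lpENorm ⊤ (u τ) = ‖linftyRep (u τ)‖ₑ ∧ lpENorm ⊤ (v τ) = ‖linftyRep (v τ)‖ₑ ∧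
          lpENorm ⊤ (u τ - v τ) = ‖linftyRep (u τ) - linftyRep (v τ)‖ₑ := by
        refine ⟨?_, ?_, ?_⟩ <;> rw [← lpENorm_coe] <;> simp only [hsub, (hrep τ hτT).1, (hrep τ hτT).2]
      rw [hnorm.1, hnorm.2.1, hnorm.2.2, ← integral_sub (integrable_smul_oseenQuadratic hs _ w)
        (integrable_smul_oseenQuadratic hs _ w)]
      set f := linftyRep (u τ)
      set k := linftyRep (v τ)
      have h3 : ‖∫ x, (w x • oseenQuadratic (t - τ) k x - w x • oseenQuadratic (t - τ) f x)‖ ≤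
          ∫ x, ‖w x‖ * (C * (√(t - τ))⁻¹ * ((‖f‖ + ‖k‖) * ‖f - k‖)) := by
        refine norm_integral_le_of_norm_le (w.integrable.norm.mul_const _) (Eventually.of_forall fun x => ?_)
        rw [← smul_sub, norm_smul, norm_sub_rev]
        exact mul_le_mul_of_nonneg_left (h _ hs f k x) (norm_nonneg _)
      rw [integral_mul_const] at h3
      rw [← ofReal_norm]
      refine (ENNReal.ofReal_le_ofReal h3).trans (le_of_eq ?_)
      rw [← ofReal_norm f, ← ofReal_norm k, ← ofReal_norm (f - k), ← ENNReal.ofReal_add (norm_nonneg _) (norm_nonneg _),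
        ← ENNReal.ofReal_mul (by positivity), ← ENNReal.ofReal_mul (by positivity), ← ENNReal.ofReal_mul hC.le,
        ← ENNReal.ofReal_mul (by positivity)]
      congr 1
      ring
    have h4 := ENNReal.toReal_mono (ENNReal.mul_ne_top hR ENNReal.ofReal_ne_top) h2
    rwa [toReal_enorm, ENNReal.toReal_mul, ENNReal.toReal_ofReal hw0] at h4
  rw [← hg, lpENorm_coe, ← ofReal_norm, ← ENNReal.ofReal_toReal hR]
  exact ENNReal.ofReal_le_ofReal hmain

theorem weightedSup_eq (σ T : ℝ) (u : ℝ → TempDist n) : weightedSup σ T u = supW σ T fun t => lpENorm ⊤ (u t) := rfl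

theorem weightedLq_eq (σ q T : ℝ) (u : ℝ → TempDist n) : weightedLq σ q T u = lqW σ q T fun t => lpENorm ⊤ (u t) := by
  rw [lqW_eq, lintegral_nu]
  rfl

/-- Uniqueness of mild solutions in the path space. -/
theorem eqOn_of_isMildSolution {σ q T : ℝ} (hq : 1 ≤ q) (hσ : sigmaCrit q ≤ σ) {I : Set ℝ} (hI : Ioo 0 T ⊆ I)
    (hI' : I ⊆ Icc 0 T) {u₀ : TempDist n} {u v : ℝ → TempDist n} (hu : MemLinftyLoc T u) (hv : MemLinftyLoc T v)
    (mu : IsMildSolution I u₀ u) (mv : IsMildSolution I u₀ v)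
    (su : weightedSup σ T u < ⊤) (lu : weightedLq σ q T u < ⊤) (sv : weightedSup σ T v < ⊤)
    (lv : weightedLq σ q T v < ⊤) : EqOn u v I := by
  obtain ⟨C, hC, hG⟩ := exists_lpENorm_sub_le_gInt n
  have h0 := fun (u : ℝ → TempDist n) (hu : MemLinftyLoc T u) =>
    aemeasurable_lpENorm hu.1.choose_spec.1 hu.1.choose_spec.2
  have hN := normW_add_le (σ := σ) hq (h0 u hu) (h0 v hv)
  rw [weightedSup_eq] at su sv
  rw [weightedLq_eq] at lu lv
  have hm := eq_zero_of_le_gInt hq hσ ((h0 u hu).add (h0 v hv)) (hN.trans_lt (ENNReal.add_lt_top.2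
    ⟨ENNReal.add_lt_top.2 ⟨su, lu⟩, ENNReal.add_lt_top.2 ⟨sv, lv⟩⟩))
    (m := fun t => lpENorm ⊤ (u t - v t)) (fun t _ => lpENorm_sub_le _ _) ENNReal.ofReal_ne_top
    fun t ht => hG I u₀ T u v hu hv mu mv t (hI ht) ht
  have heq : ∀ t ∈ Ioo 0 T, u t = v t := by
    intro t ht
    have h1 := hm t ht
    obtain ⟨g, hg⟩ := exists_of_lpENorm_lt_top (f := u t - v t) (by simp only [h1]; exact ENNReal.zero_lt_top)
    simp only [← hg, lpENorm_coe, enorm_eq_zero] at h1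
    rw [← sub_eq_zero, ← hg, h1]
    exact map_zero (Lp.toTemperedDistributionCLM (Cn n) (volume : Measure (Rn n)) ⊤)
  -- Endpoints in `I` follow from the equation itself, whose right side involves only the open
  -- interval `(0, t)`.
  intro t ht
  ext1 w
  rw [(mu t ht w).2, (mv t ht w).2]
  congr 1
  rw [intervalIntegral.integral_of_le (hI' ht).1, intervalIntegral.integral_of_le (hI' ht).1,
    integral_Ioc_eq_integral_Ioo, integral_Ioc_eq_integral_Ioo]
  refine setIntegral_congr_fun measurableSet_Ioo fun τ hτ => ?_
  simp only [heq τ ⟨hτ.1, hτ.2.trans_le (hI' ht).2⟩]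

end NavierStokesBesov

namespace NavierStokesBesov

variable {n : ℕ} {V W : Type*} [NormedAddCommGroup V] [NormedSpace ℂ V] [CompleteSpace V]
  [NormedAddCommGroup W] [NormedSpace ℂ W] [CompleteSpace W]

/-! ### The heat extension -/

/-- The heat operator on bounded continuous functions, `t > 0`. -/
def heatL (n : ℕ) (t : ℝ) : Cb n (Cn n) →L[ℂ] Cb n (Cn n) := convL n (Cn n) (kerD (gauss n) (√t))

theorem heatL_eq {t : ℝ} (ht : 0 < t) : heatL n t = mult (Cn n) (heatS n t ht) := by
  rw [heatL, kerD_of_pos _ (Real.sqrt_pos.2 ht)]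
  rfl

theorem continuousOn_heatL : ContinuousOn (heatL n) (Ioi 0) :=
  (convL n (Cn n)).continuous.comp_continuousOn ((continuousOn_kerD (gauss n)).comp
    Real.continuous_sqrt.continuousOn fun _ ht => Real.sqrt_pos.2 ht)

theorem toDist_heatL {t : ℝ} (ht : 0 < t) (f : Cb n (Cn n)) :
    toDist n (Cn n) (heatL n t f) = heat t (toDist n (Cn n) f) := by
  rw [heatL_eq ht, toDist_mult, heat_eq t ht]

theorem heat_heat {s t : ℝ} (hs : 0 < s) (ht : 0 < t) (f : TempDist n) : heat s (heat t f) = heat (t + s) f := by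
  rw [heat_eq s hs, heat_eq t ht, fourierMultiplier_mulS, heat_eq (t + s) (by positivity)]
  refine fourierMultiplier_congr (fun η => ?_) f
  rw [mulS_apply, heatS_apply, heatS_apply, heatS_apply, ← Complex.ofReal_mul, ← Real.exp_add]
  congr 3
  ring

/-- Half of the time makes the distribution a bounded function, the other half makes it continuous.
Continuity in `t` follows by restarting at `t₀/2`, since the heat operators are norm continuous at
positive times. -/
theorem exists_toDist_eq_heat {f : TempDist n} (hf : ∀ t, 0 < t → lpENorm ⊤ (heat t f) < ⊤) :
    ∃ h : ℝ → Cb n (Cn n), ContinuousOn h (Ioi 0) ∧ ∀ t, 0 < t → toDist n (Cn n) (h t) = heat t f := by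
  have h1 : ∀ t : ℝ, ∃ g : Cb n (Cn n), 0 < t → toDist n (Cn n) g = heat t f := by
    intro t
    by_cases ht : 0 < t
    · obtain ⟨g, hg, -⟩ := exists_mult_of_lpENorm (heatS n (t / 2) (half_pos ht)) (hf (t / 2) (half_pos ht))
      refine ⟨g, fun _ => ?_⟩
      rw [hg, ← heat_eq, heat_heat (half_pos ht) (half_pos ht), add_halves]
    · exact ⟨0, fun h => absurd h ht⟩
  choose h hh using h1
  refine ⟨h, fun t₀ ht₀ => ContinuousAt.continuousWithinAt ?_, hh⟩
  have ht₀' : 0 < t₀ / 2 := half_pos ht₀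
  have h2 : ContinuousAt (fun t => heatL n (t - t₀ / 2) (h (t₀ / 2))) t₀ := by
    have h3 : ContinuousAt (heatL n) (t₀ - t₀ / 2) := continuousOn_heatL.continuousAt (Ioi_mem_nhds (by linarith))
    exact (ContinuousAt.comp (f := fun t => t - t₀ / 2) h3 (by fun_prop)).clm_apply continuousAt_const
  refine h2.congr ?_
  filter_upwards [Ioi_mem_nhds (show t₀ / 2 < t₀ by linarith)] with t ht
  have ht' : 0 < t - t₀ / 2 := sub_pos.2 ht
  apply toDist_injective
  rw [toDist_heatL ht', hh _ ht₀', heat_heat ht' ht₀', hh t (ht₀'.trans ht)]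
  congr 1
  ring

/-- A function is bounded by the `L¹` norm of its transform; uniform convergence thus reduces to
dominated convergence in frequency. -/
theorem norm_fourierMultiplier_sub_le (m g : _) (x : Rn n) :
    ‖(SchwartzMap.fourierMultiplierCLM (Cn n) ((m : 𝓢(Rn n, ℂ)) : Rn n → ℂ) g) x - (g : 𝓢(Rn n, Cn n)) x‖ ≤
      ∫ η, ‖m η - 1‖ * ‖𝓕 g η‖ := by
  have h1 : (SchwartzMap.fourierMultiplierCLM (Cn n) (m : Rn n → ℂ) g) x - g x =
      𝓕⁻ (SchwartzMap.smulLeftCLM (Cn n) (m : Rn n → ℂ) (𝓕 g) - 𝓕 g) x := by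
    rw [sub_eq_add_neg _ (𝓕 g), FourierTransform.fourierInv_add, FourierTransform.fourierInv_neg,
      FourierTransform.fourierInv_fourier_eq, SchwartzMap.fourierMultiplierCLM_apply]
    exact sub_eq_add_neg _ _
  rw [h1, SchwartzMap.fourierInv_coe, Real.fourierInv_eq]
  refine (norm_integral_le_integral_norm _).trans (le_of_eq (integral_congr_ae (Eventually.of_forall fun η => ?_)))
  simp only [Circle.norm_smul, _root_.sub_apply, SchwartzMap.smulLeftCLM_apply_apply m.hasTemperateGrowth]
  rw [← norm_smul, sub_smul, one_smul]

/-- The heat extension of a test function converges uniformly to it. -/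
theorem tendsto_heat_schwartz (g : 𝓢(Rn n, Cn n)) :
    Tendsto (fun t => ‖heatL n t g.toBoundedContinuousFunction - g.toBoundedContinuousFunction‖) (𝓝[>] 0) (𝓝 0) := by
  set ρ : ℝ → Rn n → ℝ := fun t η => ‖((Real.exp (-(t * (2 * Real.pi * ‖η‖) ^ 2)) : ℝ) : ℂ) - 1‖ * ‖𝓕 g η‖
  have hρ : Tendsto (fun t => ∫ η, ρ t η) (𝓝[>] 0) (𝓝 0) := by
    have h0 : ∫ η, ρ 0 η = 0 := by simp [ρ]
    suffices key : Tendsto (fun t => ∫ η, ρ t η) (𝓝[>] 0) (𝓝 (∫ η, ρ 0 η)) by rwa [h0] at key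
    refine tendsto_integral_filter_of_dominated_convergence (fun η => ‖𝓕 g η‖) ?_ ?_ (𝓕 g).integrable.norm ?_
    · refine Eventually.of_forall fun t => Continuous.aestronglyMeasurable ?_
      have := (𝓕 g).continuous
      fun_prop
    · filter_upwards [self_mem_nhdsWithin] with t ht
      refine Eventually.of_forall fun η => ?_
      have ht0 : 0 < t := ht
      rw [Real.norm_of_nonneg (by positivity)]
      refine mul_le_of_le_one_left (norm_nonneg _) ?_
      have h1 : Real.exp (-(t * (2 * Real.pi * ‖η‖) ^ 2)) ≤ 1 := by
        rw [Real.exp_le_one_iff]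
        have : 0 ≤ t * (2 * Real.pi * ‖η‖) ^ 2 := by positivity
        linarith
      have h2 := Real.exp_pos (-(t * (2 * Real.pi * ‖η‖) ^ 2))
      rw [← Complex.ofReal_one, ← Complex.ofReal_sub, Complex.norm_real, Real.norm_eq_abs, abs_le]
      constructor <;> linarith
    · refine Eventually.of_forall fun η => ?_
      have : Continuous fun t => ρ t η := by fun_prop
      exact (this.tendsto 0).mono_left nhdsWithin_le_nhds
  refine squeeze_zero' (Eventually.of_forall fun _ => norm_nonneg _) ?_ hρ
  filter_upwards [self_mem_nhdsWithin] with t ht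
  rw [heatL_eq ht, mult_schwartz]
  refine (BoundedContinuousFunction.norm_le (integral_nonneg fun η => by positivity)).2 fun x => ?_
  refine (norm_fourierMultiplier_sub_le (heatS n t ht) g x).trans (le_of_eq ?_)
  refine integral_congr_ae (Eventually.of_forall fun η => ?_)
  simp only [heatS_apply t ht, ρ]

/-! ### The quadratic term in the Besov space -/

theorem isSingularBil_oseenBil (n : ℕ) : ∃ C, IsSingularBil (oseenBil n) C := by
  obtain ⟨C, hC, h⟩ := exists_norm_oseenBil_le n
  exact ⟨C, continuousOn_oseenBil, hC, h⟩

/-- The Besov norm of the quadratic term. -/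
theorem exists_normB_duh_sub_le (n : ℕ) {φ : ℝ → ℝ} (hφ : IsCutoff φ) {σ q : ℝ} (hq : 1 ≤ q) (hσ : sigmaCrit q ≤ σ)
    (T : ℝ) : ∃ C, 0 < C ∧ ∀ u v : ℝ → Cb n (Cn n), ContinuousOn u (Ioc 0 T) →
    ContinuousOn v (Ioc 0 T) → pn σ q T u < ⊤ → pn σ q T v < ⊤ → ∀ t ∈ Ioc 0 T,
      normB φ σ q (toDist n (Cn n) (duh (oseenBil n) u u t - duh (oseenBil n) v v t)) ≤ ENNReal.ofReal C *
        ((pn σ q T u + pn σ q T v) * (lqOn σ q T t (en fun τ => u τ - v τ) +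
          lw T (-σ) t * pn σ q T fun τ => u τ - v τ)) := by
  have hσ0 : 0 < σ := lt_of_lt_of_le (by norm_num) (half_le_sigmaCrit.trans hσ)
  obtain ⟨CQ, hQ⟩ := isSingularBil_oseenBil n
  obtain ⟨C₁, hC₁, h₁⟩ := exists_norm_mult_psiJ_oseenBil_le n hφ
  obtain ⟨C₂, hC₂, h₂⟩ := exists_norm_mult_phiS_oseenBil_le n hφ
  obtain ⟨C₃, hC₃, h₃⟩ := exists_seqB_blockInt_le hq hσ0 T
  refine ⟨C₂ * max 1 q + C₁ * (C₃ * (max 1 q + 1)), by positivity, fun u v hu hv hNu hNv t ht => ?_⟩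
  set A : ℝ → ℝ≥0∞ := fun τ => en u τ + en v τ
  set B : ℝ → ℝ≥0∞ := en fun τ => u τ - v τ
  have hA : AEMeasurable A (volume.restrict (Ioo 0 T)) := (aemeasurable_en hu).add (aemeasurable_en hv)
  have hB : AEMeasurable B (volume.restrict (Ioo 0 T)) := aemeasurable_en (hu.sub hv)
  set D := duh (oseenBil n) u u t - duh (oseenBil n) v v t
  set I := ∫⁻ τ in Ioo 0 t, A τ * B τ
  have iu := hQ.integrableOn hu hu ht.2 (hQ.gInt_lt_top hq hσ hu hNu ht)
  have iv := hQ.integrableOn hv hv ht.2 (hQ.gInt_lt_top hq hσ hv hNv ht)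
  -- A multiplier is continuous on `C_b` and moves under the Duhamel integral, where polarisation
  -- gives the products `A B`.
  have hmult : ∀ (m : 𝓢(Rn n, ℂ)) (F : ℝ → ℝ), (∀ s, 0 < s → 0 ≤ F s) → (∀ s, 0 < s → ∀ f g : Cb n (Cn n),
      ‖mult (Cn n) m (oseenBil n s f g)‖ ≤ F s * (‖f‖ * ‖g‖)) →
      ‖mult (Cn n) m D‖ₑ ≤ ∫⁻ τ in Ioo 0 t, ENNReal.ofReal (F (t - τ)) * (A τ * B τ) := by
    intro m F hF h
    have h' : ∀ s, 0 < s → ∀ f g : Cb n (Cn n),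
        ‖mult (Cn n) m (oseenBil n s f g)‖ₑ ≤ ENNReal.ofReal (F s) * (‖f‖ₑ * ‖g‖ₑ) := by
      intro s hs f g
      rw [← ofReal_norm, ← ofReal_norm f, ← ofReal_norm g, ← ENNReal.ofReal_mul (norm_nonneg _),
        ← ENNReal.ofReal_mul (hF s hs)]
      exact ENNReal.ofReal_le_ofReal (h s hs f g)
    simp only [D, duh]
    rw [← integral_sub iu iv, ← ContinuousLinearMap.integral_comp_comm _ (show Integrable (fun τ => oseenBil n (t - τ) (u τ) (u τ) -
      oseenBil n (t - τ) (v τ) (v τ)) (volume.restrict (Ioo 0 t)) from iu.sub iv)]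
    refine (enorm_integral_le_lintegral_enorm _).trans (setLIntegral_mono' measurableSet_Ioo fun τ hτ => ?_)
    have hs : 0 < t - τ := sub_pos.2 hτ.2
    have he : oseenBil n (t - τ) (u τ) (u τ) - oseenBil n (t - τ) (v τ) (v τ) =
        oseenBil n (t - τ) (u τ) (u τ - v τ) + oseenBil n (t - τ) (u τ - v τ) (v τ) := by
      simp only [map_sub, _root_.sub_apply]
      abel
    rw [he, map_add]
    refine (enorm_add_le _ _).trans ((add_le_add (h' _ hs _ _) (h' _ hs _ _)).trans (le_of_eq ?_))
    simp only [A, B, en]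
    ring
  have hlow : lpENorm ⊤ (lowFreq φ (toDist n (Cn n) D)) ≤ ENNReal.ofReal C₂ * I := by
    rw [lowFreq_eq hφ, ← toDist_mult, lpENorm_toDist]
    refine (hmult (phiS n hφ) (fun _ => C₂) (fun _ _ => hC₂.le) h₂).trans (le_of_eq ?_)
    rw [lintegral_const_mul' _ _ ENNReal.ofReal_ne_top]
  have hblock : ∀ j, lpENorm ⊤ (dyadicBlock φ (j + 1) (toDist n (Cn n) D)) ≤
      ENNReal.ofReal C₁ * (ENNReal.ofReal (2 ^ (j + 1)) * blockInt A B t j) := by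
    intro j
    rw [dyadicBlock_eq hφ, ← toDist_mult, lpENorm_toDist]
    refine (hmult (psiJ n hφ (j + 1)) (fun s => C₁ * (2 ^ (j + 1) * ((1 + s * 4 ^ (j + 1)) ^ 2)⁻¹))
      (fun s hs => by positivity) (h₁ (j + 1))).trans (le_of_eq ?_)
    rw [blockInt, ← lintegral_const_mul' _ _ ENNReal.ofReal_ne_top, ← lintegral_const_mul' _ _ ENNReal.ofReal_ne_top]
    refine setLIntegral_congr_fun measurableSet_Ioo fun τ _ => ?_
    rw [ENNReal.ofReal_mul hC₁.le, ENNReal.ofReal_mul (by positivity)]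
    ring
  set N := pn σ q T u + pn σ q T v
  set X := lqOn σ q T t B
  set Y := lw T (-σ) t * pn σ q T fun τ => u τ - v τ
  have hN : normW σ q T A ≤ N := normW_add_le hq (aemeasurable_en hu) (aemeasurable_en hv)
  -- The loss `ℓ^{σ+1/q}` from the low blocks is cancelled exactly by the decay in
  -- `lintegral_mul_le_norm_lqOn`.
  have hI : lw T (σ + 1 / q) t * I ≤ ENNReal.ofReal (max 1 q) * (N * X) := by
    calc _ ≤ lw T (σ + 1 / q) t * (lw T (-σ - 1 / q) t * (ENNReal.ofReal (max 1 q) * normW σ q T A * X)) :=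
          mul_le_mul_right (lintegral_mul_le_norm_lqOn hq hσ ht.1 ht.2 hA hB) _
      _ = ENNReal.ofReal (max 1 q) * (normW σ q T A * X) := by
          rw [← mul_assoc, lw_mul ht.1 ht.2, show σ + 1 / q + (-σ - 1 / q) = 0 by ring, lw_zero, one_mul, mul_assoc]
      _ ≤ _ := mul_le_mul_right (mul_le_mul_left hN _) _
  have hI' : I ≤ ENNReal.ofReal (max 1 q) * (N * X) :=
    (le_mul_of_one_le_left zero_le (one_le_lw ht.1 ht.2 (by positivity))).trans hI
  have hS : lw T (-σ) t * (supW σ T A * supW σ T B) ≤ N * Y := by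
    calc _ ≤ lw T (-σ) t * (N * pn σ q T fun τ => u τ - v τ) :=
          mul_le_mul_right (mul_le_mul' (le_self_add.trans hN) le_self_add) _
      _ = _ := by
        simp only [Y]
        ring
  have hle : N * X ≤ N * (X + Y) := mul_le_mul_right le_self_add _
  have hle' : N * Y ≤ N * (X + Y) := mul_le_mul_right le_add_self _
  rw [normB_eq]
  calc _ ≤ ENNReal.ofReal C₂ * (ENNReal.ofReal (max 1 q) * (N * X)) + ENNReal.ofReal C₁ * (ENNReal.ofReal C₃ *
        (ENNReal.ofReal (max 1 q) * (N * X) + N * Y)) := by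
        refine add_le_add (hlow.trans (mul_le_mul_right hI' _)) ((seqB_mono hq hblock).trans ?_)
        rw [seqB_const_mul hq]
        exact mul_le_mul_right ((h₃ A B t ht.1 ht.2).trans (mul_le_mul_right (add_le_add hI hS) _)) _
    _ ≤ ENNReal.ofReal C₂ * (ENNReal.ofReal (max 1 q) * (N * (X + Y))) + ENNReal.ofReal C₁ * (ENNReal.ofReal C₃ *
        (ENNReal.ofReal (max 1 q) * (N * (X + Y)) + N * (X + Y))) := by gcongr
    _ = _ := by
        rw [ENNReal.ofReal_add (by positivity) (by positivity), ENNReal.ofReal_mul hC₂.le, ENNReal.ofReal_mul hC₁.le,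
          ENNReal.ofReal_mul hC₃.le, ENNReal.ofReal_add (by positivity) zero_le_one, ENNReal.ofReal_one]
        ring

end NavierStokesBesov

namespace NavierStokesBesov

variable {n : ℕ} {V W : Type*} [NormedAddCommGroup V] [NormedSpace ℂ V] [CompleteSpace V]
  [NormedAddCommGroup W] [NormedSpace ℂ W] [CompleteSpace W]


/-! ### The mild solution with given initial value -/

/-- The curve in `S'` which is `u₀` at time `0` and is given by the function `u` afterwards. -/
def solDist (u₀ : TempDist n) (u : ℝ → Cb n (Cn n)) (t : ℝ) : TempDist n :=
  if 0 < t then toDist n (Cn n) (u t) else u₀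

theorem solDist_of_pos {u₀ : TempDist n} {u : ℝ → Cb n (Cn n)} {t : ℝ} (ht : 0 < t) :
    solDist u₀ u t = toDist n (Cn n) (u t) := if_pos ht

theorem solDist_zero {u₀ : TempDist n} {u : ℝ → Cb n (Cn n)} : solDist u₀ u 0 = u₀ := if_neg (lt_irrefl 0)

/-- A curve of bounded continuous functions which solves Duhamel's equation with initial value `u₀`. -/
structure IsDuhamelSolution (σ q T : ℝ) (u₀ : TempDist n) (u : ℝ → Cb n (Cn n)) : Prop where
  cont : ContinuousOn u (Ioc 0 T)
  norm_lt : pn σ q T u < ⊤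
  eq : ∀ t ∈ Ioc 0 T, toDist n (Cn n) (u t) = heat t u₀ - toDist n (Cn n) (duh (oseenBil n) u u t)

/-! ### Regularity of Duhamel solutions in the two classes -/

section

variable {φ : ℝ → ℝ} {σ q T : ℝ} {u₀ : TempDist n} {u : ℝ → Cb n (Cn n)}

theorem memLinftyLoc_solDist (hu : ContinuousOn u (Ioc 0 T)) : MemLinftyLoc T (solDist u₀ u) := by
  refine ⟨⟨fun p => u p.1 p.2, ?_, fun t ht => ⟨toLinf (u t), ?_, coeFn_toLinf _⟩⟩, fun δ hδ => ?_⟩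
  · have h1 : ContinuousOn (fun p : ℝ × Rn n => u p.1 p.2) (Ioo 0 T ×ˢ univ) := by
      have h2 : ContinuousOn (fun p : ℝ × Rn n => u p.1) (Ioo 0 T ×ˢ univ) :=
        hu.comp continuousOn_fst fun p hp => Ioo_subset_Ioc_self hp.1
      have h3 : Continuous fun p : Cb n (Cn n) × Rn n => p.1 p.2 := continuous_eval
      exact h3.comp_continuousOn (h2.prodMk continuousOn_snd)
    have h2 := h1.aestronglyMeasurable (μ := (volume : Measure ℝ).prod (volume : Measure (Rn n)))
      (measurableSet_Ioo.prod MeasurableSet.univ)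
    rwa [← Measure.prod_restrict, Measure.restrict_univ] at h2
  · rw [solDist_of_pos ht.1, toDist_eq]
  · have hs : Icc δ T ⊆ Ioc 0 T := fun t ht => ⟨hδ.trans_le ht.1, ht.2⟩
    obtain ⟨M, hM⟩ := isCompact_Icc.exists_bound_of_continuousOn (hu.mono hs)
    refine ⟨M.toNNReal, fun t ht => ?_⟩
    rw [solDist_of_pos (hδ.trans ht.1), lpENorm_toDist, ← ofReal_norm]
    exact ENNReal.ofReal_le_ofReal (hM t ⟨ht.1.le, ht.2.le⟩)

theorem lpENorm_solDist {t : ℝ} (ht : 0 < t) : lpENorm ⊤ (solDist u₀ u t) = en u t := by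
  rw [solDist_of_pos ht, lpENorm_toDist]

namespace IsDuhamelSolution

theorem gInt_lt_top (h : IsDuhamelSolution σ q T u₀ u) (hq : 1 ≤ q) (hσ : sigmaCrit q ≤ σ) {t : ℝ} (ht : t ∈ Ioc 0 T) :
    gInt (en u) (en u) t < ⊤ := by
  obtain ⟨C, hQ⟩ := isSingularBil_oseenBil n
  exact hQ.gInt_lt_top hq hσ h.cont h.norm_lt ht

/-- Pairing with a test function is a continuous functional on `C_b`, so the Bochner integral turns
into the absolutely convergent scalar integral of the definition. At `t = 0` both sides reduce to
the datum. -/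
theorem isMildSolution (h : IsDuhamelSolution σ q T u₀ u) (hq : 1 ≤ q) (hσ : sigmaCrit q ≤ σ) {I : Set ℝ}
    (hI : I ⊆ Icc 0 T) : IsMildSolution I u₀ (solDist u₀ u) := by
  intro t ht w
  obtain ⟨h0, hT⟩ := hI ht
  rcases h0.eq_or_lt with rfl | h0
  · simp [solDist_zero, heat_zero]
  obtain ⟨C, hQ⟩ := isSingularBil_oseenBil n
  have hi := hQ.integrableOn h.cont h.cont hT (h.gInt_lt_top hq hσ ⟨h0, hT⟩)
  have he : EqOn (fun τ => pairL w (oseenBil n (t - τ) (u τ) (u τ)))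
      (fun τ => ∫ x : Rn n, w x • oseenQuadratic (t - τ) (linftyRep (solDist u₀ u τ)) x) (Ioo 0 t) := by
    intro τ hτ
    simp only
    rw [pairL_apply, toDist_apply, solDist_of_pos hτ.1, toDist_eq, linftyRep_coe]
    refine integral_congr_ae (Eventually.of_forall fun x => ?_)
    simp only
    rw [oseenQuadratic_toLinf (sub_pos.2 hτ.2)]
  constructor
  · rw [intervalIntegrable_iff_integrableOn_Ioo_of_le h0.le]
    exact IntegrableOn.congr_fun ((pairL w).integrable_comp hi) he measurableSet_Ioo
  · rw [intervalIntegral.integral_of_le h0.le, integral_Ioc_eq_integral_Ioo, ← setIntegral_congr_fun measurableSet_Ioo he,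
      ContinuousLinearMap.integral_comp_comm _ hi, solDist_of_pos h0, h.eq t ⟨h0, hT⟩]
    rfl

theorem continuousOn_solDist (h : IsDuhamelSolution σ q T u₀ u) : ContinuousOn (solDist u₀ u) (Ioo 0 T) := by
  refine ContinuousOn.congr (f := fun t => toDist n (Cn n) (u t)) (fun t ht => ?_) fun t ht => solDist_of_pos ht.1
  refine PointwiseConvergenceCLM.tendsto_iff_forall_tendsto.2 fun w => ?_
  exact ((pairL w).continuous.tendsto (u t)).comp (h.cont.mono Ioo_subset_Ioc_self t ht)

theorem weighted_lt_top (h : IsDuhamelSolution σ q T u₀ u) (hq : 1 ≤ q) :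
    weightedSup σ T (solDist u₀ u) < ⊤ ∧ weightedLq σ q T (solDist u₀ u) < ⊤ := by
  have h1 : normW σ q T (fun t => lpENorm ⊤ (solDist u₀ u t)) < ⊤ := by
    rw [normW_congr hq fun t ht => lpENorm_solDist ht.1]
    exact h.norm_lt
  rw [weightedSup_eq, weightedLq_eq]
  exact ⟨lt_of_le_of_lt le_self_add h1, lt_of_le_of_lt le_add_self h1⟩

end IsDuhamelSolution

/-- The difference of two solutions in the Besov space. -/
theorem exists_normB_solDist_sub_le (n : ℕ) (hφ : IsCutoff φ) (hq : 1 ≤ q) (hσ : sigmaCrit q ≤ σ) (T : ℝ) :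
    ∃ C, 0 < C ∧ ∀ (u₀ v₀ : TempDist n) (u v : ℝ → Cb n (Cn n)), IsDuhamelSolution σ q T u₀ u →
      IsDuhamelSolution σ q T v₀ v → ∀ t ∈ Icc 0 T, normB φ σ q (solDist u₀ u t - solDist v₀ v t) ≤
        ENNReal.ofReal C * (normB φ σ q (u₀ - v₀) + (pn σ q T u + pn σ q T v) * pn σ q T fun τ => u τ - v τ) := by
  obtain ⟨C₁, hC₁, h₁⟩ := exists_normB_heat_le n hφ σ hq
  obtain ⟨C₂, hC₂, h₂⟩ := exists_normB_duh_sub_le n hφ hq hσ T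
  refine ⟨C₁ + 2 * C₂, by positivity, fun u₀ v₀ u v hu hv t ht => ?_⟩
  have hσ0 : 0 < σ := lt_of_lt_of_le (by norm_num) (half_le_sigmaCrit.trans hσ)
  set N := normB φ σ q (u₀ - v₀)
  set P := pn σ q T fun τ => u τ - v τ
  rw [ENNReal.ofReal_add hC₁.le (by positivity), ENNReal.ofReal_mul zero_le_two, ENNReal.ofReal_ofNat]
  have hle : ENNReal.ofReal C₁ * N + ENNReal.ofReal C₂ * ((pn σ q T u + pn σ q T v) * (P + P)) ≤
      (ENNReal.ofReal C₁ + 2 * ENNReal.ofReal C₂) * (N + (pn σ q T u + pn σ q T v) * P) := by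
    calc _ = ENNReal.ofReal C₁ * N + 2 * ENNReal.ofReal C₂ * ((pn σ q T u + pn σ q T v) * P) := by ring
      _ ≤ ENNReal.ofReal C₁ * (N + (pn σ q T u + pn σ q T v) * P) +
          2 * ENNReal.ofReal C₂ * (N + (pn σ q T u + pn σ q T v) * P) :=
        add_le_add (mul_le_mul_right le_self_add _) (mul_le_mul_right le_add_self _)
      _ = _ := by ring
  refine le_trans ?_ hle
  rcases ht.1.eq_or_lt with rfl | h0
  · rw [solDist_zero, solDist_zero]
    have := h₁ 0 le_rfl (u₀ - v₀)
    rw [heat_zero] at this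
    exact this.trans le_self_add
  have ht' : t ∈ Ioc 0 T := ⟨h0, ht.2⟩
  -- The difference is the heat extension of the difference of the data minus that of the two
  -- Duhamel terms, each already bounded in the Besov norm.
  have he : solDist u₀ u t - solDist v₀ v t = heat t (u₀ - v₀) -
      toDist n (Cn n) (duh (oseenBil n) u u t - duh (oseenBil n) v v t) := by
    rw [solDist_of_pos h0, solDist_of_pos h0, hu.eq t ht', hv.eq t ht', heat_sub, map_sub]
    abel
  rw [he]
  refine (normB_sub_le hq _ _).trans (add_le_add (h₁ t h0.le _) ((h₂ u v hu.cont hv.cont hu.norm_lt hv.norm_lt t ht').trans ?_))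
  refine mul_le_mul_right (mul_le_mul_right (add_le_add ((lqOn_le_lqW hq).trans le_add_self) ?_) _) _
  exact mul_le_of_le_one_left zero_le (lw_le_one h0 ht.2 (by linarith))

theorem normB_zero (hφ : IsCutoff φ) (hq : 1 ≤ q) (hσ : 0 < σ) : normB φ σ q (0 : TempDist n) = 0 := by
  obtain ⟨C, -, hC⟩ := exists_normB_toDist_le n hφ hσ hq
  simpa using hC 0

theorem tendsto_normB_toDist_sub {α : Type*} {l : Filter α} {f : α → Cb n (Cn n)} {g : Cb n (Cn n)} (hφ : IsCutoff φ)
    (hσ : 0 < σ) (hq : 1 ≤ q) (h : Tendsto f l (𝓝 g)) :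
    Tendsto (fun k => normB φ σ q (toDist n (Cn n) g - toDist n (Cn n) (f k))) l (𝓝 0) := by
  obtain ⟨C, -, hC⟩ := exists_normB_toDist_le n hφ hσ hq
  have h1 : Tendsto (fun k => ENNReal.ofReal C * ‖g - f k‖ₑ) l (𝓝 0) := by
    have := ENNReal.Tendsto.const_mul (a := ENNReal.ofReal C)
      (((tendsto_const_nhds (x := g)).sub h).enorm) (Or.inr ENNReal.ofReal_ne_top)
    simpa using this
  refine tendsto_of_tendsto_of_tendsto_of_le_of_le tendsto_const_nhds h1 (fun _ => zero_le) fun k => ?_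
  simp only
  rw [← map_sub]
  exact hC _

theorem pn_zero {E : Type*} [NormedAddCommGroup E] (hq : 1 ≤ q) : pn σ q T (fun _ => (0 : E)) = 0 :=
  (normW_congr hq fun _ _ => enorm_zero).trans (normW_zero hq)

theorem isDuhamelSolution_zero (hq : 1 ≤ q) : IsDuhamelSolution σ q T (0 : TempDist n) fun _ => 0 where
  cont := continuousOn_const
  norm_lt := by
    rw [pn_zero hq]
    exact ENNReal.zero_lt_top
  eq t ht := by
    rw [duh_zero, map_zero, heat_eq t ht.1, map_zero, sub_zero]

namespace IsDuhamelSolution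

/-- The uniform bound is the comparison with the zero solution. For strong measurability, simple
functions approximating the curve in `C_b` also approximate it in the weaker Besov norm. -/
theorem memLinftyB (h : IsDuhamelSolution σ q T u₀ u) (hφ : IsCutoff φ) (hq : 1 ≤ q) (hσ : sigmaCrit q ≤ σ)
    (hu₀ : MemB φ σ q u₀) : MemLinftyB φ σ q T (solDist u₀ u) := by
  have hσ0 : 0 < σ := lt_of_lt_of_le (by norm_num) (half_le_sigmaCrit.trans hσ)
  constructor
  · obtain ⟨C, -, hC⟩ := exists_normB_solDist_sub_le n hφ hq hσ T
    have h0 := isDuhamelSolution_zero (n := n) (σ := σ) (T := T) hq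
    refine ⟨(ENNReal.ofReal C * (normB φ σ q u₀ + pn σ q T u * pn σ q T u)).toNNReal, fun t ht => ?_⟩
    rw [ENNReal.coe_toNNReal (ENNReal.mul_lt_top ENNReal.ofReal_lt_top
      (ENNReal.add_lt_top.2 ⟨hu₀, ENNReal.mul_lt_top h.norm_lt h.norm_lt⟩)).ne]
    have h1 := hC u₀ 0 u (fun _ => 0) h h0 t (Ioo_subset_Icc_self ht)
    rw [pn_zero hq, solDist_of_pos (u := fun _ => (0 : Cb n (Cn n))) ht.1] at h1
    simpa only [map_zero, sub_zero, add_zero] using h1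
  · have hm : AEStronglyMeasurable u (volume.restrict (Ioo 0 T)) :=
      (h.cont.mono Ioo_subset_Ioc_self).aestronglyMeasurable measurableSet_Ioo
    obtain ⟨C, -, hC⟩ := exists_normB_toDist_le n hφ hσ0 hq
    refine ⟨fun k => (hm.stronglyMeasurable_mk.approx k).map (toDist n (Cn n)), fun k t => ?_, ?_⟩
    · exact (hC _).trans_lt (ENNReal.mul_lt_top ENNReal.ofReal_lt_top enorm_lt_top)
    · filter_upwards [hm.ae_eq_mk, ae_restrict_mem measurableSet_Ioo] with t ht ht'
      rw [solDist_of_pos ht'.1, ht]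
      exact tendsto_normB_toDist_sub hφ hσ0 hq (hm.stronglyMeasurable_mk.tendsto_approx t)

end IsDuhamelSolution

theorem MemB0.exists_mul_lt {f : TempDist n} (hf : MemB0 φ σ q f) {C ε : ℝ≥0∞} (hC : C ≠ ⊤) (hε : ε ≠ 0) :
    ∃ g : 𝓢(Rn n, Cn n), C * normB φ σ q (f - (g : TempDist n)) < ε := by
  obtain ⟨δ, hδ, h⟩ := ENNReal.exists_nnreal_pos_mul_lt hC hε
  obtain ⟨g, hg⟩ := hf.2 δ hδ
  exact ⟨g, (mul_le_mul_right hg.le _).trans_lt (by rwa [mul_comm])⟩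

theorem memB0_toDist (hφ : IsCutoff φ) (hq : 1 ≤ q) (hσ : 0 < σ) {f : Cb n (Cn n)} (hf : f ∈ schwartzB n) :
    MemB0 φ σ q (toDist n (Cn n) f) := by
  obtain ⟨C, hC0, hC⟩ := exists_normB_toDist_le n hφ hσ hq
  refine ⟨(hC _).trans_lt (ENNReal.mul_lt_top ENNReal.ofReal_lt_top enorm_lt_top), fun ε hε => ?_⟩
  obtain ⟨g, hg⟩ := exists_schwartz_norm_sub_lt hf (div_pos (NNReal.coe_pos.2 hε) hC0)
  refine ⟨g, ?_⟩
  rw [← toDist_schwartz, ← map_sub]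
  refine (hC _).trans_lt ?_
  rw [← ofReal_norm, ← ENNReal.ofReal_mul hC0.le, ENNReal.ofReal_lt_coe_iff (by positivity), mul_comm]
  exact (lt_div_iff₀ hC0).1 hg

/-- Strong continuity of the heat semigroup on the closure of the Schwartz class. -/
theorem tendsto_normB_heat_sub (hφ : IsCutoff φ) (hq : 1 ≤ q) (hσ : 0 < σ) {f : TempDist n} (hf : MemB0 φ σ q f) :
    Tendsto (fun t => normB φ σ q (heat t f - f)) (𝓝[>] 0) (𝓝 0) := by
  obtain ⟨C, hC0, hC⟩ := exists_normB_heat_le n hφ σ hq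
  rw [ENNReal.tendsto_nhds_zero]
  intro ε hε
  have hε2 : ε / 2 ≠ 0 := (ENNReal.half_pos hε.ne').ne'
  -- The approximation error occurs twice, once evolved by the semigroup and once not, hence the
  -- constant `C + 1`.
  obtain ⟨g, hg⟩ := hf.exists_mul_lt (C := ENNReal.ofReal C + 1) (by simp) hε2
  set G : TempDist n := (g : TempDist n)
  have h1 := tendsto_normB_toDist_sub hφ hσ hq (tendsto_iff_norm_sub_tendsto_zero.2 (tendsto_heat_schwartz g))
  filter_upwards [(ENNReal.tendsto_nhds_zero.1 h1) (ε / 2) (ENNReal.half_pos hε.ne'), self_mem_nhdsWithin] with t ht ht0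
  rw [toDist_heatL ht0, toDist_schwartz, normB_sub_comm] at ht
  calc normB φ σ q (heat t f - f)
      = normB φ σ q (heat t (f - G) - (f - G) + (heat t G - G)) := by
        rw [heat_sub]
        congr 1
        abel
    _ ≤ normB φ σ q (heat t (f - G)) + normB φ σ q (f - G) + ε / 2 :=
        (normB_add_le hq _ _).trans (add_le_add (normB_sub_le hq _ _) ht)
    _ ≤ ENNReal.ofReal C * normB φ σ q (f - G) + normB φ σ q (f - G) + ε / 2 := by
        gcongr
        exact hC t (le_of_lt ht0) _
    _ = (ENNReal.ofReal C + 1) * normB φ σ q (f - G) + ε / 2 := by ring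
    _ ≤ ε / 2 + ε / 2 := by gcongr
    _ = ε := ENNReal.add_halves ε

/-- At positive times continuity in `C_b` is stronger than continuity in the Besov norm. At zero the
linear part is strongly continuous on the closure of the Schwartz class, and the Duhamel term
vanishes in the limit because its bound contains only the `L^q` norm over `(0,t)` and a negative
power of `ℓ`. -/
theorem IsDuhamelSolution.memCB0 (h : IsDuhamelSolution σ q T u₀ u) (hφ : IsCutoff φ) (hq : 1 ≤ q)
    (hσ : sigmaCrit q ≤ σ) (hT : 0 < T) (hu₀ : MemB0 φ σ q u₀) (hs : ∀ t ∈ Ioc 0 T, u t ∈ schwartzB n) :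
    MemCB0 φ σ q T (solDist u₀ u) := by
  have hσ0 : 0 < σ := lt_of_lt_of_le (by norm_num) (half_le_sigmaCrit.trans hσ)
  refine ⟨fun t ht => ?_, fun t₀ ht₀ => ?_⟩
  · rcases ht.1.eq_or_lt with rfl | h0
    · rwa [solDist_zero]
    · rw [solDist_of_pos h0]
      exact memB0_toDist hφ hq hσ0 (hs t ⟨h0, ht.2⟩)
  rcases ht₀.1.eq_or_lt with rfl | h0
  · rw [← Ioc_insert_left hT.le, nhdsWithin_insert, tendsto_sup]
    constructor
    · rw [tendsto_pure_left]
      intro s hs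
      rw [sub_self]
      rw [normB_zero hφ hq hσ0]
      exact mem_of_mem_nhds hs
    · obtain ⟨C, -, hC⟩ := exists_normB_duh_sub_le n hφ hq hσ T
      set P := pn σ q T u
      have h1 : Tendsto (fun t => normB φ σ q (heat t u₀ - u₀) + ENNReal.ofReal C *
          (P * (lqOn σ q T t (en u) + lw T (-σ) t * P))) (𝓝[>] 0) (𝓝 0) := by
        have h2 := tendsto_lqOn_zero hq (lt_of_le_of_lt le_add_self h.norm_lt)
        have h3 := ENNReal.Tendsto.mul_const (b := P) (tendsto_lw_neg hT hσ0) (Or.inr h.norm_lt.ne)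
        have h4 := ENNReal.Tendsto.const_mul (a := ENNReal.ofReal C) (ENNReal.Tendsto.const_mul (a := P)
          (h2.add h3) (Or.inr h.norm_lt.ne)) (Or.inr ENNReal.ofReal_ne_top)
        simpa using (tendsto_normB_heat_sub hφ hq hσ0 hu₀).add h4
      refine tendsto_of_tendsto_of_tendsto_of_le_of_le' tendsto_const_nhds
        (h1.mono_left (nhdsWithin_mono _ Ioc_subset_Ioi_self)) (Eventually.of_forall fun _ => zero_le) ?_
      filter_upwards [self_mem_nhdsWithin] with t ht
      rw [solDist_zero, solDist_of_pos ht.1, h.eq t ht, sub_right_comm]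
      refine (normB_sub_le hq _ _).trans (add_le_add le_rfl ?_)
      have h5 := hC u (fun _ => 0) h.cont continuousOn_const h.norm_lt (isDuhamelSolution_zero (n := n) hq).norm_lt t ht
      rw [pn_zero hq] at h5
      simpa only [duh_zero, sub_zero, add_zero] using h5
  · have h1 : Tendsto u (𝓝[Icc 0 T] t₀) (𝓝 (u t₀)) := by
      have h2 := h.cont t₀ ⟨h0, ht₀.2⟩
      have h3 : 𝓝[Icc 0 T] t₀ ≤ 𝓝[Ioc 0 T] t₀ := by
        refine nhdsWithin_le_iff.2 ?_
        filter_upwards [self_mem_nhdsWithin, mem_nhdsWithin_of_mem_nhds (Ioi_mem_nhds h0)] with t h4 h5 using ⟨h5, h4.2⟩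
      exact h2.mono_left h3
    refine (tendsto_normB_toDist_sub hφ hσ0 hq h1).congr' ?_
    filter_upwards [mem_nhdsWithin_of_mem_nhds (Ioi_mem_nhds h0)] with t ht
    rw [solDist_of_pos h0, solDist_of_pos ht, normB_sub_comm]

end

end NavierStokesBesov

namespace NavierStokesBesov

variable {n : ℕ} {V W : Type*} [NormedAddCommGroup V] [NormedSpace ℂ V] [CompleteSpace V]
  [NormedAddCommGroup W] [NormedSpace ℂ W] [CompleteSpace W]


/-! ### Existence -/

section

variable {φ : ℝ → ℝ} {σ q T : ℝ} {u₀ : TempDist n}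

/-- Time horizon `t + 1`, so that `t` is an interior time at which the weighted supremum can be read
off. -/
theorem exists_lpENorm_heat_le_normB (n : ℕ) (hφ : IsCutoff φ) (hq : 1 ≤ q) (hσ : 0 < σ) {t : ℝ} (ht : 0 < t) :
    ∃ C : ℝ≥0∞, C ≠ ⊤ ∧ ∀ f : TempDist n, lpENorm ⊤ (heat t f) ≤ C * normB φ σ q f := by
  obtain ⟨C, -, hC⟩ := exists_normW_heat_le n hφ hσ hq (t + 1)
  have h0 : wt σ (t + 1) t ≠ 0 := wt_pos ht (by linarith)
  refine ⟨(wt σ (t + 1) t)⁻¹ * ENNReal.ofReal C,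
    ENNReal.mul_ne_top (ENNReal.inv_ne_top.2 h0) ENNReal.ofReal_ne_top, fun f => ?_⟩
  have h1 := (wt_mul_le_supW (A := fun t => lpENorm ⊤ (heat t f)) ⟨ht, lt_add_one t⟩).trans
    (le_self_add.trans (hC (t + 1) (by linarith) le_rfl f))
  calc lpENorm ⊤ (heat t f) = (wt σ (t + 1) t)⁻¹ * (wt σ (t + 1) t * lpENorm ⊤ (heat t f)) := by
        rw [← mul_assoc, ENNReal.inv_mul_cancel h0 wt_ne_top, one_mul]
    _ ≤ _ := by
        rw [mul_assoc]
        exact mul_le_mul_right h1 _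

theorem MemB.exists_toDist_eq_heat (hφ : IsCutoff φ) (hq : 1 ≤ q) (hσ : 0 < σ) (hu₀ : MemB φ σ q u₀) :
    ∃ h : ℝ → Cb n (Cn n), ContinuousOn h (Ioi 0) ∧ ∀ t, 0 < t → toDist n (Cn n) (h t) = heat t u₀ := by
  refine NavierStokesBesov.exists_toDist_eq_heat fun t ht => ?_
  obtain ⟨C, hC, h⟩ := exists_lpENorm_heat_le_normB n hφ hq hσ ht
  exact (h u₀).trans_lt (ENNReal.mul_lt_top hC.lt_top hu₀)

theorem MemB.aemeasurable_heat (hφ : IsCutoff φ) (hq : 1 ≤ q) (hσ : 0 < σ) (hu₀ : MemB φ σ q u₀) :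
    AEMeasurable (fun t => lpENorm ⊤ (heat t u₀)) (volume.restrict (Ioo 0 T)) := by
  obtain ⟨h, hc, he⟩ := hu₀.exists_toDist_eq_heat hφ hq hσ
  refine (aemeasurable_en (T := T) (hc.mono Ioc_subset_Ioi_self)).congr ?_
  filter_upwards [ae_restrict_mem measurableSet_Ioo] with t ht
  rw [← he t ht.1, lpENorm_toDist]

theorem normW_heat_add_le (hφ : IsCutoff φ) (hq : 1 ≤ q) (hσ : 0 < σ) {f g : TempDist n} (hf : MemB φ σ q f)
    (hg : MemB φ σ q g) : normW σ q T (fun t => lpENorm ⊤ (heat t (f + g))) ≤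
      normW σ q T (fun t => lpENorm ⊤ (heat t f)) + normW σ q T (fun t => lpENorm ⊤ (heat t g)) := by
  refine le_trans (normW_mono hq fun t ht => ?_) (normW_add_le hq (hf.aemeasurable_heat hφ hq hσ) (hg.aemeasurable_heat hφ hq hσ))
  rw [heat_add]
  exact lpENorm_add_le _ _

/-- At a fixed positive time the heat operator maps the Besov norm continuously into the sup norm,
so approximation by Schwartz functions in the former becomes uniform approximation. -/
theorem heat_mem_schwartzB (hφ : IsCutoff φ) (hq : 1 ≤ q) (hσ : 0 < σ) (hu₀ : MemB0 φ σ q u₀) {t : ℝ} (ht : 0 < t)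
    {f : Cb n (Cn n)} (hf : toDist n (Cn n) f = heat t u₀) : f ∈ schwartzB n := by
  obtain ⟨C, hC, h⟩ := exists_lpENorm_heat_le_normB n hφ hq hσ ht
  refine isClosed_schwartzB.closure_subset (EMetric.mem_closure_iff.2 fun ε hε => ?_)
  obtain ⟨g, hg⟩ := hu₀.exists_mul_lt hC hε.ne'
  refine ⟨heatL n t g.toBoundedContinuousFunction, ?_, ?_⟩
  · rw [heatL_eq ht, mult_schwartz]
    exact toBCF_mem_schwartzB _
  · rw [edist_eq_enorm_sub, ← lpENorm_toDist, map_sub, toDist_heatL ht, toDist_schwartz, hf, ← heat_sub]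
    exact (h _).trans_lt hg

/-- The three side properties come from one invariance principle, applied to three closed real
subspaces that are respected by the bilinear operator and contain the heat extension. -/
theorem exists_isDuhamelSolution (hφ : IsCutoff φ) (hq : 1 ≤ q) (hσ : sigmaCrit q ≤ σ) {C : ℝ}
    (hQ : IsSingularBil (oseenBil n) C) {η : ℝ≥0∞} (hη : ENNReal.ofReal (bilC C q) * (16 * η) ≤ 1) (hηt : η < ⊤)
    (hu₀ : MemB φ σ q u₀) (hdiv : IsDivFree u₀) (hN : normW σ q T (fun t => lpENorm ⊤ (heat t u₀)) ≤ η) :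
    ∃ u : ℝ → Cb n (Cn n), IsDuhamelSolution σ q T u₀ u ∧ pn σ q T u ≤ 4 * η ∧
      (∀ t ∈ Icc 0 T, IsDivFree (solDist u₀ u t)) ∧
      (IsRealDist u₀ → ∀ t ∈ Icc 0 T, IsRealDist (solDist u₀ u t)) ∧
      (MemB0 φ σ q u₀ → ∀ t ∈ Ioc 0 T, u t ∈ schwartzB n) := by
  have hσ0 : 0 < σ := lt_of_lt_of_le (by norm_num) (half_le_sigmaCrit.trans hσ)
  obtain ⟨h, hc, he⟩ := hu₀.exists_toDist_eq_heat hφ hq hσ0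
  have hNh : pn σ q T h ≤ η := by
    refine le_trans (le_of_eq (normW_congr hq fun t ht => ?_)) hN
    rw [← he t ht.1, lpENorm_toDist]
  obtain ⟨u, hu, hNu, heq, hF⟩ := hQ.exists_fixed_point hq hσ hη hηt (hc.mono Ioc_subset_Ioi_self) hNh
  refine ⟨u, ⟨hu, hNu.trans_lt (ENNReal.mul_lt_top (by simp) hηt), fun t ht => ?_⟩, hNu, fun t ht => ?_,
    fun hr t ht => ?_, fun h0 => ?_⟩
  · rw [heq t ht, map_sub, he t ht.1]
  · rcases ht.1.eq_or_lt with rfl | ht0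
    · rwa [solDist_zero]
    · rw [solDist_of_pos ht0]
      refine hF (divFreeB n) isClosed_divFreeB (fun s hs f _ g _ => isDivFree_oseenBil hs f g) (fun τ hτ => ?_) t ⟨ht0, ht.2⟩
      rw [mem_divFreeB, he τ hτ.1]
      exact hdiv.heat hτ.1
  · rcases ht.1.eq_or_lt with rfl | ht0
    · rwa [solDist_zero]
    · rw [solDist_of_pos ht0]
      refine isRealDist_toDist (hF (realB n) isClosed_realB (fun s hs f hf g hg => oseenBil_mem_realB hs hf hg)
        (fun τ hτ => mem_realB_of_isRealDist ?_) t ⟨ht0, ht.2⟩)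
      rw [he τ hτ.1]
      exact hr.heat hτ.1
  · exact hF (schwartzB n) isClosed_schwartzB (fun s _ f hf g hg => oseenBil_mem_schwartzB s hf hg)
      fun t ht => heat_mem_schwartzB hφ hq hσ0 h0 ht.1 (he t ht.1)

/-! ### Lipschitz dependence on the initial values -/

/-- The free term is recovered as `u` plus its own Duhamel integral, so the stability of small fixed
points applies without reference to how `u` was constructed. -/
theorem pn_sub_le_normW_heat (hq : 1 ≤ q) (hσ : sigmaCrit q ≤ σ) {C : ℝ}
    (hQ : IsSingularBil (oseenBil n) C) {η : ℝ≥0∞} (hη : ENNReal.ofReal (bilC C q) * (16 * η) ≤ 1) (hηt : η < ⊤)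
    {v₀ : TempDist n} {u v : ℝ → Cb n (Cn n)} (hu : IsDuhamelSolution σ q T u₀ u) (hv : IsDuhamelSolution σ q T v₀ v)
    (hNu : pn σ q T u ≤ 4 * η) (hNv : pn σ q T v ≤ 4 * η) :
    pn σ q T (fun t => u t - v t) ≤ 2 * normW σ q T fun t => lpENorm ⊤ (heat t (u₀ - v₀)) := by
  have hc : ∀ {u₀ : TempDist n} {u}, IsDuhamelSolution σ q T u₀ u →
      ContinuousOn (fun t => u t + duh (oseenBil n) u u t) (Ioc 0 T) := fun h =>
    h.cont.add (hQ.continuousOn_duh h.cont h.cont fun t ht => h.gInt_lt_top hq hσ ht)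
  refine (hQ.pn_sub_le_of_eq hq hσ hη hηt hu.cont hv.cont (hc hu) (hc hv) hNu hNv (fun t _ => (add_sub_cancel_right _ _).symm)
    fun t _ => (add_sub_cancel_right _ _).symm).trans (le_of_eq ?_)
  congr 1
  refine normW_congr hq fun t ht => ?_
  have ht' := Ioo_subset_Ioc_self ht
  rw [en, ← lpENorm_toDist, map_sub, map_add, map_add, hu.eq t ht', hv.eq t ht', sub_add_cancel, sub_add_cancel, heat_sub]

theorem exists_pathNorm_le (hφ : IsCutoff φ) (hq : 1 ≤ q) (hσ : sigmaCrit q ≤ σ) (hT : 0 < T) {C : ℝ}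
    (hQ : IsSingularBil (oseenBil n) C) {η : ℝ≥0∞} (hη : ENNReal.ofReal (bilC C q) * (16 * η) ≤ 1) (hηt : η < ⊤) :
    ∃ L : ℝ≥0, ∀ (u₀ v₀ : TempDist n) (u v : ℝ → Cb n (Cn n)), IsDuhamelSolution σ q T u₀ u →
      IsDuhamelSolution σ q T v₀ v → pn σ q T u ≤ 4 * η → pn σ q T v ≤ 4 * η → ∀ I : Set ℝ, I ⊆ Icc 0 T →
      pathNorm φ σ q T I (fun t => solDist u₀ u t - solDist v₀ v t) ≤ L * normB φ σ q (u₀ - v₀) := by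
  have hσ0 : 0 < σ := lt_of_lt_of_le (by norm_num) (half_le_sigmaCrit.trans hσ)
  obtain ⟨C₁, -, h₁⟩ := exists_normW_heat_le n hφ hσ0 hq T
  obtain ⟨C₂, -, h₂⟩ := exists_normB_solDist_sub_le n hφ hq hσ T
  set K : ℝ≥0∞ := ENNReal.ofReal C₂ * (1 + (4 * η + 4 * η) * (2 * ENNReal.ofReal C₁)) + 2 * ENNReal.ofReal C₁
  have hK : K ≠ ⊤ := by
    have := hηt.ne
    simp only [K]
    finiteness
  refine ⟨K.toNNReal, fun u₀ v₀ u v hu hv hNu hNv I hI => ?_⟩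
  rw [ENNReal.coe_toNNReal hK]
  set N := normB φ σ q (u₀ - v₀)
  have hP : pn σ q T (fun t => u t - v t) ≤ 2 * ENNReal.ofReal C₁ * N := by
    rw [mul_assoc]
    exact (pn_sub_le_normW_heat hq hσ hQ hη hηt hu hv hNu hNv).trans (mul_le_mul_right (h₁ T hT le_rfl _) _)
  have hS : ⨆ t ∈ I, normB φ σ q (solDist u₀ u t - solDist v₀ v t) ≤
      ENNReal.ofReal C₂ * (1 + (4 * η + 4 * η) * (2 * ENNReal.ofReal C₁)) * N := by
    refine iSup₂_le fun t ht => (h₂ u₀ v₀ u v hu hv t (hI ht)).trans ?_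
    calc _ ≤ ENNReal.ofReal C₂ * (N + (4 * η + 4 * η) * (2 * ENNReal.ofReal C₁ * N)) :=
          mul_le_mul_right (add_le_add le_rfl (mul_le_mul' (add_le_add hNu hNv) hP)) _
      _ = _ := by ring
  have hW : weightedSup σ T (fun t => solDist u₀ u t - solDist v₀ v t) +
      weightedLq σ q T (fun t => solDist u₀ u t - solDist v₀ v t) ≤ 2 * ENNReal.ofReal C₁ * N := by
    rw [weightedSup_eq, weightedLq_eq]
    refine le_trans (le_of_eq (normW_congr hq fun t ht => ?_)) hP
    rw [solDist_of_pos ht.1, solDist_of_pos ht.1, ← map_sub, lpENorm_toDist]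
  rw [pathNorm, add_assoc, add_mul]
  exact add_le_add hS hW

theorem pathNorm_congr {I : Set ℝ} (hI : Ioo 0 T ⊆ I) {u v : ℝ → TempDist n} (h : EqOn u v I) :
    pathNorm φ σ q T I u = pathNorm φ σ q T I v := by
  have h1 : ∀ t ∈ Ioo 0 T, weighted σ T u t = weighted σ T v t := fun t ht => by rw [weighted, weighted, h (hI ht)]
  have h2 : weightedLq σ q T u = weightedLq σ q T v := by
    rw [weightedLq, weightedLq, setLIntegral_congr_fun measurableSet_Ioo fun t ht => by rw [h1 t ht]]
  rw [pathNorm, pathNorm, h2, weightedSup, weightedSup]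
  congr 2
  · exact biSup_congr fun t ht => by rw [h ht]
  · exact biSup_congr h1

theorem exists_small (n : ℕ) (q : ℝ) : ∃ C, IsSingularBil (oseenBil n) C ∧
    ∃ η : ℝ≥0∞, 0 < η ∧ η < ⊤ ∧ ENNReal.ofReal (bilC C q) * (16 * η) ≤ 1 := by
  obtain ⟨C, hQ⟩ := isSingularBil_oseenBil n
  have hb := bilC_pos (q := q) hQ.pos
  -- The largest `η` allowed by the smallness condition of the iteration.
  refine ⟨C, hQ, ENNReal.ofReal (1 / (16 * bilC C q)), by simpa using hb, ENNReal.ofReal_lt_top, ?_⟩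
  rw [← ENNReal.ofReal_ofNat, ← ENNReal.ofReal_mul (by norm_num), ← ENNReal.ofReal_mul hb.le, ← ENNReal.ofReal_one]
  refine ENNReal.ofReal_le_ofReal (le_of_eq ?_)
  field_simp

/-! ### The two classes of solutions -/

theorem IsStrongPathSolution.eqOn {u v : ℝ → TempDist n} (hq : 1 ≤ q) (hσ : sigmaCrit q ≤ σ)
    (hu : IsStrongPathSolution φ σ q T u₀ u) (hv : IsStrongPathSolution φ σ q T u₀ v) : EqOn u v (Icc 0 T) :=
  eqOn_of_isMildSolution hq hσ Ioo_subset_Icc_self subset_rfl hu.memLinftyLoc hv.memLinftyLoc hu.mild hv.mild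
    hu.sup_lt_top hu.lq_lt_top hv.sup_lt_top hv.lq_lt_top

theorem IsWeakPathSolution.eqOn {u v : ℝ → TempDist n} (hq : 1 ≤ q) (hσ : sigmaCrit q ≤ σ)
    (hu : IsWeakPathSolution φ σ q T u₀ u) (hv : IsWeakPathSolution φ σ q T u₀ v) : EqOn u v (Ioo 0 T) :=
  eqOn_of_isMildSolution hq hσ subset_rfl Ioo_subset_Icc_self hu.memLinftyLoc hv.memLinftyLoc hu.mild hv.mild
    hu.sup_lt_top hu.lq_lt_top hv.sup_lt_top hv.lq_lt_top

/-- Well-posedness in a class `S` of solutions and on a set `D` of initial values for which the heat extensions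
are small. -/
theorem wellPosed_of_small {I : Set ℝ} (hφ : IsCutoff φ) (hq : 1 ≤ q) (hσ : sigmaCrit q ≤ σ) (hT : 0 < T)
    {C : ℝ} (hQ : IsSingularBil (oseenBil n) C) {η : ℝ≥0∞} (hη : ENNReal.ofReal (bilC C q) * (16 * η) ≤ 1) (hηt : η < ⊤)
    (hI : Ioo 0 T ⊆ I) (hI' : I ⊆ Icc 0 T) {D : TempDist n → Prop} {S : TempDist n → (ℝ → TempDist n) → Prop}
    (hDB : ∀ u₀, D u₀ → MemB φ σ q u₀ ∧ IsDivFree u₀)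
    (hDN : ∀ u₀, D u₀ → normW σ q T (fun t => lpENorm ⊤ (heat t u₀)) ≤ η)
    (hS : ∀ u₀ u v, S u₀ u → S u₀ v → EqOn u v I)
    (hDS : ∀ u₀, D u₀ → ∀ u, IsDuhamelSolution σ q T u₀ u → (∀ t ∈ Icc 0 T, IsDivFree (solDist u₀ u t)) →
      (MemB0 φ σ q u₀ → ∀ t ∈ Ioc 0 T, u t ∈ schwartzB n) → S u₀ (solDist u₀ u)) :
    (∀ u₀, D u₀ → ∃ u, S u₀ u ∧ (IsRealDist u₀ → ∀ t ∈ I, IsRealDist (u t))) ∧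
    ∃ L : ℝ≥0, ∀ v₀ w₀, D v₀ → D w₀ → ∀ v w, S v₀ v → S w₀ w →
      pathNorm φ σ q T I (fun t => v t - w t) ≤ L * normB φ σ q (v₀ - w₀) := by
  have key : ∀ u₀, D u₀ → ∃ u, IsDuhamelSolution σ q T u₀ u ∧ pn σ q T u ≤ 4 * η ∧ S u₀ (solDist u₀ u) ∧
      (IsRealDist u₀ → ∀ t ∈ I, IsRealDist (solDist u₀ u t)) := by
    intro u₀ h0
    obtain ⟨u, hu, hN, hd, hr, hs⟩ := exists_isDuhamelSolution hφ hq hσ hQ hη hηt (hDB u₀ h0).1 (hDB u₀ h0).2 (hDN u₀ h0)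
    exact ⟨u, hu, hN, hDS u₀ h0 u hu hd hs, fun h t ht => hr h t (hI' ht)⟩
  refine ⟨fun u₀ h0 => ?_, ?_⟩
  · obtain ⟨u, -, -, h⟩ := key u₀ h0
    exact ⟨_, h⟩
  obtain ⟨L, hL⟩ := exists_pathNorm_le hφ hq hσ hT hQ hη hηt
  refine ⟨L, fun v₀ w₀ hv₀ hw₀ v w hv hw => ?_⟩
  obtain ⟨v', hv', hNv, hSv, -⟩ := key v₀ hv₀
  obtain ⟨w', hw', hNw, hSw, -⟩ := key w₀ hw₀
  -- By uniqueness the given solutions, of whatever size, coincide with the small ones obtained by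
  -- iteration.
  rw [pathNorm_congr hI fun t ht => congrArg₂ (· - ·) (hS v₀ v _ hv hSv ht) (hS w₀ w _ hw hSw ht)]
  exact hL v₀ w₀ v' w' hv' hw' hNv hNw I hI'

theorem exists_half_small {C : ℝ} {η : ℝ≥0∞} (hη : 0 < η) : ∃ δ : ℝ≥0, 0 < δ ∧ ENNReal.ofReal C * δ ≤ η / 2 := by
  obtain ⟨δ, hδ, h⟩ := ENNReal.exists_nnreal_pos_mul_lt (a := ENNReal.ofReal C) ENNReal.ofReal_ne_top
    (ENNReal.half_pos hη.ne').ne'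
  exact ⟨δ, hδ, by rw [mul_comm]; exact h.le⟩

/-- The datum `v₀` is split into `v₀ - u₀`, `u₀ - G` and a Schwartz function `G`. The first two are
small in the Besov norm and contribute `η/4` each; the heat extension of the last is `O(√T)` and
contributes `η/2`. One `T` therefore serves a whole neighbourhood of `u₀`. -/
theorem MemB0.exists_time_normW_le (hφ : IsCutoff φ) (hq : 1 ≤ q) (hσ : 0 < σ) (hu₀ : MemB0 φ σ q u₀) {η : ℝ≥0∞}
    (hη : 0 < η) : ∃ T, 0 < T ∧ ∃ δ : ℝ≥0, 0 < δ ∧ ∀ v₀, MemB φ σ q v₀ → normB φ σ q (v₀ - u₀) < δ →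
      normW σ q T (fun t => lpENorm ⊤ (heat t v₀)) ≤ η := by
  -- With horizon one the constant is uniform for `T ≤ 1`, so the Schwartz function can be chosen
  -- before `T`.
  obtain ⟨C₁, -, h₁⟩ := exists_normW_heat_le n hφ hσ hq 1
  obtain ⟨C₂, hC₂, h₂⟩ := exists_normW_heat_toDist_le n (σ := σ) hσ hq
  have hη2 := ENNReal.half_pos hη.ne'
  have hη4 := ENNReal.half_pos hη2.ne'
  obtain ⟨δ, hδ, hδ'⟩ := exists_half_small (C := C₁) hη2
  obtain ⟨g, hg⟩ := hu₀.exists_mul_lt (C := ENNReal.ofReal C₁) ENNReal.ofReal_ne_top hη4.ne'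
  set b : Cb n (Cn n) := g.toBoundedContinuousFunction
  have hb : toDist n (Cn n) b = (g : TempDist n) := toDist_schwartz g
  rw [← hb] at hg
  set G := toDist n (Cn n) b
  have hT : ∃ T, 0 < T ∧ T ≤ 1 ∧ ENNReal.ofReal (C₂ * √T) * ‖b‖ₑ ≤ η / 2 := by
    have h3 : Tendsto (fun T => ENNReal.ofReal (C₂ * √T) * ‖b‖ₑ) (𝓝[>] 0) (𝓝 0) := by
      have h4 : Continuous fun T => ENNReal.ofReal (C₂ * √T) := ENNReal.continuous_ofReal.comp (by fun_prop)
      have h5 := ENNReal.Tendsto.mul_const (b := ‖b‖ₑ) (h4.tendsto 0) (Or.inr enorm_ne_top)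
      simp only [Real.sqrt_zero, mul_zero, ENNReal.ofReal_zero, zero_mul] at h5
      exact h5.mono_left nhdsWithin_le_nhds
    obtain ⟨T, h4, h5⟩ := ((ENNReal.tendsto_nhds_zero.1 h3 _ hη2).and (Ioc_mem_nhdsGT one_pos)).exists
    exact ⟨T, h5.1, h5.2, h4⟩
  obtain ⟨T, hT, hT1, hTb⟩ := hT
  refine ⟨T, hT, δ, hδ, fun v₀ hv₀ hv => ?_⟩
  have hG : MemB φ σ q G := by
    obtain ⟨C, -, hC⟩ := exists_normB_toDist_le n hφ hσ hq
    exact (hC b).trans_lt (ENNReal.mul_lt_top ENNReal.ofReal_lt_top enorm_lt_top)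
  have h3 := normW_heat_add_le (T := T) hφ hq hσ ((normB_sub_le hq v₀ G).trans_lt (ENNReal.add_lt_top.2 ⟨hv₀, hG⟩)) hG
  rw [sub_add_cancel] at h3
  calc _ ≤ _ := h3
    _ ≤ ENNReal.ofReal C₁ * (normB φ σ q (v₀ - u₀) + normB φ σ q (u₀ - G)) + η / 2 :=
      add_le_add ((h₁ T hT hT1 _).trans (mul_le_mul_right (normB_sub_le_sub_add_sub hq _ _ _) _)) ((h₂ T hT b).trans hTb)
    _ ≤ η / 2 / 2 + η / 2 / 2 + η / 2 := by
      rw [mul_add]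
      exact add_le_add (add_le_add ((mul_le_mul_right hv.le _).trans hδ') hg.le) le_rfl
    _ = η := by rw [ENNReal.add_halves, ENNReal.add_halves]

end

end NavierStokesBesov

end

/-! ### Assembly: local and small-data well-posedness -/

theorem theorem1p2 (n : ℕ) (hn : 2 ≤ n) (φ : ℝ → ℝ) (hφ : NavierStokesBesov.IsCutoff φ)
    (q σ : ℝ) (hq : 1 ≤ q) (hσ : 1 - min (1 - 1 / q) (1 / q) ≤ σ) :
    -- local well-posedness in the closure of the Schwartz class
    (∀ u₀ : NavierStokesBesov.TempDist n,
      NavierStokesBesov.MemB0 φ σ q u₀ → NavierStokesBesov.IsDivFree u₀ →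
      ∃ T : ℝ, 0 < T ∧
        (∃ u : ℝ → NavierStokesBesov.TempDist n,
          NavierStokesBesov.IsStrongPathSolution φ σ q T u₀ u ∧
          ∀ v : ℝ → NavierStokesBesov.TempDist n,
            NavierStokesBesov.IsStrongPathSolution φ σ q T u₀ v → Set.EqOn v u (Set.Icc 0 T)) ∧
        ∃ δ : ℝ≥0, 0 < δ ∧ ∃ L : ℝ≥0,
          (∀ v₀ : NavierStokesBesov.TempDist n,
            NavierStokesBesov.MemB0 φ σ q v₀ → NavierStokesBesov.IsDivFree v₀ →
            NavierStokesBesov.normB φ σ q (v₀ - u₀) < δ →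
            ∃ v : ℝ → NavierStokesBesov.TempDist n,
              NavierStokesBesov.IsStrongPathSolution φ σ q T v₀ v ∧
              (NavierStokesBesov.IsRealDist v₀ →
                ∀ t ∈ Set.Icc 0 T, NavierStokesBesov.IsRealDist (v t))) ∧
          ∀ v₀ w₀ : NavierStokesBesov.TempDist n,
            NavierStokesBesov.MemB0 φ σ q v₀ → NavierStokesBesov.IsDivFree v₀ →
            NavierStokesBesov.normB φ σ q (v₀ - u₀) < δ →
            NavierStokesBesov.MemB0 φ σ q w₀ → NavierStokesBesov.IsDivFree w₀ →
            NavierStokesBesov.normB φ σ q (w₀ - u₀) < δ →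
            ∀ v w : ℝ → NavierStokesBesov.TempDist n,
              NavierStokesBesov.IsStrongPathSolution φ σ q T v₀ v →
              NavierStokesBesov.IsStrongPathSolution φ σ q T w₀ w →
              NavierStokesBesov.pathNorm φ σ q T (Set.Icc 0 T) (fun t => v t - w t) ≤
                L * NavierStokesBesov.normB φ σ q (v₀ - w₀)) ∧
    -- semi-global well-posedness for small data
    (∀ T : ℝ, 0 < T → ∃ ε : ℝ≥0, 0 < ε ∧ ∀ u₀ : NavierStokesBesov.TempDist n,
      NavierStokesBesov.MemB φ σ q u₀ → NavierStokesBesov.IsDivFree u₀ →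
      NavierStokesBesov.normB φ σ q u₀ < ε →
        (∃ u : ℝ → NavierStokesBesov.TempDist n,
          NavierStokesBesov.IsWeakPathSolution φ σ q T u₀ u ∧
          ∀ v : ℝ → NavierStokesBesov.TempDist n,
            NavierStokesBesov.IsWeakPathSolution φ σ q T u₀ v → Set.EqOn v u (Set.Ioo 0 T)) ∧
        ∃ δ : ℝ≥0, 0 < δ ∧ ∃ L : ℝ≥0,
          (∀ v₀ : NavierStokesBesov.TempDist n,
            NavierStokesBesov.MemB φ σ q v₀ → NavierStokesBesov.IsDivFree v₀ →
            NavierStokesBesov.normB φ σ q (v₀ - u₀) < δ →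
            ∃ v : ℝ → NavierStokesBesov.TempDist n,
              NavierStokesBesov.IsWeakPathSolution φ σ q T v₀ v ∧
              (NavierStokesBesov.IsRealDist v₀ →
                ∀ t ∈ Set.Ioo 0 T, NavierStokesBesov.IsRealDist (v t))) ∧
          ∀ v₀ w₀ : NavierStokesBesov.TempDist n,
            NavierStokesBesov.MemB φ σ q v₀ → NavierStokesBesov.IsDivFree v₀ →
            NavierStokesBesov.normB φ σ q (v₀ - u₀) < δ →
            NavierStokesBesov.MemB φ σ q w₀ → NavierStokesBesov.IsDivFree w₀ →
            NavierStokesBesov.normB φ σ q (w₀ - u₀) < δ →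
            ∀ v w : ℝ → NavierStokesBesov.TempDist n,
              NavierStokesBesov.IsWeakPathSolution φ σ q T v₀ v →
              NavierStokesBesov.IsWeakPathSolution φ σ q T w₀ w →
              NavierStokesBesov.pathNorm φ σ q T (Set.Ioo 0 T) (fun t => v t - w t) ≤
                L * NavierStokesBesov.normB φ σ q (v₀ - w₀)) := by
  obtain ⟨C, hQ, η, hη0, hηt, hη⟩ := NavierStokesBesov.exists_small n q
  have hσ0 : 0 < σ := lt_of_lt_of_le (by norm_num) (NavierStokesBesov.half_le_sigmaCrit.trans hσ)
  constructor
  · intro u₀ hu₀ hdiv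
    obtain ⟨T, hT, δ, hδ, hN⟩ := hu₀.exists_time_normW_le hφ hq hσ0 hη0
    obtain ⟨hex, L, hL⟩ := NavierStokesBesov.wellPosed_of_small hφ hq hσ hT hQ hη hηt Set.Ioo_subset_Icc_self
      subset_rfl (D := fun v₀ => NavierStokesBesov.MemB0 φ σ q v₀ ∧ NavierStokesBesov.IsDivFree v₀ ∧
        NavierStokesBesov.normB φ σ q (v₀ - u₀) < δ) (S := NavierStokesBesov.IsStrongPathSolution φ σ q T)
      (fun v₀ h => ⟨h.1.1, h.2.1⟩) (fun v₀ h => hN v₀ h.1.1 h.2.2) (fun _ _ _ h h' => h.eqOn hq hσ h')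
      (fun v₀ h u hu hd hs => ⟨hu.memCB0 hφ hq hσ hT h.1 (hs h.1), NavierStokesBesov.memLinftyLoc_solDist hu.cont, hd,
        (hu.weighted_lt_top hq).1, (hu.weighted_lt_top hq).2, hu.isMildSolution hq hσ subset_rfl⟩)
    have h0 : NavierStokesBesov.normB φ σ q (u₀ - u₀) < δ := by
      rw [sub_self, NavierStokesBesov.normB_zero hφ hq hσ0]
      exact_mod_cast hδ
    obtain ⟨u, hu, -⟩ := hex u₀ ⟨hu₀, hdiv, h0⟩
    exact ⟨T, hT, ⟨u, hu, fun v hv => hv.eqOn hq hσ hu⟩, δ, hδ, L, fun v₀ h h' h'' => hex v₀ ⟨h, h', h''⟩,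
      fun v₀ w₀ h1 h2 h3 k1 k2 k3 => hL v₀ w₀ ⟨h1, h2, h3⟩ ⟨k1, k2, k3⟩⟩
  · intro T hT
    obtain ⟨C₁, -, h₁⟩ := NavierStokesBesov.exists_normW_heat_le n hφ hσ0 hq T
    -- The same number serves as smallness bound for `u₀` and as radius of the neighbourhood, each
    -- using up half of `η` in the triangle inequality for `v₀`.
    obtain ⟨ε, hε, hε'⟩ := NavierStokesBesov.exists_half_small (C := C₁) hη0
    refine ⟨ε, hε, fun u₀ hu₀ hdiv hs => ?_⟩
    obtain ⟨hex, L, hL⟩ := NavierStokesBesov.wellPosed_of_small hφ hq hσ hT hQ hη hηt subset_rfl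
      Set.Ioo_subset_Icc_self (D := fun v₀ => NavierStokesBesov.MemB φ σ q v₀ ∧ NavierStokesBesov.IsDivFree v₀ ∧
        NavierStokesBesov.normB φ σ q (v₀ - u₀) < ε) (S := NavierStokesBesov.IsWeakPathSolution φ σ q T)
      (fun v₀ h => ⟨h.1, h.2.1⟩)
      (fun v₀ h => by
        have h3 := NavierStokesBesov.normB_add_le (φ := φ) (σ := σ) hq (v₀ - u₀) u₀
        rw [sub_add_cancel] at h3
        refine (h₁ T hT le_rfl v₀).trans ((mul_le_mul_right (h3.trans (add_le_add h.2.2.le hs.le)) _).trans ?_)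
        rw [mul_add]
        exact (add_le_add hε' hε').trans (ENNReal.add_halves η).le)
      (fun _ _ _ h h' => h.eqOn hq hσ h')
      (fun v₀ h u hu hd _ => ⟨hu.memLinftyB hφ hq hσ h.1, NavierStokesBesov.memLinftyLoc_solDist hu.cont,
        fun t ht => hd t (Set.Ioo_subset_Icc_self ht), (hu.weighted_lt_top hq).1, (hu.weighted_lt_top hq).2,
        hu.continuousOn_solDist, hu.isMildSolution hq hσ Set.Ioo_subset_Icc_self⟩)
    have h0 : NavierStokesBesov.normB φ σ q (u₀ - u₀) < ε := by
      rw [sub_self, NavierStokesBesov.normB_zero hφ hq hσ0]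
      exact_mod_cast hε
    obtain ⟨u, hu, -⟩ := hex u₀ ⟨hu₀, hdiv, h0⟩
    exact ⟨⟨u, hu, fun v hv => hv.eqOn hq hσ hu⟩, ε, hε, L, fun v₀ h h' h'' => hex v₀ ⟨h, h', h''⟩,
      fun v₀ w₀ h1 h2 h3 k1 k2 k3 => hL v₀ w₀ ⟨h1, h2, h3⟩ ⟨k1, k2, k3⟩⟩
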